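/- **Setting.** Let $\Sigma$ be a closed (compact, boundaryless, smooth) surface with a Finsler metric $F$, not necessarily symmetric: $F$ is positive, smooth and positively $1$-homogeneous off the zero section, and $F^2$ has positive definite fibrewise Hessian. Let $\mathcal L_F(v)=F(v)\,\partial_vF(v)$ be the Legendre transformation, $F^*=F\circ\mathcal L_F^{-1}$ the dual metric, $S^*_F\Sigma=\{F^*=1\}\subset T^*\Sigma$ the unit cotangent bundle with projection $\pi$ to $\Sigma$, $\lambda=p\,dq|_{S^*_F\Sigma}$ its contact form and $\xi_F=\ker\lambda$. Let $\sigma$ be a closed geodesic of length $l$ parametrized by arc length, $\gamma_\sigma=(\sigma,\mathcal L_F(\dot\sigma))$, and let $0\le t_0-\epsilon<t_0+\epsilon\le 1$ be such that $\sigma(lt_0)$ is not a self-intersection point of $\sigma$. Let $U_1\subset S^*_F\Sigma$ be open, meeting $\gamma_\sigma$ exactly in the arc $\gamma_\sigma\big((l(t_0-\epsilon),l(t_0+\epsilon))\big)$ and such that, for $t\in[0,l)$, $\sigma(t)\in\pi(U_1)$ only if $t\in(l(t_0-\epsilon),l(t_0+\epsilon))$. **Perturbations.** Consider smooth fields $\tilde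 A(q)$ of symmetric bilinear forms on $T^*_q\Sigma$, with support in $\pi(U_1)$, such that $$f_s(q,p)=-\tfrac12\ln\bigl(1+s(\tilde A(q)p,p)\bigr)$$ satisfies $f_s|_{\gamma_\sigma}=0$ and $df_s|_{\gamma_\sigma}=0$ for every $s$ with $1+s(\tilde A(q)p,p)>0$ on $S^*_F\Sigma$. Put $h=\partial_sf_s|_{s=0}=-\tfrac12(\tilde A(q)p,p)$. For such $\tilde A$ and $s$, $\gamma_\sigma$ is an $l$-periodic Reeb orbit of $e^{f_s}\lambda$, and its linearized return map on $\xi_F|_{\gamma_\sigma(0)}$ is well defined and belongs to the symplectic group $\mathrm{Sp}(\xi_F|_{\gamma_\sigma(0)},d\lambda)\cong\mathrm{Sp}(2)$. Denote it by $P_\sigma(f_s)$. **Formula.** Let $S^1=\mathbb R/\mathbb Z$ and let $\Phi:S^1\times D^2_\delta\to U\subset S^*_F\Sigma$, $(z,x_1,x_2)\mapsto(q,p)$, be a diffeomorphism onto an open neighbourhood of $\gamma_\sigma$ that contains $U_1$, with $\Phi^*\lambda=H(dz+x_1dx_2)$, $H>0$, $\Phi(t,0,0)=\gamma_\sigma(lt)$,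 $H(t,0,0)=l$, $dH(t,0,0)=0$ and $H\equiv l$ on $\Phi^{-1}(U_1)$. Let $\tilde h=h\circ\Phi$, $J=\begin{pmatrix}0&-1\\1&0\end{pmatrix}$, and let $R_0$ be the solution of $\dot R_0(t)=-\tfrac1l J\nabla^2_xH(t,0,0)R_0(t)$ with $R_0(0)=I$. Then, with respect to the basis $\partial_{x_1},\partial_{x_2}$ of $\xi_F|_{\gamma_\sigma(0)}$, $$dP_\sigma|_{f=0}(h):=\frac{d}{ds}\Big|_{s=0}P_\sigma(f_s)=P_\sigma(0)\,R_0(t_0)^{-1}\left(-\int_{t_0-\epsilon}^{t_0+\epsilon}J\nabla^2_x\tilde h(t,0,0)\,dt\right)R_0(t_0).$$ **Surjectivity.** For every such $\tilde A$ the derivative $\frac{d}{ds}|_{s=0}P_\sigma(f_s)$ exists and lies in $T_{P_\sigma(0)}\mathrm{Sp}(\xi_F|_{\gamma_\sigma(0)},d\lambda)\cong T_{P_\sigma(0)}\mathrm{Sp}(2)$, and every element of this tangent space is obtained in this way from some such $\tilde A$. -/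

import Mathlib

open Set Filter Topology Bundle
open scoped Manifold ContDiff

namespace Finsler

noncomputable section

/-- The model space of a surface, and also the `x`-plane of the local model. -/
abbrev Plane := EuclideanSpace ℝ (Fin 2)

section Surface

variable {S : Type*} [TopologicalSpace S] [ChartedSpace Plane S] [IsManifold (𝓡 2) ∞ S]

/-- The cotangent space `T*_q S`. -/
abbrev Cot (q : S) := TangentSpace (𝓡 2) q →L[ℝ] ℝ

variable (S) in
/-- The cotangent bundle `T*S` (Mathlib's hom bundle), a smooth manifold of dimension 4. -/
abbrev CotBundle := TotalSpace (Plane →L[ℝ] ℝ) (fun q : S => Cot q)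

/-- The model with corners of `T*S`. -/
abbrev cotModel := (𝓡 2).prod 𝓘(ℝ, Plane →L[ℝ] ℝ)

/-! ### Finsler metrics -/

/-- `F : TS → ℝ` is a (not necessarily symmetric) Finsler metric. -/
structure IsFinslerMetric (F : TangentBundle (𝓡 2) S → ℝ) : Prop where
  smooth : ContMDiffOn (𝓡 2).tangent 𝓘(ℝ, ℝ) ∞ F {e | e.2 ≠ 0}
  pos : ∀ (q : S) (v : TangentSpace (𝓡 2) q), v ≠ 0 → 0 < F ⟨q, v⟩
  zero : ∀ q : S, F ⟨q, 0⟩ = 0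
  homogeneous : ∀ (q : S) (v : TangentSpace (𝓡 2) q) (a : ℝ), 0 < a → F ⟨q, a • v⟩ = a * F ⟨q, v⟩
  convex : ∀ (q : S) (v u : TangentSpace (𝓡 2) q), v ≠ 0 → u ≠ 0 →
    0 < deriv (fun s : ℝ => deriv (fun t : ℝ => F ⟨q, v + s • u + t • u⟩ ^ 2) 0) 0

/-- The Legendre transformation `v ↦ F(v) ∂F/∂v (v)` on the tangent space at `q`. -/
def legendre (F : TangentBundle (𝓡 2) S → ℝ) (q : S) (v : TangentSpace (𝓡 2) q) : Cot q :=
  F ⟨q, v⟩ • fderiv ℝ (fun w : TangentSpace (𝓡 2) q => F ⟨q, w⟩) v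

/-- The dual metric `F*(q,p) = F(q, 𝓛_F⁻¹ p)`. -/
def dualMetric (F : TangentBundle (𝓡 2) S → ℝ) (e : CotBundle S) : ℝ :=
  F ⟨e.1, Function.invFun (legendre F e.1) e.2⟩

/-- The unit cotangent bundle `S*_F S = {F* = 1}`. -/
def cosphere (F : TangentBundle (𝓡 2) S → ℝ) : Set (CotBundle S) := {e | dualMetric F e = 1}

/-- The tangent space at `e` of the hypersurface `S*_F S` of `T*S`. -/
def cosphereTangent (F : TangentBundle (𝓡 2) S → ℝ) (e : CotBundle S) :
    Submodule ℝ (TangentSpace cotModel e) :=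
  LinearMap.ker (mfderiv cotModel 𝓘(ℝ, ℝ) (dualMetric F) e).toLinearMap

/-! ### Closed geodesics -/

/-- The velocity of a curve. -/
def velocity (σ : ℝ → S) (t : ℝ) : TangentSpace (𝓡 2) (σ t) :=
  mfderiv 𝓘(ℝ, ℝ) (𝓡 2) σ t (1 : ℝ)

/-- The Lagrangian `F² / 2` in the chart at `x₀`, as a function of position and velocity. -/
def chartLagrangian (F : TangentBundle (𝓡 2) S → ℝ) (x₀ : S) (q v : Plane) : ℝ :=
  1 / 2 * F (tangentMap 𝓘(ℝ, Plane) (𝓡 2) (extChartAt (𝓡 2) x₀).symm ⟨q, v⟩) ^ 2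

/-- `σ` is a closed geodesic of `F`, parametrized by arc length, with `l` a period (the length of
one passage): it satisfies the Euler-Lagrange equation of `F² / 2` in the chart at each of its
points. -/
structure IsClosedGeodesic (F : TangentBundle (𝓡 2) S → ℝ) (σ : ℝ → S) (l : ℝ) : Prop where
  length_pos : 0 < l
  smooth : ContMDiff 𝓘(ℝ, ℝ) (𝓡 2) ∞ σ
  periodic : Function.Periodic σ l
  unit_speed : ∀ t, F ⟨σ t, velocity σ t⟩ = 1
  euler_lagrange : ∀ t : ℝ,
    HasDerivAt
      (fun s : ℝ => fderiv ℝ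
        (fun v : Plane => chartLagrangian F (σ t) (extChartAt (𝓡 2) (σ t) (σ s)) v)
        (deriv (fun r : ℝ => extChartAt (𝓡 2) (σ t) (σ r)) s))
      (fderiv ℝ
        (fun q : Plane => chartLagrangian F (σ t) q
          (deriv (fun r : ℝ => extChartAt (𝓡 2) (σ t) (σ r)) t))
        (extChartAt (𝓡 2) (σ t) (σ t)))
      t

/-- The lift `γ_σ(t) = (σ(t), 𝓛_F(σ'(t)))` of `σ` to the cotangent bundle. -/
def lift (F : TangentBundle (𝓡 2) S → ℝ) (σ : ℝ → S) (t : ℝ) : CotBundle S :=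
  ⟨σ t, legendre F (σ t) (velocity σ t)⟩

/-! ### Contact forms on the unit cotangent bundle -/

/-- The Liouville form: `λ_e(X) = e(π_* X)`. -/
def liouville (e : CotBundle S) : TangentSpace cotModel e →L[ℝ] ℝ :=
  e.2.comp (mfderiv cotModel (𝓡 2) (TotalSpace.proj : CotBundle S → S) e)

/-- The form `e^f λ`. -/
def conformalForm (f : CotBundle S → ℝ) (e : CotBundle S) : TangentSpace cotModel e →L[ℝ] ℝ :=
  Real.exp (f e) • liouville e

/-- The 1-form `α` on `T*S` written in the chart at `e₀`. -/
def chartForm (α : (e : CotBundle S) → (TangentSpace cotModel e →L[ℝ] ℝ)) (e₀ : CotBundle S)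
    (y : Plane × (Plane →L[ℝ] ℝ)) : (Plane × (Plane →L[ℝ] ℝ)) →L[ℝ] ℝ :=
  (α ((extChartAt cotModel e₀).symm y)).comp
    (mfderiv 𝓘(ℝ, Plane × (Plane →L[ℝ] ℝ)) cotModel (extChartAt cotModel e₀).symm y)

/-- The exterior derivative of the 1-form `α` at `e`, evaluated at `X, Y`, computed in the chart
at `e`. -/
def extDerivOne (α : (e : CotBundle S) → (TangentSpace cotModel e →L[ℝ] ℝ)) (e : CotBundle S)
    (X Y : TangentSpace cotModel e) : ℝ :=
  let κ := mfderiv cotModel 𝓘(ℝ, Plane × (Plane →L[ℝ] ℝ)) (extChartAt cotModel e) e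
  let D := fderiv ℝ (chartForm α e) (extChartAt cotModel e e)
  D (κ X) (κ Y) - D (κ Y) (κ X)

/-- The contact plane `ξ_F = ker λ|_{S*_F S}` at `e`. -/
def contactPlane (F : TangentBundle (𝓡 2) S → ℝ) (e : CotBundle S) :
    Submodule ℝ (TangentSpace cotModel e) :=
  cosphereTangent F e ⊓ LinearMap.ker (liouville e).toLinearMap

/-- `X` is the value at `e` of the Reeb vector field of the contact form `e^f λ|_{S*_F S}`. -/
structure IsReebVector (F : TangentBundle (𝓡 2) S → ℝ) (f : CotBundle S → ℝ) (e : CotBundle S)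
    (X : TangentSpace cotModel e) : Prop where
  tangent : X ∈ cosphereTangent F e
  normalized : conformalForm f e X = 1
  kernel : ∀ Y ∈ cosphereTangent F e, extDerivOne (conformalForm f) e X Y = 0

/-- `c` is, for times in `s`, a trajectory in `S*_F S` of the Reeb field of `e^f λ`. -/
def IsReebTrajectoryOn (F : TangentBundle (𝓡 2) S → ℝ) (f : CotBundle S → ℝ) (c : ℝ → CotBundle S)
    (s : Set ℝ) : Prop :=
  ∀ t ∈ s, c t ∈ cosphere F ∧ ∃ X : TangentSpace cotModel (c t), IsReebVector F f (c t) X ∧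
    HasMFDerivWithinAt 𝓘(ℝ, ℝ) cotModel c s t ((1 : ℝ →L[ℝ] ℝ).smulRight X)

/-- `γ` is a `T`-periodic Reeb orbit of `(S*_F S, e^f λ)`. -/
structure IsReebOrbit (F : TangentBundle (𝓡 2) S → ℝ) (f : CotBundle S → ℝ) (γ : ℝ → CotBundle S)
    (T : ℝ) : Prop where
  period_pos : 0 < T
  periodic : Function.Periodic γ T
  trajectory : IsReebTrajectoryOn F f γ univ

/-- `P` is the linearized return map `d(φ^T)|_ξ` at `e`, where `φ` is the Reeb flow of `e^f λ` on
`S*_F S` (only needed near `e` and up to time `T`) and `φ^T(e) = e`. The derivative of `φ^T` is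
taken within the hypersurface `S*_F S`; only its values on tangent vectors of `S*_F S` matter. -/
def IsLinearizedReturnMap (F : TangentBundle (𝓡 2) S → ℝ) (f : CotBundle S → ℝ) (T : ℝ)
    (e : CotBundle S) (P : contactPlane F e →ₗ[ℝ] contactPlane F e) : Prop :=
  e ∈ cosphere F ∧ ∃ φ : ℝ → CotBundle S → CotBundle S,
    (∀ᶠ x in 𝓝[cosphere F] e, φ 0 x = x ∧ IsReebTrajectoryOn F f (fun t => φ t x) (Icc 0 T)) ∧
    φ T e = e ∧
    ∃ L : TangentSpace cotModel e →L[ℝ] TangentSpace cotModel (φ T e),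
      HasMFDerivWithinAt cotModel cotModel (φ T) (cosphere F) e L ∧
      ∀ X : contactPlane F e,
        (⟨φ T e, L X⟩ : TangentBundle cotModel (CotBundle S)) =
          ⟨e, (P X : TangentSpace cotModel e)⟩

open Classical in
/-- The linearized return map at `e` after time `T` of the Reeb flow of `(S*_F S, e^f λ)`. -/
def linearizedReturnMap (F : TangentBundle (𝓡 2) S → ℝ) (f : CotBundle S → ℝ) (T : ℝ)
    (e : CotBundle S) : contactPlane F e →ₗ[ℝ] contactPlane F e :=
  if h : ∃ P, IsLinearizedReturnMap F f T e P then h.choose else 0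

/-- `P ∈ Sp(ξ_F, dλ)` at the point `e`. -/
def IsSymplectic (F : TangentBundle (𝓡 2) S → ℝ) (e : CotBundle S)
    (P : contactPlane F e →ₗ[ℝ] contactPlane F e) : Prop :=
  ∀ X Y : contactPlane F e,
    extDerivOne liouville e (P X) (P Y) = extDerivOne liouville e X Y

/-- The tangent space at `P` of the symplectic group `Sp(ξ_F, dλ) ≅ Sp(2)` at the point `e`. -/
def symplecticTangent (F : TangentBundle (𝓡 2) S → ℝ) (e : CotBundle S)
    (P : contactPlane F e →ₗ[ℝ] contactPlane F e) :
    Set (contactPlane F e →ₗ[ℝ] contactPlane F e) :=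
  {Q | ∀ X Y : contactPlane F e,
    extDerivOne liouville e (Q X) (P Y) + extDerivOne liouville e (P X) (Q Y) = 0}

/-! ### The special perturbations -/

/-- `f_s(q,p) = -½ ln (1 + s (A(q)p,p))`. -/
def pert (A : (q : S) → LinearMap.BilinForm ℝ (Cot q)) (s : ℝ) (e : CotBundle S) : ℝ :=
  -(1 / 2) * Real.log (1 + s * A e.1 e.2 e.2)

/-- The initial velocity `h(q,p) = ∂f_s/∂s|_{s=0} (q,p) = -½ (A(q)p,p)`. -/
def pertVelocity (A : (q : S) → LinearMap.BilinForm ℝ (Cot q)) (e : CotBundle S) : ℝ :=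
  -(1 / 2) * A e.1 e.2 e.2

/-- `1 + s (A(q)p,p) > 0` on `S*_F S`, that is, `f_s` is well defined there. -/
def PertDefined (F : TangentBundle (𝓡 2) S → ℝ) (A : (q : S) → LinearMap.BilinForm ℝ (Cot q))
    (s : ℝ) : Prop :=
  ∀ e ∈ cosphere F, 0 < 1 + s * A e.1 e.2 e.2

/-- `A` is a smooth field of symmetric bilinear forms on the cotangent spaces, supported in `W`,
such that `f_s|_γ = 0` and `df_s|_γ = 0` (as functions on `S*_F S`) whenever `f_s` is defined. -/
structure IsAdmissible (F : TangentBundle (𝓡 2) S → ℝ) (γ : ℝ → CotBundle S) (W : Set S)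
    (A : (q : S) → LinearMap.BilinForm ℝ (Cot q)) : Prop where
  symm : ∀ (q : S) (p p' : Cot q), A q p p' = A q p' p
  smooth : ContMDiff cotModel 𝓘(ℝ, ℝ) ∞ (fun e : CotBundle S => A e.1 e.2 e.2)
  support : closure {q | A q ≠ 0} ⊆ W
  vanish : ∀ s : ℝ, PertDefined F A s → ∀ t : ℝ, pert A s (γ t) = 0 ∧
    ∀ X ∈ cosphereTangent F (γ t), mfderiv cotModel 𝓘(ℝ, ℝ) (pert A s) (γ t) X = 0

/-! ### The local model -/

/-- `Φ : S¹ × D²_δ → S*_F S`, lifted to a 1-periodic map on `ℝ × D²_δ`, is a diffeomorphism onto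
an open neighbourhood of the orbit `γ` of period `l`, with `Φ^*λ = H (dz + x₁ dx₂)`,
`Φ(t,0) = γ(lt)`, `H(t,0) = l`, `dH(t,0) = 0` and `H ≡ l` over `U₁`. -/
structure IsLocalModel (F : TangentBundle (𝓡 2) S → ℝ) (γ : ℝ → CotBundle S) (l : ℝ)
    (U₁ : Set (CotBundle S)) (δ : ℝ) (Φ : ℝ × Plane → CotBundle S) (H : ℝ × Plane → ℝ) :
    Prop where
  radius_pos : 0 < δ
  smooth : ContMDiffOn 𝓘(ℝ, ℝ × Plane) cotModel ∞ Φ (univ ×ˢ Metric.ball 0 δ)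
  mem_cosphere : ∀ z, ∀ x ∈ Metric.ball (0 : Plane) δ, Φ (z, x) ∈ cosphere F
  periodic : ∀ z, ∀ x ∈ Metric.ball (0 : Plane) δ, Φ (z + 1, x) = Φ (z, x)
  injective : ∀ z z' : ℝ, ∀ x ∈ Metric.ball (0 : Plane) δ, ∀ x' ∈ Metric.ball (0 : Plane) δ,
    Φ (z, x) = Φ (z', x') → x = x' ∧ ∃ k : ℤ, z' = z + k
  immersive : ∀ z, ∀ x ∈ Metric.ball (0 : Plane) δ,
    Function.Injective (mfderiv 𝓘(ℝ, ℝ × Plane) cotModel Φ (z, x))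
  open_image : ∃ O : Set (CotBundle S), IsOpen O ∧
    Φ '' (univ ×ˢ Metric.ball 0 δ) = O ∩ cosphere F
  factor_smooth : ContDiffOn ℝ ∞ H (univ ×ˢ Metric.ball 0 δ)
  factor_pos : ∀ z, ∀ x ∈ Metric.ball (0 : Plane) δ, 0 < H (z, x)
  factor_periodic : ∀ z, ∀ x ∈ Metric.ball (0 : Plane) δ, H (z + 1, x) = H (z, x)
  pullback : ∀ z, ∀ x ∈ Metric.ball (0 : Plane) δ, ∀ (ζ : ℝ) (v : Plane),
    liouville (Φ (z, x)) (mfderiv 𝓘(ℝ, ℝ × Plane) cotModel Φ (z, x) ((ζ, v) : ℝ × Plane)) =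
      H (z, x) * (ζ + x 0 * v 1)
  core : ∀ t : ℝ, Φ (t, 0) = γ (l * t)
  factor_core : ∀ t : ℝ, H (t, 0) = l
  factor_deriv_core : ∀ t : ℝ, fderiv ℝ H (t, 0) = 0
  subset_image : U₁ ⊆ Φ '' (univ ×ˢ Metric.ball 0 δ)
  factor_const : ∀ z, ∀ x ∈ Metric.ball (0 : Plane) δ, Φ (z, x) ∈ U₁ → H (z, x) = l

end Surface

/-! ### Matrices and derivatives -/

/-- The standard complex structure. -/
def stdJ : Matrix (Fin 2) (Fin 2) ℝ := !![0, -1; 1, 0]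

/-- The Hessian `∇²_x g (t,0,0)` of `g(z,x)` in the variables `x = (x₁,x₂)`. -/
def hessX (g : ℝ × Plane → ℝ) (t : ℝ) : Matrix (Fin 2) (Fin 2) ℝ :=
  Matrix.of fun i j =>
    fderiv ℝ (fderiv ℝ (fun x : Plane => g (t, x))) 0
      (EuclideanSpace.single i 1) (EuclideanSpace.single j 1)

/-- `R` is the fundamental solution of `R' = -(1/l) J ∇²_x H (t,0,0) R`, `R(0) = I`. -/
def IsFundamentalSolution (l : ℝ) (H : ℝ × Plane → ℝ) (R : ℝ → Matrix (Fin 2) (Fin 2) ℝ) : Prop :=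
  R 0 = 1 ∧ ∀ (t : ℝ) (i j : Fin 2),
    HasDerivAt (fun τ => R τ i j) ((-(1 / l) • (stdJ * hessX H t * R t)) i j) t

/-- The matrix `-∫_{a}^{b} J ∇²_x g (t,0,0) dt`. -/
def hessIntegral (g : ℝ × Plane → ℝ) (a b : ℝ) : Matrix (Fin 2) (Fin 2) ℝ :=
  Matrix.of fun i j => -∫ t in a..b, (stdJ * hessX g t) i j

/-- `D` is the derivative at `s = 0` of the curve `s ↦ P s` of endomorphisms of the
finite-dimensional space `V`, taken weakly (which is the same, as `V` is finite-dimensional). -/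
def HasEndDerivAtZero {V : Type*} [AddCommGroup V] [Module ℝ V] (P : ℝ → (V →ₗ[ℝ] V))
    (D : V →ₗ[ℝ] V) : Prop :=
  ∀ (X : V) (θ : Module.Dual ℝ V), HasDerivAt (fun s => θ (P s X)) (θ (D X)) 0

end

end Finsler

open Finsler

open scoped NNReal

namespace Finsler

noncomputable section

/-! ### Linear differential equations -/

section LinearODE

variable {E : Type*} [NormedAddCommGroup E] [NormedSpace ℝ E]

/-! In a bundle chart let `G` be the dual metric. The Reeb field of `e^f p dq` on the level sets of
`G` has an explicit formula (`reebField`), smooth off the zero section. Existence, uniqueness and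
differentiability of the Reeb flow near the orbit therefore follow from ODE theory in single charts
(`isTransit_of_chart`), from concatenation (`IsTransit.comp`) and from uniqueness
(`IsTransit.unique`).

Admissibility makes the function `a = (A p, p)` vanish to first order along the lifted geodesic: on
the hypersurface by hypothesis, in the radial direction because `a` is homogeneous of degree two. So
`γ` remains a Reeb orbit, and the Hessian of `f_s` along `γ` is exactly `s` times the Hessian of
`h`. The linearized equation is then `W' = (B₀ + s B₁) W`, affine in `s`, and variation of constants
(`hasDerivAt_linear_ode_param`) differentiates its solution in `s`. The linearized flow preserves
contact planes and the symplectic form `ω` on them, and `ω(B₁ Z, Z') = D²h(Z, Z')` on contact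
vectors. Hence the derivative `P'` of the return map `P` satisfies `ω(P' X, P Y) = ∫ D²h(W X, W Y)
dt` with `W` the unperturbed linearized flow. As `ω` is nondegenerate on the contact plane and `P`
is symplectic, this pairing determines `P'`. It is proved in a chart in
`IsCoordOrbit.exists_linearFlow`, and both the formula and the surjectivity rest on it.

Formula: in the local model the Reeb field is that of `H (dz + x₁ dx₂)`, the linearized flow on
contact planes is `R`, and `ω` is `l` times the area form. Passing from time to `z` produces a
factor `l` in the integral as well, and the two cancel. Only the arc contributes, since `h` vanishes
near the rest of the orbit; there `H` is constant, so `R` is constantly `R(t₀)`. What remains is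
algebra of matrices of determinant one (`pairing_derivMatrix`).

Surjectivity: for `D` tangent to the symplectic group, `ω(D X, P Y)` is a symmetric form on a plane,
hence three numbers. Near the regular point there are two vector fields, annihilated by the lift
along the geodesic, whose symbols `p(m₀)`, `p(m₁)` have independent differentials on the contact
plane (`exists_transversal_fields`): the first detects the displacement transverse to the geodesic,
the second the transverse change of momentum. A cut-off times a quadratic polynomial in the two
symbols is an admissible field (`isAdmissible_chartField`). The map from its three coefficients to
the resulting form is an average of symmetric squares of 2 by 2 matrices that are invertible at the
regular moment (`det_symSq`, `det_symSq_symbolD_ne_zero`), so it is invertible as soon as the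
cut-off is concentrated enough (`exists_det_integral_ne_zero`). -/

theorem exists_truncation [FiniteDimensional ℝ E] (R : ℝ) (hR : 0 < R) :
    ∃ g : E → E, (∃ K : ℝ≥0, LipschitzWith K g) ∧ (∃ C, ∀ x, ‖g x‖ ≤ C) ∧
      (∀ x, ‖g x‖ ≤ ‖x‖) ∧ ∀ x, ‖x‖ ≤ R → g x = x := by
  let χ : ContDiffBump (0 : E) := ⟨R, R + 1, hR, by linarith⟩
  have hc : ContDiff ℝ 1 (fun x : E => χ x • x) := χ.contDiff.smul contDiff_id
  have hs : HasCompactSupport (fun x : E => χ x • x) := χ.hasCompactSupport.smul_right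
  refine ⟨fun x => χ x • x, hc.lipschitzWith_of_hasCompactSupport hs one_ne_zero,
    hs.exists_bound_of_continuous hc.continuous, fun x => ?_, fun x hx => ?_⟩
  · rw [norm_smul, Real.norm_of_nonneg χ.nonneg]
    exact mul_le_of_le_one_left (norm_nonneg _) χ.le_one
  · change χ x • x = x
    rw [χ.one_of_mem_closedBall (by simpa using hx), one_smul]

/-- The Picard–Lindelöf theorem limits the length of the interval by the size of the field, and a
linear field is unbounded. The field is therefore composed with a bounded Lipschitz truncation,
which gives a solution on the whole interval; Grönwall's inequality then keeps this solution in the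
ball where the truncation is the identity. The summand `1` in `R` keeps the radius positive when `x₀
= 0`. -/
theorem exists_linear_ode_Icc [FiniteDimensional ℝ E] (B : ℝ → E →L[ℝ] E) (hB : Continuous B) (a T : ℝ) (hT : 0 < T)
    (x₀ : E) : ∃ x : ℝ → E, x a = x₀ ∧
      ∀ t ∈ Icc (a - T) (a + T), HasDerivWithinAt x (B t (x t)) (Icc (a - T) (a + T)) t := by
  obtain ⟨M, hM⟩ := isCompact_Icc (a := a - T) (b := a + T) |>.exists_bound_of_continuousOn
    hB.continuousOn
  have hM0 : 0 ≤ M := (norm_nonneg _).trans (hM a ⟨by linarith, by linarith⟩)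
  set R := ‖x₀‖ * Real.exp (M * T) + 1 with hRdef
  obtain ⟨g, ⟨K, hK⟩, ⟨C, hC⟩, hgle, hgid⟩ := exists_truncation (E := E) R (by positivity)
  have hC0 : 0 ≤ C := (norm_nonneg _).trans (hC 0)
  let t₀ : Icc (a - T) (a + T) := ⟨a, by linarith, by linarith⟩
  have hpl : IsPicardLindelof (fun t x => B t (g x)) t₀ x₀ (Real.toNNReal (M * C * T)) 0
      (Real.toNNReal (M * C)) (Real.toNNReal M * K) := by
    refine ⟨fun t ht => ?_, fun x _ => ?_, fun t ht x _ => ?_, ?_⟩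
    · refine LipschitzWith.lipschitzOnWith ?_
      have h1 : LipschitzWith (Real.toNNReal M) (B t) :=
        (B t).lipschitz.weaken (by
          rw [← NNReal.coe_le_coe, Real.coe_toNNReal _ hM0]; exact hM t ht)
      exact h1.comp hK
    · exact (hB.clm_apply continuous_const).continuousOn
    · rw [Real.coe_toNNReal _ (by positivity)]
      exact ((B t).le_opNorm _).trans (mul_le_mul (hM t ht) (hC _) (norm_nonneg _) hM0)
    · rw [Real.coe_toNNReal _ (by positivity), Real.coe_toNNReal _ (by positivity)]
      simp [t₀]
  obtain ⟨x, hx0, hx⟩ := hpl.exists_eq_forall_mem_Icc_hasDerivWithinAt₀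
  have hx0' : x a = x₀ := hx0
  refine ⟨x, hx0', fun t ht => ?_⟩
  suffices h : ‖x t‖ ≤ R by
    have := hx t ht
    rwa [hgid _ h] at this
  have hexp : ∀ u, 0 ≤ u → u ≤ T → ‖x₀‖ * Real.exp (M * u) ≤ R := by
    intro u _ hu
    have : Real.exp (M * u) ≤ Real.exp (M * T) :=
      Real.exp_le_exp.2 (mul_le_mul_of_nonneg_left hu hM0)
    have := mul_le_mul_of_nonneg_left this (norm_nonneg x₀)
    linarith
  have hcont : ContinuousOn x (Icc (a - T) (a + T)) := fun s hs => (hx s hs).continuousWithinAt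
  rcases le_total a t with hat | hta
  · have := norm_le_gronwallBound_of_norm_deriv_right_le (f := x) (f' := fun t => B t (g (x t)))
      (δ := ‖x₀‖) (K := M) (ε := 0) (a := a) (b := a + T)
      (hcont.mono (Icc_subset_Icc (by linarith) le_rfl))
      (fun s hs => (hx s ⟨by linarith [hs.1], hs.2.le⟩).mono_of_mem_nhdsWithin
        (mem_of_superset (Icc_mem_nhdsGE hs.2) (Icc_subset_Icc (by linarith [hs.1]) le_rfl)))
      (by rw [hx0'])
      (fun s hs => by
        rw [add_zero]
        exact ((B s).le_opNorm _).trans (mul_le_mul (hM s ⟨by linarith [hs.1], hs.2.le⟩)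
          (hgle _) (norm_nonneg _) hM0)) t ⟨hat, ht.2⟩
    rw [gronwallBound_ε0] at this
    exact this.trans (hexp _ (by linarith) (by linarith [ht.2]))
  -- Grönwall's inequality runs forward in time, so times before `a` are treated by reflection about
  -- `a`.
  · have hderiv : ∀ s ∈ Ico a (a + T), HasDerivWithinAt (fun s => x (2 * a - s))
        (-(B (2 * a - s) (g (x (2 * a - s))))) (Ici s) s := by
      intro s hs
      have h1 : HasDerivWithinAt (fun s : ℝ => 2 * a - s) (-1) (Icc a (a + T)) s := by
        simpa using (hasDerivWithinAt_id s _).const_sub (2 * a)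
      have h2 := (hx (2 * a - s) ⟨by linarith [hs.2], by linarith [hs.1]⟩).scomp s h1
        (fun u hu => ⟨by linarith [hu.2], by linarith [hu.1]⟩)
      simp only [neg_smul, one_smul] at h2
      exact h2.mono_of_mem_nhdsWithin
        (mem_of_superset (Icc_mem_nhdsGE hs.2) (Icc_subset_Icc hs.1 le_rfl))
    have := norm_le_gronwallBound_of_norm_deriv_right_le (f := fun s => x (2 * a - s))
      (f' := fun s => -(B (2 * a - s) (g (x (2 * a - s)))))
      (δ := ‖x₀‖) (K := M) (ε := 0) (a := a) (b := a + T)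
      (hcont.comp (by fun_prop) (fun u hu => ⟨by linarith [hu.2], by linarith [hu.1]⟩))
      hderiv (by simp only [two_mul, add_sub_cancel_right]; rw [hx0'])
      (fun s hs => by
        rw [add_zero, norm_neg]
        exact ((B _).le_opNorm _).trans (mul_le_mul
          (hM _ ⟨by linarith [hs.2], by linarith [hs.1]⟩)
          (hgle _) (norm_nonneg _) hM0)) (2 * a - t) ⟨by linarith, by linarith [ht.1]⟩
    rw [gronwallBound_ε0] at this
    simp only [sub_sub_cancel] at this
    exact this.trans (hexp _ (by linarith) (by linarith [ht.1]))

theorem linear_ode_unique (B : ℝ → E →L[ℝ] E) (hB : Continuous B) {a T : ℝ} (hT : 0 < T)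
    {x y : ℝ → E} (h : x a = y a)
    (hx : ∀ t ∈ Icc (a - T) (a + T), HasDerivWithinAt x (B t (x t)) (Icc (a - T) (a + T)) t)
    (hy : ∀ t ∈ Icc (a - T) (a + T), HasDerivWithinAt y (B t (y t)) (Icc (a - T) (a + T)) t) :
    EqOn x y (Icc (a - T) (a + T)) := by
  obtain ⟨M, hM⟩ := isCompact_Icc (a := a - T) (b := a + T) |>.exists_bound_of_continuousOn
    hB.continuousOn
  have hM0 : 0 ≤ M := (norm_nonneg _).trans (hM a ⟨by linarith, by linarith⟩)
  refine ODE_solution_unique_of_mem_Icc (v := fun t x => B t x) (s := fun _ => univ)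
    (K := Real.toNNReal M) (t₀ := a) (fun t ht => ?_) ⟨by linarith, by linarith⟩
    (fun s hs => (hx s hs).continuousWithinAt)
    (fun s hs => (hx s (Ioo_subset_Icc_self hs)).hasDerivAt (Icc_mem_nhds hs.1 hs.2))
    (fun _ _ => trivial) (fun s hs => (hy s hs).continuousWithinAt)
    (fun s hs => (hy s (Ioo_subset_Icc_self hs)).hasDerivAt (Icc_mem_nhds hs.1 hs.2))
    (fun _ _ => trivial) h
  exact ((B t).lipschitz.weaken (by
    rw [← NNReal.coe_le_coe, Real.coe_toNNReal _ hM0]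
    exact hM t (Ioo_subset_Icc_self ht))).lipschitzOnWith

/-- Linear differential equations have global solutions. -/
theorem exists_linear_ode [FiniteDimensional ℝ E] (B : ℝ → E →L[ℝ] E) (hB : Continuous B) (a : ℝ) (x₀ : E) :
    ∃ x : ℝ → E, x a = x₀ ∧ ∀ t, HasDerivAt x (B t (x t)) t := by
  choose x hxa hx using fun n : ℕ => exists_linear_ode_Icc B hB a (n + 1) (by positivity) x₀
  have hmono : ∀ m n : ℕ, m ≤ n → EqOn (x m) (x n) (Icc (a - (m + 1)) (a + (m + 1))) := by
    intro m n hmn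
    have hmn' : (m : ℝ) ≤ n := by exact_mod_cast hmn
    refine linear_ode_unique B hB (by positivity) (by rw [hxa, hxa]) (hx m) fun t ht => ?_
    exact (hx n t ⟨by linarith [ht.1], by linarith [ht.2]⟩).mono
      (Icc_subset_Icc (by linarith) (by linarith))
  -- The global solution takes at `t` the value of the solution with index `⌈|t - a|⌉`, whose
  -- interval contains `t`; near any given time it coincides with a single `x n`.
  have hev : ∀ n : ℕ, ∀ t ∈ Ioo (a - (n + 1 : ℝ)) (a + (n + 1)), x ⌈|t - a|⌉₊ t = x n t := by
    intro n t ht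
    have h1 : |t - a| < n + 1 := abs_sub_lt_iff.2 ⟨by linarith [ht.2], by linarith [ht.1]⟩
    have h2 := Nat.le_ceil |t - a|
    have h3 := abs_le.1 h2
    rcases le_total ⌈|t - a|⌉₊ n with h | h
    · exact hmono _ _ h ⟨by linarith, by linarith⟩
    · exact (hmono _ _ h ⟨ht.1.le, ht.2.le⟩).symm
  refine ⟨fun t => x ⌈|t - a|⌉₊ t, by simp [hxa], fun t => ?_⟩
  obtain ⟨n, hn⟩ := exists_nat_gt |t - a|
  have h1 := abs_sub_lt_iff.1 hn
  have ht : t ∈ Ioo (a - (n + 1 : ℝ)) (a + (n + 1)) := ⟨by linarith, by linarith⟩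
  have h2 := (hx n t (Ioo_subset_Icc_self ht)).hasDerivAt (Icc_mem_nhds ht.1 ht.2)
  have h3 : (fun t => x ⌈|t - a|⌉₊ t) =ᶠ[𝓝 t] x n := by
    filter_upwards [Ioo_mem_nhds ht.1 ht.2] with s hs using hev n s hs
  rw [show (fun t => x ⌈|t - a|⌉₊ t) t = x n t from hev n t ht]
  exact h2.congr_of_eventuallyEq h3

end LinearODE

/-! ### Fundamental solutions and their derivative in a parameter. -/

section Fundamental

variable {𝔸 : Type*} [NormedRing 𝔸] [NormedAlgebra ℝ 𝔸] [FiniteDimensional ℝ 𝔸]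

/-- The fundamental solution of a linear differential equation, with its inverse. -/
theorem exists_fundamental (B : ℝ → 𝔸) (hB : Continuous B) (a : ℝ) :
    ∃ W V : ℝ → 𝔸, W a = 1 ∧ (∀ t, HasDerivAt W (B t * W t) t) ∧ Continuous V ∧
      (∀ t, V t * W t = 1) ∧ ∀ t, W t * V t = 1 := by
  obtain ⟨W, hWa, hW⟩ := exists_linear_ode (fun t => ContinuousLinearMap.mul ℝ 𝔸 (B t))
    ((ContinuousLinearMap.mul ℝ 𝔸).continuous.comp hB) a 1
  -- The inverse is produced as the solution of `V' = -V B`, for which `V W` has derivative zero.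
  obtain ⟨V, hVa, hV⟩ := exists_linear_ode
    (fun t => -(ContinuousLinearMap.mul ℝ 𝔸).flip (B t))
    ((ContinuousLinearMap.mul ℝ 𝔸).flip.continuous.comp hB).neg a 1
  have h1 : ∀ t, V t * W t = 1 := by
    have hd : ∀ t, HasDerivAt (fun t => V t * W t) 0 t := fun t => by
      convert! (hV t).mul (hW t) using 1
      simp [mul_assoc]
    intro t
    have := is_const_of_deriv_eq_zero (fun t => (hd t).differentiableAt) (fun t => (hd t).deriv) t a
    simpa [hVa, hWa] using this
  refine ⟨W, V, hWa, hW, continuous_iff_continuousAt.2 fun t => (hV t).continuousAt, h1,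
    fun t => ?_⟩
  -- A left inverse makes multiplication by `W t` injective, hence surjective in finite dimension,
  -- so the left inverse is a right inverse too.
  have hinj : Function.Injective (LinearMap.mulLeft ℝ (W t)) := fun x y hxy => by
    have : V t * (W t * x) = V t * (W t * y) := congrArg (V t * ·) hxy
    simpa [← mul_assoc, h1] using this
  obtain ⟨y, hy⟩ := LinearMap.surjective_of_injective hinj 1
  have hy' : W t * y = 1 := hy
  rwa [show V t = y by rw [← mul_one (V t), ← hy', ← mul_assoc, h1, one_mul]]

theorem hasDerivAt_of_sq_bound {E : Type*} [NormedAddCommGroup E] [NormedSpace ℝ E]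
    {f : ℝ → E} {f' : E} {C : ℝ} (h : ∀ᶠ s in 𝓝 (0 : ℝ), ‖f s - f 0 - s • f'‖ ≤ C * s ^ 2) :
    HasDerivAt f f' 0 := by
  rw [hasDerivAt_iff_isLittleO]
  have h1 : (fun s : ℝ => f s - f 0 - (s - 0) • f') =O[𝓝 0] fun s => s ^ 2 :=
    Asymptotics.IsBigO.of_bound C (by
      filter_upwards [h] with s hs
      simpa using hs)
  refine h1.trans_isLittleO ?_
  simpa using Asymptotics.isLittleO_pow_id (𝕜 := ℝ) one_lt_two

/-- The derivative with respect to `s` of the solution of `W' = (B₀ + s B₁) W`. -/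
theorem hasDerivAt_linear_ode_param (B₀ B₁ : ℝ → 𝔸) (h₁ : Continuous B₁) {a b : ℝ} (hab : a ≤ b)
    (W : ℝ → ℝ → 𝔸) (hWa : ∀ s, W s a = 1)
    (hW : ∀ s t, HasDerivAt (W s) ((B₀ t + s • B₁ t) * W s t) t) (V : ℝ → 𝔸)
    (hVW : ∀ t, V t * W 0 t = 1) (hWV : ∀ t, W 0 t * V t = 1) (hVc : Continuous V) :
    HasDerivAt (fun s => W s b) (W 0 b * ∫ t in a..b, V t * B₁ t * W 0 t) 0 := by
  have hVd : ∀ t, HasDerivAt V (-(V t * B₀ t)) t := by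
    intro t
    have hu : ∀ t, IsUnit (W 0 t) := fun t => ⟨⟨W 0 t, V t, hWV t, hVW t⟩, rfl⟩
    have hinv : ∀ t, V t = Ring.inverse (W 0 t) := fun t =>
      (Ring.inverse_unit (⟨W 0 t, V t, hWV t, hVW t⟩ : 𝔸ˣ)).symm
    have : CompleteSpace 𝔸 := FiniteDimensional.complete ℝ 𝔸
    have h := (hasFDerivAt_ringInverse (𝕜 := ℝ) (⟨W 0 t, V t, hWV t, hVW t⟩ : 𝔸ˣ)).comp_hasDerivAt
      t (hW 0 t)
    have h2 : V = Ring.inverse ∘ (W 0) := funext hinv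
    rw [← h2] at h
    convert! h using 1
    simp [mul_assoc, hWV]
  set N : ℝ → 𝔸 := fun t => V t * B₁ t * W 0 t with hN
  have hW0c : Continuous (W 0) := continuous_iff_continuousAt.2 fun t => (hW 0 t).continuousAt
  have hNc : Continuous N := (hVc.mul h₁).mul hW0c
  obtain ⟨C, hC⟩ := isCompact_Icc (a := a) (b := b) |>.exists_bound_of_continuousOn hNc.continuousOn
  have hC0 : 0 ≤ C := (norm_nonneg _).trans (hC a ⟨le_rfl, hab⟩)
  -- Variation of constants: `U = V W_s` solves `U' = s N U` with `U(a) = 1`. Three successive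
  -- estimates follow: `U` is bounded, `U - 1 = O(s)`, and `U - 1 - s ∫ N = O(s²)`; the last one is
  -- the derivative at `s = 0`.
  have hU : ∀ s t, HasDerivAt (fun t => V t * W s t) (s • (N t * (V t * W s t))) t := by
    intro s t
    convert! (hVd t).mul (hW s t) using 1
    simp only [hN, mul_assoc, add_mul, mul_add, smul_mul_assoc, mul_smul_comm]
    rw [← mul_assoc (W 0 t) (V t), hWV, one_mul, neg_mul, mul_assoc]
    abel
  set K := ‖(1 : 𝔸)‖ * Real.exp (C * (b - a)) with hKdef
  have hK0 : 0 ≤ K := by positivity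
  have hUa : ∀ s, V a * W s a = 1 := fun s => by rw [hWa, ← hWa 0, hVW, hWa]
  have hUb : ∀ s, |s| ≤ 1 → ∀ t ∈ Icc a b, ‖V t * W s t‖ ≤ K := by
    intro s hs t ht
    have := norm_le_gronwallBound_of_norm_deriv_right_le (f := fun t => V t * W s t)
      (f' := fun t => s • (N t * (V t * W s t))) (δ := ‖(1 : 𝔸)‖) (K := C) (ε := 0)
      (a := a) (b := b) (fun t _ => (hU s t).continuousAt.continuousWithinAt)
      (fun t _ => (hU s t).hasDerivWithinAt) (by rw [hUa]) (fun t ht => by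
        rw [add_zero, norm_smul, Real.norm_eq_abs]
        calc |s| * ‖N t * (V t * W s t)‖ ≤ 1 * (C * ‖V t * W s t‖) := by
              refine mul_le_mul hs ((norm_mul_le _ _).trans ?_) (norm_nonneg _) zero_le_one
              exact mul_le_mul_of_nonneg_right (hC t (Ico_subset_Icc_self ht)) (norm_nonneg _)
          _ = _ := one_mul _) t ht
    rw [gronwallBound_ε0] at this
    refine this.trans (mul_le_mul_of_nonneg_left (Real.exp_le_exp.2 ?_) (norm_nonneg _))
    exact mul_le_mul_of_nonneg_left (by linarith [ht.2]) hC0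
  have hU1 : ∀ s, |s| ≤ 1 → ∀ t ∈ Icc a b, ‖V t * W s t - 1‖ ≤ |s| * (C * K) * (b - a) := by
    intro s hs t ht
    have := norm_image_sub_le_of_norm_deriv_le_segment' (f := fun t => V t * W s t)
      (f' := fun t => s • (N t * (V t * W s t))) (a := a) (b := b) (C := |s| * (C * K))
      (fun t _ => (hU s t).hasDerivWithinAt) (fun t ht => by
        rw [norm_smul, Real.norm_eq_abs]
        refine mul_le_mul_of_nonneg_left ((norm_mul_le _ _).trans ?_) (abs_nonneg _)
        exact mul_le_mul (hC t (Ico_subset_Icc_self ht)) (hUb s hs t (Ico_subset_Icc_self ht))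
          (norm_nonneg _) hC0) t ht
    simp only [hUa] at this
    exact this.trans (mul_le_mul_of_nonneg_left (by linarith [ht.2]) (by positivity))
  have : CompleteSpace 𝔸 := FiniteDimensional.complete ℝ 𝔸
  have hInt : ∀ t, HasDerivAt (fun t => ∫ u in a..t, N u) (N t) t := fun t =>
    intervalIntegral.integral_hasDerivAt_right (hNc.intervalIntegrable _ _)
      (hNc.stronglyMeasurableAtFilter _ _) hNc.continuousAt
  have hfin : HasDerivAt (fun s => V b * W s b) (∫ t in a..b, N t) 0 := by
    refine hasDerivAt_of_sq_bound (C := C * (C * K) * (b - a) * (b - a)) ?_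
    filter_upwards [Metric.closedBall_mem_nhds (0 : ℝ) one_pos] with s hs
    have hs' : |s| ≤ 1 := by simpa using hs
    have := norm_image_sub_le_of_norm_deriv_le_segment'
      (f := fun t => V t * W s t - s • ∫ u in a..t, N u)
      (f' := fun t => s • (N t * (V t * W s t)) - s • N t) (a := a) (b := b)
      (C := |s| * (C * (|s| * (C * K) * (b - a))))
      (fun t _ => ((hU s t).sub ((hInt t).const_smul s)).hasDerivWithinAt) (fun t ht => by
        rw [← smul_sub, norm_smul, Real.norm_eq_abs]
        refine mul_le_mul_of_nonneg_left ?_ (abs_nonneg _)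
        have : N t * (V t * W s t) - N t = N t * (V t * W s t - 1) := by rw [mul_sub, mul_one]
        rw [this]
        refine (norm_mul_le _ _).trans ?_
        exact mul_le_mul (hC t (Ico_subset_Icc_self ht)) (hU1 s hs' t (Ico_subset_Icc_self ht))
          (norm_nonneg _) hC0) b ⟨hab, le_rfl⟩
    simp only [hUa, intervalIntegral.integral_same, smul_zero, sub_zero] at this
    rw [hVW]
    calc _ = ‖V b * W s b - s • (∫ u in a..b, N u) - 1‖ := by congr 1; abel
      _ ≤ _ := this
      _ = _ := by rw [← sq_abs s]; ring
  have := hfin.const_mul (W 0 b)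
  simpa only [← mul_assoc, hWV, one_mul] using this

end Fundamental

/-! ### Nonlinear differential equations -/

section Flow

variable {E : Type*} [NormedAddCommGroup E] [NormedSpace ℝ E] [FiniteDimensional ℝ E]

/-- With zero initial error the bound is linear in the forcing. This turns the Grönwall estimate for
the flow into a multiple of the distance between the initial points. -/
theorem gronwallBound_zero_mul (K ε x : ℝ) :
    gronwallBound 0 K ε x = ε * gronwallBound 0 K 1 x := by
  by_cases hK : K = 0
  · simp [hK, gronwallBound_K0]
  · simp only [gronwallBound_of_K_ne_0 hK]
    ring

/-- The flow of a globally Lipschitz bounded field on a compact interval. -/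
theorem exists_flow_of_bounded {X : E → E} {K : ℝ≥0} (hX : LipschitzWith K X) {C : ℝ}
    (hC : ∀ x, ‖X x‖ ≤ C) {a b : ℝ} (hab : a ≤ b) (x₀ : E) :
    ∃ ψ : E → ℝ → E, ∀ x ∈ Metric.closedBall x₀ 1, ψ x a = x ∧
      ∀ t ∈ Icc a b, HasDerivWithinAt (ψ x) (X (ψ x t)) (Icc a b) t := by
  have hC0 : 0 ≤ C := (norm_nonneg _).trans (hC 0)
  have hpl : IsPicardLindelof (fun _ x => X x) (⟨a, le_rfl, hab⟩ : Icc a b) x₀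
      (Real.toNNReal (C * (b - a) + 1)) 1 (Real.toNNReal C) K := by
    have : 0 ≤ b - a := by linarith
    refine ⟨fun t _ => hX.lipschitzOnWith, fun x _ => continuousOn_const, fun t _ x _ => ?_, ?_⟩
    · rw [Real.coe_toNNReal _ hC0]
      exact hC x
    · rw [Real.coe_toNNReal _ hC0, Real.coe_toNNReal _ (by positivity)]
      simp [this]
  exact hpl.exists_forall_mem_closedBall_eq_forall_mem_Icc_hasDerivWithinAt

/-- Differentiability of the flow in the initial point comes from Grönwall's inequality for the
remainder `ψ x t - y t - L t (x - y a)`. Its derivative is `DX` applied to the remainder plus a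
Taylor error, and that error is uniformly small along the trajectory because `DX`, having compact
support, is uniformly continuous. -/
theorem exists_flow_of_compactSupport {X : E → E} (hX : ContDiff ℝ 1 X) (hc : HasCompactSupport X)
    {a b : ℝ} (hab : a ≤ b) {y : ℝ → E}
    (hy : ∀ t ∈ Icc a b, HasDerivWithinAt y (X (y t)) (Icc a b) t)
    {L : ℝ → E →L[ℝ] E} (hLa : L a = ContinuousLinearMap.id ℝ E)
    (hL : ∀ t ∈ Icc a b, HasDerivWithinAt L ((fderiv ℝ X (y t)).comp (L t)) (Icc a b) t) :
    ∃ ψ : E → ℝ → E, (∀ x ∈ Metric.closedBall (y a) 1, ψ x a = x ∧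
        ∀ t ∈ Icc a b, HasDerivWithinAt (ψ x) (X (ψ x t)) (Icc a b) t) ∧
      (∃ C, ∀ x ∈ Metric.closedBall (y a) 1, ∀ t ∈ Icc a b, ‖ψ x t - y t‖ ≤ C * ‖x - y a‖) ∧
      HasFDerivAt (fun x => ψ x b) (L b) (y a) := by
  obtain ⟨K, hK⟩ := hX.lipschitzWith_of_hasCompactSupport hc one_ne_zero
  obtain ⟨C₀, hC₀⟩ := hc.exists_bound_of_continuous hX.continuous
  obtain ⟨ψ, hψ⟩ := exists_flow_of_bounded hK hC₀ hab (y a)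
  have right : ∀ {G : Type _} [NormedAddCommGroup G] [NormedSpace ℝ G] {f : ℝ → G} {f' : ℝ → G},
      (∀ t ∈ Icc a b, HasDerivWithinAt f (f' t) (Icc a b) t) →
      ∀ t ∈ Ico a b, HasDerivWithinAt f (f' t) (Ici t) t := fun h t ht =>
    (h t (Ico_subset_Icc_self ht)).mono_of_mem_nhdsWithin
      (mem_of_superset (Icc_mem_nhdsGE ht.2) (Icc_subset_Icc ht.1 le_rfl))
  have hyc : ContinuousOn y (Icc a b) := fun t ht => (hy t ht).continuousWithinAt
  set C := Real.exp (K * (b - a)) with hCdef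
  have hCpos : 0 < C := Real.exp_pos _
  have hclose : ∀ x ∈ Metric.closedBall (y a) 1, ∀ t ∈ Icc a b,
      ‖ψ x t - y t‖ ≤ C * ‖x - y a‖ := by
    intro x hx t ht
    have := dist_le_of_trajectories_ODE (v := fun _ => X) (fun _ => hK) (f := ψ x) (g := y)
      (fun t ht => ((hψ x hx).2 t ht).continuousWithinAt) (right (hψ x hx).2) hyc (right hy)
      (le_of_eq (by rw [(hψ x hx).1])) t ht
    rw [dist_eq_norm, dist_eq_norm, mul_comm] at this
    refine this.trans (mul_le_mul_of_nonneg_right (Real.exp_le_exp.2 ?_) (norm_nonneg _))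
    exact mul_le_mul_of_nonneg_left (by linarith [ht.2]) K.2
  refine ⟨ψ, hψ, ⟨C, hclose⟩, ?_⟩
  have hψy : ψ (y a) b = y b := by
    have := hclose (y a) (Metric.mem_closedBall_self zero_le_one) b ⟨hab, le_rfl⟩
    simpa [sub_eq_zero] using this
  have hDc : UniformContinuous (fderiv ℝ X) :=
    (hc.fderiv ℝ).uniformContinuous_of_continuous (hX.continuous_fderiv one_ne_zero)
  rw [hasFDerivAt_iff_isLittleO, Asymptotics.isLittleO_iff]
  intro c hcpos
  set Γ := gronwallBound 0 K 1 (b - a) with hΓ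
  have hΓ0 : 0 ≤ Γ := by
    have := gronwallBound_mono (δ := 0) (K := K) (ε := 1) le_rfl zero_le_one K.2
      (show (0 : ℝ) ≤ b - a by linarith)
    rwa [gronwallBound_x0] at this
  -- Chosen so that the final bound `ε C Γ` is at most `c`; `Γ + 1` replaces `Γ` because `Γ` may
  -- vanish.
  set ε := c / (C * (Γ + 1)) with hε
  have hεpos : 0 < ε := by positivity
  obtain ⟨δ, hδ, hDδ⟩ := Metric.uniformContinuous_iff.1 hDc ε hεpos
  have hball : Metric.ball (y a) (min 1 (δ / C)) ∈ 𝓝 (y a) :=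
    Metric.ball_mem_nhds _ (by positivity)
  filter_upwards [hball] with x hx
  have hx1 : x ∈ Metric.closedBall (y a) 1 :=
    Metric.ball_subset_closedBall (Metric.ball_subset_ball (min_le_left _ _) hx)
  have hxδ : C * ‖x - y a‖ < δ := by
    have := (Metric.mem_ball.1 hx).trans_le (min_le_right _ _)
    rw [dist_eq_norm, lt_div_iff₀ hCpos] at this
    linarith
  have hder : ∀ t ∈ Icc a b, HasDerivWithinAt (fun t => ψ x t - y t - L t (x - y a))
      (X (ψ x t) - X (y t) - fderiv ℝ X (y t) (L t (x - y a))) (Icc a b) t := fun t ht =>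
    (((hψ x hx1).2 t ht).sub (hy t ht)).sub (by simpa using (hL t ht).clm_apply (hasDerivWithinAt_const t _ (x - y a)))
  have hbound : ∀ t ∈ Ico a b, ‖X (ψ x t) - X (y t) - fderiv ℝ X (y t) (L t (x - y a))‖ ≤
      K * ‖ψ x t - y t - L t (x - y a)‖ + ε * (C * ‖x - y a‖) := by
    intro t ht
    have ht' := Ico_subset_Icc_self ht
    have h1 : ‖X (ψ x t) - X (y t) - fderiv ℝ X (y t) (ψ x t - y t)‖ ≤ ε * ‖ψ x t - y t‖ := by
      refine (convex_ball (y t) δ).norm_image_sub_le_of_norm_fderiv_le'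
        (fun z _ => (hX.differentiable one_ne_zero) z) (fun z hz => ?_)
        (Metric.mem_ball_self hδ) ?_
      · rw [← dist_eq_norm]
        exact (hDδ (Metric.mem_ball.1 hz)).le
      · rw [Metric.mem_ball, dist_eq_norm]
        exact (hclose x hx1 t ht').trans_lt hxδ
    have h2 : ‖fderiv ℝ X (y t)‖ ≤ K := norm_fderiv_le_of_lipschitz ℝ hK
    calc _ = ‖(X (ψ x t) - X (y t) - fderiv ℝ X (y t) (ψ x t - y t)) +
          fderiv ℝ X (y t) (ψ x t - y t - L t (x - y a))‖ := by
            congr 1; simp only [map_sub]; abel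
      _ ≤ _ := norm_add_le _ _
      _ ≤ ε * (C * ‖x - y a‖) + K * ‖ψ x t - y t - L t (x - y a)‖ := by
          refine add_le_add (h1.trans (mul_le_mul_of_nonneg_left (hclose x hx1 t ht') hεpos.le)) ?_
          exact ((fderiv ℝ X (y t)).le_opNorm _).trans
            (mul_le_mul_of_nonneg_right h2 (norm_nonneg _))
      _ = _ := add_comm _ _
  have := norm_le_gronwallBound_of_norm_deriv_right_le (δ := 0)
    (fun t ht => (hder t ht).continuousWithinAt) (right hder)
    (by simp [(hψ x hx1).1, hLa]) hbound b ⟨hab, le_rfl⟩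
  rw [gronwallBound_zero_mul] at this
  rw [hψy]
  refine this.trans ?_
  calc ε * (C * ‖x - y a‖) * Γ ≤ ε * (C * ‖x - y a‖) * (Γ + 1) := by gcongr; linarith
    _ = c * ‖x - y a‖ := by rw [hε]; field_simp

/-- The flow of a `C¹` field near a solution on a compact interval, and its derivative with respect
to the initial value. -/
theorem exists_flow_near {X : E → E} {V : Set E} (hV : IsOpen V) (hX : ContDiffOn ℝ 1 X V)
    {a b : ℝ} (hab : a ≤ b) {y : ℝ → E} (hyV : ∀ t ∈ Icc a b, y t ∈ V)
    (hy : ∀ t ∈ Icc a b, HasDerivWithinAt y (X (y t)) (Icc a b) t)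
    {L : ℝ → E →L[ℝ] E} (hLa : L a = ContinuousLinearMap.id ℝ E)
    (hL : ∀ t ∈ Icc a b, HasDerivWithinAt L ((fderiv ℝ X (y t)).comp (L t)) (Icc a b) t) :
    ∃ ψ : E → ℝ → E, (∀ᶠ x in 𝓝 (y a), ψ x a = x ∧
        ∀ t ∈ Icc a b, ψ x t ∈ V ∧ HasDerivWithinAt (ψ x) (X (ψ x t)) (Icc a b) t) ∧
      ψ (y a) b = y b ∧ HasFDerivAt (fun x => ψ x b) (L b) (y a) := by
  have hyc : ContinuousOn y (Icc a b) := fun t ht => (hy t ht).continuousWithinAt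
  have hK : IsCompact (y '' Icc a b) := isCompact_Icc.image_of_continuousOn hyc
  have hKV : y '' Icc a b ⊆ V := by rintro _ ⟨t, ht, rfl⟩; exact hyV t ht
  obtain ⟨Q, hQ, hKQ, hQV⟩ := exists_compact_between hK hV hKV
  -- Multiplication by a cut-off that is `1` near the trajectory and vanishes off a compact subset
  -- of `V` reduces the local statement to compactly supported fields.
  obtain ⟨χ, hχ1, hχ0, -⟩ := exists_contMDiffMap_one_nhds_of_subset_interior (n := 1) 𝓘(ℝ, E)
    hK.isClosed hKQ
  have hχc : ContDiff ℝ 1 χ := χ.contMDiff.contDiff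
  have hcomp : HasCompactSupport (fun x => χ x • X x) :=
    HasCompactSupport.intro hQ fun x hx => by simp [hχ0 x hx]
  have hcd : ContDiff ℝ 1 (fun x => χ x • X x) := by
    refine contDiff_iff_contDiffAt.2 fun x => ?_
    by_cases hx : x ∈ V
    · exact hχc.contDiffAt.smul (hX.contDiffAt (hV.mem_nhds hx))
    · refine (contDiffAt_const (c := (0 : E))).congr_of_eventuallyEq ?_
      filter_upwards [hQ.isClosed.isOpen_compl.mem_nhds fun h => hx (hQV h)] with z hz
      simp [hχ0 z hz]
  obtain ⟨O, hO, hKO, hO1⟩ := eventually_nhdsSet_iff_exists.1 hχ1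
  -- A uniform tube around the trajectory on which the cut-off is `1`. Trajectories with nearby
  -- initial points stay in the tube, so there the truncated field may be replaced by `X`.
  obtain ⟨δ, hδ, hδO⟩ := hK.exists_thickening_subset_open hO hKO
  have hδ1 : ∀ {z}, z ∈ Metric.thickening δ (y '' Icc a b) → χ z = 1 := fun hz => hO1 _ (hδO hz)
  have hev : ∀ t ∈ Icc a b, (fun x => χ x • X x) =ᶠ[𝓝 (y t)] X := by
    intro t ht
    have : Metric.thickening δ (y '' Icc a b) ∈ 𝓝 (y t) :=
      Metric.isOpen_thickening.mem_nhds (Metric.self_subset_thickening hδ _ ⟨t, ht, rfl⟩)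
    filter_upwards [this] with x hx
    simp [hδ1 hx]
  obtain ⟨ψ, hψ, ⟨C, hC⟩, hd⟩ := exists_flow_of_compactSupport hcd hcomp hab (y := y) (L := L)
    (fun t ht => by rw [(hev t ht).eq_of_nhds]; exact hy t ht) hLa
    (fun t ht => by rw [(hev t ht).fderiv_eq]; exact hL t ht)
  have hya : y a ∈ Metric.closedBall (y a) 1 := Metric.mem_closedBall_self zero_le_one
  refine ⟨ψ, ?_, ?_, hd⟩
  · have hlim : Tendsto (fun x => C * ‖x - y a‖) (𝓝 (y a)) (𝓝 0) := by
      have : Continuous fun x => C * ‖x - y a‖ := by fun_prop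
      simpa using this.tendsto (y a)
    filter_upwards [Metric.closedBall_mem_nhds (y a) one_pos, hlim.eventually (gt_mem_nhds hδ)]
      with x hx hxδ
    refine ⟨(hψ x hx).1, fun t ht => ?_⟩
    have h1 : χ (ψ x t) = 1 := hδ1 (Metric.mem_thickening_iff.2 ⟨y t, ⟨t, ht, rfl⟩, by
      rw [dist_eq_norm]
      exact (hC x hx t ht).trans_lt hxδ⟩)
    refine ⟨hQV ?_, ?_⟩
    · by_contra hn
      simp [hχ0 _ hn] at h1
    · have := (hψ x hx).2 t ht
      rwa [h1, one_smul] at this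
  · have := hC (y a) hya b ⟨hab, le_rfl⟩
    simpa [sub_eq_zero] using this

end Flow

/-- The model space of the cotangent bundle. -/
abbrev Mod := Plane × (Plane →L[ℝ] ℝ)

section Shortcuts

variable (S : Type*) [TopologicalSpace S] [ChartedSpace Plane S] [IsManifold (𝓡 2) ∞ S]

/-- The topology of the cotangent bundle. -/
abbrev cotTopology : TopologicalSpace (CotBundle S) := inferInstance

/-- The charts of the cotangent bundle. -/
abbrev cotChartedSpace : ChartedSpace (ModelProd Plane (Plane →L[ℝ] ℝ)) (CotBundle S) :=
  inferInstance

theorem cot_isManifold : IsManifold cotModel ∞ (CotBundle S) := inferInstance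

theorem cot_isManifold_one : IsManifold cotModel 1 (CotBundle S) := inferInstance

theorem continuousSMul_mod : ContinuousSMul ℝ Mod := inferInstance

end Shortcuts

/-! ### Bundle charts of the tangent and cotangent bundles. -/

section Charts

attribute [local instance] cotTopology cotChartedSpace cot_isManifold cot_isManifold_one
  continuousSMul_mod

variable {S : Type*} [TopologicalSpace S] [ChartedSpace Plane S]

/-- The derivative of the inverse of the chart at `q₀`. -/
def tanPar (q₀ : S) (x : Plane) : Plane →L[ℝ] Plane :=
  mfderiv 𝓘(ℝ, Plane) (𝓡 2) (extChartAt (𝓡 2) q₀).symm x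

/-- The derivative of the chart at `q₀`. -/
def tanChart (q₀ : S) (q : S) : Plane →L[ℝ] Plane :=
  mfderiv (𝓡 2) 𝓘(ℝ, Plane) (extChartAt (𝓡 2) q₀) q

/-- A covector in the preferred coordinates of its base point. -/
def covec (e : CotBundle S) : Plane →L[ℝ] ℝ := e.2

theorem isOpen_chart_target (q₀ : S) : IsOpen (extChartAt (𝓡 2) q₀).target :=
  isOpen_extChartAt_target q₀

theorem cotBundle_ext {e e' : CotBundle S} (h : e.1 = e'.1) (h' : covec e = covec e') : e = e' := by
  obtain ⟨q, p⟩ := e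
  obtain ⟨q', p'⟩ := e'
  cases h
  exact congrArg _ h'

variable [IsManifold (𝓡 2) ∞ S]

theorem tanChart_comp_tanPar {q₀ : S} {x : Plane} (hx : x ∈ (extChartAt (𝓡 2) q₀).target) :
    (tanChart q₀ ((extChartAt (𝓡 2) q₀).symm x)).comp (tanPar q₀ x) =
      ContinuousLinearMap.id ℝ Plane := by
  have := mfderiv_extChartAt_comp_mfderivWithin_extChartAt_symm (I := 𝓡 2) hx
  rw [ModelWithCorners.range_eq_univ, mfderivWithin_univ] at this
  exact this

theorem tanPar_comp_tanChart {q₀ : S} {x : Plane} (hx : x ∈ (extChartAt (𝓡 2) q₀).target) :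
    (tanPar q₀ x).comp (tanChart q₀ ((extChartAt (𝓡 2) q₀).symm x)) =
      ContinuousLinearMap.id ℝ Plane := by
  have := mfderivWithin_extChartAt_symm_comp_mfderiv_extChartAt (I := 𝓡 2) hx
  rw [ModelWithCorners.range_eq_univ, mfderivWithin_univ] at this
  exact this

theorem tanPar_self (q₀ : S) :
    tanPar q₀ (extChartAt (𝓡 2) q₀ q₀) = ContinuousLinearMap.id ℝ Plane := by
  have := mfderivWithin_range_extChartAt_symm (I := 𝓡 2) (x := q₀)
  rw [ModelWithCorners.range_eq_univ, mfderivWithin_univ] at this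
  exact this

/-- The chart of the cotangent bundle over the chart at `q₀`. -/
def cotChart (q₀ : S) : PartialEquiv (CotBundle S) Mod :=
  extChartAt cotModel (⟨q₀, 0⟩ : CotBundle S)

theorem cotChart_source (q₀ : S) :
    (cotChart q₀).source = {e | e.1 ∈ (extChartAt (𝓡 2) q₀).source} := by
  ext e
  rw [cotChart, FiberBundle.extChartAt, PartialEquiv.trans_source]
  simp
  exact fun h => h

/-- The trivialization of the hom bundle precomposes a covector with the inverse of the tangent
trivialization, and that inverse is the derivative of the inverse chart. -/
theorem cotChart_apply {q₀ : S} {e : CotBundle S} (he : e.1 ∈ (extChartAt (𝓡 2) q₀).source) :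
    cotChart q₀ e = (extChartAt (𝓡 2) q₀ e.1,
      (covec e).comp (tanPar q₀ (extChartAt (𝓡 2) q₀ e.1))) := by
  rw [cotChart, FiberBundle.extChartAt]
  simp only [PartialEquiv.coe_trans, Function.comp_apply, PartialEquiv.prod_coe]
  refine Prod.ext rfl ?_
  change (trivializationAt (Plane →L[ℝ] ℝ) (fun q : S => Cot q) q₀ e).2 = _
  rw [hom_trivializationAt_apply]
  ext v
  have := TangentBundle.symmL_trivializationAt (I := 𝓡 2) (x₀ := q₀) (x := e.1) (by simpa using he)
  simp only [ContinuousLinearMap.inCoordinates]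
  rw [this]
  simp [tanPar]
  rfl

theorem cotChart_target (q₀ : S) :
    (cotChart q₀).target = (extChartAt (𝓡 2) q₀).target ×ˢ univ := by
  rw [cotChart, FiberBundle.extChartAt_target]
  congr 1
  refine inter_eq_left.2 fun x hx => ?_
  have := (extChartAt (𝓡 2) q₀).map_target hx
  simpa using this

theorem isOpen_cotChart_source (q₀ : S) : IsOpen (cotChart q₀).source :=
  isOpen_extChartAt_source _

theorem isOpen_cotChart_target (q₀ : S) : IsOpen (cotChart q₀).target :=
  isOpen_extChartAt_target _

theorem mem_cotChart_target {q₀ : S} {y : Mod} :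
    y ∈ (cotChart q₀).target ↔ y.1 ∈ (extChartAt (𝓡 2) q₀).target := by
  rw [cotChart_target]
  simp

theorem cotChart_symm_proj {q₀ : S} {y : Mod} (hy : y ∈ (cotChart q₀).target) :
    ((cotChart q₀).symm y).1 = (extChartAt (𝓡 2) q₀).symm y.1 := by
  have h1 := (cotChart q₀).map_target hy
  rw [cotChart_source] at h1
  have h2 := (cotChart q₀).right_inv hy
  rw [cotChart_apply h1] at h2
  rw [← congrArg Prod.fst h2]
  exact ((extChartAt (𝓡 2) q₀).left_inv h1).symm

theorem covec_cotChart_symm {q₀ : S} {y : Mod} (hy : y ∈ (cotChart q₀).target) :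
    covec ((cotChart q₀).symm y) = y.2.comp (tanChart q₀ ((extChartAt (𝓡 2) q₀).symm y.1)) := by
  have h1 := (cotChart q₀).map_target hy
  rw [cotChart_source] at h1
  have h2 := (cotChart q₀).right_inv hy
  rw [cotChart_apply h1] at h2
  have h3 := congrArg Prod.fst h2
  have h4 := congrArg Prod.snd h2
  simp only at h3 h4
  rw [h3] at h4
  rw [← h4, ContinuousLinearMap.comp_assoc, tanPar_comp_tanChart (mem_cotChart_target.1 hy)]
  rfl

theorem cotChart_symm_apply {q₀ : S} {y : Mod} (hy : y ∈ (cotChart q₀).target) :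
    (cotChart q₀).symm y = (⟨(extChartAt (𝓡 2) q₀).symm y.1,
      y.2.comp (tanChart q₀ ((extChartAt (𝓡 2) q₀).symm y.1))⟩ : CotBundle S) :=
  cotBundle_ext (cotChart_symm_proj hy) (covec_cotChart_symm hy)

theorem cotChart_self (e : CotBundle S) :
    cotChart e.1 e = (extChartAt (𝓡 2) e.1 e.1, covec e) := by
  rw [cotChart_apply (mem_extChartAt_source e.1), tanPar_self]
  rfl

theorem mem_cotChart_source (e : CotBundle S) : e ∈ (cotChart e.1).source := by
  rw [cotChart_source]
  exact mem_extChartAt_source e.1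

theorem contMDiffOn_cotChart (q₀ : S) :
    ContMDiffOn cotModel 𝓘(ℝ, Mod) ∞ (cotChart q₀) (cotChart q₀).source := by
  have := contMDiffOn_extChartAt (I := cotModel) (x := (⟨q₀, 0⟩ : CotBundle S)) (n := ∞)
  rwa [← extChartAt_source (I := cotModel)] at this

theorem contMDiffOn_cotChart_symm (q₀ : S) :
    ContMDiffOn 𝓘(ℝ, Mod) cotModel ∞ (cotChart q₀).symm (cotChart q₀).target :=
  contMDiffOn_extChartAt_symm (I := cotModel) (⟨q₀, 0⟩ : CotBundle S)

theorem contMDiffAt_cotChart {q₀ : S} {e : CotBundle S} (he : e ∈ (cotChart q₀).source) :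
    ContMDiffAt cotModel 𝓘(ℝ, Mod) ∞ (cotChart q₀) e :=
  (contMDiffOn_cotChart q₀).contMDiffAt ((isOpen_cotChart_source q₀).mem_nhds he)

theorem contMDiffAt_cotChart_symm {q₀ : S} {y : Mod} (hy : y ∈ (cotChart q₀).target) :
    ContMDiffAt 𝓘(ℝ, Mod) cotModel ∞ (cotChart q₀).symm y :=
  (contMDiffOn_cotChart_symm q₀).contMDiffAt ((isOpen_cotChart_target q₀).mem_nhds hy)

/-- The derivative of the chart of the cotangent bundle. -/
def chartD (q₀ : S) (e : CotBundle S) : Mod →L[ℝ] Mod :=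
  mfderiv cotModel 𝓘(ℝ, Mod) (cotChart q₀) e

/-- The derivative of the inverse of the chart of the cotangent bundle. -/
def parD (q₀ : S) (y : Mod) : Mod →L[ℝ] Mod :=
  mfderiv 𝓘(ℝ, Mod) cotModel (cotChart q₀).symm y

theorem hasMFDerivAt_cotChart {q₀ : S} {e : CotBundle S} (he : e ∈ (cotChart q₀).source) :
    HasMFDerivAt cotModel 𝓘(ℝ, Mod) (cotChart q₀) e (chartD q₀ e) :=
  ((contMDiffAt_cotChart he).mdifferentiableAt (by simp)).hasMFDerivAt

theorem hasMFDerivAt_cotChart_symm {q₀ : S} {y : Mod} (hy : y ∈ (cotChart q₀).target) :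
    HasMFDerivAt 𝓘(ℝ, Mod) cotModel (cotChart q₀).symm y (parD q₀ y) :=
  ((contMDiffAt_cotChart_symm hy).mdifferentiableAt (by simp)).hasMFDerivAt

theorem chartD_comp_parD {q₀ : S} {y : Mod} (hy : y ∈ (cotChart q₀).target) :
    (chartD q₀ ((cotChart q₀).symm y)).comp (parD q₀ y) = ContinuousLinearMap.id ℝ Mod := by
  have := mfderiv_extChartAt_comp_mfderivWithin_extChartAt_symm (I := cotModel)
    (x := (⟨q₀, 0⟩ : CotBundle S)) hy
  rw [ModelWithCorners.range_eq_univ, mfderivWithin_univ] at this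
  exact this

theorem parD_comp_chartD {q₀ : S} {y : Mod} (hy : y ∈ (cotChart q₀).target) :
    (parD q₀ y).comp (chartD q₀ ((cotChart q₀).symm y)) = ContinuousLinearMap.id ℝ Mod := by
  have := mfderivWithin_extChartAt_symm_comp_mfderiv_extChartAt (I := cotModel)
    (x := (⟨q₀, 0⟩ : CotBundle S)) hy
  rw [ModelWithCorners.range_eq_univ, mfderivWithin_univ] at this
  exact this

theorem chartD_parD {q₀ : S} {y : Mod} (hy : y ∈ (cotChart q₀).target) (W : Mod) :
    chartD q₀ ((cotChart q₀).symm y) (parD q₀ y W) = W :=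
  congrArg (fun L : Mod →L[ℝ] Mod => L W) (chartD_comp_parD hy)

theorem parD_chartD {q₀ : S} {y : Mod} (hy : y ∈ (cotChart q₀).target) (W : Mod) :
    parD q₀ y (chartD q₀ ((cotChart q₀).symm y) W) = W :=
  congrArg (fun L : Mod →L[ℝ] Mod => L W) (parD_comp_chartD hy)

theorem parD_chartD' {q₀ : S} {e : CotBundle S} (he : e ∈ (cotChart q₀).source) (W : Mod) :
    parD q₀ (cotChart q₀ e) (chartD q₀ e W) = W := by
  have := parD_chartD ((cotChart q₀).map_source he) W
  rwa [(cotChart q₀).left_inv he] at this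

theorem chartD_parD' {q₀ : S} {e : CotBundle S} (he : e ∈ (cotChart q₀).source) (W : Mod) :
    chartD q₀ e (parD q₀ (cotChart q₀ e) W) = W := by
  have := chartD_parD ((cotChart q₀).map_source he) W
  rwa [(cotChart q₀).left_inv he] at this

theorem chartD_self (e : CotBundle S) : chartD e.1 e = ContinuousLinearMap.id ℝ Mod :=
  mfderiv_extChartAt_self (I := cotModel) (x := e)

theorem parD_self (e : CotBundle S) : parD e.1 (cotChart e.1 e) = ContinuousLinearMap.id ℝ Mod := by
  have := parD_comp_chartD ((cotChart e.1).map_source (mem_cotChart_source e))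
  rwa [(cotChart e.1).left_inv (mem_cotChart_source e), chartD_self] at this

/-! ### Curves in charts -/

theorem hasDerivWithinAt_cotChart_comp {q₀ : S} {c : ℝ → CotBundle S} {s : Set ℝ} {t : ℝ}
    {X : Mod} (hc : c t ∈ (cotChart q₀).source)
    (h : HasMFDerivWithinAt 𝓘(ℝ, ℝ) cotModel c s t ((1 : ℝ →L[ℝ] ℝ).smulRight X)) :
    HasDerivWithinAt (fun t => cotChart q₀ (c t)) (chartD q₀ (c t) X) s t := by
  have h1 := (hasMFDerivAt_cotChart hc).comp_hasMFDerivWithinAt t h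
  have h2 : HasFDerivWithinAt (fun t => cotChart q₀ (c t))
      ((chartD q₀ (c t)).comp ((1 : ℝ →L[ℝ] ℝ).smulRight X)) s t :=
    hasMFDerivWithinAt_iff_hasFDerivWithinAt.1 h1
  refine h2.hasDerivWithinAt.congr_deriv ?_
  change chartD q₀ (c t) ((1 : ℝ) • X) = _
  rw [one_smul]

theorem hasMFDerivWithinAt_cotChart_symm_comp {q₀ : S} {y : ℝ → Mod} {s : Set ℝ} {t : ℝ}
    {ξ : Mod} (hy : y t ∈ (cotChart q₀).target) (h : HasDerivWithinAt y ξ s t) :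
    HasMFDerivWithinAt 𝓘(ℝ, ℝ) cotModel (fun t => (cotChart q₀).symm (y t)) s t
      ((1 : ℝ →L[ℝ] ℝ).smulRight (parD q₀ (y t) ξ)) := by
  have h1 := hasMFDerivWithinAt_iff_hasFDerivWithinAt.2 h.hasFDerivWithinAt
  have h2 := (hasMFDerivAt_cotChart_symm hy).comp_hasMFDerivWithinAt t h1
  have key : (parD q₀ (y t)).comp (ContinuousLinearMap.toSpanSingleton ℝ ξ) =
      (1 : ℝ →L[ℝ] ℝ).smulRight (parD q₀ (y t) ξ) := by
    ext1
    simp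
  have h3 : ∀ L : ℝ →L[ℝ] Mod,
      (parD q₀ (y t)).comp (ContinuousLinearMap.toSpanSingleton ℝ ξ) = L →
      HasMFDerivWithinAt 𝓘(ℝ, ℝ) cotModel (fun t => (cotChart q₀).symm (y t)) s t L := by
    rintro _ rfl
    exact h2
  exact h3 _ key

/-! ### The Liouville form -/

/-- The bundle projection read in the chart is the first coordinate, and the covector component is
pulled back by the chart of the base; the two derivatives of the base chart cancel. Every chart
computation with the contact form starts from this local expression `p dq`. -/
theorem liouville_parD {q₀ : S} {y : Mod} (hy : y ∈ (cotChart q₀).target) (W : Mod) :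
    liouville ((cotChart q₀).symm y) (parD q₀ y W) = y.2 W.1 := by
  have hx := mem_cotChart_target.1 hy
  have h1 : HasMFDerivAt 𝓘(ℝ, Mod) (𝓡 2) ((TotalSpace.proj : CotBundle S → S) ∘ (cotChart q₀).symm)
      y ((mfderiv cotModel (𝓡 2) (TotalSpace.proj : CotBundle S → S) ((cotChart q₀).symm y)).comp
        (parD q₀ y)) :=
    (mdifferentiableAt_proj (fun q : S => Cot q)).hasMFDerivAt.comp y
      (hasMFDerivAt_cotChart_symm hy)
  have hsymm : MDifferentiableAt 𝓘(ℝ, Plane) (𝓡 2) (extChartAt (𝓡 2) q₀).symm y.1 :=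
    (mdifferentiableOn_extChartAt_symm (I := 𝓡 2) (x := q₀)).mdifferentiableAt
      ((isOpen_chart_target q₀).mem_nhds hx)
  have h2 : HasMFDerivAt 𝓘(ℝ, Mod) (𝓡 2) ((extChartAt (𝓡 2) q₀).symm ∘ Prod.fst) y
      ((tanPar q₀ y.1).comp (ContinuousLinearMap.fst ℝ Plane (Plane →L[ℝ] ℝ))) :=
    HasMFDerivAt.comp y (I' := 𝓘(ℝ, Plane)) hsymm.hasMFDerivAt
      (ContinuousLinearMap.fst ℝ Plane (Plane →L[ℝ] ℝ)).hasMFDerivAt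
  have h3 : (TotalSpace.proj : CotBundle S → S) ∘ (cotChart q₀).symm =ᶠ[𝓝 y]
      (extChartAt (𝓡 2) q₀).symm ∘ Prod.fst := by
    filter_upwards [(isOpen_cotChart_target q₀).mem_nhds hy] with z hz using cotChart_symm_proj hz
  have h4 := hasMFDerivAt_unique h1 (h2.congr_of_eventuallyEq h3)
  have h5 := congrArg (fun L : Mod →L[ℝ] Plane => covec ((cotChart q₀).symm y) (L W)) h4
  refine h5.trans ?_
  change covec ((cotChart q₀).symm y) (tanPar q₀ y.1 W.1) = _
  rw [covec_cotChart_symm hy]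
  change y.2 (((tanChart q₀ ((extChartAt (𝓡 2) q₀).symm y.1)).comp (tanPar q₀ y.1)) W.1) = _
  rw [tanChart_comp_tanPar hx]
  rfl

theorem liouville_apply (e : CotBundle S) (X : Mod) : liouville e X = covec e X.1 := by
  have h := liouville_parD ((cotChart e.1).map_source (mem_cotChart_source e)) X
  rw [(cotChart e.1).left_inv (mem_cotChart_source e), parD_self, cotChart_self] at h
  exact h

end Charts

theorem hasDerivAt_fderiv_line {E : Type*} [NormedAddCommGroup E] [NormedSpace ℝ E] {g : E → ℝ}
    {v u w : E} {t : ℝ} (hg : DifferentiableAt ℝ (fderiv ℝ g) (v + t • u)) :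
    HasDerivAt (fun s : ℝ => fderiv ℝ g (v + s • u) w)
      (fderiv ℝ (fderiv ℝ g) (v + t • u) u w) t := by
  have h2 : HasDerivAt (fun t : ℝ => v + t • u) u t := by
    simpa using ((hasDerivAt_id t).smul_const u).const_add v
  have h3 : HasDerivAt (fun s : ℝ => fderiv ℝ g (v + s • u))
      (fderiv ℝ (fderiv ℝ g) (v + t • u) u) t := hg.hasFDerivAt.comp_hasDerivAt t h2
  exact (ContinuousLinearMap.apply ℝ ℝ w).hasFDerivAt.comp_hasDerivAt t h3

/-! ### Minkowski norms -/

/-- A (not necessarily symmetric) Minkowski norm on the plane. -/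
structure IsMinkowski (M : Plane → ℝ) : Prop where
  smooth : ∀ v, v ≠ 0 → ContDiffAt ℝ ∞ M v
  pos : ∀ v, v ≠ 0 → 0 < M v
  zero : M 0 = 0
  homogeneous : ∀ v (a : ℝ), 0 < a → M (a • v) = a * M v
  convex : ∀ v u, v ≠ 0 → u ≠ 0 →
    0 < deriv (fun s : ℝ => deriv (fun t : ℝ => M (v + s • u + t • u) ^ 2) 0) 0

namespace IsMinkowski

variable {M : Plane → ℝ} (hM : IsMinkowski M)

include hM

theorem exists_bounds : ∃ c C : ℝ, 0 < c ∧ 0 < C ∧ ∀ v, c * ‖v‖ ≤ M v ∧ M v ≤ C * ‖v‖ := by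
  have hc : ContinuousOn M (Metric.sphere (0 : Plane) 1) := fun v hv =>
    (hM.smooth v (by rintro rfl; simp at hv)).continuousAt.continuousWithinAt
  have hne : (Metric.sphere (0 : Plane) 1).Nonempty := NormedSpace.sphere_nonempty.2 zero_le_one
  obtain ⟨a, ha, hamin⟩ := (isCompact_sphere (0 : Plane) 1).exists_isMinOn hne hc
  obtain ⟨b, hb, hbmax⟩ := (isCompact_sphere (0 : Plane) 1).exists_isMaxOn hne hc
  have ha0 : a ≠ 0 := by rintro rfl; simp at ha
  have hb0 : b ≠ 0 := by rintro rfl; simp at hb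
  refine ⟨M a, M b, hM.pos a ha0, hM.pos b hb0, fun v => ?_⟩
  by_cases hv : v = 0
  · simp [hv, hM.zero]
  have hv' : 0 < ‖v‖ := norm_pos_iff.2 hv
  have hw : ‖v‖⁻¹ • v ∈ Metric.sphere (0 : Plane) 1 := by
    simp [norm_smul, hv'.ne']
  have h1 : M v = ‖v‖ * M (‖v‖⁻¹ • v) := by
    rw [hM.homogeneous _ _ (by positivity)]
    field_simp
  rw [h1, mul_comm (M a), mul_comm (M b)]
  exact ⟨mul_le_mul_of_nonneg_left (hamin hw) hv'.le, mul_le_mul_of_nonneg_left (hbmax hw) hv'.le⟩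

theorem nonneg (v : Plane) : 0 ≤ M v := by
  by_cases hv : v = 0
  · rw [hv, hM.zero]
  · exact (hM.pos v hv).le

theorem contDiffAt_energy {v : Plane} (hv : v ≠ 0) :
    ContDiffAt ℝ ∞ (fun w => 1 / 2 * M w ^ 2) v :=
  contDiffAt_const.mul ((hM.smooth v hv).pow 2)

theorem hasFDerivAt_energy {v : Plane} (hv : v ≠ 0) :
    HasFDerivAt (fun w => 1 / 2 * M w ^ 2) (M v • fderiv ℝ M v) v := by
  have h := (((hM.smooth v hv).differentiableAt (by simp)).hasFDerivAt.pow 2).const_mul (1 / 2)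
  convert! h using 1
  ext w
  simp
  ring

theorem fderiv_energy {v : Plane} (hv : v ≠ 0) :
    fderiv ℝ (fun w => 1 / 2 * M w ^ 2) v = M v • fderiv ℝ M v :=
  (hM.hasFDerivAt_energy hv).fderiv

/-- The energy is bounded by a multiple of `‖w‖²`, which suffices at the origin, where smoothness is
not available. It covers the case in which the minimum in `legendre_surjective` is attained at `0`.
-/
theorem hasFDerivAt_energy_zero :
    HasFDerivAt (fun w => 1 / 2 * M w ^ 2) (0 : Plane →L[ℝ] ℝ) 0 := by
  obtain ⟨c, C, hc, hC, h⟩ := hM.exists_bounds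
  rw [hasFDerivAt_iff_isLittleO]
  have h1 : (fun w : Plane => 1 / 2 * M w ^ 2 - 1 / 2 * M 0 ^ 2 - (0 : Plane →L[ℝ] ℝ) (w - 0))
      =O[𝓝 0] fun w => ‖w‖ ^ 2 := by
    refine Asymptotics.IsBigO.of_bound (1 / 2 * C ^ 2) (Eventually.of_forall fun w => ?_)
    have h2 : M w ^ 2 ≤ (C * ‖w‖) ^ 2 := pow_le_pow_left₀ (hM.nonneg w) (h w).2 2
    simp only [hM.zero, sub_zero, zero_apply]
    have h3 : 1 / 2 * M w ^ 2 - 1 / 2 * 0 ^ 2 = 1 / 2 * M w ^ 2 := by ring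
    rw [h3, Real.norm_of_nonneg (by positivity), Real.norm_of_nonneg (by positivity)]
    nlinarith
  refine h1.trans_isLittleO ?_
  simpa using (Asymptotics.isLittleO_norm_pow_id (E' := Plane) one_lt_two)

theorem continuous : Continuous M := by
  refine continuous_iff_continuousAt.2 fun v => ?_
  by_cases hv : v = 0
  · obtain ⟨c, C, hc, hC, h⟩ := hM.exists_bounds
    subst hv
    rw [ContinuousAt, hM.zero]
    refine squeeze_zero hM.nonneg (fun w => (h w).2) ?_
    have : Continuous fun w : Plane => C * ‖w‖ := by fun_prop
    simpa using this.tendsto 0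
  · exact (hM.smooth v hv).continuousAt

/-- Euler's identity. -/
theorem fderiv_self {v : Plane} (hv : v ≠ 0) : fderiv ℝ M v v = M v := by
  have h1 : HasDerivAt (fun t : ℝ => M ((1 + t) • v)) (fderiv ℝ M v v) 0 := by
    have h2 : HasDerivAt (fun t : ℝ => (1 + t) • v) v 0 := by
      simpa using ((hasDerivAt_id (0 : ℝ)).const_add 1).smul_const v
    have h3 : HasFDerivAt M (fderiv ℝ M v) ((1 + (0 : ℝ)) • v) := by
      simpa using ((hM.smooth v hv).differentiableAt (by simp)).hasFDerivAt
    exact h3.comp_hasDerivAt 0 h2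
  have h4 : HasDerivAt (fun t : ℝ => (1 + t) * M v) (M v) 0 := by
    simpa using ((hasDerivAt_id (0 : ℝ)).const_add 1).mul_const (M v)
  refine h1.unique (h4.congr_of_eventuallyEq ?_)
  filter_upwards [lt_mem_nhds (show (-1 : ℝ) < 0 by norm_num)] with t ht
  exact hM.homogeneous v _ (by linarith)

/-- The differential of a function homogeneous of degree one is homogeneous of degree zero;
consequently the Legendre transformation is homogeneous of degree one. -/
theorem fderiv_smul {v : Plane} (hv : v ≠ 0) {r : ℝ} (hr : 0 < r) :
    fderiv ℝ M (r • v) = fderiv ℝ M v := by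
  have hd := ((hM.smooth (r • v) (smul_ne_zero hr.ne' hv)).differentiableAt (by simp)).hasFDerivAt
  have h1 : HasFDerivAt (fun w => M (r • w)) ((fderiv ℝ M (r • v)).comp
      (r • ContinuousLinearMap.id ℝ Plane)) v :=
    hd.comp v ((hasFDerivAt_id v).const_smul r)
  have h2 : HasFDerivAt (fun w => M (r • w)) (r • fderiv ℝ M v) v := by
    have := ((hM.smooth v hv).differentiableAt (by simp)).hasFDerivAt.const_mul r
    refine this.congr_of_eventuallyEq (Eventually.of_forall fun w => hM.homogeneous w r hr)
  have h3 := h1.unique h2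
  ext w
  have := congrArg (fun L : Plane →L[ℝ] ℝ => L w) h3
  simp only [ContinuousLinearMap.comp_apply, smul_apply,
    ContinuousLinearMap.id_apply, map_smul, smul_eq_mul] at this
  exact mul_left_cancel₀ hr.ne' this

theorem deriv_line {v u : Plane} (hv : v ≠ 0) :
    deriv (fun t : ℝ => M (v + t • u) ^ 2) 0 =
      2 * fderiv ℝ (fun w => 1 / 2 * M w ^ 2) v u := by
  have h2 : HasDerivAt (fun t : ℝ => v + t • u) u 0 := by
    simpa using ((hasDerivAt_id (0 : ℝ)).smul_const u).const_add v
  have h3 : HasFDerivAt (fun w => 1 / 2 * M w ^ 2)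
      (fderiv ℝ (fun w => 1 / 2 * M w ^ 2) v) (v + (0 : ℝ) • u) := by
    simpa using ((hM.contDiffAt_energy hv).differentiableAt (by simp)).hasFDerivAt
  have h4 := (h3.comp_hasDerivAt 0 h2).const_mul 2
  rw [← h4.deriv]
  congr 1
  ext t
  simp

/-- Convexity is given through iterated one-variable derivatives. Off the origin the energy is
smooth, so these are twice its second Fréchet derivative. -/
theorem hessian_pos {v u : Plane} (hv : v ≠ 0) (hu : u ≠ 0) :
    0 < fderiv ℝ (fderiv ℝ (fun w => 1 / 2 * M w ^ 2)) v u u := by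
  have h := hM.convex v u hv hu
  have h2 : HasDerivAt (fun t : ℝ => v + t • u) u 0 := by
    simpa using ((hasDerivAt_id (0 : ℝ)).smul_const u).const_add v
  have h4 : HasDerivAt (fun s : ℝ => 2 * fderiv ℝ (fun w => 1 / 2 * M w ^ 2) (v + s • u) u)
      (2 * fderiv ℝ (fderiv ℝ (fun w => 1 / 2 * M w ^ 2)) v u u) 0 := by
    have h3 : DifferentiableAt ℝ (fderiv ℝ (fun w => 1 / 2 * M w ^ 2)) (v + (0 : ℝ) • u) := by
      rw [zero_smul, add_zero]
      exact ((hM.contDiffAt_energy hv).fderiv_right (m := ∞) (by simp)).differentiableAt (by simp)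
    have := (hasDerivAt_fderiv_line (w := u) h3).const_mul 2
    rwa [zero_smul, add_zero] at this
  have h5 : (fun s : ℝ => deriv (fun t : ℝ => M (v + s • u + t • u) ^ 2) 0) =ᶠ[𝓝 0]
      fun s => 2 * fderiv ℝ (fun w => 1 / 2 * M w ^ 2) (v + s • u) u := by
    have hne : ∀ᶠ s : ℝ in 𝓝 0, v + s • u ≠ 0 := by
      have : ContinuousAt (fun s : ℝ => v + s • u) 0 := h2.continuousAt
      exact this.eventually_ne (by simpa using hv)
    filter_upwards [hne] with s hs using hM.deriv_line hs
  rw [h5.deriv_eq, h4.deriv] at h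
  linarith

/-- The Legendre transformation of a Minkowski norm is injective. -/
theorem legendre_injective : Function.Injective fun v => M v • fderiv ℝ M v := by
  have key : ∀ v, v ≠ 0 → 0 < (M v • fderiv ℝ M v) v := fun v hv => by
    have := hM.pos v hv
    rw [smul_apply, hM.fderiv_self hv, smul_eq_mul]
    positivity
  intro v w hvw
  simp only at hvw
  by_cases hv : v = 0
  · by_contra hne
    have hw : w ≠ 0 := fun h => hne (by rw [hv, h])
    have := key w hw
    rw [← hvw, hv, hM.zero] at this
    simp at this
  by_cases hw : w = 0
  · have := key v hv
    rw [hvw, hw, hM.zero] at this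
    simp at this
  by_contra hne
  have hu : w - v ≠ 0 := fun h => hne (sub_eq_zero.1 h).symm
  -- The energy need not be twice differentiable at the origin, so the segment from `v` to `w` must
  -- avoid it for the convexity argument. If it passes through the origin, `v` and `w` point in
  -- opposite directions, and a common Legendre image would be positive on both by Euler's identity,
  -- which is impossible.
  by_cases hseg : ∃ t ∈ Icc (0 : ℝ) 1, v + t • (w - v) = 0
  · obtain ⟨t, ht, h0⟩ := hseg
    have ht0 : t ≠ 0 := by rintro rfl; simp at h0; exact hv h0
    have ht1 : t ≠ 1 := by rintro rfl; simp at h0; exact hw h0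
    have htp : 0 < t := lt_of_le_of_ne ht.1 ht0.symm
    have htq : 0 < 1 - t := sub_pos.2 (lt_of_le_of_ne ht.2 ht1)
    have hv' : v = (-t) • (w - v) := by
      rw [neg_smul]; exact eq_neg_of_add_eq_zero_left h0
    have hw' : w = (1 - t) • (w - v) := by
      rw [sub_smul, one_smul]
      have : w = v + (w - v) := by abel
      nth_rewrite 1 [this]
      nth_rewrite 1 [hv']
      rw [neg_smul]; abel
    have h1 := key v hv
    have h2 := key w hw
    rw [← hvw] at h2
    set q := M v • fderiv ℝ M v with hq
    rw [show q v = (-t) * q (w - v) by nth_rewrite 1 [hv']; rw [map_smul, smul_eq_mul]] at h1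
    rw [show q w = (1 - t) * q (w - v) by nth_rewrite 1 [hw']; rw [map_smul, smul_eq_mul]] at h2
    have := (pos_iff_pos_of_mul_pos h2).1 htq
    nlinarith
  · push Not at hseg
    -- The derivative of the energy along the segment is strictly increasing, whereas equal Legendre
    -- images would give it equal values at the ends.
    set g : ℝ → ℝ := fun t => fderiv ℝ (fun w => 1 / 2 * M w ^ 2) (v + t • (w - v)) (w - v) with hg
    have hd : ∀ t ∈ Icc (0 : ℝ) 1, HasDerivAt g (fderiv ℝ (fderiv ℝ (fun w => 1 / 2 * M w ^ 2))
        (v + t • (w - v)) (w - v) (w - v)) t := by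
      intro t ht
      exact hasDerivAt_fderiv_line (((hM.contDiffAt_energy (hseg t ht)).fderiv_right (m := ∞)
        (by simp)).differentiableAt (by simp))
    have hmono : StrictMonoOn g (Icc 0 1) := by
      refine strictMonoOn_of_deriv_pos (convex_Icc 0 1)
        (fun t ht => (hd t ht).continuousAt.continuousWithinAt) fun t ht => ?_
      rw [interior_Icc] at ht
      rw [(hd t (Ioo_subset_Icc_self ht)).deriv]
      exact hM.hessian_pos (hseg t (Ioo_subset_Icc_self ht)) hu
    have h01 := hmono (left_mem_Icc.2 zero_le_one) (right_mem_Icc.2 zero_le_one) zero_lt_one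
    simp only [hg, zero_smul, add_zero, one_smul, add_sub_cancel] at h01
    rw [hM.fderiv_energy hv, hM.fderiv_energy hw, hvw] at h01
    exact lt_irrefl _ h01

/-- The Legendre transformation of a Minkowski norm is surjective. -/
theorem legendre_surjective : Function.Surjective fun v => M v • fderiv ℝ M v := by
  intro p
  obtain ⟨c, C, hc, hC, h⟩ := hM.exists_bounds
  -- A preimage of `p` is a critical point of energy minus `p`; a minimum exists because the energy
  -- grows quadratically.
  set g : Plane → ℝ := fun v => 1 / 2 * M v ^ 2 - p v with hg
  have hgc : Continuous g := (continuous_const.mul (hM.continuous.pow 2)).sub p.continuous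
  have hlim : Tendsto g (cocompact Plane) atTop := by
    have h1 : Tendsto (fun v : Plane => ‖v‖ * (1 / 2 * c ^ 2 * ‖v‖ - ‖p‖)) (cocompact Plane)
        atTop := by
      refine tendsto_norm_cocompact_atTop.atTop_mul_atTop₀ ?_
      exact tendsto_atTop_add_const_right _ _
        (tendsto_norm_cocompact_atTop.const_mul_atTop (by positivity))
    refine tendsto_atTop_mono (fun v => ?_) h1
    have h2 : (c * ‖v‖) ^ 2 ≤ M v ^ 2 := pow_le_pow_left₀ (by positivity) (h v).1 2
    have h3 : p v ≤ ‖p‖ * ‖v‖ := (le_abs_self _).trans (p.le_opNorm v)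
    simp only [hg]
    nlinarith
  obtain ⟨v, hv⟩ := hgc.exists_forall_le hlim
  have hmin : IsLocalMin g v := Eventually.of_forall hv
  refine ⟨v, ?_⟩
  by_cases hv0 : v = 0
  · subst hv0
    have h1 := hmin.hasFDerivAt_eq_zero (hM.hasFDerivAt_energy_zero.sub p.hasFDerivAt)
    simp only [hM.zero, zero_smul]
    exact (sub_eq_zero.1 h1)
  · have h1 := hmin.hasFDerivAt_eq_zero ((hM.hasFDerivAt_energy hv0).sub p.hasFDerivAt)
    exact sub_eq_zero.1 h1

end IsMinkowski

/-! ### Finsler metrics in coordinates -/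

/-- A smooth family of Minkowski norms over a subset of the plane. -/
structure IsCoordFinsler (Ω : Set Plane) (N : Plane × Plane → ℝ) : Prop where
  isOpen : IsOpen Ω
  smooth : ∀ x ∈ Ω, ∀ v, v ≠ 0 → ContDiffAt ℝ ∞ N (x, v)
  minkowski : ∀ x ∈ Ω, IsMinkowski fun v => N (x, v)

/-- The Legendre transformation of a family of Minkowski norms. -/
def coordLegendre (N : Plane × Plane → ℝ) (x v : Plane) : Plane →L[ℝ] ℝ :=
  N (x, v) • fderiv ℝ (fun w => N (x, w)) v

/-- A positive function on the cotangent bundle in coordinates, homogeneous of degree one in the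
fibres and smooth off the zero section. -/
structure IsCoordDual (Ω : Set Plane) (G : Mod → ℝ) : Prop where
  isOpen : IsOpen Ω
  smooth : ∀ y : Mod, y.1 ∈ Ω → y.2 ≠ 0 → ContDiffAt ℝ ∞ G y
  pos : ∀ y : Mod, y.1 ∈ Ω → y.2 ≠ 0 → 0 < G y
  homogeneous : ∀ (y : Mod) (r : ℝ), y.1 ∈ Ω → y.2 ≠ 0 → 0 < r → G (y.1, r • y.2) = r * G y

namespace IsCoordFinsler

variable {Ω : Set Plane} {N : Plane × Plane → ℝ} (hN : IsCoordFinsler Ω N)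

include hN

theorem contDiffAt_energy {x v : Plane} (hx : x ∈ Ω) (hv : v ≠ 0) :
    ContDiffAt ℝ ∞ (fun y => 1 / 2 * N y ^ 2) (x, v) :=
  contDiffAt_const.mul ((hN.smooth x hx v hv).pow 2)

/-- Writing the fibre derivative as a restriction of the total derivative of the energy shows that
the Legendre transformation is jointly smooth in position and velocity. -/
theorem coordLegendre_eq {x v : Plane} (hx : x ∈ Ω) (hv : v ≠ 0) :
    coordLegendre N x v = (fderiv ℝ (fun y => 1 / 2 * N y ^ 2) (x, v)).comp
      (ContinuousLinearMap.inr ℝ Plane Plane) := by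
  have h1 := ((hN.contDiffAt_energy hx hv).differentiableAt (by simp)).hasFDerivAt
  have h2 : HasFDerivAt (fun w : Plane => (x, w)) (ContinuousLinearMap.inr ℝ Plane Plane) v :=
    hasFDerivAt_prodMk_right x v
  exact ((hN.minkowski x hx).hasFDerivAt_energy hv).unique (h1.comp v h2)

theorem coordLegendre_eq_fderiv {x v : Plane} (hx : x ∈ Ω) (hv : v ≠ 0) :
    coordLegendre N x v = fderiv ℝ (fun w => 1 / 2 * N (x, w) ^ 2) v :=
  ((hN.minkowski x hx).fderiv_energy hv).symm

theorem coordLegendre_ne_zero {x v : Plane} (hx : x ∈ Ω) (hv : v ≠ 0) :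
    coordLegendre N x v ≠ 0 := by
  intro h
  refine hv ((hN.minkowski x hx).legendre_injective ?_)
  simp only [(hN.minkowski x hx).zero, zero_smul]
  exact h

theorem eventually_mem {x v : Plane} (hx : x ∈ Ω) (hv : v ≠ 0) :
    ∀ᶠ y : Plane × Plane in 𝓝 (x, v), y.1 ∈ Ω ∧ y.2 ≠ 0 :=
  (continuousAt_fst.eventually (hN.isOpen.mem_nhds hx)).and
    (continuousAt_snd.eventually_ne hv)

theorem contDiffAt_legendre {x v : Plane} (hx : x ∈ Ω) (hv : v ≠ 0) :
    ContDiffAt ℝ ∞ (fun y : Plane × Plane => coordLegendre N y.1 y.2) (x, v) := by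
  have h1 : ContDiffAt ℝ ∞ (fderiv ℝ (fun y => 1 / 2 * N y ^ 2)) (x, v) :=
    (hN.contDiffAt_energy hx hv).fderiv_right (m := ∞) (by simp)
  have h2 := h1.clm_comp (contDiffAt_const (c := ContinuousLinearMap.inr ℝ Plane Plane))
  refine h2.congr_of_eventuallyEq ?_
  filter_upwards [hN.eventually_mem hx hv] with y hy using hN.coordLegendre_eq hy.1 hy.2

theorem fderiv_legendre_pos {x v u : Plane} (hx : x ∈ Ω) (hv : v ≠ 0) (hu : u ≠ 0) :
    0 < fderiv ℝ (fun y : Plane × Plane => coordLegendre N y.1 y.2) (x, v) (0, u) u := by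
  have h1 := ((hN.contDiffAt_legendre hx hv).differentiableAt (by simp)).hasFDerivAt
  have h2 : HasFDerivAt (fun w : Plane => (x, w)) (ContinuousLinearMap.inr ℝ Plane Plane) v :=
    hasFDerivAt_prodMk_right x v
  have h3 := h1.comp v h2
  have h4 : (fderiv ℝ (fun w => 1 / 2 * N (x, w) ^ 2)) =ᶠ[𝓝 v]
      (fun y : Plane × Plane => coordLegendre N y.1 y.2) ∘ fun w : Plane => (x, w) := by
    filter_upwards [isOpen_ne.mem_nhds hv] with w hw
      using (hN.coordLegendre_eq_fderiv hx hw).symm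
  have h5 := (hN.minkowski x hx).hessian_pos hv hu
  rw [h4.fderiv_eq, h3.fderiv] at h5
  exact h5

/-- The derivative of the Legendre transformation, as a linear isomorphism. -/
theorem exists_legendre_equiv {x v : Plane} (hx : x ∈ Ω) (hv : v ≠ 0) :
    ∃ A : (Plane × Plane) ≃L[ℝ] Mod,
      HasFDerivAt (fun y : Plane × Plane => (y.1, coordLegendre N y.1 y.2))
        (A : (Plane × Plane) →L[ℝ] Mod) (x, v) := by
  have h1 := ((hN.contDiffAt_legendre hx hv).differentiableAt (by simp)).hasFDerivAt
  set D := fderiv ℝ (fun y : Plane × Plane => coordLegendre N y.1 y.2) (x, v) with hD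
  have h2 : HasFDerivAt (fun y : Plane × Plane => (y.1, coordLegendre N y.1 y.2))
      ((ContinuousLinearMap.fst ℝ Plane Plane).prod D) (x, v) := hasFDerivAt_fst.prodMk h1
  set T := (ContinuousLinearMap.fst ℝ Plane Plane).prod D with hT
  -- The derivative is block triangular with the identity in the position block, so a kernel vector
  -- is vertical, and positivity of the fibre Hessian excludes those.
  have hinj : Function.Injective T.toLinearMap := by
    rw [← LinearMap.ker_eq_bot, LinearMap.ker_eq_bot']
    rintro ⟨ξ, u⟩ h
    have ha : ξ = 0 := congrArg Prod.fst h
    have hb : D (ξ, u) = 0 := congrArg Prod.snd h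
    subst ha
    by_contra hne
    have hu : u ≠ 0 := fun h => hne (by rw [h]; rfl)
    have := hN.fderiv_legendre_pos hx hv hu
    rw [← hD, hb] at this
    simp at this
  have hdim : Module.finrank ℝ (Plane × Plane) = Module.finrank ℝ Mod := by
    have : Module.finrank ℝ (Plane →L[ℝ] ℝ) = Module.finrank ℝ (Plane →ₗ[ℝ] ℝ) :=
      LinearMap.toContinuousLinearMap.symm.finrank_eq
    rw [Module.finrank_prod, Module.finrank_prod, this, Module.finrank_linearMap]
    simp
  refine ⟨(LinearMap.linearEquivOfInjective T.toLinearMap hinj hdim).toContinuousLinearEquiv, ?_⟩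
  convert! h2 using 1

variable {G : Mod → ℝ} (hG : ∀ x ∈ Ω, ∀ v, G (x, coordLegendre N x v) = N (x, v))

include hG

theorem dual_comp (y : Mod) (hy : y.1 ∈ Ω) (hp : y.2 ≠ 0) :
    ∃ v, v ≠ 0 ∧ coordLegendre N y.1 v = y.2 ∧ G y = N (y.1, v) := by
  obtain ⟨v, hv⟩ := (hN.minkowski y.1 hy).legendre_surjective y.2
  have hv' : coordLegendre N y.1 v = y.2 := hv
  refine ⟨v, ?_, hv', ?_⟩
  · rintro rfl
    apply hp
    rw [← hv', coordLegendre, (hN.minkowski y.1 hy).zero, zero_smul]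
  · rw [← hG _ hy, hv']

/-- By the inverse function theorem `(x, v) ↦ (x, 𝓛(x, v))` has a smooth local inverse, and locally
`G` is `N` composed with it. Positivity and homogeneity are transported by the Legendre
transformation. -/
theorem isCoordDual : IsCoordDual Ω G where
  isOpen := hN.isOpen
  smooth := by
    rintro ⟨x, p⟩ hx hp
    obtain ⟨v, hv, hvp, -⟩ := hN.dual_comp hG (x, p) hx hp
    simp only at hx hvp
    obtain ⟨A, hA⟩ := hN.exists_legendre_equiv hx hv
    have hcd : ContDiffAt ℝ ∞ (fun y : Plane × Plane => (y.1, coordLegendre N y.1 y.2)) (x, v) :=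
      contDiffAt_fst.prodMk (hN.contDiffAt_legendre hx hv)
    have hne : (∞ : WithTop ℕ∞) ≠ 0 := by simp
    have hstrict := hcd.hasStrictFDerivAt' hA hne
    set inv := hcd.localInverse hA hne with hinv
    have hsm : ContDiffAt ℝ ∞ inv (x, p) := by
      have := hcd.to_localInverse hA hne
      simp only [hvp] at this
      exact this
    have hinv0 : inv (x, p) = (x, v) := by
      have := hstrict.localInverse_apply_image
      simp only [hvp] at this
      exact this
    have hr : ∀ᶠ y in 𝓝 (x, p), ((inv y).1, coordLegendre N (inv y).1 (inv y).2) = y := by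
      have := hstrict.eventually_right_inverse
      simp only [hvp] at this
      exact this
    have hmem : ∀ᶠ y in 𝓝 (x, p), (inv y).1 ∈ Ω ∧ (inv y).2 ≠ 0 := by
      have := hsm.continuousAt.tendsto
      rw [hinv0] at this
      exact this.eventually (hN.eventually_mem hx hv)
    have hN' : ContDiffAt ℝ ∞ N (inv (x, p)) := by
      rw [hinv0]
      exact hN.smooth x hx v hv
    refine (hN'.comp (x, p) hsm).congr_of_eventuallyEq ?_
    filter_upwards [hr, hmem] with y hy hy'
    have := hG _ hy'.1 (inv y).2
    rw [hy] at this
    exact this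
  pos y hy hp := by
    obtain ⟨v, hv, -, h⟩ := hN.dual_comp hG y hy hp
    rw [h]
    exact (hN.minkowski _ hy).pos v hv
  homogeneous y r hy hp hr := by
    obtain ⟨v, hv, hvp, h⟩ := hN.dual_comp hG y hy hp
    have h1 : coordLegendre N y.1 (r • v) = r • y.2 := by
      rw [← hvp, coordLegendre, coordLegendre, (hN.minkowski _ hy).fderiv_smul hv hr, smul_smul]
      congr 1
      exact (hN.minkowski _ hy).homogeneous v r hr
    rw [← h1, hG _ hy, h]
    exact (hN.minkowski _ hy).homogeneous v r hr

/-- The derivative of the dual metric at a unit covector. -/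
theorem fderiv_dual {x v : Plane} (hx : x ∈ Ω) (hv : v ≠ 0) (h1 : N (x, v) = 1) (W : Mod) :
    fderiv ℝ G (x, coordLegendre N x v) W =
      W.2 v - fderiv ℝ (fun y => 1 / 2 * N y ^ 2) (x, v) (W.1, 0) := by
  obtain ⟨A, hA⟩ := hN.exists_legendre_equiv hx hv
  set Lg : Plane × Plane → ℝ := fun y => 1 / 2 * N y ^ 2 with hLg
  have hLd := ((hN.contDiffAt_energy hx hv).differentiableAt (by simp)).hasFDerivAt
  have hleg := ((hN.contDiffAt_legendre hx hv).differentiableAt (by simp)).hasFDerivAt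
  set D := fderiv ℝ (fun y : Plane × Plane => coordLegendre N y.1 y.2) (x, v) with hD
  have hAD : ∀ Z, A Z = (Z.1, D Z) := by
    intro Z
    have h2 : HasFDerivAt (fun y : Plane × Plane => (y.1, coordLegendre N y.1 y.2))
      ((ContinuousLinearMap.fst ℝ Plane Plane).prod D) (x, v) := hasFDerivAt_fst.prodMk hleg
    exact congrArg (fun L : (Plane × Plane) →L[ℝ] Mod => L Z) (hA.unique h2)
  have hGd : HasFDerivAt G (fderiv ℝ G (x, coordLegendre N x v)) (x, coordLegendre N x v) :=
    (((hN.isCoordDual hG).smooth (x, coordLegendre N x v) hx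
      (hN.coordLegendre_ne_zero hx hv)).differentiableAt (by simp)).hasFDerivAt
  have hG1 : G (x, coordLegendre N x v) = 1 := by rw [hG x hx, h1]
  -- differentiate `G² / 2 ∘ 𝓛 = L`
  have hcomp : ∀ Z, fderiv ℝ G (x, coordLegendre N x v) (Z.1, D Z) =
      fderiv ℝ Lg (x, v) Z := by
    intro Z
    have h2 : HasFDerivAt (fun y => 1 / 2 * G y ^ 2) (fderiv ℝ G (x, coordLegendre N x v))
        (x, coordLegendre N x v) := by
      have := (hGd.pow 2).const_mul (1 / 2)
      convert! this using 1
      ext w <;> simp [hG1]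
    have h3 := HasFDerivAt.comp (x, v) h2 hA
    have h4 : Lg =ᶠ[𝓝 (x, v)] (fun y => 1 / 2 * G y ^ 2) ∘
        fun y : Plane × Plane => (y.1, coordLegendre N y.1 y.2) := by
      filter_upwards [hN.eventually_mem hx hv] with y hy
      simp only [hLg, Function.comp_apply]
      rw [hG _ hy.1]
    have h5 := hLd.unique (h3.congr_of_eventuallyEq h4)
    have h6 := congrArg (fun L : (Plane × Plane) →L[ℝ] ℝ => L Z) h5
    simp only [ContinuousLinearMap.comp_apply] at h6
    rw [← hAD]
    exact h6.symm
  -- differentiate Euler's identity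
  have heuler : ∀ Z : Plane × Plane, D Z v + fderiv ℝ Lg (x, v) (0, Z.2) =
      2 * fderiv ℝ Lg (x, v) Z := by
    intro Z
    have h2 : HasFDerivAt (fun y : Plane × Plane => coordLegendre N y.1 y.2 y.2)
        (((coordLegendre N x v).comp (ContinuousLinearMap.snd ℝ Plane Plane)) + D.flip v) (x, v) :=
      hleg.clm_apply hasFDerivAt_snd
    have h3 : (fun y : Plane × Plane => coordLegendre N y.1 y.2 y.2) =ᶠ[𝓝 (x, v)]
        fun y => 2 * Lg y := by
      filter_upwards [hN.eventually_mem hx hv] with y hy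
      have := (hN.minkowski y.1 hy.1).fderiv_self hy.2
      simp only [coordLegendre, smul_apply, hLg]
      rw [this, smul_eq_mul]
      ring
    have h4 := (h2.congr_of_eventuallyEq h3.symm).unique (hLd.const_mul 2)
    have h5 := congrArg (fun L : (Plane × Plane) →L[ℝ] ℝ => L Z) h4
    simp only [add_apply, ContinuousLinearMap.comp_apply,
      ContinuousLinearMap.coe_snd', ContinuousLinearMap.flip_apply,
      smul_apply, smul_eq_mul] at h5
    rw [hN.coordLegendre_eq hx hv] at h5
    simp only [ContinuousLinearMap.comp_apply, ContinuousLinearMap.inr_apply] at h5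
    linarith
  obtain ⟨Z, hZ⟩ := A.surjective W
  rw [hAD] at hZ
  rw [← hZ, hcomp]
  simp only
  have h2 := heuler Z
  have h3 : fderiv ℝ Lg (x, v) Z = fderiv ℝ Lg (x, v) (Z.1, 0) + fderiv ℝ Lg (x, v) (0, Z.2) := by
    rw [← map_add]
    simp
  linarith

end IsCoordFinsler

section Shortcuts

attribute [local instance] continuousSMul_mod

abbrev modDualNACG : NormedAddCommGroup (Mod →L[ℝ] ℝ) := ContinuousLinearMap.toNormedAddCommGroup
abbrev modDualNS : NormedSpace ℝ (Mod →L[ℝ] ℝ) := ContinuousLinearMap.toNormedSpace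
attribute [local instance] modDualNACG modDualNS
abbrev modDualACG : AddCommGroup (Mod →L[ℝ] ℝ) := ContinuousLinearMap.addCommGroup
abbrev modDualACM : AddCommMonoid (Mod →L[ℝ] ℝ) := ContinuousLinearMap.addCommMonoid
abbrev modDualModule : Module ℝ (Mod →L[ℝ] ℝ) := ContinuousLinearMap.module
abbrev modDualTop : TopologicalSpace (Mod →L[ℝ] ℝ) := ContinuousLinearMap.topologicalSpace
attribute [local instance] modDualACG modDualACM modDualModule modDualTop
abbrev modEndNACG : NormedAddCommGroup (Mod →L[ℝ] Mod) := ContinuousLinearMap.toNormedAddCommGroup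
abbrev modEndNS : NormedSpace ℝ (Mod →L[ℝ] Mod) := ContinuousLinearMap.toNormedSpace
abbrev modDualDualNACG : NormedAddCommGroup (Mod →L[ℝ] Mod →L[ℝ] ℝ) :=
  ContinuousLinearMap.toNormedAddCommGroup
abbrev modDualDualNS : NormedSpace ℝ (Mod →L[ℝ] Mod →L[ℝ] ℝ) :=
  ContinuousLinearMap.toNormedSpace

end Shortcuts

/-! ### The canonical symplectic form on the model space. -/

section Symplectic

attribute [local instance] continuousSMul_mod modDualNACG modDualNS modDualACG modDualACM
  modDualModule modDualTop modEndNACG modEndNS modDualDualNACG modDualDualNS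

/-- The canonical symplectic form. -/
def symp (Z W : Mod) : ℝ := Z.2 W.1 - W.2 Z.1

/-- The canonical one-form `p dq`. -/
def lam : Mod →L[ℝ] (Mod →L[ℝ] ℝ) :=
  ((ContinuousLinearMap.compL ℝ Mod Plane ℝ).flip
    (ContinuousLinearMap.fst ℝ Plane (Plane →L[ℝ] ℝ))).comp
    (ContinuousLinearMap.snd ℝ Plane (Plane →L[ℝ] ℝ))

@[simp] theorem lam_apply (y W : Mod) : lam y W = y.2 W.1 := rfl

/-- The radial vector in the fibres. -/
def eul (y : Mod) : Mod := (0, y.2)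

/-- The isomorphism between covectors and vectors given by the symplectic form. -/
def sharp : (Mod →L[ℝ] ℝ) →L[ℝ] Mod :=
  (∑ i : Fin 2, (ContinuousLinearMap.apply ℝ ℝ
    ((0, EuclideanSpace.proj i) : Mod)).smulRight (EuclideanSpace.single i (1 : ℝ) : Plane)).prod
  (-((ContinuousLinearMap.compL ℝ Plane Mod ℝ).flip
    (ContinuousLinearMap.inl ℝ Plane (Plane →L[ℝ] ℝ))))

theorem plane_eq_sum (x : Plane) :
    x = ∑ i : Fin 2, x i • (EuclideanSpace.single i (1 : ℝ) : Plane) := by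
  ext j
  fin_cases j <;> simp

theorem dual_eq_sum (p : Plane →L[ℝ] ℝ) :
    p = ∑ i : Fin 2, p (EuclideanSpace.single i (1 : ℝ)) •
      (EuclideanSpace.proj i : Plane →L[ℝ] ℝ) := by
  ext x
  nth_rewrite 1 [plane_eq_sum x]
  simp [mul_comm]

/-- With this sign `sharp (dG) = (∂G/∂p, -∂G/∂q)` is the Hamiltonian field of `G`. -/
theorem symp_sharp (η : Mod →L[ℝ] ℝ) (W : Mod) : symp (sharp η) W = -η W := by
  have h1 : (sharp η).2 W.1 = -η (W.1, 0) := by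
    simp [sharp]
  have h2 : W.2 (sharp η).1 = η (0, W.2) := by
    have h3 : ((0, W.2) : Mod) = ∑ i : Fin 2, W.2 (EuclideanSpace.single i (1 : ℝ)) •
        ((0, EuclideanSpace.proj i) : Mod) := by
      refine Prod.ext ?_ ?_
      · simp
      · simp only [Prod.snd_sum, Prod.smul_mk]
        exact dual_eq_sum W.2
    rw [h3, map_sum]
    simp only [map_smul, Fin.sum_univ_two]
    simp [sharp]
    ring
  rw [symp, h1, h2, ← neg_add', ← map_add]
  simp

theorem symp_add_left (Z Z' W : Mod) : symp (Z + Z') W = symp Z W + symp Z' W := by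
  simp [symp]; ring

theorem symp_smul_left (r : ℝ) (Z W : Mod) : symp (r • Z) W = r * symp Z W := by
  simp [symp]; ring

theorem symp_neg_left (Z W : Mod) : symp (-Z) W = -symp Z W := by
  simp [symp]; ring

theorem symp_sub_left (Z Z' W : Mod) : symp (Z - Z') W = symp Z W - symp Z' W := by
  simp [symp]; ring

theorem symp_swap (Z W : Mod) : symp Z W = -symp W Z := by
  simp [symp]

theorem symp_zero_left (W : Mod) : symp 0 W = 0 := by
  simp [symp]

theorem symp_add_right (Z W W' : Mod) : symp Z (W + W') = symp Z W + symp Z W' := by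
  simp [symp]; ring

theorem symp_smul_right (r : ℝ) (Z W : Mod) : symp Z (r • W) = r * symp Z W := by
  simp [symp]; ring

theorem symp_sub_right (Z W W' : Mod) : symp Z (W - W') = symp Z W - symp Z W' := by
  simp [symp]; ring

theorem symp_eul (y W : Mod) : symp (eul y) W = lam y W := by
  simp [symp, eul]

theorem eq_zero_of_symp {Z : Mod} (h : ∀ W, symp Z W = 0) : Z = 0 := by
  refine Prod.ext ?_ ?_
  · ext i
    have := h (0, EuclideanSpace.proj i)
    simpa [symp] using this
  · ext x
    have := h (x, 0)
    simpa [symp] using this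

theorem lam_sharp (y : Mod) (η : Mod →L[ℝ] ℝ) : lam y (sharp η) = η (eul y) := by
  rw [← symp_eul, symp_swap, symp_sharp, neg_neg]

theorem apply_sharp_self (η : Mod →L[ℝ] ℝ) : η (sharp η) = 0 := by
  have := symp_sharp η (sharp η)
  have h2 := symp_swap (sharp η) (sharp η)
  linarith

theorem _root_.HasDerivWithinAt.symp {f g : ℝ → Mod} {f' g' : Mod} {s : Set ℝ} {t : ℝ}
    (hf : HasDerivWithinAt f f' s t) (hg : HasDerivWithinAt g g' s t) :
    HasDerivWithinAt (fun t => symp (f t) (g t)) (symp f' (g t) + symp (f t) g') s t := by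
  have hf1 : HasDerivWithinAt (fun t => (f t).1) f'.1 s t := 
    (ContinuousLinearMap.fst ℝ Plane (Plane →L[ℝ] ℝ)).hasFDerivAt.comp_hasDerivWithinAt t hf
  have hf2 : HasDerivWithinAt (fun t => (f t).2) f'.2 s t := 
    (ContinuousLinearMap.snd ℝ Plane (Plane →L[ℝ] ℝ)).hasFDerivAt.comp_hasDerivWithinAt t hf
  have hg1 : HasDerivWithinAt (fun t => (g t).1) g'.1 s t := 
    (ContinuousLinearMap.fst ℝ Plane (Plane →L[ℝ] ℝ)).hasFDerivAt.comp_hasDerivWithinAt t hg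
  have hg2 : HasDerivWithinAt (fun t => (g t).2) g'.2 s t := 
    (ContinuousLinearMap.snd ℝ Plane (Plane →L[ℝ] ℝ)).hasFDerivAt.comp_hasDerivWithinAt t hg
  convert! (hf2.clm_apply hg1).sub (hg2.clm_apply hf1) using 1
  simp only [Finsler.symp]
  ring

/-- The projection along the characteristic directions, and with it the vectors of the contact
plane, detect nondegeneracy. -/
theorem eq_zero_of_symp_contact {dG : Mod →L[ℝ] ℝ} {y Z : Mod} (hG : dG (eul y) ≠ 0)
    (hZ : dG Z = 0) (hZ' : lam y Z = 0)
    (h : ∀ W, dG W = 0 → lam y W = 0 → symp Z W = 0) : Z = 0 := by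
  refine eq_zero_of_symp fun W => ?_
  have hE : symp Z (eul y) = 0 := by rw [symp_swap, symp_eul, hZ', neg_zero]
  have hX : symp Z (sharp dG) = 0 := by rw [symp_swap, symp_sharp, hZ, neg_zero, neg_zero]
  have hlE : lam y (eul y) = 0 := by simp [eul]
  set c := dG (eul y) with hc
  have hlX : lam y (sharp dG) = c := lam_sharp y dG
  -- Subtracting multiples of the radial vector and of the Hamiltonian vector projects `W` into the
  -- contact plane. Both vectors are symplectically orthogonal to `Z`, because `lam y Z = 0` and `dG
  -- Z = 0`.
  have := h (W - (dG W / c) • eul y - (lam y W / c) • sharp dG)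
    (by rw [map_sub, map_sub, map_smul, map_smul, apply_sharp_self, smul_eq_mul, ← hc]
        field_simp; simp)
    (by rw [map_sub, map_sub, map_smul, map_smul, hlE, hlX, smul_eq_mul, smul_eq_mul]
        field_simp; simp)
  rw [symp_sub_right, symp_sub_right, symp_smul_right, symp_smul_right, hE, hX] at this
  simpa using this

end Symplectic

/-! ### The Reeb field in coordinates -/

section ReebField

attribute [local instance] continuousSMul_mod modDualNACG modDualNS modDualACG modDualACM
  modDualModule modDualTop modEndNACG modEndNS modDualDualNACG modDualDualNS

/-- The conditions on a Reeb vector of `e^f p dq` on the hypersurfaces `G = const`. -/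
structure IsCoordReeb (G f : Mod → ℝ) (y ξ : Mod) : Prop where
  tangent : fderiv ℝ G y ξ = 0
  normalized : Real.exp (f y) * lam y ξ = 1
  kernel : ∀ η, fderiv ℝ G y η = 0 →
    Real.exp (f y) * (fderiv ℝ f y ξ * lam y η - fderiv ℝ f y η * lam y ξ + symp ξ η) = 0

/-- The correction to the Reeb field produced by the covector `η`. -/
def reebCorrection (G : Mod → ℝ) (y : Mod) (η : Mod →L[ℝ] ℝ) : Mod :=
  -sharp η + ((G y)⁻¹ * fderiv ℝ G y (sharp η)) • eul y +
    ((G y)⁻¹ * η (eul y)) • sharp (fderiv ℝ G y)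

/-- The Reeb field of `p dq` on the hypersurfaces `G = const`. -/
def reebField₀ (G : Mod → ℝ) (y : Mod) : Mod := (G y)⁻¹ • sharp (fderiv ℝ G y)

/-- The Reeb field of `e^f p dq` on the hypersurfaces `G = const`. -/
def reebField (G f : Mod → ℝ) (y : Mod) : Mod :=
  Real.exp (-f y) • (reebField₀ G y + reebCorrection G y (fderiv ℝ f y))

theorem IsCoordDual.fderiv_eul {Ω : Set Plane} {G : Mod → ℝ} (hG : IsCoordDual Ω G) {y : Mod}
    (hy : y.1 ∈ Ω) (hp : y.2 ≠ 0) : fderiv ℝ G y (eul y) = G y := by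
  have h1 : HasDerivAt (fun t : ℝ => G (y + t • eul y)) (fderiv ℝ G y (eul y)) 0 := by
    have h2 : HasDerivAt (fun t : ℝ => y + t • eul y) (eul y) 0 := by
      simpa using ((hasDerivAt_id (0 : ℝ)).smul_const (eul y)).const_add y
    have h3 : HasFDerivAt G (fderiv ℝ G y) (y + (0 : ℝ) • eul y) := by
      rw [zero_smul, add_zero]
      exact ((hG.smooth y hy hp).differentiableAt (by simp)).hasFDerivAt
    exact h3.comp_hasDerivAt 0 h2
  have h4 : HasDerivAt (fun t : ℝ => (1 + t) * G y) (G y) 0 := by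
    simpa using ((hasDerivAt_id (0 : ℝ)).const_add 1).mul_const (G y)
  refine h1.unique (h4.congr_of_eventuallyEq ?_)
  filter_upwards [lt_mem_nhds (show (-1 : ℝ) < 0 by norm_num)] with t ht
  rw [← hG.homogeneous y (1 + t) hy hp (by linarith)]
  congr 1
  refine Prod.ext ?_ ?_
  · simp [eul]
  · simp [eul, add_smul]

theorem fderiv_reebCorrection {G : Mod → ℝ} {y : Mod} (hy : G y ≠ 0)
    (hE : fderiv ℝ G y (eul y) = G y) (η : Mod →L[ℝ] ℝ) :
    fderiv ℝ G y (reebCorrection G y η) = 0 := by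
  simp only [reebCorrection, map_add, map_neg, map_smul, smul_eq_mul, apply_sharp_self, hE]
  field_simp
  ring

theorem lam_reebCorrection {G : Mod → ℝ} {y : Mod} (hy : G y ≠ 0)
    (hE : fderiv ℝ G y (eul y) = G y) (η : Mod →L[ℝ] ℝ) :
    lam y (reebCorrection G y η) = 0 := by
  have hlE : lam y (eul y) = 0 := by simp [eul]
  simp only [reebCorrection, map_add, map_neg, map_smul, smul_eq_mul, lam_sharp, hE, hlE]
  field_simp
  ring

theorem fderiv_reebField {G f : Mod → ℝ} {y : Mod} (hy : G y ≠ 0)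
    (hE : fderiv ℝ G y (eul y) = G y) : fderiv ℝ G y (reebField G f y) = 0 := by
  simp only [reebField, reebField₀, map_smul, map_add, apply_sharp_self,
    fderiv_reebCorrection hy hE]
  simp

theorem lam_reebField {G f : Mod → ℝ} {y : Mod} (hy : G y ≠ 0)
    (hE : fderiv ℝ G y (eul y) = G y) : lam y (reebField G f y) = Real.exp (-f y) := by
  simp only [reebField, reebField₀, map_smul, map_add, lam_sharp, hE, lam_reebCorrection hy hE,
    smul_eq_mul]
  field_simp
  simp

theorem symp_reebCorrection {G : Mod → ℝ} {y W : Mod} (η : Mod →L[ℝ] ℝ)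
    (hW : fderiv ℝ G y W = 0) (hW' : lam y W = 0) : symp (reebCorrection G y η) W = η W := by
  simp only [reebCorrection, symp_add_left, symp_neg_left, symp_smul_left, symp_sharp, symp_eul,
    hW, hW']
  ring

/-- Up to the factor `e^{-f}` the field is the Hamiltonian field of `G`, normalized by Euler's
identity, plus a correction tangent to the contact plane that absorbs `df`. The kernel condition
uses that `df` on the Hamiltonian field of `G` is minus `dG` on the Hamiltonian field of `f`. -/
theorem isCoordReeb_reebField {G f : Mod → ℝ} {y : Mod} (hy : G y ≠ 0)
    (hE : fderiv ℝ G y (eul y) = G y) : IsCoordReeb G f y (reebField G f y) where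
  tangent := fderiv_reebField hy hE
  normalized := by rw [lam_reebField hy hE, ← Real.exp_add]; simp
  kernel η hη := by
    set e := Real.exp (-f y) with he
    have h1 : fderiv ℝ f y (reebField G f y) =
        e * ((G y)⁻¹ * (fderiv ℝ G y (sharp (fderiv ℝ f y)) * fderiv ℝ f y (eul y)) +
          ((G y)⁻¹ + (G y)⁻¹ * fderiv ℝ f y (eul y)) *
            fderiv ℝ f y (sharp (fderiv ℝ G y))) := by
      simp only [reebField, reebField₀, reebCorrection, map_smul, map_add, map_neg,
        smul_eq_mul, apply_sharp_self]
      ring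
    have h2 : fderiv ℝ f y (sharp (fderiv ℝ G y)) = -fderiv ℝ G y (sharp (fderiv ℝ f y)) := by
      have h3 := symp_sharp (fderiv ℝ f y) (sharp (fderiv ℝ G y))
      have h4 := symp_sharp (fderiv ℝ G y) (sharp (fderiv ℝ f y))
      have h5 := symp_swap (sharp (fderiv ℝ G y)) (sharp (fderiv ℝ f y))
      linarith
    have h3 : symp (reebField G f y) η =
        e * (fderiv ℝ f y η + (G y)⁻¹ * fderiv ℝ G y (sharp (fderiv ℝ f y)) * lam y η) := by
      simp only [reebField, reebField₀, reebCorrection, symp_smul_left, symp_add_left,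
        symp_neg_left, symp_sharp, symp_eul, hη]
      ring
    rw [h1, h3, lam_reebField hy hE, h2, ← he]
    ring

/-- The normalizations put the difference of two candidates in the contact plane. On contact vectors
the kernel conditions then reduce to its symplectic orthogonality to the plane, and the form is
nondegenerate there. -/
theorem IsCoordReeb.unique {G f : Mod → ℝ} {y ξ ξ' : Mod} (hy : fderiv ℝ G y (eul y) ≠ 0)
    (h : IsCoordReeb G f y ξ) (h' : IsCoordReeb G f y ξ') : ξ = ξ' := by
  have hexp := (Real.exp_pos (f y)).ne'
  have hl : lam y ξ = lam y ξ' := mul_left_cancel₀ hexp (h.normalized.trans h'.normalized.symm)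
  set Z := ξ - ξ' with hZ
  have hlZ : lam y Z = 0 := by rw [hZ, map_sub, hl, sub_self]
  have hGZ : fderiv ℝ G y Z = 0 := by rw [hZ, map_sub, h.tangent, h'.tangent, sub_self]
  have hk : ∀ η, fderiv ℝ G y η = 0 → fderiv ℝ f y Z * lam y η + symp Z η = 0 := by
    intro η hη
    have h1 := (mul_eq_zero.1 (h.kernel η hη)).resolve_left hexp
    have h2 := (mul_eq_zero.1 (h'.kernel η hη)).resolve_left hexp
    rw [hZ, map_sub, symp_sub_left]
    rw [hl] at h1
    linear_combination h1 - h2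
  have : Z = 0 := eq_zero_of_symp_contact hy hGZ hlZ fun W hW hW' => by
    have := hk W hW
    rw [hW', mul_zero, zero_add] at this
    exact this
  exact sub_eq_zero.1 this

theorem contDiffAt_reebField₀ {G : Mod → ℝ} {y : Mod} (hG : ContDiffAt ℝ ∞ G y) (hy : G y ≠ 0) :
    ContDiffAt ℝ ∞ (reebField₀ G) y := by
  have hdG : ContDiffAt ℝ ∞ (fderiv ℝ G) y := hG.fderiv_right (m := ∞) (by simp)
  exact (hG.inv hy).smul (sharp.contDiff.contDiffAt.comp y hdG)

theorem contDiff_eul : ContDiff ℝ ∞ eul := contDiff_const.prodMk contDiff_snd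

theorem contDiffAt_reebField {G f : Mod → ℝ} {y : Mod} (hG : ContDiffAt ℝ ∞ G y)
    (hf : ContDiffAt ℝ ∞ f y) (hy : G y ≠ 0) : ContDiffAt ℝ ∞ (reebField G f) y := by
  have hdG : ContDiffAt ℝ ∞ (fderiv ℝ G) y := hG.fderiv_right (m := ∞) (by simp)
  have hdf : ContDiffAt ℝ ∞ (fderiv ℝ f) y := hf.fderiv_right (m := ∞) (by simp)
  have hs : ContDiffAt ℝ ∞ (fun y => sharp (fderiv ℝ f y)) y :=
    sharp.contDiff.contDiffAt.comp y hdf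
  have hs' : ContDiffAt ℝ ∞ (fun y => sharp (fderiv ℝ G y)) y :=
    sharp.contDiff.contDiffAt.comp y hdG
  have he : ContDiffAt ℝ ∞ eul y := contDiff_eul.contDiffAt
  refine hf.neg.exp.smul ((contDiffAt_reebField₀ hG hy).add ?_)
  exact (hs.neg.add (((hG.inv hy).mul (hdG.clm_apply hs)).smul he)).add
    (((hG.inv hy).mul (hdf.clm_apply he)).smul hs')

/-- The linearization of the Reeb field at a point where `f` and its differential vanish. -/
theorem fderiv_reebField_apply {G f : Mod → ℝ} {y : Mod} (hG : ContDiffAt ℝ ∞ G y)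
    (hf : ContDiffAt ℝ ∞ f y) (hy : G y ≠ 0) (h0 : f y = 0) (h1 : fderiv ℝ f y = 0) (Z : Mod) :
    fderiv ℝ (reebField G f) y Z = fderiv ℝ (reebField₀ G) y Z +
      reebCorrection G y (fderiv ℝ (fderiv ℝ f) y Z) := by
  have hdG : HasFDerivAt (fderiv ℝ G) (fderiv ℝ (fderiv ℝ G) y) y :=
    ((hG.fderiv_right (m := ∞) (by simp)).differentiableAt (by simp)).hasFDerivAt
  have hdf : HasFDerivAt (fderiv ℝ f) (fderiv ℝ (fderiv ℝ f) y) y :=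
    ((hf.fderiv_right (m := ∞) (by simp)).differentiableAt (by simp)).hasFDerivAt
  have hGi : HasFDerivAt (fun y => (G y)⁻¹) (fderiv ℝ (fun y => (G y)⁻¹) y) y :=
    ((hG.inv hy).differentiableAt (by simp)).hasFDerivAt
  have hs : HasFDerivAt (fun y => sharp (fderiv ℝ f y)) _ y := sharp.hasFDerivAt.comp y hdf
  have hs' : HasFDerivAt (fun y => sharp (fderiv ℝ G y)) _ y := sharp.hasFDerivAt.comp y hdG
  have he : HasFDerivAt eul (fderiv ℝ eul y) y :=
    (contDiff_eul.differentiable (by simp) y).hasFDerivAt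
  have hc : HasFDerivAt (fun y => reebCorrection G y (fderiv ℝ f y)) _ y :=
    (hs.neg.add ((hGi.mul (hdG.clm_apply hs)).smul he)).add
      ((hGi.mul (hdf.clm_apply he)).smul hs')
  have hX : HasFDerivAt (reebField₀ G) (fderiv ℝ (reebField₀ G) y) y :=
    ((contDiffAt_reebField₀ hG hy).differentiableAt (by simp)).hasFDerivAt
  have hexp : HasFDerivAt (fun y => Real.exp (-f y)) (0 : Mod →L[ℝ] ℝ) y := by
    have := (((hf.differentiableAt (by simp)).hasFDerivAt).neg).exp
    simpa [h1] using this
  have hall : HasFDerivAt (reebField G f) _ y := hexp.smul (hX.add hc)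
  rw [hall.fderiv]
  simp [h0, h1, reebCorrection]

/-- The derivative of the factor `1 / G` contributes a multiple of the Hamiltonian vector, which is
symplectically orthogonal to tangent vectors of the level set. Only the Hessian of `G` is left, and
its symmetry makes the linearized flow symplectic. -/
theorem symp_fderiv_reebField₀ {G : Mod → ℝ} {y W : Mod} (hG : ContDiffAt ℝ ∞ G y)
    (hy : G y = 1) (hW : fderiv ℝ G y W = 0) (Z : Mod) :
    symp (fderiv ℝ (reebField₀ G) y Z) W = -fderiv ℝ (fderiv ℝ G) y Z W := by
  have hdG : HasFDerivAt (fderiv ℝ G) (fderiv ℝ (fderiv ℝ G) y) y :=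
    ((hG.fderiv_right (m := ∞) (by simp)).differentiableAt (by simp)).hasFDerivAt
  have hGi : HasFDerivAt (fun y => (G y)⁻¹) (fderiv ℝ (fun y => (G y)⁻¹) y) y :=
    ((hG.inv (by rw [hy]; exact one_ne_zero)).differentiableAt (by simp)).hasFDerivAt
  have hs' : HasFDerivAt (fun y => sharp (fderiv ℝ G y)) _ y := sharp.hasFDerivAt.comp y hdG
  have hX : HasFDerivAt (reebField₀ G) _ y := hGi.smul hs'
  rw [hX.fderiv]
  simp [symp_add_left, symp_smul_left, symp_sharp, hy, hW]

end ReebField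

theorem two_le_infty : (2 : WithTop ℕ∞) ≤ ∞ :=
  WithTop.coe_le_coe.2 (le_top : (2 : ℕ∞) ≤ ⊤)

/-! ### Pulling back the exterior derivative of `p dq`. -/

section Pullback

attribute [local instance] continuousSMul_mod modDualNACG modDualNS modDualACG modDualACM
  modDualModule modDualTop modEndNACG modEndNS modDualDualNACG modDualDualNS

set_option synthInstance.maxHeartbeats 200000 in
-- Naturality of the exterior derivative: if `g` pulls `p dq` back to `β`, it pulls the symplectic
-- form back to `dβ`, as the second derivatives of `g` cancel by symmetry. It applies to transitions
-- between bundle charts and to the local model.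
theorem symp_fderiv_eq {E : Type*} [NormedAddCommGroup E] [NormedSpace ℝ E] {g : E → Mod} {y : E}
    (hg : ContDiffAt ℝ 2 g y) {β : E → E →L[ℝ] ℝ}
    (hβ : ∀ᶠ y' in 𝓝 y, ∀ u, lam (g y') (fderiv ℝ g y' u) = β y' u) (u w : E) :
    symp (fderiv ℝ g y u) (fderiv ℝ g y w) = fderiv ℝ β y u w - fderiv ℝ β y w u := by
  have h1 : HasFDerivAt g (fderiv ℝ g y) y := (hg.differentiableAt (by simp)).hasFDerivAt
  have h2 : HasFDerivAt (fderiv ℝ g) (fderiv ℝ (fderiv ℝ g) y) y :=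
    ((hg.fderiv_right (m := 1) (by norm_num)).differentiableAt (by simp)).hasFDerivAt
  have h3 : HasFDerivAt (fun y' => (lam (g y')).comp (fderiv ℝ g y')) _ y :=
    (lam.hasFDerivAt.comp y h1).clm_comp h2
  have h4 : β =ᶠ[𝓝 y] fun y' => (lam (g y')).comp (fderiv ℝ g y') := by
    filter_upwards [hβ] with y' hy'
    ext u
    exact (hy' u).symm
  rw [h4.fderiv_eq, h3.fderiv]
  have hsym : fderiv ℝ (fderiv ℝ g) y u w = fderiv ℝ (fderiv ℝ g) y w u :=
    hg.isSymmSndFDerivAt (by simp) u w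
  simp [hsym, symp]

end Pullback

/-! ### Functions, the symplectic form and exterior derivatives in bundle charts. -/

section Surface

attribute [local instance] cotTopology cotChartedSpace cot_isManifold cot_isManifold_one
  continuousSMul_mod modDualNACG modDualNS modDualACG modDualACM
  modDualModule modDualTop modEndNACG modEndNS modDualDualNACG modDualDualNS

variable {S : Type*} [TopologicalSpace S] [ChartedSpace Plane S] [IsManifold (𝓡 2) ∞ S]

/-- The differential of a function on the cotangent bundle. -/
def cotD (f : CotBundle S → ℝ) (e : CotBundle S) : Mod →L[ℝ] ℝ :=
  mfderiv cotModel 𝓘(ℝ, ℝ) f e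

/-- A function on the cotangent bundle in the chart at `q₀`. -/
def coordFun (q₀ : S) (f : CotBundle S → ℝ) : Mod → ℝ := fun y => f ((cotChart q₀).symm y)

theorem eventuallyEq_coordFun {q₀ : S} (f : CotBundle S → ℝ) {e : CotBundle S}
    (he : e ∈ (cotChart q₀).source) : f =ᶠ[𝓝 e] fun e' => coordFun q₀ f (cotChart q₀ e') := by
  filter_upwards [(isOpen_cotChart_source q₀).mem_nhds he] with e' he'
  rw [coordFun, (cotChart q₀).left_inv he']

theorem coordFun_apply {q₀ : S} (f : CotBundle S → ℝ) {e : CotBundle S}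
    (he : e ∈ (cotChart q₀).source) : coordFun q₀ f (cotChart q₀ e) = f e := by
  rw [coordFun, (cotChart q₀).left_inv he]

theorem hasMFDerivAt_of_coordFun {q₀ : S} {f : CotBundle S → ℝ} {e : CotBundle S}
    (he : e ∈ (cotChart q₀).source) (hf : DifferentiableAt ℝ (coordFun q₀ f) (cotChart q₀ e)) :
    HasMFDerivAt cotModel 𝓘(ℝ, ℝ) f e
      ((fderiv ℝ (coordFun q₀ f) (cotChart q₀ e)).comp (chartD q₀ e)) := by
  have h1 := (hf.hasFDerivAt.hasMFDerivAt).comp e (hasMFDerivAt_cotChart he)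
  exact h1.congr_of_eventuallyEq (eventuallyEq_coordFun f he)

theorem cotD_of_coordFun {q₀ : S} {f : CotBundle S → ℝ} {e : CotBundle S}
    (he : e ∈ (cotChart q₀).source) (hf : DifferentiableAt ℝ (coordFun q₀ f) (cotChart q₀ e))
    (X : Mod) : cotD f e X = fderiv ℝ (coordFun q₀ f) (cotChart q₀ e) (chartD q₀ e X) :=
  congrArg (fun L : Mod →L[ℝ] ℝ => L X) (hasMFDerivAt_of_coordFun he hf).mfderiv

theorem contDiffAt_coordFun {q₀ : S} {f : CotBundle S → ℝ} {y : Mod} {n : WithTop ℕ∞}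
    (hn : n ≤ ∞) (hy : y ∈ (cotChart q₀).target)
    (hf : ContMDiffAt cotModel 𝓘(ℝ, ℝ) n f ((cotChart q₀).symm y)) :
    ContDiffAt ℝ n (coordFun q₀ f) y := by
  have := hf.comp y ((contMDiffAt_cotChart_symm hy).of_le hn)
  exact this.contDiffAt

theorem contMDiffAt_of_coordFun {q₀ : S} {f : CotBundle S → ℝ} {e : CotBundle S} {n : WithTop ℕ∞}
    (hn : n ≤ ∞) (he : e ∈ (cotChart q₀).source)
    (hf : ContDiffAt ℝ n (coordFun q₀ f) (cotChart q₀ e)) :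
    ContMDiffAt cotModel 𝓘(ℝ, ℝ) n f e := by
  have := hf.contMDiffAt.comp e ((contMDiffAt_cotChart he).of_le hn)
  exact this.congr_of_eventuallyEq (eventuallyEq_coordFun f he)

theorem hasFDerivAt_coordFun {q₀ : S} {f : CotBundle S → ℝ} {y : Mod}
    (hy : y ∈ (cotChart q₀).target)
    (hf : MDifferentiableAt cotModel 𝓘(ℝ, ℝ) f ((cotChart q₀).symm y)) :
    HasFDerivAt (coordFun q₀ f) ((cotD f ((cotChart q₀).symm y)).comp (parD q₀ y)) y :=
  (hf.hasMFDerivAt.comp y (hasMFDerivAt_cotChart_symm hy)).hasFDerivAt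

theorem fderiv_coordFun {q₀ : S} {f : CotBundle S → ℝ} {y : Mod} (hy : y ∈ (cotChart q₀).target)
    (hf : MDifferentiableAt cotModel 𝓘(ℝ, ℝ) f ((cotChart q₀).symm y)) (W : Mod) :
    fderiv ℝ (coordFun q₀ f) y W = cotD f ((cotChart q₀).symm y) (parD q₀ y W) := by
  rw [(hasFDerivAt_coordFun hy hf).fderiv]
  rfl

/-- The transition maps of the charts of the cotangent bundle preserve the symplectic form. -/
theorem symp_chartD {q₀ : S} {e : CotBundle S} (he : e ∈ (cotChart q₀).source) (X Y : Mod) :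
    symp (chartD q₀ e X) (chartD q₀ e Y) = symp X Y := by
  set y := cotChart e.1 e with hy
  have hyt : y ∈ (cotChart e.1).target := (cotChart e.1).map_source (mem_cotChart_source e)
  have hye : (cotChart e.1).symm y = e := (cotChart e.1).left_inv (mem_cotChart_source e)
  have hg : ContDiffAt ℝ ∞ (fun z => cotChart q₀ ((cotChart e.1).symm z)) y := by
    refine ContMDiffAt.contDiffAt ?_
    refine ContMDiffAt.comp (I' := cotModel) y ?_ (contMDiffAt_cotChart_symm hyt)
    rw [hye]
    exact contMDiffAt_cotChart he
  have hev : ∀ᶠ z in 𝓝 y, z ∈ (cotChart e.1).target ∧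
      (cotChart e.1).symm z ∈ (cotChart q₀).source := by
    refine ((isOpen_cotChart_target e.1).eventually_mem hyt).and ?_
    have hc : ContinuousAt (cotChart e.1).symm y := (contMDiffAt_cotChart_symm hyt).continuousAt
    refine hc.eventually_mem ((isOpen_cotChart_source q₀).mem_nhds ?_)
    rwa [hye]
  have hfd : ∀ z, z ∈ (cotChart e.1).target → (cotChart e.1).symm z ∈ (cotChart q₀).source →
      ∀ u, fderiv ℝ (fun z => cotChart q₀ ((cotChart e.1).symm z)) z u =
        chartD q₀ ((cotChart e.1).symm z) (parD e.1 z u) := by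
    intro z hz hz' u
    have h2 : HasFDerivAt (fun z => cotChart q₀ ((cotChart e.1).symm z))
        ((chartD q₀ ((cotChart e.1).symm z)).comp (parD e.1 z)) z :=
      ((hasMFDerivAt_cotChart hz').comp z (hasMFDerivAt_cotChart_symm hz)).hasFDerivAt
    rw [h2.fderiv]
    rfl
  -- Both charts express the same Liouville form as `p dq`, so the transition map pulls `p dq` back
  -- to itself.
  have key := symp_fderiv_eq (hg.of_le two_le_infty) (β := fun z => lam z) (by
    filter_upwards [hev] with z hz u
    rw [hfd z hz.1 hz.2]
    have h1 := liouville_parD hz.1 u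
    have h2 := liouville_parD ((cotChart q₀).map_source hz.2)
      (chartD q₀ ((cotChart e.1).symm z) (parD e.1 z u))
    rw [parD_chartD' hz.2, (cotChart q₀).left_inv hz.2, h1] at h2
    exact h2.symm) X Y
  rw [hfd y hyt (by rwa [hye]), hfd y hyt (by rwa [hye]), hye, hy, parD_self] at key
  refine key.trans ?_
  rw [ContinuousLinearMap.fderiv]
  rfl

theorem symp_parD {q₀ : S} {y : Mod} (hy : y ∈ (cotChart q₀).target) (X Y : Mod) :
    symp (parD q₀ y X) (parD q₀ y Y) = symp X Y := by
  rw [← symp_chartD ((cotChart q₀).map_target hy), chartD_parD hy, chartD_parD hy]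

/-- The exterior derivative of `e^f p dq`. -/
theorem extDerivOne_conformalForm {f : CotBundle S → ℝ} {e : CotBundle S}
    (hf : MDifferentiableAt cotModel 𝓘(ℝ, ℝ) f e) (X Y : Mod) :
    extDerivOne (conformalForm f) e X Y = Real.exp (f e) *
      (cotD f e X * liouville e Y - cotD f e Y * liouville e X + symp X Y) := by
  set y := cotChart e.1 e with hy
  have hyt : y ∈ (cotChart e.1).target := (cotChart e.1).map_source (mem_cotChart_source e)
  have hye : (cotChart e.1).symm y = e := (cotChart e.1).left_inv (mem_cotChart_source e)
  have h1 : chartForm (conformalForm f) e =ᶠ[𝓝 y]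
      fun z => Real.exp (coordFun e.1 f z) • lam z := by
    filter_upwards [(isOpen_cotChart_target e.1).mem_nhds hyt] with z hz
    refine ContinuousLinearMap.ext fun W => ?_
    exact congrArg (fun r => Real.exp (coordFun e.1 f z) * r) (liouville_parD hz W)
  have hd : ∀ W, fderiv ℝ (coordFun e.1 f) y W = cotD f e W := by
    intro W
    rw [fderiv_coordFun hyt (by rwa [hye]), hye, hy, parD_self]
    rfl
  have hdf : DifferentiableAt ℝ (coordFun e.1 f) y :=
    (hasFDerivAt_coordFun hyt (by rwa [hye])).differentiableAt
  have h2 : HasFDerivAt (fun z => Real.exp (coordFun e.1 f z) • lam z) _ y :=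
    hdf.hasFDerivAt.exp.smul lam.hasFDerivAt
  have h3 : extDerivOne (conformalForm f) e X Y =
      fderiv ℝ (chartForm (conformalForm f) e) y (chartD e.1 e X) (chartD e.1 e Y) -
      fderiv ℝ (chartForm (conformalForm f) e) y (chartD e.1 e Y) (chartD e.1 e X) := rfl
  have hfy : coordFun e.1 f y = f e := coordFun_apply f (mem_cotChart_source e)
  have hl : ∀ W : Mod, liouville e W = lam y W := fun W => by
    rw [liouville_apply, hy, cotChart_self]
    rfl
  rw [h3, h1.fderiv_eq, h2.fderiv, chartD_self, hl, hl, ← hd, ← hd]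
  simp [hfy, symp]
  ring

theorem extDerivOne_liouville (e : CotBundle S) (X Y : Mod) :
    extDerivOne liouville e X Y = symp X Y := by
  have h : (liouville : (e : CotBundle S) → (TangentSpace cotModel e →L[ℝ] ℝ)) =
      conformalForm (fun _ => 0) := by
    funext e
    simp [conformalForm]
  have h0 : cotD (fun _ : CotBundle S => (0 : ℝ)) e = 0 := mfderiv_const
  rw [h, extDerivOne_conformalForm mdifferentiableAt_const, h0]
  simp

end Surface

/-! ### Finsler metrics and their duals in charts. -/

section Metric

attribute [local instance] cotTopology cotChartedSpace cot_isManifold cot_isManifold_one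
  continuousSMul_mod modDualNACG modDualNS modDualACG modDualACM
  modDualModule modDualTop modEndNACG modEndNS modDualDualNACG modDualDualNS

variable {S : Type*} [TopologicalSpace S] [ChartedSpace Plane S] [IsManifold (𝓡 2) ∞ S]
  {F : TangentBundle (𝓡 2) S → ℝ}

/-- A Finsler metric in the chart at `q₀`. -/
def coordN (F : TangentBundle (𝓡 2) S → ℝ) (q₀ : S) (z : Plane × Plane) : ℝ :=
  F ⟨(extChartAt (𝓡 2) q₀).symm z.1, tanPar q₀ z.1 z.2⟩

theorem tanPar_injective {q₀ : S} {x : Plane} (hx : x ∈ (extChartAt (𝓡 2) q₀).target) {v : Plane}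
    (hv : v ≠ 0) : tanPar q₀ x v ≠ 0 := by
  intro h
  have := congrArg (fun L : Plane →L[ℝ] Plane => L v) (tanChart_comp_tanPar hx)
  simp only [ContinuousLinearMap.comp_apply, h, map_zero, ContinuousLinearMap.id_apply] at this
  exact hv this.symm

/-- Smoothness of `F` refers to the manifold structure of the tangent bundle, while `coordN` uses
the derivative of the inverse base chart; here the two descriptions are identified. -/
theorem tangentChart_symm_apply {q₀ : S} {x : Plane} (hx : x ∈ (extChartAt (𝓡 2) q₀).target)
    (v : Plane) : (extChartAt (𝓡 2).tangent (⟨q₀, 0⟩ : TangentBundle (𝓡 2) S)).symm (x, v) =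
      ⟨(extChartAt (𝓡 2) q₀).symm x, tanPar q₀ x v⟩ := by
  set c := extChartAt (𝓡 2).tangent (⟨q₀, 0⟩ : TangentBundle (𝓡 2) S) with hc
  set z : TangentBundle (𝓡 2) S := ⟨(extChartAt (𝓡 2) q₀).symm x, tanPar q₀ x v⟩ with hz
  have hs : (extChartAt (𝓡 2) q₀).symm x ∈ (extChartAt (𝓡 2) q₀).source :=
    (extChartAt (𝓡 2) q₀).map_target hx
  have hzs : z ∈ c.source := by
    rw [hc, FiberBundle.extChartAt, PartialEquiv.trans_source]
    simp
    change (extChartAt (𝓡 2) q₀).symm x ∈ (chartAt Plane q₀).source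
    simpa using hs
  have hcz : c z = (x, v) := by
    rw [hc, FiberBundle.extChartAt]
    simp only [PartialEquiv.coe_trans, Function.comp_apply, PartialEquiv.prod_coe]
    refine Prod.ext ((extChartAt (𝓡 2) q₀).right_inv hx) ?_
    have h1 := TangentBundle.continuousLinearMapAt_trivializationAt (I := 𝓡 2) (x₀ := q₀)
      (x := (extChartAt (𝓡 2) q₀).symm x) (by simpa using hs)
    have h2 := congrArg (fun L : Plane →L[ℝ] Plane => L (tanPar q₀ x v)) h1
    have h3 := congrArg (fun L : Plane →L[ℝ] Plane => L v) (tanChart_comp_tanPar hx)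
    refine Eq.trans ?_ (h2.trans h3)
    exact (Trivialization.continuousLinearMapAt_apply_of_mem (R := ℝ)
      (trivializationAt Plane (TangentSpace (𝓡 2)) q₀) (by simpa using hs) _).symm
  rw [← hcz, c.left_inv hzs]

theorem IsFinslerMetric.isCoordFinsler (hF : IsFinslerMetric F) (q₀ : S) :
    IsCoordFinsler (extChartAt (𝓡 2) q₀).target (coordN F q₀) := by
  have hsm : ∀ x ∈ (extChartAt (𝓡 2) q₀).target, ∀ v, v ≠ 0 →
      ContDiffAt ℝ ∞ (coordN F q₀) (x, v) := by
    intro x hx v hv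
    set c := extChartAt (𝓡 2).tangent (⟨q₀, 0⟩ : TangentBundle (𝓡 2) S) with hc
    have hct : ∀ x ∈ (extChartAt (𝓡 2) q₀).target, ∀ v, (x, v) ∈ c.target := by
      intro x hx v
      rw [hc, FiberBundle.extChartAt_target]
      refine ⟨⟨hx, ?_⟩, mem_univ _⟩
      have := (extChartAt (𝓡 2) q₀).map_target hx
      simpa using this
    have h1 : ContMDiffAt 𝓘(ℝ, Plane × Plane) (𝓡 2).tangent ∞ c.symm (x, v) :=
      (contMDiffOn_extChartAt_symm (I := (𝓡 2).tangent) _).contMDiffAt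
        ((isOpen_extChartAt_target _).mem_nhds (hct x hx v))
    have hopen : {e : TangentBundle (𝓡 2) S | e.2 ≠ 0} ∈ 𝓝 (c.symm (x, v)) := by
      have hs : c.symm (x, v) ∈ c.source := c.map_target (hct x hx v)
      have hcc : ContinuousAt c (c.symm (x, v)) :=
        (continuousOn_extChartAt _).continuousAt ((isOpen_extChartAt_source _).mem_nhds hs)
      have hne : ∀ᶠ e in 𝓝 (c.symm (x, v)), (c e).2 ≠ 0 :=
        (continuous_snd.continuousAt.comp hcc).eventually_ne (by
          simpa [c.right_inv (hct x hx v)] using hv)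
      filter_upwards [hne, (isOpen_extChartAt_source _).mem_nhds hs] with e he hes
      have h3 := c.map_source hes
      rw [hc, FiberBundle.extChartAt_target] at h3
      have h4 := c.left_inv hes
      rw [← Prod.mk.eta (p := c e), tangentChart_symm_apply h3.1.1] at h4
      rw [← h4]
      exact tanPar_injective h3.1.1 he
    have h2 : ContMDiffAt (𝓡 2).tangent 𝓘(ℝ, ℝ) ∞ F (c.symm (x, v)) := by
      exact hF.smooth.contMDiffAt hopen
    refine (h2.comp (x, v) h1).contDiffAt.congr_of_eventuallyEq ?_
    have : ∀ᶠ z : Plane × Plane in 𝓝 (x, v), z.1 ∈ (extChartAt (𝓡 2) q₀).target :=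
      continuous_fst.continuousAt.eventually_mem ((isOpen_chart_target q₀).mem_nhds hx)
    filter_upwards [this] with z hz
    exact congrArg F (tangentChart_symm_apply hz z.2).symm
  refine ⟨isOpen_chart_target q₀, hsm, fun x hx => ?_⟩
  refine ⟨fun v hv => ?_, fun v hv => hF.pos _ _ (tanPar_injective hx hv), ?_, ?_, ?_⟩
  · exact (hsm x hx v hv).comp v (contDiffAt_const.prodMk contDiffAt_id)
  · simp only [coordN, map_zero]
    exact hF.zero _
  · intro v a ha
    simp only [coordN, map_smul]
    exact hF.homogeneous _ _ a ha
  · intro v u hv hu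
    have := hF.convex ((extChartAt (𝓡 2) q₀).symm x) _ _ (tanPar_injective hx hv) (tanPar_injective hx hu)
    simp only [coordN, map_add, map_smul]
    exact this

theorem IsFinslerMetric.isMinkowski (hF : IsFinslerMetric F) (q : S) :
    IsMinkowski fun w : Plane => F ⟨q, w⟩ := by
  have h := (hF.isCoordFinsler q).minkowski _ (mem_extChartAt_target q)
  simp only [coordN, tanPar_self] at h
  have key : ∀ q', q' = q → (IsMinkowski fun w : Plane => F ⟨q', w⟩) →
      IsMinkowski fun w : Plane => F ⟨q, w⟩ := by
    rintro _ rfl h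
    exact h
  exact key _ (extChartAt_to_inv q) h

theorem legendre_bijective (hF : IsFinslerMetric F) (q : S) :
    Function.Bijective (legendre F q) :=
  ⟨(hF.isMinkowski q).legendre_injective, (hF.isMinkowski q).legendre_surjective⟩

theorem dualMetric_legendre (hF : IsFinslerMetric F) (q : S) (w : TangentSpace (𝓡 2) q) :
    dualMetric F ⟨q, legendre F q w⟩ = F ⟨q, w⟩ := by
  simp only [dualMetric]
  rw [Function.leftInverse_invFun (legendre_bijective hF q).1 w]

theorem legendre_tanPar (hF : IsFinslerMetric F) {q₀ : S} {x : Plane}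
    (hx : x ∈ (extChartAt (𝓡 2) q₀).target) {v : Plane} (hv : v ≠ 0) :
    (legendre F ((extChartAt (𝓡 2) q₀).symm x) (tanPar q₀ x v) : Plane →L[ℝ] ℝ) =
      (coordLegendre (coordN F q₀) x v).comp (tanChart q₀ ((extChartAt (𝓡 2) q₀).symm x)) := by
  set q := (extChartAt (𝓡 2) q₀).symm x with hq
  have hd : HasFDerivAt (fun w : Plane => F ⟨q, w⟩)
      (fderiv ℝ (fun w : Plane => F ⟨q, w⟩) (tanPar q₀ x v)) (tanPar q₀ x v) :=
    (((hF.isMinkowski q).smooth _ (tanPar_injective hx hv)).differentiableAt (by simp)).hasFDerivAt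
  have h1 : HasFDerivAt (fun w : Plane => coordN F q₀ (x, w))
      ((fderiv ℝ (fun w : Plane => F ⟨q, w⟩) (tanPar q₀ x v)).comp (tanPar q₀ x)) v :=
    HasFDerivAt.comp (g := fun w : Plane => F ⟨q, w⟩) v hd (tanPar q₀ x).hasFDerivAt
  rw [coordLegendre, h1.fderiv]
  have h2 := tanPar_comp_tanChart hx
  rw [ContinuousLinearMap.smul_comp, ContinuousLinearMap.comp_assoc, h2]
  rfl

/-- This is the relation on which the coordinate theory of dual metrics is based. It comes from the
covariance of the Legendre transformation; the zero vector is separate because the covariance lemma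
differentiates `F` on the fibre. -/
theorem coordFun_dualMetric (hF : IsFinslerMetric F) (q₀ : S) :
    ∀ x ∈ (extChartAt (𝓡 2) q₀).target, ∀ v, coordFun q₀ (dualMetric F)
      (x, coordLegendre (coordN F q₀) x v) = coordN F q₀ (x, v) := by
  intro x hx v
  have hy : ((x, coordLegendre (coordN F q₀) x v) : Mod) ∈ (cotChart q₀).target :=
    mem_cotChart_target.2 hx
  rw [coordFun, cotChart_symm_apply hy]
  by_cases hv : v = 0
  · subst hv
    have h0 : coordN F q₀ (x, 0) = 0 := ((hF.isCoordFinsler q₀).minkowski x hx).zero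
    have h1 : coordLegendre (coordN F q₀) x 0 = 0 := by rw [coordLegendre, h0, zero_smul]
    have h2 : legendre F ((extChartAt (𝓡 2) q₀).symm x) 0 = 0 := by
      rw [legendre, hF.zero, zero_smul]
    rw [h0, h1]
    have h3 := dualMetric_legendre hF ((extChartAt (𝓡 2) q₀).symm x) 0
    rw [h2, hF.zero] at h3
    exact h3
  · have h3 := dualMetric_legendre hF ((extChartAt (𝓡 2) q₀).symm x) (tanPar q₀ x v)
    exact (congrArg (fun p : Plane →L[ℝ] ℝ => dualMetric F ⟨(extChartAt (𝓡 2) q₀).symm x, p⟩)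
      (legendre_tanPar hF hx hv)).symm.trans h3

theorem IsFinslerMetric.isCoordDual (hF : IsFinslerMetric F) (q₀ : S) :
    IsCoordDual (extChartAt (𝓡 2) q₀).target (coordFun q₀ (dualMetric F)) :=
  (hF.isCoordFinsler q₀).isCoordDual (coordFun_dualMetric hF q₀)

end Metric

/-! ### Reeb vectors and Reeb trajectories in charts. -/

section Reeb

attribute [local instance] cotTopology cotChartedSpace cot_isManifold cot_isManifold_one
  continuousSMul_mod modDualNACG modDualNS modDualACG modDualACM
  modDualModule modDualTop modEndNACG modEndNS modDualDualNACG modDualDualNS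

variable {S : Type*} [TopologicalSpace S] [ChartedSpace Plane S] [IsManifold (𝓡 2) ∞ S]
  {F : TangentBundle (𝓡 2) S → ℝ}

/-- The dual metric in the chart at `q₀`. -/
abbrev coordG (F : TangentBundle (𝓡 2) S → ℝ) (q₀ : S) : Mod → ℝ := coordFun q₀ (dualMetric F)

theorem covec_ne_zero (hF : IsFinslerMetric F) {e : CotBundle S} (he : e ∈ cosphere F) :
    covec e ≠ 0 := by
  intro h
  have h2 : legendre F e.1 0 = 0 := by rw [legendre, hF.zero, zero_smul]
  have h3 := dualMetric_legendre hF e.1 0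
  rw [h2, hF.zero] at h3
  have h4 : e = ⟨e.1, 0⟩ := cotBundle_ext rfl h
  have h5 : dualMetric F e = 1 := he
  rw [h4, h3] at h5
  exact zero_ne_one h5

theorem snd_cotChart_ne_zero {q₀ : S} {e : CotBundle S} (he : e ∈ (cotChart q₀).source)
    (hp : covec e ≠ 0) : (cotChart q₀ e).2 ≠ 0 := by
  intro h
  have h1 := covec_cotChart_symm ((cotChart q₀).map_source he)
  rw [(cotChart q₀).left_inv he, h] at h1
  exact hp h1

theorem contDiffAt_coordG (hF : IsFinslerMetric F) {q₀ : S} {y : Mod}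
    (hy : y ∈ (cotChart q₀).target) (hp : y.2 ≠ 0) : ContDiffAt ℝ ∞ (coordG F q₀) y :=
  (hF.isCoordDual q₀).smooth y (mem_cotChart_target.1 hy) hp

theorem coordG_pos (hF : IsFinslerMetric F) {q₀ : S} {y : Mod}
    (hy : y ∈ (cotChart q₀).target) (hp : y.2 ≠ 0) : 0 < coordG F q₀ y :=
  (hF.isCoordDual q₀).pos y (mem_cotChart_target.1 hy) hp

theorem snd_ne_zero_of_coordG (hF : IsFinslerMetric F) {q₀ : S} {y : Mod}
    (hy : y ∈ (cotChart q₀).target) (h : coordG F q₀ y = 1) : y.2 ≠ 0 := by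
  have := snd_cotChart_ne_zero ((cotChart q₀).map_target hy) (covec_ne_zero hF h)
  rwa [(cotChart q₀).right_inv hy] at this

theorem fderiv_coordG_eul (hF : IsFinslerMetric F) {q₀ : S} {y : Mod}
    (hy : y ∈ (cotChart q₀).target) (hp : y.2 ≠ 0) :
    fderiv ℝ (coordG F q₀) y (eul y) = coordG F q₀ y :=
  (hF.isCoordDual q₀).fderiv_eul (mem_cotChart_target.1 hy) hp

theorem mem_cosphereTangent_iff (hF : IsFinslerMetric F) {q₀ : S} {e : CotBundle S}
    (he : e ∈ (cotChart q₀).source) (hp : covec e ≠ 0) (X : Mod) :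
    (X : TangentSpace cotModel e) ∈ cosphereTangent F e ↔
      fderiv ℝ (coordG F q₀) (cotChart q₀ e) (chartD q₀ e X) = 0 := by
  have h := cotD_of_coordFun he ((contDiffAt_coordG hF ((cotChart q₀).map_source he)
    (snd_cotChart_ne_zero he hp)).differentiableAt (by simp)) X
  rw [← h]
  exact Iff.rfl

theorem liouville_chartD {q₀ : S} {e : CotBundle S} (he : e ∈ (cotChart q₀).source) (X : Mod) :
    liouville e X = lam (cotChart q₀ e) (chartD q₀ e X) := by
  have h := liouville_parD ((cotChart q₀).map_source he) (chartD q₀ e X)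
  rw [parD_chartD' he, (cotChart q₀).left_inv he] at h
  exact h

theorem isReebVector_iff (hF : IsFinslerMetric F) {f : CotBundle S → ℝ} {q₀ : S} {e : CotBundle S}
    (he : e ∈ (cotChart q₀).source) (hp : covec e ≠ 0)
    (hf : MDifferentiableAt cotModel 𝓘(ℝ, ℝ) f e) (X : Mod) :
    IsReebVector F f e X ↔
      IsCoordReeb (coordG F q₀) (coordFun q₀ f) (cotChart q₀ e) (chartD q₀ e X) := by
  have hfe : coordFun q₀ f (cotChart q₀ e) = f e := coordFun_apply f he
  have hdf : ∀ W : Mod, cotD f e W = fderiv ℝ (coordFun q₀ f) (cotChart q₀ e) (chartD q₀ e W) := by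
    intro W
    rw [fderiv_coordFun ((cotChart q₀).map_source he) (by rwa [(cotChart q₀).left_inv he]),
      parD_chartD' he, (cotChart q₀).left_inv he]
  have hn : conformalForm f e X = Real.exp (f e) * lam (cotChart q₀ e) (chartD q₀ e X) := by
    rw [← liouville_chartD he]
    rfl
  have hk : ∀ Y : Mod, extDerivOne (conformalForm f) e X Y = Real.exp (coordFun q₀ f (cotChart q₀ e)) *
      (fderiv ℝ (coordFun q₀ f) (cotChart q₀ e) (chartD q₀ e X) *
          lam (cotChart q₀ e) (chartD q₀ e Y) -
        fderiv ℝ (coordFun q₀ f) (cotChart q₀ e) (chartD q₀ e Y) *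
          lam (cotChart q₀ e) (chartD q₀ e X) + symp (chartD q₀ e X) (chartD q₀ e Y)) := by
    intro Y
    rw [extDerivOne_conformalForm hf, hdf, hdf, liouville_chartD he, liouville_chartD he,
      symp_chartD he, hfe]
  constructor
  · intro h
    refine ⟨(mem_cosphereTangent_iff hF he hp X).1 h.tangent, ?_, fun η hη => ?_⟩
    · rw [hfe, ← hn]
      exact h.normalized
    · have h1 := h.kernel (parD q₀ (cotChart q₀ e) η) ((mem_cosphereTangent_iff hF he hp _).2 (by
        rwa [chartD_parD' he]))
      have h2 := hk (parD q₀ (cotChart q₀ e) η)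
      rw [chartD_parD' he] at h2
      exact h2.symm.trans h1
  · intro h
    refine ⟨(mem_cosphereTangent_iff hF he hp X).2 h.tangent, ?_, fun Y hY => ?_⟩
    · have := h.normalized
      rw [hfe, ← hn] at this
      exact this
    · exact (hk Y).trans (h.kernel _ ((mem_cosphereTangent_iff hF he hp Y).1 hY))

/-- Existence and uniqueness in coordinates turn the implicit definition of a Reeb vector into the
value of an explicit smooth field on an open set of the chart, to which ODE theory applies. -/
theorem isReebVector_iff_eq (hF : IsFinslerMetric F) {f : CotBundle S → ℝ} {q₀ : S}
    {e : CotBundle S} (he : e ∈ (cotChart q₀).source) (hp : covec e ≠ 0)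
    (hf : MDifferentiableAt cotModel 𝓘(ℝ, ℝ) f e) (X : Mod) :
    IsReebVector F f e X ↔
      chartD q₀ e X = reebField (coordG F q₀) (coordFun q₀ f) (cotChart q₀ e) := by
  have hy := (cotChart q₀).map_source he
  have hp' := snd_cotChart_ne_zero he hp
  have hG := (coordG_pos hF hy hp').ne'
  have hE := fderiv_coordG_eul hF hy hp'
  rw [isReebVector_iff hF he hp hf]
  constructor
  · intro h
    exact h.unique (by rw [hE]; exact hG) (isCoordReeb_reebField hG hE)
  · intro h
    rw [h]
    exact isCoordReeb_reebField hG hE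

theorem IsReebTrajectoryOn.chart (hF : IsFinslerMetric F) {f : CotBundle S → ℝ}
    {c : ℝ → CotBundle S} {s : Set ℝ} (h : IsReebTrajectoryOn F f c s) {q₀ : S} {t : ℝ}
    (ht : t ∈ s) (hc : c t ∈ (cotChart q₀).source)
    (hf : MDifferentiableAt cotModel 𝓘(ℝ, ℝ) f (c t)) :
    HasDerivWithinAt (fun t => cotChart q₀ (c t))
      (reebField (coordG F q₀) (coordFun q₀ f) (cotChart q₀ (c t))) s t := by
  obtain ⟨h1, X, hX, hd⟩ := h t ht
  rw [← (isReebVector_iff_eq hF hc (covec_ne_zero hF h1) hf X).1 hX]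
  exact hasDerivWithinAt_cotChart_comp hc hd

theorem isReebTrajectoryOn_of_chart (hF : IsFinslerMetric F) {f : CotBundle S → ℝ}
    {y : ℝ → Mod} {s : Set ℝ} {q₀ : S}
    (h : ∀ t ∈ s, y t ∈ (cotChart q₀).target ∧ coordG F q₀ (y t) = 1 ∧
      MDifferentiableAt cotModel 𝓘(ℝ, ℝ) f ((cotChart q₀).symm (y t)) ∧
      HasDerivWithinAt y (reebField (coordG F q₀) (coordFun q₀ f) (y t)) s t) :
    IsReebTrajectoryOn F f (fun t => (cotChart q₀).symm (y t)) s := by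
  intro t ht
  obtain ⟨h1, h2, h3, h4⟩ := h t ht
  have hs := (cotChart q₀).map_target h1
  refine ⟨h2, parD q₀ (y t) (reebField (coordG F q₀) (coordFun q₀ f) (y t)), ?_,
    hasMFDerivWithinAt_cotChart_symm_comp h1 h4⟩
  rw [isReebVector_iff_eq hF hs (covec_ne_zero hF h2) h3, chartD_parD h1, (cotChart q₀).right_inv h1]

end Reeb

/-! ### Lifts of geodesics are Reeb orbits. -/

section Lift

attribute [local instance] cotTopology cotChartedSpace cot_isManifold cot_isManifold_one
  continuousSMul_mod modDualNACG modDualNS modDualACG modDualACM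
  modDualModule modDualTop modEndNACG modEndNS modDualDualNACG modDualDualNS

variable {S : Type*} [TopologicalSpace S] [ChartedSpace Plane S] [IsManifold (𝓡 2) ∞ S]
  {F : TangentBundle (𝓡 2) S → ℝ} {σ : ℝ → S} {l : ℝ}

/-- A curve on the surface in the chart at `q₀`. -/
def coordCurve (q₀ : S) (σ : ℝ → S) (t : ℝ) : Plane := extChartAt (𝓡 2) q₀ (σ t)

theorem IsClosedGeodesic.contDiffAt_coordCurve (hσ : IsClosedGeodesic F σ l) {q₀ : S} {t : ℝ}
    (ht : σ t ∈ (extChartAt (𝓡 2) q₀).source) : ContDiffAt ℝ ∞ (coordCurve q₀ σ) t := by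
  have h1 : ContMDiffAt (𝓡 2) 𝓘(ℝ, Plane) ∞ (extChartAt (𝓡 2) q₀) (σ t) :=
    contMDiffAt_extChartAt' (by simpa using ht)
  exact (h1.comp t (hσ.smooth t)).contDiffAt

theorem IsClosedGeodesic.velocity_eq (hσ : IsClosedGeodesic F σ l) {q₀ : S} {t : ℝ}
    (ht : σ t ∈ (extChartAt (𝓡 2) q₀).source) :
    (velocity σ t : Plane) = tanPar q₀ (coordCurve q₀ σ t) (deriv (coordCurve q₀ σ) t) := by
  have h1 : MDifferentiableAt (𝓡 2) 𝓘(ℝ, Plane) (extChartAt (𝓡 2) q₀) (σ t) :=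
    (contMDiffAt_extChartAt' (n := ∞) (by simpa using ht)).mdifferentiableAt (by simp)
  have h2 : MDifferentiableAt 𝓘(ℝ, ℝ) (𝓡 2) σ t := (hσ.smooth t).mdifferentiableAt (by simp)
  have h3 : HasFDerivAt (coordCurve q₀ σ) ((tanChart q₀ (σ t)).comp
    (mfderiv 𝓘(ℝ, ℝ) (𝓡 2) σ t : ℝ →L[ℝ] Plane)) t :=
    (h1.hasMFDerivAt.comp t h2.hasMFDerivAt).hasFDerivAt
  have h4 : deriv (coordCurve q₀ σ) t = tanChart q₀ (σ t) (velocity σ t) := h3.hasDerivAt.deriv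
  have h5 := tanPar_comp_tanChart ((extChartAt (𝓡 2) q₀).map_source ht)
  rw [(extChartAt (𝓡 2) q₀).left_inv ht] at h5
  rw [h4]
  exact (congrArg (fun L : Plane →L[ℝ] Plane => L (velocity σ t)) h5).symm

theorem IsClosedGeodesic.velocity_ne_zero (hF : IsFinslerMetric F) (hσ : IsClosedGeodesic F σ l)
    (t : ℝ) : velocity σ t ≠ 0 := by
  intro h
  have := hσ.unit_speed t
  rw [h, hF.zero] at this
  exact zero_ne_one this

theorem IsClosedGeodesic.deriv_ne_zero (hF : IsFinslerMetric F) (hσ : IsClosedGeodesic F σ l)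
    {q₀ : S} {t : ℝ} (ht : σ t ∈ (extChartAt (𝓡 2) q₀).source) :
    deriv (coordCurve q₀ σ) t ≠ 0 := by
  intro h
  have h1 := hσ.velocity_eq ht
  rw [h, map_zero] at h1
  exact hσ.velocity_ne_zero hF t h1

theorem mem_cotChart_lift {q₀ : S} {t : ℝ} :
    lift F σ t ∈ (cotChart q₀).source ↔ σ t ∈ (extChartAt (𝓡 2) q₀).source := by
  rw [cotChart_source]
  rfl

theorem IsClosedGeodesic.cotChart_lift (hF : IsFinslerMetric F) (hσ : IsClosedGeodesic F σ l)
    {q₀ : S} {t : ℝ} (ht : σ t ∈ (extChartAt (𝓡 2) q₀).source) :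
    cotChart q₀ (lift F σ t) = (coordCurve q₀ σ t,
      coordLegendre (coordN F q₀) (coordCurve q₀ σ t) (deriv (coordCurve q₀ σ) t)) := by
  have hx : coordCurve q₀ σ t ∈ (extChartAt (𝓡 2) q₀).target :=
    (extChartAt (𝓡 2) q₀).map_source ht
  have hd := hσ.deriv_ne_zero hF ht
  have hl : (extChartAt (𝓡 2) q₀).symm (coordCurve q₀ σ t) = σ t :=
    (extChartAt (𝓡 2) q₀).left_inv ht
  have hy : ((coordCurve q₀ σ t, coordLegendre (coordN F q₀) (coordCurve q₀ σ t)
      (deriv (coordCurve q₀ σ) t)) : Mod) ∈ (cotChart q₀).target := mem_cotChart_target.2 hx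
  rw [← (cotChart q₀).right_inv hy]
  congr 1
  refine cotBundle_ext ?_ ?_
  · rw [cotChart_symm_proj hy]
    exact hl.symm
  · rw [covec_cotChart_symm hy]
    refine Eq.trans ?_ (legendre_tanPar hF hx hd)
    have key : ∀ q', q' = σ t → ∀ v : Plane, (velocity σ t : Plane) = v →
        (legendre F (σ t) (velocity σ t) : Plane →L[ℝ] ℝ) =
          (legendre F q' v : Plane →L[ℝ] ℝ) := by
      rintro _ rfl _ rfl
      rfl
    exact key _ hl _ (hσ.velocity_eq ht)

theorem IsClosedGeodesic.coordN_eq (hσ : IsClosedGeodesic F σ l)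
    {q₀ : S} {t : ℝ} (ht : σ t ∈ (extChartAt (𝓡 2) q₀).source) :
    coordN F q₀ (coordCurve q₀ σ t, deriv (coordCurve q₀ σ) t) = 1 := by
  have hl : (extChartAt (𝓡 2) q₀).symm (coordCurve q₀ σ t) = σ t :=
    (extChartAt (𝓡 2) q₀).left_inv ht
  have key : ∀ q', q' = σ t → ∀ v : Plane, F ⟨q', v⟩ = F ⟨σ t, v⟩ := by
    rintro _ rfl v
    rfl
  refine (key _ hl _).trans ?_
  rw [← hσ.velocity_eq ht]
  exact hσ.unit_speed t

theorem IsClosedGeodesic.lift_mem (hF : IsFinslerMetric F) (hσ : IsClosedGeodesic F σ l) (t : ℝ) :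
    lift F σ t ∈ cosphere F :=
  (dualMetric_legendre hF _ _).trans (hσ.unit_speed t)

theorem IsClosedGeodesic.eventually_mem (hσ : IsClosedGeodesic F σ l)
    {q₀ : S} {t : ℝ} (ht : σ t ∈ (extChartAt (𝓡 2) q₀).source) :
    ∀ᶠ s in 𝓝 t, σ s ∈ (extChartAt (𝓡 2) q₀).source :=
  (hσ.smooth t).continuousAt.eventually_mem ((isOpen_extChartAt_source q₀).mem_nhds ht)

theorem IsClosedGeodesic.contDiffAt_cotChart_lift (hF : IsFinslerMetric F)
    (hσ : IsClosedGeodesic F σ l) {q₀ : S} {t : ℝ} (ht : σ t ∈ (extChartAt (𝓡 2) q₀).source) :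
    ContDiffAt ℝ ∞ (fun s => cotChart q₀ (lift F σ s)) t := by
  have h1 := hσ.contDiffAt_coordCurve ht
  have h2 : ContDiffAt ℝ ∞ (deriv (coordCurve q₀ σ)) t := by
    have : ContDiffAt ℝ ∞ (fun s => fderiv ℝ (coordCurve q₀ σ) s 1) t :=
      (h1.fderiv_right (m := ∞) (by simp)).clm_apply contDiffAt_const
    exact this
  have h3 : ContDiffAt ℝ ∞ (fun s => coordLegendre (coordN F q₀) (coordCurve q₀ σ s)
      (deriv (coordCurve q₀ σ) s)) t :=
    ((hF.isCoordFinsler q₀).contDiffAt_legendre ((extChartAt (𝓡 2) q₀).map_source ht)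
      (hσ.deriv_ne_zero hF ht)).comp
      (f := fun s => (coordCurve q₀ σ s, deriv (coordCurve q₀ σ) s)) t (h1.prodMk h2)
  refine (h1.prodMk h3).congr_of_eventuallyEq ?_
  filter_upwards [hσ.eventually_mem ht] with s hs using hσ.cotChart_lift hF hs

/-- The lift of a geodesic is a trajectory of the Reeb field of `p dq`. -/
theorem IsClosedGeodesic.isCoordReeb_lift (hF : IsFinslerMetric F) (hσ : IsClosedGeodesic F σ l)
    (t : ℝ) : ∃ ξ : Mod, HasDerivAt (fun s => cotChart (σ t) (lift F σ s)) ξ t ∧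
      fderiv ℝ (coordG F (σ t)) (cotChart (σ t) (lift F σ t)) ξ = 0 ∧
      lam (cotChart (σ t) (lift F σ t)) ξ = 1 ∧
      ∀ η, fderiv ℝ (coordG F (σ t)) (cotChart (σ t) (lift F σ t)) η = 0 → symp ξ η = 0 := by
  set q₀ := σ t with hq₀
  have ht : σ t ∈ (extChartAt (𝓡 2) q₀).source := mem_extChartAt_source q₀
  have hx : coordCurve q₀ σ t ∈ (extChartAt (𝓡 2) q₀).target :=
    (extChartAt (𝓡 2) q₀).map_source ht
  have hd := hσ.deriv_ne_zero hF ht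
  set x := coordCurve q₀ σ t with hxdef
  set v := deriv (coordCurve q₀ σ) t with hv
  have hN := hF.isCoordFinsler q₀
  have hN1 : coordN F q₀ (x, v) = 1 := hσ.coordN_eq ht
  have hfd : DifferentiableAt ℝ (fun z => 1 / 2 * coordN F q₀ z ^ 2) (x, v) :=
    (hN.contDiffAt_energy hx hd).differentiableAt (by simp)
  have hDx : fderiv ℝ (fun q : Plane => chartLagrangian F q₀ q v) x =
      (fderiv ℝ (fun z => 1 / 2 * coordN F q₀ z ^ 2) (x, v)).comp
        (ContinuousLinearMap.inl ℝ Plane Plane) := by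
    have h1 : HasFDerivAt (fun q : Plane => ((q, v) : Plane × Plane))
      (ContinuousLinearMap.inl ℝ Plane Plane) x := hasFDerivAt_prodMk_left x v
    have h2 : HasFDerivAt (fun q : Plane => chartLagrangian F q₀ q v) _ x :=
      HasFDerivAt.comp (g := fun z => 1 / 2 * coordN F q₀ z ^ 2) x hfd.hasFDerivAt h1
    exact h2.fderiv
  have hEL : HasDerivAt (fun s => coordLegendre (coordN F q₀) (coordCurve q₀ σ s)
      (deriv (coordCurve q₀ σ) s))
      (fderiv ℝ (fun q : Plane => chartLagrangian F q₀ q v) x) t := by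
    refine (hσ.euler_lagrange t).congr_of_eventuallyEq ?_
    filter_upwards [hσ.eventually_mem ht] with s hs
    exact hN.coordLegendre_eq_fderiv ((extChartAt (𝓡 2) q₀).map_source hs)
      (hσ.deriv_ne_zero hF hs)
  set D := fderiv ℝ (fun q : Plane => chartLagrangian F q₀ q v) x with hD
  have hyt := hσ.cotChart_lift hF ht
  have hdual := fun W => hN.fderiv_dual (coordFun_dualMetric hF q₀) hx hd hN1 W
  -- Hamilton's equations: the position moves with velocity `v`, and the momentum with the position
  -- derivative of the Lagrangian by the Euler–Lagrange equation. The derivative of the dual metric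
  -- at a unit covector is expressed through the same two quantities.
  refine ⟨(v, D), ?_, ?_, ?_, ?_⟩
  · have h1 : HasDerivAt (coordCurve q₀ σ) v t :=
      ((hσ.contDiffAt_coordCurve ht).differentiableAt (by simp)).hasDerivAt
    refine (h1.prodMk hEL).congr_of_eventuallyEq ?_
    filter_upwards [hσ.eventually_mem ht] with s hs using hσ.cotChart_lift hF hs
  · rw [hyt, hdual, hDx]
    simp
  · rw [hyt]
    change coordN F q₀ (x, v) * fderiv ℝ (fun w => coordN F q₀ (x, w)) v v = 1
    rw [(hN.minkowski x hx).fderiv_self hd, hN1, one_mul]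
  · intro η hη
    rw [hyt, hdual] at hη
    have : D η.1 = fderiv ℝ (fun z => 1 / 2 * coordN F q₀ z ^ 2) (x, v) (η.1, 0) := by
      rw [hDx]
      rfl
    simp only [symp]
    rw [this]
    linarith

/-- The lift of a geodesic is a trajectory of the Reeb field of `e^f p dq` if `f` vanishes to
first order along it. -/
theorem IsClosedGeodesic.isReebTrajectoryOn_lift (hF : IsFinslerMetric F)
    (hσ : IsClosedGeodesic F σ l) {f : CotBundle S → ℝ}
    (hf : ∀ t, MDifferentiableAt cotModel 𝓘(ℝ, ℝ) f (lift F σ t)) (h0 : ∀ t, f (lift F σ t) = 0)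
    (h1 : ∀ t, ∀ X ∈ cosphereTangent F (lift F σ t), cotD f (lift F σ t) X = 0) :
    IsReebTrajectoryOn F f (lift F σ) univ := by
  intro t _
  refine ⟨hσ.lift_mem hF t, ?_⟩
  have hs : lift F σ t ∈ (cotChart (σ t)).source := mem_cotChart_source (lift F σ t)
  have hcov := covec_ne_zero hF (hσ.lift_mem hF t)
  obtain ⟨ξ, hd, hξ1, hξ2, hξ3⟩ := hσ.isCoordReeb_lift hF t
  set y := cotChart (σ t) (lift F σ t) with hy
  have hyt : y ∈ (cotChart (σ t)).target := (cotChart (σ t)).map_source hs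
  have hye : (cotChart (σ t)).symm y = lift F σ t := (cotChart (σ t)).left_inv hs
  refine ⟨parD (σ t) y ξ, ?_, ?_⟩
  · rw [isReebVector_iff hF hs hcov (hf t), chartD_parD' hs]
    have hf0 : coordFun (σ t) f y = 0 := (coordFun_apply f hs).trans (h0 t)
    have hdf : ∀ η, fderiv ℝ (coordG F (σ t)) y η = 0 → fderiv ℝ (coordFun (σ t) f) y η = 0 := by
      intro η hη
      rw [fderiv_coordFun hyt (by rw [hye]; exact hf t), hye]
      refine h1 t _ ((mem_cosphereTangent_iff hF hs hcov _).2 ?_)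
      rwa [chartD_parD' hs]
    refine ⟨hξ1, ?_, fun η hη => ?_⟩
    · rw [hf0, hξ2]
      simp
    · rw [hdf ξ hξ1, hdf η hη, hξ3 η hη]
      simp
  · have h2 := hasMFDerivWithinAt_cotChart_symm_comp (t := t) (s := univ) hyt hd.hasDerivWithinAt
    refine h2.congr_of_eventuallyEq ?_ hye.symm
    rw [nhdsWithin_univ]
    filter_upwards [hσ.eventually_mem (mem_extChartAt_source (σ t))] with s hs'
    exact ((cotChart (σ t)).left_inv (mem_cotChart_lift.2 hs')).symm

theorem IsClosedGeodesic.periodic_lift (hσ : IsClosedGeodesic F σ l) :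
    Function.Periodic (lift F σ) l := by
  intro t
  have ht := mem_extChartAt_source (I := 𝓡 2) (σ t)
  have hp := hσ.periodic t
  have ht' : σ (t + l) ∈ (extChartAt (𝓡 2) (σ t)).source := by rwa [hp]
  have hcp : ∀ s, coordCurve (σ t) σ (s + l) = coordCurve (σ t) σ s := fun s => by
    rw [coordCurve, hσ.periodic s, coordCurve]
  have hv : (velocity σ (t + l) : Plane) = velocity σ t := by
    rw [hσ.velocity_eq ht', hσ.velocity_eq ht, hcp t, ← deriv_comp_add_const]
    simp only [hcp]
    rfl
  have key : ∀ (q q' : S) (v v' : Plane), q = q' → v = v' →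
      (⟨q, v⟩ : TangentBundle (𝓡 2) S) = ⟨q', v'⟩ := by
    rintro _ _ _ _ rfl rfl
    rfl
  have h : (⟨σ (t + l), velocity σ (t + l)⟩ : TangentBundle (𝓡 2) S) = ⟨σ t, velocity σ t⟩ :=
    key _ _ _ _ hp hv
  exact congrArg (fun z : TangentBundle (𝓡 2) S =>
    (⟨z.1, legendre F z.1 z.2⟩ : CotBundle S)) h

end Lift

/-! ### The perturbing functions along the orbit. -/

section Pert

attribute [local instance] cotTopology cotChartedSpace cot_isManifold cot_isManifold_one
  continuousSMul_mod modDualNACG modDualNS modDualACG modDualACM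
  modDualModule modDualTop modEndNACG modEndNS modDualDualNACG modDualDualNS

variable {S : Type*} [TopologicalSpace S] [ChartedSpace Plane S] [IsManifold (𝓡 2) ∞ S]
  {F : TangentBundle (𝓡 2) S → ℝ} {σ : ℝ → S} {l : ℝ} {W : Set S}
  {A : (q : S) → LinearMap.BilinForm ℝ (Cot q)}

/-- The quadratic function on the cotangent bundle defined by a field of bilinear forms. -/
def quad (A : (q : S) → LinearMap.BilinForm ℝ (Cot q)) (e : CotBundle S) : ℝ := A e.1 e.2 e.2

theorem quad_smul {q₀ : S} {y : Mod} (hy : y ∈ (cotChart q₀).target) (r : ℝ) :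
    coordFun q₀ (quad A) (y.1, r • y.2) = r ^ 2 * coordFun q₀ (quad A) y := by
  have hy' : ((y.1, r • y.2) : Mod) ∈ (cotChart q₀).target :=
    mem_cotChart_target.2 (mem_cotChart_target.1 hy)
  have h : (cotChart q₀).symm (y.1, r • y.2) =
      (⟨((cotChart q₀).symm y).1, r • ((cotChart q₀).symm y).2⟩ : CotBundle S) := by
    refine cotBundle_ext ?_ ?_
    · rw [cotChart_symm_proj hy', cotChart_symm_proj hy]
    · rw [covec_cotChart_symm hy']
      refine Eq.trans ?_ (congrArg (fun p => r • p) (covec_cotChart_symm hy).symm)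
      exact ContinuousLinearMap.smul_comp _ _ _
  simp only [coordFun]
  rw [h]
  simp only [quad, map_smul, LinearMap.smul_apply, smul_eq_mul]
  ring

/-- The quotient of a quadratic function by the square of the dual metric is homogeneous of degree
zero on the fibres, so over a compact ball in a chart it is bounded by its maximum on a Euclidean
sphere bundle. Compactness of the surface combines finitely many such bounds. -/
theorem exists_bound_quad [CompactSpace S] (hF : IsFinslerMetric F) (hA : Continuous (quad A)) :
    ∃ C : ℝ, ∀ e ∈ cosphere F, |quad A e| ≤ C := by
  suffices h : ∃ C : ℝ, ∀ e ∈ cosphere F, e.1 ∈ (univ : Set S) → |quad A e| ≤ C by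
    obtain ⟨C, hC⟩ := h
    exact ⟨C, fun e he => hC e he (mem_univ _)⟩
  refine isCompact_univ.induction_on (p := fun s : Set S =>
    ∃ C : ℝ, ∀ e ∈ cosphere F, e.1 ∈ s → |quad A e| ≤ C) ⟨0, by simp⟩ ?_ ?_ ?_
  · rintro s t hst ⟨C, hC⟩
    exact ⟨C, fun e he hs => hC e he (hst hs)⟩
  · rintro s t ⟨C, hC⟩ ⟨C', hC'⟩
    refine ⟨max C C', fun e he hs => ?_⟩
    rcases hs with hs | hs
    · exact (hC e he hs).trans (le_max_left _ _)
    · exact (hC' e he hs).trans (le_max_right _ _)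
  intro q₀ _
  rw [nhdsWithin_univ]
  set c := extChartAt (𝓡 2) q₀ with hc
  obtain ⟨r, hr, hball⟩ := Metric.nhds_basis_closedBall.mem_iff.1
    ((isOpen_chart_target q₀).mem_nhds (mem_extChartAt_target q₀))
  set K : Set Mod := Metric.closedBall (c q₀) r ×ˢ Metric.sphere (0 : Plane →L[ℝ] ℝ) 1 with hK
  have hKc : IsCompact K := (isCompact_closedBall _ _).prod (isCompact_sphere _ _)
  have hKt : ∀ y ∈ K, y ∈ (cotChart q₀).target ∧ y.2 ≠ 0 := by
    rintro y ⟨h1, h2⟩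
    refine ⟨mem_cotChart_target.2 (hball h1), fun h => ?_⟩
    rw [h] at h2
    simp at h2
  have hcont : ContinuousOn (fun y => coordFun q₀ (quad A) y * (coordG F q₀ y ^ 2)⁻¹) K := by
    intro y hy
    obtain ⟨h1, h2⟩ := hKt y hy
    have h3 : ContinuousAt (coordFun q₀ (quad A)) y :=
      hA.continuousAt.comp (contMDiffAt_cotChart_symm h1).continuousAt
    have h4 : ContinuousAt (coordG F q₀) y := (contDiffAt_coordG hF h1 h2).continuousAt
    exact (h3.mul ((h4.pow 2).inv₀
      (pow_ne_zero 2 (coordG_pos hF h1 h2).ne'))).continuousWithinAt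
  obtain ⟨C, hC⟩ := hKc.exists_bound_of_continuousOn hcont
  refine ⟨{q | q ∈ c.source ∧ c q ∈ Metric.closedBall (c q₀) r}, ?_, C, ?_⟩
  · refine Filter.inter_mem ((isOpen_extChartAt_source q₀).mem_nhds (mem_extChartAt_source q₀)) ?_
    exact (continuousAt_extChartAt q₀).preimage_mem_nhds (Metric.closedBall_mem_nhds _ hr)
  · rintro e he ⟨hs, hs'⟩
    have hes : e ∈ (cotChart q₀).source := by rwa [cotChart_source]
    set y := cotChart q₀ e with hy
    have hyt : y ∈ (cotChart q₀).target := (cotChart q₀).map_source hes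
    have hp : y.2 ≠ 0 := snd_cotChart_ne_zero hes (covec_ne_zero hF he)
    have hn : 0 < ‖y.2‖ := norm_pos_iff.2 hp
    have hG : coordG F q₀ y = 1 := (coordFun_apply _ hes).trans he
    have hQ : coordFun q₀ (quad A) y = quad A e := coordFun_apply _ hes
    have hy1 : y.1 = c e.1 := by rw [hy, cotChart_apply hs]
    have hmem : ((y.1, ‖y.2‖⁻¹ • y.2) : Mod) ∈ K := by
      refine ⟨by rw [hy1]; exact hs', ?_⟩
      rw [mem_sphere_zero_iff_norm, norm_smul, norm_inv, norm_norm, inv_mul_cancel₀ hn.ne']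
    have h1 := hC _ hmem
    have h2 : coordG F q₀ (y.1, ‖y.2‖⁻¹ • y.2) = ‖y.2‖⁻¹ := by
      have := (hF.isCoordDual q₀).homogeneous y _ (mem_cotChart_target.1 hyt) hp (inv_pos.2 hn)
      exact this.trans (by rw [show coordFun q₀ (dualMetric F) y = 1 from hG, mul_one])
    rw [quad_smul hyt, h2, hQ] at h1
    have h3 : ‖y.2‖⁻¹ ^ 2 * quad A e * (‖y.2‖⁻¹ ^ 2)⁻¹ = quad A e := by
      field_simp
    rw [h3, Real.norm_eq_abs] at h1
    exact h1

theorem eventually_pertDefined [CompactSpace S] (hF : IsFinslerMetric F)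
    (hA : Continuous (quad A)) : ∀ᶠ s in 𝓝 (0 : ℝ), PertDefined F A s := by
  obtain ⟨C, hC⟩ := exists_bound_quad hF hA
  have h0 : ContinuousAt (fun s : ℝ => |s| * |C|) 0 := by fun_prop
  have h1 : ∀ᶠ s in 𝓝 (0 : ℝ), |s| * |C| < 1 := h0.eventually_lt_const (by simp)
  filter_upwards [h1] with s hs e he
  have h2 : |s * quad A e| < 1 := by
    rw [abs_mul]
    exact (mul_le_mul_of_nonneg_left ((hC e he).trans (le_abs_self C)) (abs_nonneg s)).trans_lt hs
  have h3 : -1 < s * quad A e := (abs_lt.1 h2).1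
  change 0 < 1 + s * quad A e
  linarith

theorem contMDiffAt_pert {s : ℝ} {e : CotBundle S} (hA : ContMDiff cotModel 𝓘(ℝ, ℝ) ∞ (quad A))
    (h : 0 < 1 + s * quad A e) : ContMDiffAt cotModel 𝓘(ℝ, ℝ) ∞ (pert A s) e := by
  have h1 : ContDiffAt ℝ ∞ (fun a : ℝ => -(1 / 2) * Real.log (1 + s * a)) (quad A e) := by
    have h2 : ContDiffAt ℝ ∞ (fun a : ℝ => 1 + s * a) (quad A e) := by fun_prop
    exact contDiffAt_const.mul (h2.log h.ne')
  exact h1.contMDiffAt.comp e (hA e)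

/-- The perturbing function in a chart. -/
def coordPert (a : Mod → ℝ) (s : ℝ) (y : Mod) : ℝ := -(1 / 2) * Real.log (1 + s * a y)

theorem coordFun_pert (q₀ : S) (s : ℝ) :
    coordFun q₀ (pert A s) = coordPert (coordFun q₀ (quad A)) s := rfl

theorem contDiffAt_coordPert {a : Mod → ℝ} {s : ℝ} {y : Mod} (ha : ContDiffAt ℝ ∞ a y)
    (h : 0 < 1 + s * a y) : ContDiffAt ℝ ∞ (coordPert a s) y :=
  contDiffAt_const.mul ((contDiffAt_const.add (contDiffAt_const.mul ha)).log h.ne')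

theorem hasFDerivAt_coordPert {a : Mod → ℝ} {s : ℝ} {y : Mod} (ha : DifferentiableAt ℝ a y)
    (h : 0 < 1 + s * a y) :
    HasFDerivAt (coordPert a s) ((-(1 / 2) * s * (1 + s * a y)⁻¹) • fderiv ℝ a y) y := by
  have h1 := (((ha.hasFDerivAt.const_mul s).const_add 1).log h.ne').const_mul (-(1 / 2))
  refine h1.congr_fderiv ?_
  simp only [smul_smul]
  congr 1
  ring

/-- At a critical zero of `a` the nonlinearity of the logarithm does not reach second order. This
makes the linearized equation exactly affine in `s`, with no error term. -/
theorem fderiv_fderiv_coordPert {a : Mod → ℝ} {s : ℝ} {y : Mod} (ha : ContDiffAt ℝ ∞ a y)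
    (h0 : a y = 0) (h1 : fderiv ℝ a y = 0) :
    fderiv ℝ (fderiv ℝ (coordPert a s)) y = (-(1 / 2) * s) • fderiv ℝ (fderiv ℝ a) y := by
  have hev : ∀ᶠ z in 𝓝 y, ContDiffAt ℝ 1 a z ∧ 0 < 1 + s * a z := by
    have h2 : ContinuousAt (fun z => 1 + s * a z) y := by
      have := ha.continuousAt
      fun_prop
    refine ((ha.of_le (m := 1) (by simp)).eventually (by simp)).and ?_
    exact h2.eventually_const_lt (by simp [h0])
  have hev' : fderiv ℝ (coordPert a s) =ᶠ[𝓝 y]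
      fun z => (-(1 / 2) * s * (1 + s * a z)⁻¹) • fderiv ℝ a z := by
    filter_upwards [hev] with z hz
    exact (hasFDerivAt_coordPert (hz.1.differentiableAt (by simp)) hz.2).fderiv
  have hda : HasFDerivAt (fderiv ℝ a) (fderiv ℝ (fderiv ℝ a) y) y :=
    ((ha.fderiv_right (m := ∞) (by simp)).differentiableAt (by simp)).hasFDerivAt
  have hc : DifferentiableAt ℝ (fun z => -(1 / 2) * s * (1 + s * a z)⁻¹) y := by
    have hd := ha.differentiableAt (by simp)
    have : (1 : ℝ) + s * a y ≠ 0 := by rw [h0]; simp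
    fun_prop (disch := assumption)
  have h2 : HasFDerivAt (fun z => (-(1 / 2) * s * (1 + s * a z)⁻¹) • fderiv ℝ a z) _ y :=
    hc.hasFDerivAt.smul hda
  rw [hev'.fderiv_eq, h2.fderiv]
  ext Z W
  all_goals simp [h0, h1]

/-- An admissible field vanishes to first order along the orbit. -/
theorem IsAdmissible.quad_eq_zero [CompactSpace S] (hF : IsFinslerMetric F)
    (hσ : IsClosedGeodesic F σ l) (hA : IsAdmissible F (lift F σ) W A) (t : ℝ) :
    quad A (lift F σ t) = 0 ∧ cotD (quad A) (lift F σ t) = 0 := by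
  -- One nonzero parameter at which `f_s` is defined suffices: from it the vanishing of `f_s` passes
  -- to the quadratic function itself.
  obtain ⟨s, hs, hs0⟩ := ((eventually_pertDefined hF hA.smooth.continuous).filter_mono
    nhdsWithin_le_nhds |>.and (eventually_mem_nhdsWithin (s := {(0 : ℝ)}ᶜ))).exists
  have hs0 : s ≠ 0 := hs0
  set e := lift F σ t with he
  have hec := hσ.lift_mem hF t
  obtain ⟨h1, h2⟩ := hA.vanish s hs t
  have hpos : 0 < 1 + s * quad A e := hs e hec
  have hq : quad A e = 0 := by
    have h3 : Real.log (1 + s * quad A e) = 0 := by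
      have : -(1 / 2) * Real.log (1 + s * quad A e) = 0 := h1
      linarith
    have h4 := Real.eq_one_of_pos_of_log_eq_zero hpos h3
    have h5 : s * quad A e = 0 := by linarith
    exact (mul_eq_zero.1 h5).resolve_left hs0
  refine ⟨hq, ?_⟩
  have hes := mem_cotChart_source e
  set y := cotChart e.1 e with hy
  have hyt : y ∈ (cotChart e.1).target := (cotChart e.1).map_source hes
  have hcov := covec_ne_zero hF hec
  have hp := snd_cotChart_ne_zero hes hcov
  have hye : (cotChart e.1).symm y = e := (cotChart e.1).left_inv hes
  have ha : ContDiffAt ℝ ∞ (coordFun e.1 (quad A)) y :=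
    contDiffAt_coordFun le_rfl hyt (hA.smooth _)
  have had := ha.differentiableAt (by simp)
  have hay : coordFun e.1 (quad A) y = 0 := (coordFun_apply _ hes).trans hq
  have hpd := hasFDerivAt_coordPert (s := s) had (by rw [hay]; simp)
  have hker : ∀ Z, fderiv ℝ (coordG F e.1) y Z = 0 →
      fderiv ℝ (coordFun e.1 (quad A)) y Z = 0 := by
    intro Z hZ
    have h3 := h2 Z ((mem_cosphereTangent_iff hF hes hcov Z).2 (by rwa [chartD_self]))
    have h4 : cotD (pert A s) e Z = 0 := h3
    rw [cotD_of_coordFun (f := pert A s) hes hpd.differentiableAt, coordFun_pert, hpd.fderiv,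
      chartD_self, hay] at h4
    simpa [hs0] using h4
  -- The hypothesis controls the differential only on the hypersurface. In the complementary radial
  -- direction the quadratic function vanishes identically, by homogeneity.
  have heul : fderiv ℝ (coordFun e.1 (quad A)) y (eul y) = 0 := by
    have h3 : HasDerivAt (fun r : ℝ => coordFun e.1 (quad A) (y.1, r • y.2))
        (fderiv ℝ (coordFun e.1 (quad A)) y (eul y)) 1 := by
      have h4 : HasDerivAt (fun r : ℝ => ((y.1, r • y.2) : Mod)) (eul y) 1 := by
        have := ((hasDerivAt_id (1 : ℝ)).smul_const y.2)
        rw [one_smul] at this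
        exact (hasDerivAt_const (1 : ℝ) y.1).prodMk this
      have h5 : HasFDerivAt (coordFun e.1 (quad A)) (fderiv ℝ (coordFun e.1 (quad A)) y)
          (y.1, (1 : ℝ) • y.2) := by
        rw [one_smul]
        exact had.hasFDerivAt
      exact h5.comp_hasDerivAt (1 : ℝ) h4
    have h6 : (fun r : ℝ => coordFun e.1 (quad A) (y.1, r • y.2)) = fun _ => 0 := by
      funext r
      rw [quad_smul hyt, hay, mul_zero]
    rw [h6] at h3
    exact h3.unique (hasDerivAt_const _ _)
  have hall : fderiv ℝ (coordFun e.1 (quad A)) y = 0 := by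
    refine ContinuousLinearMap.ext fun Z => ?_
    have hE := fderiv_coordG_eul hF hyt hp
    have hG := (coordG_pos hF hyt hp).ne'
    have h3 := hker (Z - (fderiv ℝ (coordG F e.1) y Z / coordG F e.1 y) • eul y) (by
      rw [map_sub, map_smul, hE, smul_eq_mul]
      field_simp
      simp)
    rw [map_sub, map_smul, heul, smul_zero, sub_zero] at h3
    exact h3
  refine ContinuousLinearMap.ext fun Z => ?_
  rw [cotD_of_coordFun hes had, hall]
  rfl

theorem IsAdmissible.coordFun_quad_eq_zero [CompactSpace S] (hF : IsFinslerMetric F)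
    (hσ : IsClosedGeodesic F σ l) (hA : IsAdmissible F (lift F σ) W A) {q₀ : S} {t : ℝ}
    (ht : σ t ∈ (extChartAt (𝓡 2) q₀).source) :
    coordFun q₀ (quad A) (cotChart q₀ (lift F σ t)) = 0 ∧
      fderiv ℝ (coordFun q₀ (quad A)) (cotChart q₀ (lift F σ t)) = 0 := by
  have hs := mem_cotChart_lift (F := F) |>.2 ht
  obtain ⟨h1, h2⟩ := hA.quad_eq_zero hF hσ t
  refine ⟨(coordFun_apply _ hs).trans h1, ContinuousLinearMap.ext fun Z => ?_⟩
  rw [fderiv_coordFun (f := quad A) ((cotChart q₀).map_source hs)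
    ((hA.smooth _).mdifferentiableAt (by simp)), (cotChart q₀).left_inv hs, h2]
  rfl

theorem IsAdmissible.isReebOrbit (hF : IsFinslerMetric F)
    (hσ : IsClosedGeodesic F σ l) (hA : IsAdmissible F (lift F σ) W A) {s : ℝ}
    (hs : PertDefined F A s) : IsReebOrbit F (pert A s) (lift F σ) l where
  period_pos := hσ.length_pos
  periodic := hσ.periodic_lift
  trajectory := hσ.isReebTrajectoryOn_lift hF
    (fun t => (contMDiffAt_pert hA.smooth (hs _ (hσ.lift_mem hF t))).mdifferentiableAt (by simp))
    (fun t => (hA.vanish s hs t).1) (fun t => (hA.vanish s hs t).2)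

end Pert

/-! ### Reeb flows between points: uniqueness, concatenation, existence in a chart. -/

section Transit

attribute [local instance] cotTopology cotChartedSpace cot_isManifold cot_isManifold_one
  continuousSMul_mod modDualNACG modDualNS modDualACG modDualACM
  modDualModule modDualTop modEndNACG modEndNS modDualDualNACG modDualDualNS

variable {S : Type*} [TopologicalSpace S] [ChartedSpace Plane S] [IsManifold (𝓡 2) ∞ S]
  {F : TangentBundle (𝓡 2) S → ℝ} {f : CotBundle S → ℝ}

theorem continuousWithinAt_proj_cotBundle {c : ℝ → CotBundle S} {s : Set ℝ} {t : ℝ}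
    (h : ContinuousWithinAt c s t) : ContinuousWithinAt (fun t => (c t).1) s t :=
  (FiberBundle.continuous_proj (Plane →L[ℝ] ℝ) (fun q : S => Cot q)).continuousAt.comp_continuousWithinAt h

theorem IsReebTrajectoryOn.continuousWithinAt {c : ℝ → CotBundle S} {s : Set ℝ}
    (h : IsReebTrajectoryOn F f c s) {t : ℝ} (ht : t ∈ s) : ContinuousWithinAt c s t := by
  obtain ⟨-, X, -, hX⟩ := h t ht
  exact hX.continuousWithinAt

theorem IsReebTrajectoryOn.congr {c c' : ℝ → CotBundle S} {s : Set ℝ}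
    (h : IsReebTrajectoryOn F f c s) (hc : EqOn c' c s) : IsReebTrajectoryOn F f c' s := by
  intro t ht
  obtain ⟨h1, X, h2, h3⟩ := h t ht
  have key : ∀ e, e = c t → e ∈ cosphere F ∧ IsReebVector F f e X := by
    rintro _ rfl
    exact ⟨h1, h2⟩
  obtain ⟨h4, h5⟩ := key _ (hc ht)
  exact ⟨h4, X, h5, h3.congr_mono hc (hc ht) subset_rfl⟩

theorem IsReebVector.unique (hF : IsFinslerMetric F) {e : CotBundle S} (he : e ∈ cosphere F)
    (hf : MDifferentiableAt cotModel 𝓘(ℝ, ℝ) f e) {X Y : Mod} (hX : IsReebVector F f e X)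
    (hY : IsReebVector F f e Y) : X = Y := by
  have hs := mem_cotChart_source e
  have hc := covec_ne_zero hF he
  rw [← parD_chartD' hs X, ← parD_chartD' hs Y, (isReebVector_iff_eq hF hs hc hf X).1 hX,
    (isReebVector_iff_eq hF hs hc hf Y).1 hY]

/-- At the junction the velocities from the left and from the right agree because the Reeb vector at
a point is unique. -/
theorem IsReebTrajectoryOn.union (hF : IsFinslerMetric F)
    (hf : ∀ e ∈ cosphere F, MDifferentiableAt cotModel 𝓘(ℝ, ℝ) f e) {c : ℝ → CotBundle S}
    {a b d : ℝ} (hab : a ≤ b) (hbd : b ≤ d) (h₁ : IsReebTrajectoryOn F f c (Icc a b))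
    (h₂ : IsReebTrajectoryOn F f c (Icc b d)) : IsReebTrajectoryOn F f c (Icc a d) := by
  intro t ht
  rcases lt_trichotomy t b with h | rfl | h
  · obtain ⟨h1, X, h2, h3⟩ := h₁ t ⟨ht.1, h.le⟩
    refine ⟨h1, X, h2, h3.mono_of_mem_nhdsWithin ?_⟩
    filter_upwards [self_mem_nhdsWithin, mem_nhdsWithin_of_mem_nhds (Iio_mem_nhds h)] with u hu hu'
    exact ⟨hu.1, le_of_lt hu'⟩
  · obtain ⟨h1, X, h2, h3⟩ := h₁ t ⟨hab, le_rfl⟩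
    obtain ⟨-, Y, h5, h6⟩ := h₂ t ⟨le_rfl, hbd⟩
    have hXY : X = Y := h2.unique hF h1 (hf _ h1) h5
    refine ⟨h1, X, h2, ?_⟩
    rw [← Icc_union_Icc_eq_Icc hab hbd]
    refine h3.union ?_
    rw [hXY]
    exact h6
  · obtain ⟨h1, X, h2, h3⟩ := h₂ t ⟨h.le, ht.2⟩
    refine ⟨h1, X, h2, h3.mono_of_mem_nhdsWithin ?_⟩
    filter_upwards [self_mem_nhdsWithin, mem_nhdsWithin_of_mem_nhds (Ioi_mem_nhds h)] with u hu hu'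
    exact ⟨le_of_lt hu', hu.2⟩

/-- Reeb trajectories are determined by their initial point. -/
theorem IsReebTrajectoryOn.eqOn [T2Space S] (hF : IsFinslerMetric F)
    (hf : ∀ e ∈ cosphere F, ContMDiffAt cotModel 𝓘(ℝ, ℝ) ∞ f e) {c c' : ℝ → CotBundle S}
    {a b : ℝ} (h : IsReebTrajectoryOn F f c (Icc a b)) (h' : IsReebTrajectoryOn F f c' (Icc a b))
    (ha : c a = c' a) : EqOn c c' (Icc a b) := by
  have hchart : ∀ {c : ℝ → CotBundle S}, IsReebTrajectoryOn F f c (Icc a b) → ∀ {q₀ : S} {t : ℝ},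
      t ∈ Icc a b → c t ∈ (cotChart q₀).source →
      ContinuousWithinAt (fun t => cotChart q₀ (c t)) (Icc a b) t := by
    intro c hc q₀ t ht hs
    exact (contMDiffAt_cotChart hs).continuousAt.comp_continuousWithinAt (hc.continuousWithinAt ht)
  refine IsClosed.Icc_subset_of_forall_mem_nhdsWithin (s := {t | c t = c' t}) ?_ ha ?_
  -- Only the surface is assumed Hausdorff. At a limit of coincidence times the base points agree
  -- first; both curves then lie in one bundle chart, where limits are unique.
  · refine isClosed_of_closure_subset fun t ht => ?_
    have htI : t ∈ Icc a b := isClosed_Icc.closure_subset (closure_mono inter_subset_right ht)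
    refine ⟨?_, htI⟩
    have : (𝓝[{t | c t = c' t} ∩ Icc a b] t).NeBot := mem_closure_iff_nhdsWithin_neBot.1 ht
    have hq : (c t).1 = (c' t).1 := by
      refine tendsto_nhds_unique (f := fun t => (c t).1) (l := 𝓝[{t | c t = c' t} ∩ Icc a b] t)
        ((continuousWithinAt_proj_cotBundle (h.continuousWithinAt htI)).mono inter_subset_right) ?_
      refine Tendsto.congr' ?_ ((continuousWithinAt_proj_cotBundle
        (h'.continuousWithinAt htI)).mono inter_subset_right)
      filter_upwards [self_mem_nhdsWithin] with u hu
      rw [show c u = c' u from hu.1]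
    have hs : c t ∈ (cotChart (c t).1).source := mem_cotChart_source _
    have hs' : c' t ∈ (cotChart (c t).1).source := by
      rw [hq]
      exact mem_cotChart_source _
    refine (cotChart (c t).1).injOn hs hs' ?_
    refine tendsto_nhds_unique (f := fun u => cotChart (c t).1 (c u))
      (l := 𝓝[{t | c t = c' t} ∩ Icc a b] t) ((hchart h htI hs).mono inter_subset_right) ?_
    refine Tendsto.congr' ?_ ((hchart h' htI hs').mono inter_subset_right)
    filter_upwards [self_mem_nhdsWithin] with u hu
    rw [show c u = c' u from hu.1]
  · rintro t ⟨htc, htI⟩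
    have htc : c t = c' t := htc
    have htI' : t ∈ Icc a b := Ico_subset_Icc_self htI
    set q₀ := (c t).1 with hq₀
    have hs : c t ∈ (cotChart q₀).source := mem_cotChart_source _
    have hs' : c' t ∈ (cotChart q₀).source := htc ▸ hs
    set y := cotChart q₀ (c t) with hy
    have hyt : y ∈ (cotChart q₀).target := (cotChart q₀).map_source hs
    have hp := snd_cotChart_ne_zero hs (covec_ne_zero hF (h t htI').1)
    have hX : ContDiffAt ℝ ∞ (reebField (coordG F q₀) (coordFun q₀ f)) y := by
      refine contDiffAt_reebField (contDiffAt_coordG hF hyt hp)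
        (contDiffAt_coordFun le_rfl hyt ?_) (coordG_pos hF hyt hp).ne'
      rw [(cotChart q₀).left_inv hs]
      exact hf _ (h t htI').1
    -- From a coincidence time, both curves stay for a short while in a chart and in a region where
    -- the Reeb field is Lipschitz, so ODE uniqueness extends the agreement to the right.
    obtain ⟨K, N, hN, hK⟩ := (hX.of_le (m := 1) (by simp)).exists_lipschitzOnWith
    have hev : ∀ {c : ℝ → CotBundle S}, IsReebTrajectoryOn F f c (Icc a b) →
        c t ∈ (cotChart q₀).source → cotChart q₀ (c t) = y →
        ∀ᶠ u in 𝓝[Icc a b] t, c u ∈ (cotChart q₀).source ∧ cotChart q₀ (c u) ∈ N := by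
      intro c hc hcs hcy
      refine ((hc.continuousWithinAt htI').eventually
        ((isOpen_cotChart_source q₀).mem_nhds hcs)).and ?_
      refine (hchart hc htI' hcs).eventually (p := fun z => z ∈ N) ?_
      change ∀ᶠ z in 𝓝 (cotChart q₀ (c t)), z ∈ N
      rw [hcy]
      exact hN
    have hIcc : Icc a b ∈ 𝓝[≥] t := Icc_mem_nhdsGE_of_mem htI
    have hev2 := ((hev h hs rfl).and (hev h' hs' (by rw [← htc]))).filter_mono
      (nhdsWithin_le_of_mem hIcc)
    obtain ⟨d, hd, hsub⟩ := mem_nhdsGE_iff_exists_Icc_subset.1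
      (Filter.inter_mem hev2 hIcc)
    have hd : t < d := hd
    have hcd : ∀ {c : ℝ → CotBundle S}, IsReebTrajectoryOn F f c (Icc a b) →
        (∀ u ∈ Icc t d, c u ∈ (cotChart q₀).source) →
        ContinuousOn (fun u => cotChart q₀ (c u)) (Icc t d) ∧ ∀ u ∈ Ico t d,
          HasDerivWithinAt (fun u => cotChart q₀ (c u))
            (reebField (coordG F q₀) (coordFun q₀ f) (cotChart q₀ (c u))) (Ici u) u := by
      intro c hc hcs
      refine ⟨fun u hu => (hchart hc (hsub hu).2 (hcs u hu)).mono fun w hw => (hsub hw).2,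
        fun u hu => ?_⟩
      have huI := (hsub (Ico_subset_Icc_self hu)).2
      have h1 := hc.chart hF huI (hcs u (Ico_subset_Icc_self hu))
        ((hf _ (hc u huI).1).mdifferentiableAt (by simp))
      refine h1.mono_of_mem_nhdsWithin (Icc_mem_nhdsGE_of_mem ⟨huI.1, ?_⟩)
      exact hu.2.trans_le (hsub (right_mem_Icc.2 hd.le)).2.2
    obtain ⟨h1, h2⟩ := hcd h fun u hu => (hsub hu).1.1.1
    obtain ⟨h3, h4⟩ := hcd h' fun u hu => (hsub hu).1.2.1
    have key := ODE_solution_unique_of_mem_Icc_right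
      (v := fun _ => reebField (coordG F q₀) (coordFun q₀ f)) (s := fun _ => N) (K := K)
      (fun _ _ => hK) h1 h2 (fun u hu => (hsub (Ico_subset_Icc_self hu)).1.1.2) h3 h4
      (fun u hu => (hsub (Ico_subset_Icc_self hu)).1.2.2) (by rw [htc])
    filter_upwards [Icc_mem_nhdsGT hd] with u hu
    exact (cotChart q₀).injOn (hsub hu).1.1.1 (hsub hu).1.2.1 (key hu)

/-- A tangent vector of the hypersurface is the velocity of a curve in it. -/
theorem exists_curve_cosphere (hF : IsFinslerMetric F) {e : CotBundle S} (he : e ∈ cosphere F)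
    {X : Mod} (hX : (X : TangentSpace cotModel e) ∈ cosphereTangent F e) :
    ∃ c : ℝ → CotBundle S, c 0 = e ∧ (∀ᶠ t in 𝓝 0, c t ∈ cosphere F) ∧
      ∀ L : Mod →L[ℝ] Mod, ∀ φ : CotBundle S → CotBundle S,
        HasMFDerivWithinAt cotModel cotModel φ (cosphere F) e L → ∀ q₀ : S,
        φ e ∈ (cotChart q₀).source →
        HasDerivAt (fun t => cotChart q₀ (φ (c t))) (chartD q₀ (φ e) (L X)) 0 := by
  have hs := mem_cotChart_source e
  have hp := snd_cotChart_ne_zero hs (covec_ne_zero hF he)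
  set y := cotChart e.1 e with hy
  have hyt : y ∈ (cotChart e.1).target := (cotChart e.1).map_source hs
  have hye : (cotChart e.1).symm y = e := (cotChart e.1).left_inv hs
  have hG1 : coordG F e.1 y = 1 := (coordFun_apply _ hs).trans he
  have hDX : fderiv ℝ (coordG F e.1) y X = 0 := by
    have := (mem_cosphereTangent_iff hF hs (covec_ne_zero hF he) X).1 hX
    rwa [chartD_self] at this
  have hline : HasDerivAt (fun t : ℝ => y + t • X) X 0 := by
    simpa using ((hasDerivAt_id (0 : ℝ)).smul_const X).const_add y
  set g : ℝ → ℝ := fun t => coordG F e.1 (y + t • X) with hg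
  have hg0 : g 0 = 1 := by simp [hg, hG1]
  have hgd : HasDerivAt g 0 0 := by
    have h1 : HasFDerivAt (coordG F e.1) (fderiv ℝ (coordG F e.1) y) (y + (0 : ℝ) • X) := by
      rw [zero_smul, add_zero]
      exact ((contDiffAt_coordG hF hyt hp).differentiableAt (by simp)).hasFDerivAt
    have h2 := h1.comp_hasDerivAt (0 : ℝ) hline
    rwa [hDX] at h2
  -- The straight line is brought back to the hypersurface by rescaling covectors. Tangency of `X`
  -- gives `g'(0) = 0`, so the velocity at `0` is unchanged.
  set z : ℝ → Mod := fun t => ((y + t • X).1, (g t)⁻¹ • (y + t • X).2) with hz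
  have hzd : HasDerivAt z X 0 := by
    have h1 : HasDerivAt (fun t : ℝ => (y + t • X).1) X.1 0 :=
      (ContinuousLinearMap.fst ℝ Plane (Plane →L[ℝ] ℝ)).hasFDerivAt.comp_hasDerivAt 0 hline
    have h2 : HasDerivAt (fun t : ℝ => (y + t • X).2) X.2 0 :=
      (ContinuousLinearMap.snd ℝ Plane (Plane →L[ℝ] ℝ)).hasFDerivAt.comp_hasDerivAt 0 hline
    have h3 := (hgd.inv (by rw [hg0]; exact one_ne_zero)).smul h2
    refine (h1.prodMk h3).congr_deriv ?_
    simp [hg0]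
  have hz0 : z 0 = y := by simp [hz, hg0]
  have hev : ∀ᶠ t in 𝓝 (0 : ℝ), (y + t • X) ∈ (cotChart e.1).target ∧ (y + t • X).2 ≠ 0 := by
    have hc : ContinuousAt (fun t : ℝ => y + t • X) 0 := hline.continuousAt
    refine (hc.eventually ((isOpen_cotChart_target e.1).mem_nhds (by simpa using hyt))).and ?_
    exact (continuous_snd.continuousAt.comp hc).eventually_ne (by simpa using hp)
  have hcos : ∀ᶠ t in 𝓝 (0 : ℝ), (cotChart e.1).symm (z t) ∈ cosphere F := by
    filter_upwards [hev] with t ht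
    have h1 := (hF.isCoordDual e.1).homogeneous (y + t • X) (g t)⁻¹
      (mem_cotChart_target.1 ht.1) ht.2 (inv_pos.2 (coordG_pos hF ht.1 ht.2))
    exact h1.trans (inv_mul_cancel₀ (coordG_pos hF ht.1 ht.2).ne')
  refine ⟨fun t => (cotChart e.1).symm (z t), by simp only [hz0, hye], hcos, ?_⟩
  · intro L φ hφ q₀ hq₀
    have hX' : HasMFDerivWithinAt 𝓘(ℝ, ℝ) cotModel (fun t => (cotChart e.1).symm (z t))
        {t | (cotChart e.1).symm (z t) ∈ cosphere F} 0 ((1 : ℝ →L[ℝ] ℝ).smulRight X) := by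
      have h1 := hasMFDerivWithinAt_cotChart_symm_comp (q₀ := e.1)
        (s := {t | (cotChart e.1).symm (z t) ∈ cosphere F}) (by rwa [hz0]) hzd.hasDerivWithinAt
      have h2 : parD e.1 (z 0) X = X := by rw [hz0, hy, parD_self]; rfl
      rw [h2] at h1
      exact h1
    have hφ' : ∀ e', e' = e → HasMFDerivWithinAt cotModel cotModel φ (cosphere F) e' L := by
      rintro _ rfl
      exact hφ
    have hz0' : (cotChart e.1).symm (z 0) = e := by rw [hz0, hye]
    have h3 : HasMFDerivWithinAt 𝓘(ℝ, ℝ) cotModel (fun t => φ ((cotChart e.1).symm (z t)))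
        {t | (cotChart e.1).symm (z t) ∈ cosphere F} 0 ((1 : ℝ →L[ℝ] ℝ).smulRight (L X)) := by
      have h4 := HasMFDerivWithinAt.comp (0 : ℝ) (hφ' _ hz0') hX' (fun t ht => ht)
      have h5 : L.comp ((1 : ℝ →L[ℝ] ℝ).smulRight X) = (1 : ℝ →L[ℝ] ℝ).smulRight (L X) := by
        ext1
        simp
      have h6 : ∀ M : ℝ →L[ℝ] Mod, L.comp ((1 : ℝ →L[ℝ] ℝ).smulRight X) = M →
          HasMFDerivWithinAt 𝓘(ℝ, ℝ) cotModel (fun t => φ ((cotChart e.1).symm (z t)))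
            {t | (cotChart e.1).symm (z t) ∈ cosphere F} 0 M := by
        rintro _ rfl
        exact h4
      exact h6 _ h5
    have h6 := hasDerivWithinAt_cotChart_comp (q₀ := q₀)
      (c := fun t => φ ((cotChart e.1).symm (z t))) (by simpa only [hz0'] using hq₀) h3
    simp only [hz0'] at h6
    exact h6.hasDerivAt hcos

/-- The flow of the Reeb field of `e^f p dq` on the hypersurface takes `e₁` at the time `a` to
`e₂` at the time `b`, with derivative `L`. -/
def IsTransit (F : TangentBundle (𝓡 2) S → ℝ) (f : CotBundle S → ℝ) (a b : ℝ)
    (e₁ e₂ : CotBundle S) (L : Mod →L[ℝ] Mod) : Prop :=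
  ∃ φ : ℝ → CotBundle S → CotBundle S,
    (∀ᶠ x in 𝓝[cosphere F] e₁, φ a x = x ∧ IsReebTrajectoryOn F f (fun t => φ t x) (Icc a b)) ∧
    φ b e₁ = e₂ ∧ HasMFDerivWithinAt cotModel cotModel (φ b) (cosphere F) e₁ L

/-- Two flows agree on the hypersurface near the initial point. A derivative within the hypersurface
is determined only on its tangent vectors, where it is tested along curves in the hypersurface. -/
theorem IsTransit.unique [T2Space S] (hF : IsFinslerMetric F)
    (hf : ∀ e ∈ cosphere F, ContMDiffAt cotModel 𝓘(ℝ, ℝ) ∞ f e) {a b : ℝ} (hab : a ≤ b)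
    {e₁ e₂ e₂' : CotBundle S} (he : e₁ ∈ cosphere F) {L L' : Mod →L[ℝ] Mod}
    (h : IsTransit F f a b e₁ e₂ L) (h' : IsTransit F f a b e₁ e₂' L') {X : Mod}
    (hX : (X : TangentSpace cotModel e₁) ∈ cosphereTangent F e₁) : L X = L' X := by
  obtain ⟨φ, h1, -, h3⟩ := h
  obtain ⟨φ', h1', -, h3'⟩ := h'
  have hev : φ b =ᶠ[𝓝[cosphere F] e₁] φ' b := by
    filter_upwards [h1, h1'] with x hx hx'
    exact hx.2.eqOn hF hf hx'.2 (hx.1.trans hx'.1.symm) (right_mem_Icc.2 hab)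
  have hpt : φ b e₁ = φ' b e₁ := hev.self_of_nhdsWithin he
  obtain ⟨c, hc0, hc, hcd⟩ := exists_curve_cosphere hF he hX
  have hs := mem_cotChart_source (φ b e₁)
  have d1 := hcd L (φ b) h3 _ hs
  have d2 := hcd L' (φ b) (h3'.congr_of_eventuallyEq hev hpt) _ hs
  have := d1.unique d2
  rw [← parD_chartD' hs (L X), this, parD_chartD' hs]

/-- The second flow is started at the endpoint of the first. The first maps the hypersurface into
itself, which is what the chain rule for derivatives within it requires. -/
theorem IsTransit.comp (hF : IsFinslerMetric F)
    (hf : ∀ e ∈ cosphere F, MDifferentiableAt cotModel 𝓘(ℝ, ℝ) f e) {a b d : ℝ}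
    (hab : a ≤ b) (hbd : b ≤ d) {e₁ e₂ e₃ : CotBundle S} {L L' : Mod →L[ℝ] Mod}
    (he : e₁ ∈ cosphere F)
    (h : IsTransit F f a b e₁ e₂ L) (h' : IsTransit F f b d e₂ e₃ L') :
    IsTransit F f a d e₁ e₃ (L'.comp L) := by
  obtain ⟨φ, h1, h2, h3⟩ := h
  obtain ⟨φ', h1', h2', h3'⟩ := h'
  subst h2
  set ψ : ℝ → CotBundle S → CotBundle S := fun t x =>
    if t ≤ b then φ t x else φ' t (φ b x) with hψ
  have htend : Tendsto (φ b) (𝓝[cosphere F] e₁) (𝓝[cosphere F] (φ b e₁)) := by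
    refine tendsto_nhdsWithin_iff.2 ⟨h3.continuousWithinAt, ?_⟩
    filter_upwards [h1] with x hx
    exact (hx.2 b (right_mem_Icc.2 hab)).1
  have hboth := h1.and (htend.eventually h1')
  have hψd : ∀ x, φ' b (φ b x) = φ b x → ψ d x = φ' d (φ b x) := by
    intro x hx
    by_cases hd : d ≤ b
    · obtain rfl : d = b := le_antisymm hd hbd
      simp only [hψ, le_refl, if_true, hx]
    · simp only [hψ, hd, if_false]
  have hψe : ψ d =ᶠ[𝓝[cosphere F] e₁] φ' d ∘ φ b := by
    filter_upwards [hboth] with x hx using hψd x hx.2.1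
  have hψ1 : ψ d e₁ = φ' d (φ b e₁) := hψe.self_of_nhdsWithin he
  refine ⟨ψ, ?_, hψ1.trans h2', ?_⟩
  · filter_upwards [hboth] with x hx
    refine ⟨by simp only [hψ, hab, if_true, hx.1.1], ?_⟩
    refine IsReebTrajectoryOn.union hF hf hab hbd (hx.1.2.congr fun t ht => ?_)
      (hx.2.2.congr fun t ht => ?_)
    · simp only [hψ, ht.2, if_true]
    · by_cases htb : t ≤ b
      · obtain rfl : t = b := le_antisymm htb ht.1
        simp only [hψ, le_refl, if_true, hx.2.1]
      · simp only [hψ, htb, if_false]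
  · have hm : HasMFDerivWithinAt cotModel cotModel (φ' d ∘ φ b) (cosphere F ∩ φ b ⁻¹' cosphere F) e₁
        (L'.comp L) :=
      HasMFDerivWithinAt.comp e₁ h3' (h3.mono inter_subset_left) inter_subset_right
    have hm2 : HasMFDerivWithinAt cotModel cotModel (φ' d ∘ φ b) (cosphere F) e₁ (L'.comp L) := by
      refine hm.mono_of_mem_nhdsWithin (Filter.inter_mem self_mem_nhdsWithin ?_)
      exact htend self_mem_nhdsWithin
    exact hm2.congr_of_eventuallyEq hψe hψ1

/-- The Reeb flow near a trajectory that stays in one chart. -/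
theorem isTransit_of_chart (hF : IsFinslerMetric F) {q₀ : S} {V : Set Mod} (hV : IsOpen V)
    (hVt : V ⊆ (cotChart q₀).target) (hVp : ∀ y ∈ V, y.2 ≠ 0)
    (hf : ∀ y ∈ V, ContDiffAt ℝ ∞ (coordFun q₀ f) y) {a b : ℝ} (hab : a ≤ b)
    {y : ℝ → Mod} (hyV : ∀ t ∈ Icc a b, y t ∈ V)
    (hy : ∀ t ∈ Icc a b, HasDerivWithinAt y
      (reebField (coordG F q₀) (coordFun q₀ f) (y t)) (Icc a b) t)
    {L : ℝ → Mod →L[ℝ] Mod} (hLa : L a = ContinuousLinearMap.id ℝ Mod)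
    (hL : ∀ t ∈ Icc a b, HasDerivWithinAt L
      ((fderiv ℝ (reebField (coordG F q₀) (coordFun q₀ f)) (y t)).comp (L t)) (Icc a b) t) :
    IsTransit F f a b ((cotChart q₀).symm (y a)) ((cotChart q₀).symm (y b))
      (((parD q₀ (y b)).comp (L b)).comp (chartD q₀ ((cotChart q₀).symm (y a)))) := by
  have hX : ContDiffOn ℝ 1 (reebField (coordG F q₀) (coordFun q₀ f)) V := fun z hz =>
    ((contDiffAt_reebField (contDiffAt_coordG hF (hVt hz) (hVp z hz)) (hf z hz)
      (coordG_pos hF (hVt hz) (hVp z hz)).ne').of_le (by simp)).contDiffWithinAt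
  obtain ⟨ψ, h1, h2, h3⟩ := exists_flow_near hV hX hab hyV hy hLa hL
  have ha : y a ∈ (cotChart q₀).target := hVt (hyV a (left_mem_Icc.2 hab))
  have hb : y b ∈ (cotChart q₀).target := hVt (hyV b (right_mem_Icc.2 hab))
  have hs := (cotChart q₀).map_target ha
  have hκ : Tendsto (cotChart q₀) (𝓝 ((cotChart q₀).symm (y a))) (𝓝 (y a)) := by
    have := (contMDiffAt_cotChart hs).continuousAt
    rwa [ContinuousAt, (cotChart q₀).right_inv ha] at this
  refine ⟨fun t x => (cotChart q₀).symm (ψ (cotChart q₀ x) t), ?_, ?_, ?_⟩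
  · have hev := (hκ.eventually h1).and ((isOpen_cotChart_source q₀).eventually_mem hs)
    filter_upwards [mem_nhdsWithin_of_mem_nhds hev, self_mem_nhdsWithin] with x ⟨⟨hx1, hx2⟩, hx3⟩ hx4
    refine ⟨by rw [hx1, (cotChart q₀).left_inv hx3], ?_⟩
    refine isReebTrajectoryOn_of_chart hF fun t ht => ?_
    obtain ⟨hv, hd⟩ := hx2 t ht
    refine ⟨hVt hv, ?_, ?_, hd⟩
    -- The field lives on an open set of the cotangent bundle. Its flow preserves the hypersurface
    -- because the field is tangent to all level sets of the dual metric.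
    · have hcont : ContinuousOn (fun u => coordG F q₀ (ψ (cotChart q₀ x) u)) (Icc a b) := by
        intro u hu
        exact (contDiffAt_coordG hF (hVt (hx2 u hu).1) (hVp _ (hx2 u hu).1)).continuousAt.comp_continuousWithinAt
          (hx2 u hu).2.continuousWithinAt
      have hder : ∀ u ∈ Ico a b, HasDerivWithinAt (fun u => coordG F q₀ (ψ (cotChart q₀ x) u)) 0
          (Ici u) u := by
        intro u hu
        have hu' := Ico_subset_Icc_self hu
        obtain ⟨hv, hd⟩ := hx2 u hu'
        have hGd := ((contDiffAt_coordG hF (hVt hv) (hVp _ hv)).differentiableAt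
          (by simp)).hasFDerivAt.comp_hasDerivWithinAt u hd
        rw [fderiv_reebField (coordG_pos hF (hVt hv) (hVp _ hv)).ne'
          (fderiv_coordG_eul hF (hVt hv) (hVp _ hv))] at hGd
        exact hGd.mono_of_mem_nhdsWithin (Icc_mem_nhdsGE_of_mem hu)
      rw [constant_of_has_deriv_right_zero hcont hder t ht, hx1]
      exact (coordFun_apply _ hx3).trans hx4
    · refine (contMDiffAt_of_coordFun le_rfl ((cotChart q₀).map_target (hVt hv)) ?_).mdifferentiableAt
        (by simp)
      rw [(cotChart q₀).right_inv (hVt hv)]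
      exact hf _ hv
  · simp only [(cotChart q₀).right_inv ha, h2]
  · have hm1 := hasMFDerivAt_cotChart hs
    have h3' : HasFDerivAt (fun x => ψ x b) (L b) (cotChart q₀ ((cotChart q₀).symm (y a))) := by
      rwa [(cotChart q₀).right_inv ha]
    have hm2 := h3'.hasMFDerivAt.comp _ hm1
    have hb' : ψ (cotChart q₀ ((cotChart q₀).symm (y a))) b = y b := by
      rw [(cotChart q₀).right_inv ha, h2]
    have hm3 : HasMFDerivAt 𝓘(ℝ, Mod) cotModel (cotChart q₀).symm
        (ψ (cotChart q₀ ((cotChart q₀).symm (y a))) b) (parD q₀ (y b)) := by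
      rw [hb']
      exact hasMFDerivAt_cotChart_symm hb
    exact (HasMFDerivAt.comp (g := (cotChart q₀).symm) (f := (fun x => ψ x b) ∘ cotChart q₀) _
      hm3 hm2).hasMFDerivWithinAt

end Transit

theorem eq_left_of_hasDerivWithinAt_zero {E : Type*} [NormedAddCommGroup E] [NormedSpace ℝ E]
    {g : ℝ → E} {a b : ℝ} (h : ∀ t ∈ Icc a b, HasDerivWithinAt g 0 (Icc a b) t) {t : ℝ}
    (ht : t ∈ Icc a b) : g t = g a :=
  constant_of_has_deriv_right_zero (fun u hu => (h u hu).continuousWithinAt)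
    (fun u hu => (h u (Ico_subset_Icc_self hu)).mono_of_mem_nhdsWithin
      (Icc_mem_nhdsGE_of_mem hu)) t ht

/-- The Duhamel integral `I` is kept behind linear functionals, in which form the symplectic pairing
will use it. -/
theorem exists_linear_flow_family {E : Type*} [NormedAddCommGroup E] [NormedSpace ℝ E]
    [FiniteDimensional ℝ E] {B₀ B₁ : ℝ → E →L[ℝ] E} (h₀ : Continuous B₀) (h₁ : Continuous B₁)
    {a b : ℝ} (hab : a ≤ b) :
    ∃ (W : ℝ → ℝ → E →L[ℝ] E) (V : ℝ → E →L[ℝ] E),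
      (∀ s, W s a = ContinuousLinearMap.id ℝ E) ∧
      (∀ s t, HasDerivAt (W s) ((B₀ t + s • B₁ t).comp (W s t)) t) ∧
      (∀ t X, W 0 t (V t X) = X) ∧ ((∀ t, B₁ t = 0) → ∀ s, W s = W 0) ∧
      ∃ I : E →L[ℝ] E, HasDerivAt (fun s => W s b) ((W 0 b).comp I) 0 ∧
        ∀ (T : E →L[ℝ] ℝ) X, T (I X) = ∫ t in a..b, T (V t (B₁ t (W 0 t X))) := by
  have hex : ∀ s : ℝ, ∃ W V : ℝ → E →L[ℝ] E, W a = 1 ∧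
      (∀ t, HasDerivAt W ((B₀ t + s • B₁ t) * W t) t) ∧ Continuous V ∧
      (∀ t, V t * W t = 1) ∧ ∀ t, W t * V t = 1 := fun s =>
    exists_fundamental (fun t => B₀ t + s • B₁ t) (h₀.add (h₁.const_smul s)) a
  choose W' V' hWa' hW' hVc' hVW' hWV' using hex
  classical
  -- Solutions are chosen separately for each `s`. When `B₁` vanishes identically the same choice is
  -- used for every `s`, so that the family is literally constant.
  set c : ℝ → ℝ := fun s => if ∀ t, B₁ t = 0 then 0 else s with hcdef
  set W : ℝ → ℝ → E →L[ℝ] E := fun s => W' (c s) with hWdef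
  set V : ℝ → ℝ → E →L[ℝ] E := fun s => V' (c s) with hVdef
  have hWa : ∀ s, W s a = 1 := fun s => hWa' _
  have hW : ∀ s t, HasDerivAt (W s) ((B₀ t + s • B₁ t) * W s t) t := by
    intro s t
    have h := hW' (c s) t
    by_cases h0 : ∀ t, B₁ t = 0
    · rw [h0 t, smul_zero] at h ⊢
      exact h
    · have : c s = s := by simp only [hcdef, h0, if_false]
      rw [this] at h
      simpa only [hWdef, this] using h
  have hVc : ∀ s, Continuous (V s) := fun s => hVc' _
  have hVW : ∀ s t, V s t * W s t = 1 := fun s => hVW' _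
  have hWV : ∀ s t, W s t * V s t = 1 := fun s => hWV' _
  have hW0 : (∀ t, B₁ t = 0) → ∀ s, W s = W 0 := by
    intro h0 s
    simp only [hWdef, hcdef, h0, implies_true, if_true]
  have hW0c : Continuous (W 0) := continuous_iff_continuousAt.2 fun t => (hW 0 t).continuousAt
  have hc : Continuous fun t => V 0 t * B₁ t * W 0 t := ((hVc 0).mul h₁).mul hW0c
  refine ⟨W, V 0, hWa, hW, fun t X => congrArg (fun L : E →L[ℝ] E => L X) (hWV 0 t), hW0, _,
    hasDerivAt_linear_ode_param B₀ B₁ h₁ hab W hWa hW (V 0) (hVW 0) (hWV 0) (hVc 0), ?_⟩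
  intro T X
  have := FiniteDimensional.complete ℝ E
  exact ((T.comp (ContinuousLinearMap.apply ℝ E X)).intervalIntegral_comp_comm
    (hc.intervalIntegrable a b)).symm

/-! ### The linearized Reeb flow along an orbit in coordinates. -/

section CoordOrbit

attribute [local instance] continuousSMul_mod modDualNACG modDualNS modDualACG modDualACM
  modDualModule modDualTop modEndNACG modEndNS modDualDualNACG modDualDualNS

/-- A trajectory of the Reeb field of `p dq` in coordinates on the interval `[a, b]`, extended
arbitrarily. -/
structure IsCoordOrbit (G : Mod → ℝ) (y : ℝ → Mod) (a b : ℝ) : Prop where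
  continuous : Continuous y
  smooth : ∀ t, ContDiffAt ℝ ∞ G (y t)
  unit : ∀ t, G (y t) = 1
  euler : ∀ t, ∀ᶠ z in 𝓝 (y t), fderiv ℝ G z (eul z) = G z
  deriv : ∀ t ∈ Icc a b, HasDerivWithinAt y (reebField₀ G (y t)) (Icc a b) t

/-- A function that vanishes to first order along a curve. -/
structure IsCoordPert (h : Mod → ℝ) (y : ℝ → Mod) : Prop where
  smooth : ∀ t, ContDiffAt ℝ ∞ h (y t)
  zero : ∀ t, h (y t) = 0
  deriv_zero : ∀ t, fderiv ℝ h (y t) = 0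

/-- The contact plane in coordinates. -/
structure IsContactVector (G : Mod → ℝ) (y Z : Mod) : Prop where
  tangent : fderiv ℝ G y Z = 0
  kernel : lam y Z = 0

/-- The linearization of the Reeb field of `p dq` along a curve. -/
def linB₀ (G : Mod → ℝ) (y : ℝ → Mod) (t : ℝ) : Mod →L[ℝ] Mod :=
  fderiv ℝ (reebField₀ G) (y t)

/-- The contribution of a perturbation to the linearization of the Reeb field. -/
def linB₁ (G h : Mod → ℝ) (y : ℝ → Mod) (t : ℝ) : Mod →L[ℝ] Mod :=
  fderiv ℝ (reebField G h) (y t) - linB₀ G y t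

variable {G h : Mod → ℝ} {y : ℝ → Mod} {a b : ℝ}

theorem reebCorrection_smul (G : Mod → ℝ) (y : Mod) (s : ℝ) (η : Mod →L[ℝ] ℝ) :
    reebCorrection G y (s • η) = s • reebCorrection G y η := by
  simp only [reebCorrection, map_smul, smul_apply, smul_eq_mul]
  module

namespace IsCoordOrbit

variable (hG : IsCoordOrbit G y a b)

include hG

theorem ne_zero (t : ℝ) : G (y t) ≠ 0 := by
  rw [hG.unit]
  exact one_ne_zero

theorem euler_self (t : ℝ) : fderiv ℝ G (y t) (eul (y t)) = G (y t) := (hG.euler t).self_of_nhds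

theorem continuous_linB₀ : Continuous (linB₀ G y) := by
  refine continuous_iff_continuousAt.2 fun t => ?_
  have h1 : ContinuousAt (fderiv ℝ (reebField₀ G)) (y t) :=
    ((contDiffAt_reebField₀ (hG.smooth t) (hG.ne_zero t)).fderiv_right (m := ∞)
      (by simp)).continuousAt
  exact h1.comp hG.continuous.continuousAt

theorem continuous_linB₁ (hh : IsCoordPert h y) : Continuous (linB₁ G h y) := by
  refine Continuous.sub ?_ hG.continuous_linB₀
  refine continuous_iff_continuousAt.2 fun t => ?_
  have h1 : ContinuousAt (fderiv ℝ (reebField G h)) (y t) :=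
    ((contDiffAt_reebField (hG.smooth t) (hh.smooth t) (hG.ne_zero t)).fderiv_right (m := ∞)
      (by simp)).continuousAt
  exact h1.comp hG.continuous.continuousAt

theorem linB₁_apply (hh : IsCoordPert h y) (t : ℝ) (Z : Mod) :
    linB₁ G h y t Z = reebCorrection G (y t) (fderiv ℝ (fderiv ℝ h) (y t) Z) := by
  rw [linB₁, sub_apply, fderiv_reebField_apply (hG.smooth t) (hh.smooth t)
    (hG.ne_zero t) (hh.zero t) (hh.deriv_zero t), linB₀, add_sub_cancel_left]

/-- The linearization of the perturbed Reeb field. -/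
theorem fderiv_reebField_eq (hh : IsCoordPert h y) {f : Mod → ℝ} {s t : ℝ}
    (hf : ContDiffAt ℝ ∞ f (y t)) (h0 : f (y t) = 0) (h1 : fderiv ℝ f (y t) = 0)
    (h2 : fderiv ℝ (fderiv ℝ f) (y t) = s • fderiv ℝ (fderiv ℝ h) (y t)) :
    fderiv ℝ (reebField G f) (y t) = linB₀ G y t + s • linB₁ G h y t := by
  refine ContinuousLinearMap.ext fun Z => ?_
  rw [fderiv_reebField_apply (hG.smooth t) hf (hG.ne_zero t) h0 h1, h2,
    add_apply, smul_apply, smul_apply, hG.linB₁_apply hh, reebCorrection_smul, linB₀]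

theorem isContactVector_linB₁ (hh : IsCoordPert h y) (t : ℝ) (Z : Mod) :
    IsContactVector G (y t) (linB₁ G h y t Z) := by
  rw [hG.linB₁_apply hh]
  exact ⟨fderiv_reebCorrection (hG.ne_zero t) (hG.euler_self t) _,
    lam_reebCorrection (hG.ne_zero t) (hG.euler_self t) _⟩

/-- Of the three terms of the Reeb correction, the two along the radial and the Hamiltonian vector
pair to zero with a contact vector. This identity brings the Hessian of `h` into the derivative of
the return map. -/
theorem symp_linB₁ (hh : IsCoordPert h y) (t : ℝ) (Z : Mod) {W : Mod}
    (hW : IsContactVector G (y t) W) :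
    symp (linB₁ G h y t Z) W = fderiv ℝ (fderiv ℝ h) (y t) Z W := by
  rw [hG.linB₁_apply hh]
  exact symp_reebCorrection _ hW.tangent hW.kernel

theorem hasFDerivAt_fderiv (t : ℝ) :
    HasFDerivAt (fderiv ℝ G) (fderiv ℝ (fderiv ℝ G) (y t)) (y t) :=
  (((hG.smooth t).fderiv_right (m := ∞) (by simp)).differentiableAt (by simp)).hasFDerivAt

theorem hasFDerivAt_reebField₀ (t : ℝ) :
    HasFDerivAt (reebField₀ G) (linB₀ G y t) (y t) :=
  ((contDiffAt_reebField₀ (hG.smooth t) (hG.ne_zero t)).differentiableAt (by simp)).hasFDerivAt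

/-- Obtained by differentiating the identity `dG(X) = 0` for the Reeb field `X`; `lam_linB₀`
differentiates `λ(X) = 1` in the same way. -/
theorem fderiv_linB₀ (t : ℝ) (Z : Mod) : fderiv ℝ G (y t) (linB₀ G y t Z) =
    -fderiv ℝ (fderiv ℝ G) (y t) Z (reebField₀ G (y t)) := by
  have h1 : HasFDerivAt (fun z => fderiv ℝ G z (reebField₀ G z)) _ (y t) :=
    (hG.hasFDerivAt_fderiv t).clm_apply (hG.hasFDerivAt_reebField₀ t)
  have h2 : (fun z => fderiv ℝ G z (reebField₀ G z)) = fun _ => (0 : ℝ) := by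
    funext z
    simp only [reebField₀, map_smul, apply_sharp_self, smul_zero]
  rw [h2] at h1
  have h3 := congrArg (fun L : Mod →L[ℝ] ℝ => L Z) (h1.unique (hasFDerivAt_const 0 (y t)))
  simp at h3
  linarith

theorem lam_linB₀ (t : ℝ) (Z : Mod) :
    lam (y t) (linB₀ G y t Z) = -lam Z (reebField₀ G (y t)) := by
  have h1 : HasFDerivAt (fun z => lam z (reebField₀ G z)) _ (y t) :=
    (lam.hasFDerivAt).clm_apply (hG.hasFDerivAt_reebField₀ t)
  have hne : ∀ᶠ z in 𝓝 (y t), G z ≠ 0 := (hG.smooth t).continuousAt.eventually_ne (hG.ne_zero t)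
  have h2 : (fun z => lam z (reebField₀ G z)) =ᶠ[𝓝 (y t)] fun _ => (1 : ℝ) := by
    filter_upwards [hG.euler t, hne] with z hz hz'
    rw [reebField₀, map_smul, lam_sharp, hz, smul_eq_mul, inv_mul_cancel₀ hz']
  have h3 := congrArg (fun L : Mod →L[ℝ] ℝ => L Z)
    (h1.unique ((hasFDerivAt_const (1 : ℝ) (y t)).congr_of_eventuallyEq h2))
  simp at h3
  simp only [lam_apply]
  linarith

theorem fderiv_fderiv_comm (t : ℝ) (Z W : Mod) : fderiv ℝ (fderiv ℝ G) (y t) Z W =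
    fderiv ℝ (fderiv ℝ G) (y t) W Z :=
  ((hG.smooth t).of_le two_le_infty).isSymmSndFDerivAt (by simp) Z W

/-- The properties of the solutions of the linearized equation. -/
theorem fderiv_eq (hh : IsCoordPert h y) {s : ℝ} {Z : ℝ → Mod}
    (hZ : ∀ t ∈ Icc a b, HasDerivWithinAt Z ((linB₀ G y t + s • linB₁ G h y t) (Z t)) (Icc a b) t)
    {t : ℝ} (ht : t ∈ Icc a b) : fderiv ℝ G (y t) (Z t) = fderiv ℝ G (y a) (Z a) := by
  refine eq_left_of_hasDerivWithinAt_zero (g := fun t => fderiv ℝ G (y t) (Z t))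
    (fun t ht => ?_) ht
  have h1 : HasDerivWithinAt (fun t => fderiv ℝ G (y t))
      (fderiv ℝ (fderiv ℝ G) (y t) (reebField₀ G (y t))) (Icc a b) t :=
    (hG.hasFDerivAt_fderiv t).comp_hasDerivWithinAt t (hG.deriv t ht)
  refine (h1.clm_apply (hZ t ht)).congr_deriv ?_
  rw [add_apply, smul_apply, map_add, map_smul, hG.fderiv_linB₀,
    (hG.isContactVector_linB₁ hh t (Z t)).tangent, hG.fderiv_fderiv_comm t (Z t)]
  simp

theorem lam_eq (hh : IsCoordPert h y) {s : ℝ} {Z : ℝ → Mod}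
    (hZ : ∀ t ∈ Icc a b, HasDerivWithinAt Z ((linB₀ G y t + s • linB₁ G h y t) (Z t)) (Icc a b) t)
    (hZa : fderiv ℝ G (y a) (Z a) = 0) {t : ℝ} (ht : t ∈ Icc a b) :
    lam (y t) (Z t) = lam (y a) (Z a) := by
  refine eq_left_of_hasDerivWithinAt_zero (g := fun t => lam (y t) (Z t)) (fun t ht => ?_) ht
  have h1 : HasDerivWithinAt (fun t => lam (y t)) (lam (reebField₀ G (y t))) (Icc a b) t :=
    lam.hasFDerivAt.comp_hasDerivWithinAt t (hG.deriv t ht)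
  refine (h1.clm_apply (hZ t ht)).congr_deriv ?_
  have h2 : symp (reebField₀ G (y t)) (Z t) = 0 := by
    rw [reebField₀, symp_smul_left, symp_sharp, hG.fderiv_eq hh hZ ht, hZa]
    simp
  have h3 : lam (reebField₀ G (y t)) (Z t) - lam (Z t) (reebField₀ G (y t)) = 0 := h2
  rw [add_apply, smul_apply, map_add, map_smul, hG.lam_linB₀,
    (hG.isContactVector_linB₁ hh t (Z t)).kernel, smul_zero, add_zero]
  linarith

theorem isContactVector_of_ode (hh : IsCoordPert h y) {s : ℝ} {Z : ℝ → Mod}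
    (hZ : ∀ t ∈ Icc a b, HasDerivWithinAt Z ((linB₀ G y t + s • linB₁ G h y t) (Z t)) (Icc a b) t)
    (hZa : IsContactVector G (y a) (Z a)) {t : ℝ} (ht : t ∈ Icc a b) :
    IsContactVector G (y t) (Z t) :=
  ⟨(hG.fderiv_eq hh hZ ht).trans hZa.tangent, (hG.lam_eq hh hZ hZa.tangent ht).trans hZa.kernel⟩

/-- On contact vectors the coefficient matrix is Hamiltonian: its symplectic pairings are the
Hessians of `G` and of `h`, and their symmetry cancels the two terms of the derivative. -/
theorem symp_eq (hh : IsCoordPert h y) {s : ℝ} {Z W : ℝ → Mod}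
    (hZ : ∀ t ∈ Icc a b, HasDerivWithinAt Z ((linB₀ G y t + s • linB₁ G h y t) (Z t)) (Icc a b) t)
    (hW : ∀ t ∈ Icc a b, HasDerivWithinAt W ((linB₀ G y t + s • linB₁ G h y t) (W t)) (Icc a b) t)
    (hZa : IsContactVector G (y a) (Z a)) (hWa : IsContactVector G (y a) (W a)) {t : ℝ}
    (ht : t ∈ Icc a b) : symp (Z t) (W t) = symp (Z a) (W a) := by
  refine eq_left_of_hasDerivWithinAt_zero (g := fun t => symp (Z t) (W t)) (fun t ht => ?_) ht
  have hZt := hG.isContactVector_of_ode hh hZ hZa ht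
  have hWt := hG.isContactVector_of_ode hh hW hWa ht
  refine ((hZ t ht).symp (hW t ht)).congr_deriv ?_
  have hsym : fderiv ℝ (fderiv ℝ h) (y t) (Z t) (W t) = fderiv ℝ (fderiv ℝ h) (y t) (W t) (Z t) :=
    ((hh.smooth t).of_le two_le_infty).isSymmSndFDerivAt (by simp) _ _
  rw [symp_swap (Z t)]
  simp only [add_apply, smul_apply, symp_add_left,
    symp_smul_left, hG.symp_linB₁ hh t _ hZt, hG.symp_linB₁ hh t _ hWt]
  rw [linB₀, symp_fderiv_reebField₀ (hG.smooth t) (hG.unit t) hWt.tangent,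
    symp_fderiv_reebField₀ (hG.smooth t) (hG.unit t) hZt.tangent, hsym,
    hG.fderiv_fderiv_comm t (Z t)]
  ring

end IsCoordOrbit

/-- A family of solutions of the linearized equations for the perturbations `s h`. -/
structure IsLinearFlow (G h : Mod → ℝ) (y : ℝ → Mod) (a b : ℝ)
    (L : ℝ → ℝ → Mod →L[ℝ] Mod) : Prop where
  initial : ∀ s, L s a = ContinuousLinearMap.id ℝ Mod
  deriv : ∀ s, ∀ t ∈ Icc a b, HasDerivWithinAt (L s)
    ((linB₀ G y t + s • linB₁ G h y t).comp (L s t)) (Icc a b) t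

theorem IsLinearFlow.apply {L : ℝ → ℝ → Mod →L[ℝ] Mod} (hL : IsLinearFlow G h y a b L) (s : ℝ)
    (X : Mod) : ∀ t ∈ Icc a b, HasDerivWithinAt (fun t => L s t X)
      ((linB₀ G y t + s • linB₁ G h y t) (L s t X)) (Icc a b) t := by
  intro t ht
  exact ((ContinuousLinearMap.apply ℝ Mod X).hasFDerivAt.comp_hasDerivWithinAt t (hL.deriv s t ht))

/-- The linearized flows, and the derivative with respect to the size of the perturbation. -/
theorem IsCoordOrbit.exists_linearFlow (hG : IsCoordOrbit G y a b) (hh : IsCoordPert h y)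
    (hab : a ≤ b) : ∃ L : ℝ → ℝ → Mod →L[ℝ] Mod, IsLinearFlow G h y a b L ∧
      ((∀ t, linB₁ G h y t = 0) → ∀ s, L s = L 0) ∧
      ∃ D : Mod →L[ℝ] Mod, HasDerivAt (fun s => L s b) D 0 ∧
        ∀ X Y, IsContactVector G (y a) X → IsContactVector G (y a) Y →
          symp (D X) (L 0 b Y) =
            ∫ t in a..b, fderiv ℝ (fderiv ℝ h) (y t) (L 0 t X) (L 0 t Y) := by
  obtain ⟨W, V, hWa, hW, hWV, hW0, I, hI, hfun⟩ :=
    exists_linear_flow_family hG.continuous_linB₀ (hG.continuous_linB₁ hh) hab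
  have hL : IsLinearFlow G h y a b W := ⟨hWa, fun s t _ => (hW s t).hasDerivWithinAt⟩
  refine ⟨W, hL, hW0, _, hI, ?_⟩
  intro X Y hX hY
  -- The conservation laws, read from `t` back to `a`: the inverse flow maps contact vectors to
  -- contact vectors and is the symplectic adjoint of the flow.
  have hVT : ∀ t ∈ Icc a b, ∀ Z, IsContactVector G (y t) Z →
      IsContactVector G (y a) (V t Z) ∧ ∀ Y, IsContactVector G (y a) Y →
        symp (V t Z) Y = symp Z (W 0 t Y) := by
    intro t ht Z hZ
    have hWVZ : W 0 t (V t Z) = Z := hWV t Z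
    have hid : ∀ U, W 0 a U = U := fun U => by rw [hWa]; rfl
    have h1 : fderiv ℝ G (y a) (V t Z) = 0 := by
      have := hG.fderiv_eq hh (hL.apply 0 (V t Z)) ht
      rw [hWVZ, hid, hZ.tangent] at this
      exact this.symm
    have h2 : lam (y a) (V t Z) = 0 := by
      have := hG.lam_eq hh (hL.apply 0 (V t Z)) (by rwa [hid]) ht
      rw [hWVZ, hid, hZ.kernel] at this
      exact this.symm
    refine ⟨⟨h1, h2⟩, fun Y hY => ?_⟩
    have := hG.symp_eq hh (hL.apply 0 (V t Z)) (hL.apply 0 Y) (by rw [hid]; exact ⟨h1, h2⟩)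
      (by rwa [hid]) ht
    rw [hWVZ, hid, hid] at this
    exact this.symm
  have huI : ∀ t ∈ uIcc a b, t ∈ Icc a b := fun t ht => by rwa [uIcc_of_le hab] at ht
  -- The integrand of the Duhamel integral takes values in the contact plane at `y a`, so the
  -- integral does too, and the flow preserves its pairing with `Y`.
  have hIX : IsContactVector G (y a) (I X) := by
    constructor
    · rw [hfun, intervalIntegral.integral_congr (g := fun _ => (0 : ℝ))
        fun t ht => (hVT t (huI t ht) _ (hG.isContactVector_linB₁ hh t _)).1.tangent]
      simp
    · rw [hfun, intervalIntegral.integral_congr (g := fun _ => (0 : ℝ))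
        fun t ht => (hVT t (huI t ht) _ (hG.isContactVector_linB₁ hh t _)).1.kernel]
      simp
  have hid : ∀ U, W 0 a U = U := fun U => by rw [hWa]; rfl
  have h1 : symp (W 0 b (I X)) (W 0 b Y) = symp (I X) Y := by
    have := hG.symp_eq hh (hL.apply 0 (I X)) (hL.apply 0 Y) (by rwa [hid]) (by rwa [hid])
      (right_mem_Icc.2 hab)
    rwa [hid, hid] at this
  change symp (W 0 b (I X)) (W 0 b Y) = _
  set T : Mod →L[ℝ] ℝ := (ContinuousLinearMap.apply ℝ ℝ Y.1).comp
      (ContinuousLinearMap.snd ℝ Plane (Plane →L[ℝ] ℝ)) -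
    Y.2.comp (ContinuousLinearMap.fst ℝ Plane (Plane →L[ℝ] ℝ)) with hT
  have hTs : ∀ Z, T Z = symp Z Y := fun Z => rfl
  rw [h1, ← hTs, hfun]
  refine intervalIntegral.integral_congr fun t ht => ?_
  have h2 := (hVT t (huI t ht) _ (hG.isContactVector_linB₁ hh t (W 0 t X))).2 Y hY
  have h3 : IsContactVector G (y t) (W 0 t Y) :=
    hG.isContactVector_of_ode hh (hL.apply 0 Y) (by rwa [hid]) (huI t ht)
  exact (hTs _).trans (h2.trans (hG.symp_linB₁ hh t _ h3))

end CoordOrbit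

/-! ### Linearized flows of the perturbed Reeb fields along the geodesic. -/

section Family

attribute [local instance] cotTopology cotChartedSpace cot_isManifold cot_isManifold_one
  continuousSMul_mod modDualNACG modDualNS modDualACG modDualACM
  modDualModule modDualTop modEndNACG modEndNS modDualDualNACG modDualDualNS

variable {S : Type*} [TopologicalSpace S] [ChartedSpace Plane S] [IsManifold (𝓡 2) ∞ S]
  {F : TangentBundle (𝓡 2) S → ℝ} {σ : ℝ → S} {l : ℝ} {W : Set S}
  {A : (q : S) → LinearMap.BilinForm ℝ (Cot q)}

/-- Membership in the contact plane. -/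
def IsContact (F : TangentBundle (𝓡 2) S → ℝ) (e : CotBundle S) (X : Mod) : Prop :=
  (X : TangentSpace cotModel e) ∈ contactPlane F e

theorem isContact_iff (hF : IsFinslerMetric F) {q₀ : S} {e : CotBundle S}
    (he : e ∈ (cotChart q₀).source) (hp : e ∈ cosphere F) (X : Mod) :
    IsContact F e X ↔ IsContactVector (coordG F q₀) (cotChart q₀ e) (chartD q₀ e X) := by
  have h1 := mem_cosphereTangent_iff hF he (covec_ne_zero hF hp) X
  have h2 := liouville_chartD he X
  constructor
  · rintro ⟨h3, h4⟩
    exact ⟨h1.1 h3, h2.symm.trans h4⟩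
  · rintro ⟨h3, h4⟩
    exact ⟨h1.2 h3, h2.trans h4⟩

/-- The perturbed fields thus have the same orbit `γ`, and only their linearizations along it
differ. -/
theorem reebField_eq_of_zero {G f : Mod → ℝ} {y : Mod} (h0 : f y = 0) (h1 : fderiv ℝ f y = 0) :
    reebField G f y = reebField₀ G y := by
  simp [reebField, h0, h1, reebCorrection]

/-- The lift of a curve in a chart, on an interval, extended by constants. -/
def coordLift (F : TangentBundle (𝓡 2) S → ℝ) (σ : ℝ → S) (q₀ : S) {a b : ℝ} (hab : a ≤ b)
    (t : ℝ) : Mod := cotChart q₀ (lift F σ (projIcc a b hab t))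

theorem coordLift_of_mem {q₀ : S} {a b : ℝ} (hab : a ≤ b) {t : ℝ} (ht : t ∈ Icc a b) :
    coordLift F σ q₀ hab t = cotChart q₀ (lift F σ t) := by
  rw [coordLift, projIcc_of_mem hab ht]

variable {q₀ : S} {a b : ℝ}

theorem IsClosedGeodesic.isCoordOrbit (hF : IsFinslerMetric F) (hσ : IsClosedGeodesic F σ l)
    (hab : a ≤ b) (hsrc : ∀ t ∈ Icc a b, σ t ∈ (extChartAt (𝓡 2) q₀).source) :
    IsCoordOrbit (coordG F q₀) (coordLift F σ q₀ hab) a b := by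
  have hs : ∀ t, lift F σ (projIcc a b hab t) ∈ (cotChart q₀).source := fun t =>
    mem_cotChart_lift.2 (hsrc _ (projIcc a b hab t).2)
  have ht : ∀ t, coordLift F σ q₀ hab t ∈ (cotChart q₀).target := fun t =>
    (cotChart q₀).map_source (hs t)
  have hp : ∀ t, (coordLift F σ q₀ hab t).2 ≠ 0 := fun t =>
    snd_cotChart_ne_zero (hs t) (covec_ne_zero hF (hσ.lift_mem hF _))
  refine ⟨?_, fun t => contDiffAt_coordG hF (ht t) (hp t),
    fun t => (coordFun_apply _ (hs t)).trans (hσ.lift_mem hF _), fun t => ?_, fun t hab' => ?_⟩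
  · have h1 : ContinuousOn (fun t => cotChart q₀ (lift F σ t)) (Icc a b) := fun t ht =>
      (hσ.contDiffAt_cotChart_lift hF (hsrc t ht)).continuousAt.continuousWithinAt
    exact (continuousOn_iff_continuous_domRestrict.1 h1).comp continuous_projIcc
  · filter_upwards [(isOpen_cotChart_target q₀).mem_nhds (ht t),
      continuous_snd.continuousAt.eventually_ne (hp t)] with z hz hz'
    exact fderiv_coordG_eul hF hz hz'
  · have hf : IsReebTrajectoryOn F (fun _ => 0) (lift F σ) univ :=
      hσ.isReebTrajectoryOn_lift hF (fun t => mdifferentiableAt_const) (fun _ => rfl)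
        fun t X _ => by
          have : cotD (fun _ : CotBundle S => (0 : ℝ)) (lift F σ t) = 0 := mfderiv_const
          rw [this]
          rfl
    have h1 := hf.chart hF (mem_univ t) (mem_cotChart_lift.2 (hsrc t hab')) mdifferentiableAt_const
    have h2 : coordFun q₀ (fun _ : CotBundle S => (0 : ℝ)) = fun _ => 0 := rfl
    rw [h2, reebField_eq_of_zero rfl (fderiv_const_apply (0 : ℝ))] at h1
    rw [coordLift_of_mem hab hab']
    exact (h1.mono (subset_univ _)).congr (fun u hu => coordLift_of_mem hab hu)
      (coordLift_of_mem hab hab')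

theorem coordFun_pertVelocity (q₀ : S) :
    coordFun q₀ (pertVelocity A) = fun y => -(1 / 2) * coordFun q₀ (quad A) y := rfl

theorem contDiffAt_coordFun_quad {n : WithTop ℕ∞} (hn : n ≤ ∞)
    (hA : ContMDiff cotModel 𝓘(ℝ, ℝ) ∞ (quad A)) {y : Mod}
    (hy : y ∈ (cotChart q₀).target) : ContDiffAt ℝ n (coordFun q₀ (quad A)) y :=
  (contDiffAt_coordFun le_rfl hy (hA _)).of_le hn

theorem fderiv_coordFun_pertVelocity (hA : ContMDiff cotModel 𝓘(ℝ, ℝ) ∞ (quad A)) {y : Mod}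
    (hy : y ∈ (cotChart q₀).target) : fderiv ℝ (coordFun q₀ (pertVelocity A)) y =
      (-(1 / 2) : ℝ) • fderiv ℝ (coordFun q₀ (quad A)) y := by
  rw [coordFun_pertVelocity]
  exact ((contDiffAt_coordFun_quad le_rfl hA hy).differentiableAt (by simp)).hasFDerivAt.const_mul
    _ |>.fderiv

theorem fderiv_fderiv_coordFun_pertVelocity (hA : ContMDiff cotModel 𝓘(ℝ, ℝ) ∞ (quad A)) {y : Mod}
    (hy : y ∈ (cotChart q₀).target) : fderiv ℝ (fderiv ℝ (coordFun q₀ (pertVelocity A))) y =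
      (-(1 / 2) : ℝ) • fderiv ℝ (fderiv ℝ (coordFun q₀ (quad A))) y := by
  have h1 : fderiv ℝ (coordFun q₀ (pertVelocity A)) =ᶠ[𝓝 y]
      fun z => (-(1 / 2) : ℝ) • fderiv ℝ (coordFun q₀ (quad A)) z := by
    filter_upwards [(isOpen_cotChart_target q₀).mem_nhds hy] with z hz
    exact fderiv_coordFun_pertVelocity hA hz
  have h2 : HasFDerivAt (fderiv ℝ (coordFun q₀ (quad A)))
      (fderiv ℝ (fderiv ℝ (coordFun q₀ (quad A))) y) y :=
    (((contDiffAt_coordFun_quad le_rfl hA hy).fderiv_right (m := ∞) (by simp)).differentiableAt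
      (by simp)).hasFDerivAt
  rw [h1.fderiv_eq]
  exact (h2.const_smul (-(1 / 2) : ℝ)).fderiv

theorem IsAdmissible.isCoordPert [CompactSpace S] (hF : IsFinslerMetric F)
    (hσ : IsClosedGeodesic F σ l) (hA : IsAdmissible F (lift F σ) W A) (hab : a ≤ b)
    (hsrc : ∀ t ∈ Icc a b, σ t ∈ (extChartAt (𝓡 2) q₀).source) :
    IsCoordPert (coordFun q₀ (pertVelocity A)) (coordLift F σ q₀ hab) := by
  have ht : ∀ t, coordLift F σ q₀ hab t ∈ (cotChart q₀).target := fun t =>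
    (cotChart q₀).map_source (mem_cotChart_lift.2 (hsrc _ (projIcc a b hab t).2))
  have h0 := fun t => hA.coordFun_quad_eq_zero hF hσ (hsrc _ (projIcc a b hab t).2)
  refine ⟨fun t => ?_, fun t => ?_, fun t => ?_⟩
  · exact contDiffAt_const.mul (contDiffAt_coordFun_quad le_rfl hA.smooth (ht t))
  · change -(1 / 2) * coordFun q₀ (quad A) (coordLift F σ q₀ hab t) = 0
    rw [coordLift, (h0 t).1, mul_zero]
  · rw [fderiv_coordFun_pertVelocity hA.smooth (ht t), coordLift, (h0 t).2, smul_zero]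

/-- Along the orbit `f_s` and its differential vanish and its Hessian is `s` times that of `h`, so
the linearized equation in `hL` is the variational equation of the perturbed Reeb field, whatever
the value of `s`. The set `V` is where the logarithm and the dual metric are smooth. -/
theorem IsAdmissible.isTransit_of_linearFlow [CompactSpace S] (hF : IsFinslerMetric F)
    (hσ : IsClosedGeodesic F σ l) (hA : IsAdmissible F (lift F σ) W A) (hab : a ≤ b)
    (hsrc : ∀ t ∈ Icc a b, σ t ∈ (extChartAt (𝓡 2) q₀).source) {L : ℝ → ℝ → Mod →L[ℝ] Mod}
    (hL : IsLinearFlow (coordG F q₀) (coordFun q₀ (pertVelocity A)) (coordLift F σ q₀ hab) a b L)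
    (s : ℝ) :
    IsTransit F (pert A s) a b (lift F σ a) (lift F σ b)
      (((parD q₀ (cotChart q₀ (lift F σ b))).comp (L s b)).comp (chartD q₀ (lift F σ a))) := by
  have hG := hσ.isCoordOrbit hF hab hsrc
  have hh := hA.isCoordPert hF hσ hab hsrc
  set y := coordLift F σ q₀ hab with hy
  have hst : ∀ t ∈ Icc a b, lift F σ t ∈ (cotChart q₀).source := fun t ht =>
    mem_cotChart_lift.2 (hsrc t ht)
  have hyt : ∀ t, y t ∈ (cotChart q₀).target := fun t =>
    (cotChart q₀).map_source (hst _ (projIcc a b hab t).2)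
  have h0 := fun t => hA.coordFun_quad_eq_zero hF hσ (hsrc _ (projIcc a b hab t).2)
  set V : Set Mod := {z | (z ∈ (cotChart q₀).target ∧ z.2 ≠ 0) ∧
    0 < 1 + s * coordFun q₀ (quad A) z} with hV
  have hVo : IsOpen V := by
    rw [isOpen_iff_mem_nhds]
    rintro z ⟨⟨h1, h2⟩, h3⟩
    have h4 := (contDiffAt_coordFun_quad (n := 1) (by simp) hA.smooth h1).continuousAt
    have h5 : ContinuousAt (fun z => 1 + s * coordFun q₀ (quad A) z) z := by fun_prop
    filter_upwards [(isOpen_cotChart_target q₀).mem_nhds h1,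
      continuous_snd.continuousAt.eventually_ne h2, h5.eventually_const_lt h3] with w hw hw' hw''
    exact ⟨⟨hw, hw'⟩, hw''⟩
  have hf : ∀ z ∈ V, ContDiffAt ℝ ∞ (coordFun q₀ (pert A s)) z := fun z hz => by
    rw [coordFun_pert]
    exact contDiffAt_coordPert (contDiffAt_coordFun_quad le_rfl hA.smooth hz.1.1) hz.2
  have hyV : ∀ t, y t ∈ V := fun t =>
    ⟨⟨hyt t, snd_ne_zero_of_coordG hF (hyt t) (hG.unit t)⟩, by rw [hy, coordLift, (h0 t).1]; simp⟩
  have hf0 : ∀ t, coordFun q₀ (pert A s) (y t) = 0 := fun t => by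
    rw [coordFun_pert, coordPert, hy, coordLift, (h0 t).1]
    simp
  have hf1 : ∀ t, fderiv ℝ (coordFun q₀ (pert A s)) (y t) = 0 := fun t => by
    rw [coordFun_pert, (hasFDerivAt_coordPert ((contDiffAt_coordFun_quad le_rfl hA.smooth
      (hyt t)).differentiableAt (by simp)) (hyV t).2).fderiv, hy, coordLift, (h0 t).2, smul_zero]
  have hf2 : ∀ t, fderiv ℝ (fderiv ℝ (coordFun q₀ (pert A s))) (y t) =
      s • fderiv ℝ (fderiv ℝ (coordFun q₀ (pertVelocity A))) (y t) := fun t => by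
    rw [coordFun_pert, fderiv_fderiv_coordPert (contDiffAt_coordFun_quad le_rfl hA.smooth
      (hyt t)) (h0 t).1 (h0 t).2, fderiv_fderiv_coordFun_pertVelocity hA.smooth (hyt t), smul_smul]
    congr 1
    ring
  have key := isTransit_of_chart hF (f := pert A s) hVo (fun z hz => hz.1.1) (fun z hz => hz.1.2)
    hf hab (y := y) (fun t _ => hyV t)
    (fun t ht => by
      rw [reebField_eq_of_zero (hf0 t) (hf1 t)]
      exact hG.deriv t ht) (hL.initial s)
    (fun t ht => by
      rw [hG.fderiv_reebField_eq hh (hf _ (hyV t)) (hf0 t) (hf1 t) (hf2 t)]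
      exact hL.deriv s t ht)
  have hya : y a = cotChart q₀ (lift F σ a) := coordLift_of_mem hab (left_mem_Icc.2 hab)
  have hyb : y b = cotChart q₀ (lift F σ b) := coordLift_of_mem hab (right_mem_Icc.2 hab)
  rw [hya, hyb, (cotChart q₀).left_inv (hst a (left_mem_Icc.2 hab)),
    (cotChart q₀).left_inv (hst b (right_mem_Icc.2 hab))] at key
  exact key

/-- The linearized flows of the perturbed Reeb fields along an arc of the geodesic. -/
structure IsTransitFamily (F : TangentBundle (𝓡 2) S → ℝ) (σ : ℝ → S)
    (A : (q : S) → LinearMap.BilinForm ℝ (Cot q)) (a b : ℝ) (L : ℝ → Mod →L[ℝ] Mod) : Prop where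
  transit : ∀ s, PertDefined F A s → IsTransit F (pert A s) a b (lift F σ a) (lift F σ b) (L s)
  differentiable : DifferentiableAt ℝ L 0
  contact : ∀ s X, IsContact F (lift F σ a) X → IsContact F (lift F σ b) (L s X)
  symplectic : ∀ s X Y, IsContact F (lift F σ a) X → IsContact F (lift F σ a) Y →
    symp (L s X) (L s Y) = symp X Y

theorem IsTransitFamily.comp (hF : IsFinslerMetric F) (hσ : IsClosedGeodesic F σ l)
    (hA : ContMDiff cotModel 𝓘(ℝ, ℝ) ∞ (quad A))
    {d : ℝ} (hab : a ≤ b) (hbd : b ≤ d) {L L' : ℝ → Mod →L[ℝ] Mod}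
    (h : IsTransitFamily F σ A a b L) (h' : IsTransitFamily F σ A b d L') :
    IsTransitFamily F σ A a d fun s => (L' s).comp (L s) where
  transit s hs := IsTransit.comp hF
    (fun e he => (contMDiffAt_pert hA (hs e he)).mdifferentiableAt (by simp)) hab hbd
    (hσ.lift_mem hF a) (h.transit s hs) (h'.transit s hs)
  differentiable := h'.differentiable.clm_comp h.differentiable
  contact s X hX := h'.contact s _ (h.contact s X hX)
  symplectic s X Y hX hY :=
    (h'.symplectic s _ _ (h.contact s X hX) (h.contact s Y hY)).trans (h.symplectic s X Y hX hY)

theorem IsAdmissible.isTransitFamily_of_linearFlow [CompactSpace S] (hF : IsFinslerMetric F)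
    (hσ : IsClosedGeodesic F σ l) (hA : IsAdmissible F (lift F σ) W A) (hab : a ≤ b)
    (hsrc : ∀ t ∈ Icc a b, σ t ∈ (extChartAt (𝓡 2) q₀).source) {L : ℝ → ℝ → Mod →L[ℝ] Mod}
    (hL : IsLinearFlow (coordG F q₀) (coordFun q₀ (pertVelocity A)) (coordLift F σ q₀ hab) a b L)
    (hd : DifferentiableAt ℝ (fun s => L s b) 0) :
    IsTransitFamily F σ A a b fun s =>
      ((parD q₀ (cotChart q₀ (lift F σ b))).comp (L s b)).comp (chartD q₀ (lift F σ a)) := by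
  have hG := hσ.isCoordOrbit hF hab hsrc
  have hh := hA.isCoordPert hF hσ hab hsrc
  have hsa : lift F σ a ∈ (cotChart q₀).source :=
    mem_cotChart_lift.2 (hsrc a (left_mem_Icc.2 hab))
  have hsb : lift F σ b ∈ (cotChart q₀).source :=
    mem_cotChart_lift.2 (hsrc b (right_mem_Icc.2 hab))
  have hya : coordLift F σ q₀ hab a = cotChart q₀ (lift F σ a) :=
    coordLift_of_mem hab (left_mem_Icc.2 hab)
  have hyb : coordLift F σ q₀ hab b = cotChart q₀ (lift F σ b) :=
    coordLift_of_mem hab (right_mem_Icc.2 hab)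
  have hcont : ∀ X, IsContact F (lift F σ a) X → ∀ s, IsContactVector (coordG F q₀)
      (coordLift F σ q₀ hab a) (L s a (chartD q₀ (lift F σ a) X)) := by
    intro X hX s
    rw [hya, hL.initial]
    exact (isContact_iff hF hsa (hσ.lift_mem hF a) X).1 hX
  refine ⟨fun s _ => hA.isTransit_of_linearFlow hF hσ hab hsrc hL s, ?_, fun s X hX => ?_,
    fun s X Y hX hY => ?_⟩
  · exact ((differentiableAt_const _).clm_comp hd).clm_comp (differentiableAt_const _)
  · rw [isContact_iff hF hsb (hσ.lift_mem hF b)]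
    have := hG.isContactVector_of_ode hh (hL.apply s (chartD q₀ (lift F σ a) X)) (hcont X hX s)
      (right_mem_Icc.2 hab)
    rw [hyb] at this
    simp only [ContinuousLinearMap.comp_apply]
    rwa [chartD_parD' hsb]
  · have := hG.symp_eq hh (hL.apply s (chartD q₀ (lift F σ a) X))
      (hL.apply s (chartD q₀ (lift F σ a) Y)) (hcont X hX s) (hcont Y hY s) (right_mem_Icc.2 hab)
    rw [hL.initial] at this
    simp only [ContinuousLinearMap.comp_apply]
    rw [symp_parD ((cotChart q₀).map_source hsb), this]
    exact symp_chartD hsa X Y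

/-- If the field vanishes near the arc, then `B₁ = 0` along it and the family does not depend on
`s`. The second clause records this for the arcs that carry no perturbation. -/
theorem IsAdmissible.exists_isTransitFamily_of_chart [CompactSpace S] (hF : IsFinslerMetric F)
    (hσ : IsClosedGeodesic F σ l) (hA : IsAdmissible F (lift F σ) W A) (hab : a ≤ b)
    (hsrc : ∀ t ∈ Icc a b, σ t ∈ (extChartAt (𝓡 2) q₀).source) :
    ∃ L, IsTransitFamily F σ A a b L ∧
      ((∀ t ∈ Icc a b, ∀ᶠ q in 𝓝 (σ t), A q = 0) → ∀ s, L s = L 0) := by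
  have hG := hσ.isCoordOrbit hF hab hsrc
  have hh := hA.isCoordPert hF hσ hab hsrc
  obtain ⟨L, hL, hL0, D, hD, -⟩ := hG.exists_linearFlow hh hab
  refine ⟨_, hA.isTransitFamily_of_linearFlow hF hσ hab hsrc hL hD.differentiableAt, fun h0 s => ?_⟩
  rw [hL0 fun t => ?_]
  have ht := (projIcc a b hab t).2
  have hyt : coordLift F σ q₀ hab t ∈ (cotChart q₀).target :=
    (cotChart q₀).map_source (mem_cotChart_lift.2 (hsrc _ ht))
  have hev : coordFun q₀ (pertVelocity A) =ᶠ[𝓝 (coordLift F σ q₀ hab t)] fun _ => 0 := by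
    have h1 : Tendsto (fun z => ((cotChart q₀).symm z).1) (𝓝 (coordLift F σ q₀ hab t))
        (𝓝 (σ (projIcc a b hab t))) := by
      have h2 : ContinuousAt (fun z => ((cotChart q₀).symm z).1) (coordLift F σ q₀ hab t) :=
        (FiberBundle.continuous_proj (Plane →L[ℝ] ℝ) (fun q : S => Cot q)).continuousAt.comp
          (contMDiffAt_cotChart_symm hyt).continuousAt
      have h3 : (cotChart q₀).symm (coordLift F σ q₀ hab t) = lift F σ (projIcc a b hab t) :=
        (cotChart q₀).left_inv (mem_cotChart_lift.2 (hsrc _ ht))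
      rw [ContinuousAt, h3] at h2
      exact h2
    filter_upwards [h1.eventually (h0 _ ht)] with z hz
    simp only [coordFun, pertVelocity]
    rw [hz]
    simp
  refine ContinuousLinearMap.ext fun Z => ?_
  have h2 : fderiv ℝ (fderiv ℝ (coordFun q₀ (pertVelocity A))) (coordLift F σ q₀ hab t) = 0 := by
    have h3 : fderiv ℝ (coordFun q₀ (pertVelocity A)) =ᶠ[𝓝 (coordLift F σ q₀ hab t)]
        fun _ => 0 := by
      filter_upwards [hev.eventuallyEq_nhds] with z hz
      rw [hz.fderiv_eq]
      exact fderiv_const_apply _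
    rw [h3.fderiv_eq]
    exact fderiv_const_apply _
  rw [hG.linB₁_apply hh, h2]
  simp [reebCorrection]

/-- The interval is divided so that each piece of the geodesic lies in one chart; the families of
the pieces are composed. -/
theorem IsAdmissible.exists_isTransitFamily [CompactSpace S] (hF : IsFinslerMetric F)
    (hσ : IsClosedGeodesic F σ l) (hA : IsAdmissible F (lift F σ) W A) (hab : a ≤ b) :
    ∃ L, IsTransitFamily F σ A a b L ∧
      ((∀ t ∈ Icc a b, ∀ᶠ q in 𝓝 (σ t), A q = 0) → ∀ s, L s = L 0) := by
  obtain ⟨t, ht0, htm, ⟨m, hm⟩, hcov⟩ := exists_monotone_Icc_subset_open_cover_Icc hab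
    (c := fun q₀ : S => {u : Icc a b | σ u ∈ (extChartAt (𝓡 2) q₀).source})
    (fun q₀ => (isOpen_extChartAt_source q₀).preimage
      (hσ.smooth.continuous.comp continuous_subtype_val))
    (fun u _ => mem_iUnion.2 ⟨σ u, mem_extChartAt_source (σ u)⟩)
  have hind : ∀ n, ∃ L, IsTransitFamily F σ A a (t n) L ∧
      ((∀ u ∈ Icc a (t n : ℝ), ∀ᶠ q in 𝓝 (σ u), A q = 0) → ∀ s, L s = L 0) := by
    intro n
    induction n with
    | zero =>
      rw [ht0]
      exact hA.exists_isTransitFamily_of_chart hF hσ (q₀ := σ a) le_rfl fun u hu => by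
        rw [Icc_self] at hu
        rw [hu]
        exact mem_extChartAt_source (σ a)
    | succ n ih =>
      obtain ⟨L, hL, hL0⟩ := ih
      obtain ⟨q₀, hq₀⟩ := hcov n
      have hle : (t n : ℝ) ≤ t (n + 1) := htm (Nat.le_succ n)
      obtain ⟨L', hL', hL0'⟩ := hA.exists_isTransitFamily_of_chart hF hσ (q₀ := q₀) hle
        fun u hu => hq₀ (show (⟨u, (t n).2.1.trans hu.1, hu.2.trans (t (n + 1)).2.2⟩ : Icc a b) ∈
          Icc (t n) (t (n + 1)) from hu)
      refine ⟨_, hL.comp hF hσ hA.smooth (t n).2.1 hle hL', fun h0 s => ?_⟩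
      rw [hL0 (fun u hu => h0 u ⟨hu.1, hu.2.trans hle⟩) s,
        hL0' (fun u hu => h0 u ⟨(t n).2.1.trans hu.1, hu.2⟩) s]
  obtain ⟨L, hL⟩ := hind m
  rw [hm m le_rfl] at hL
  exact ⟨L, hL⟩

end Family

/-- A linear retraction of `ι` extends every functional on `V` to `E`, so the weak derivative on the
contact plane can be computed in the ambient model space. -/
theorem hasEndDerivAtZero_of_injective {V E : Type*} [AddCommGroup V] [Module ℝ V]
    [NormedAddCommGroup E] [NormedSpace ℝ E] [FiniteDimensional ℝ E] (ι : V →ₗ[ℝ] E)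
    (hι : Function.Injective ι) {P : ℝ → (V →ₗ[ℝ] V)} {D : V →ₗ[ℝ] V} {L : ℝ → V → E} {L' : V → E}
    (h : ∀ᶠ s in 𝓝 (0 : ℝ), ∀ X, ι (P s X) = L s X)
    (hL : ∀ X, HasDerivAt (fun s => L s X) (L' X) 0) (hD : ∀ X, ι (D X) = L' X) :
    HasEndDerivAtZero P D := by
  intro X θ
  obtain ⟨ρ, hρ⟩ := LinearMap.exists_leftInverse_of_injective ι (LinearMap.ker_eq_bot.2 hι)
  have hθ : ∀ Y, θ Y = (θ ∘ₗ ρ) (ι Y) := fun Y =>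
    congrArg θ (congrArg (fun T : V →ₗ[ℝ] V => T Y) hρ).symm
  have h2 := (LinearMap.toContinuousLinearMap (θ ∘ₗ ρ)).hasFDerivAt.comp_hasDerivAt (0 : ℝ) (hL X)
  rw [hθ, hD]
  refine HasDerivAt.congr_of_eventuallyEq h2 ?_
  filter_upwards [h] with s hs
  rw [hθ, hs]
  rfl

/-! ### The linearized return map: well-definedness, symplecticity, differentiability. -/

section ReturnMap

attribute [local instance] cotTopology cotChartedSpace cot_isManifold cot_isManifold_one
  continuousSMul_mod modDualNACG modDualNS modDualACG modDualACM
  modDualModule modDualTop modEndNACG modEndNS modDualDualNACG modDualDualNS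

variable {S : Type*} [TopologicalSpace S] [ChartedSpace Plane S] [IsManifold (𝓡 2) ∞ S]
  {F : TangentBundle (𝓡 2) S → ℝ} {f : CotBundle S → ℝ} {σ : ℝ → S} {l : ℝ} {W : Set S}
  {A : (q : S) → LinearMap.BilinForm ℝ (Cot q)}

/-- A vector of the contact plane in coordinates. -/
def contactVec {e : CotBundle S} (X : contactPlane F e) : Mod := (X : TangentSpace cotModel e)

theorem isContact_contactVec {e : CotBundle S} (X : contactPlane F e) :
    IsContact F e (contactVec X) := X.2

theorem contactVec_injective {e : CotBundle S} :
    Function.Injective (contactVec : contactPlane F e → Mod) := Subtype.val_injective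

theorem extDerivOne_contactVec {e : CotBundle S} (X Y : contactPlane F e) :
    extDerivOne liouville e X Y = symp (contactVec X) (contactVec Y) :=
  extDerivOne_liouville e (contactVec X) (contactVec Y)

/-- The restriction of a linear map to the contact plane. -/
def restrictContact {e : CotBundle S} (L : Mod →L[ℝ] Mod)
    (h : ∀ X, IsContact F e X → IsContact F e (L X)) : contactPlane F e →ₗ[ℝ] contactPlane F e where
  toFun X := ⟨L (contactVec X), h _ X.2⟩
  map_add' X Y := Subtype.ext (L.map_add (contactVec X) (contactVec Y))
  map_smul' r X := Subtype.ext (L.map_smul r (contactVec X))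

theorem contactVec_restrictContact {e : CotBundle S} (L : Mod →L[ℝ] Mod)
    (h : ∀ X, IsContact F e X → IsContact F e (L X)) (X : contactPlane F e) :
    contactVec (restrictContact L h X) = L (contactVec X) := rfl

theorem isLinearizedReturnMap_iff {T : ℝ} {e : CotBundle S}
    {P : contactPlane F e →ₗ[ℝ] contactPlane F e} :
    IsLinearizedReturnMap F f T e P ↔ e ∈ cosphere F ∧ ∃ L : Mod →L[ℝ] Mod,
      IsTransit F f 0 T e e L ∧ ∀ X, L (contactVec X) = contactVec (P X) := by
  constructor
  · rintro ⟨he, φ, h1, h2, L, h3, h4⟩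
    refine ⟨he, L, ⟨φ, h1, h2, h3⟩, fun X => ?_⟩
    exact congrArg (fun z : TangentBundle cotModel (CotBundle S) => (z.2 : Mod)) (h4 X)
  · rintro ⟨he, L, ⟨φ, h1, h2, h3⟩, h4⟩
    refine ⟨he, φ, h1, h2, L, h3, fun X => ?_⟩
    have key : ∀ (e' : CotBundle S) (v v' : Mod), e' = e → v = v' →
        (⟨e', v⟩ : TangentBundle cotModel (CotBundle S)) = ⟨e, v'⟩ := by
      rintro _ _ _ rfl rfl
      rfl
    exact key _ _ _ h2 (h4 X)

theorem IsLinearizedReturnMap.unique [T2Space S] (hF : IsFinslerMetric F)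
    (hf : ∀ e ∈ cosphere F, ContMDiffAt cotModel 𝓘(ℝ, ℝ) ∞ f e) {T : ℝ} (hT : 0 ≤ T)
    {e : CotBundle S} {P P' : contactPlane F e →ₗ[ℝ] contactPlane F e}
    (h : IsLinearizedReturnMap F f T e P) (h' : IsLinearizedReturnMap F f T e P') : P = P' := by
  obtain ⟨he, L, hL, hP⟩ := isLinearizedReturnMap_iff.1 h
  obtain ⟨-, L', hL', hP'⟩ := isLinearizedReturnMap_iff.1 h'
  refine LinearMap.ext fun X => contactVec_injective ?_
  rw [← hP, ← hP']
  exact hL.unique hF hf hT he hL' X.2.1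

theorem isLinearizedReturnMap_of_transit {T : ℝ} {e : CotBundle S} (he : e ∈ cosphere F)
    {L : Mod →L[ℝ] Mod} (hL : IsTransit F f 0 T e e L)
    (h : ∀ X, IsContact F e X → IsContact F e (L X)) :
    IsLinearizedReturnMap F f T e (restrictContact L h) :=
  isLinearizedReturnMap_iff.2 ⟨he, L, hL, fun _ => rfl⟩

theorem linearizedReturnMap_eq_of_transit [T2Space S] (hF : IsFinslerMetric F)
    (hf : ∀ e ∈ cosphere F, ContMDiffAt cotModel 𝓘(ℝ, ℝ) ∞ f e) {T : ℝ} (hT : 0 ≤ T)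
    {e : CotBundle S} (he : e ∈ cosphere F)
    {L : Mod →L[ℝ] Mod} (hL : IsTransit F f 0 T e e L)
    (h : ∀ X, IsContact F e X → IsContact F e (L X)) :
    linearizedReturnMap F f T e = restrictContact L h := by
  have hex : ∃ P, IsLinearizedReturnMap F f T e P :=
    ⟨_, isLinearizedReturnMap_of_transit he hL h⟩
  rw [linearizedReturnMap, dif_pos hex]
  exact hex.choose_spec.unique hF hf hT (isLinearizedReturnMap_of_transit he hL h)

theorem contMDiffAt_pert_of_pertDefined (hA : ContMDiff cotModel 𝓘(ℝ, ℝ) ∞ (quad A)) {s : ℝ}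
    (hs : PertDefined F A s) :
    ∀ e ∈ cosphere F, ContMDiffAt cotModel 𝓘(ℝ, ℝ) ∞ (pert A s) e :=
  fun e he => contMDiffAt_pert hA (hs e he)

theorem IsClosedGeodesic.lift_period (hσ : IsClosedGeodesic F σ l) : lift F σ l = lift F σ 0 := by
  have := hσ.periodic_lift 0
  rwa [zero_add] at this

theorem IsTransitFamily.transit_period (hσ : IsClosedGeodesic F σ l) {L : ℝ → Mod →L[ℝ] Mod}
    (hL : IsTransitFamily F σ A 0 l L) {s : ℝ} (hs : PertDefined F A s) :
    IsTransit F (pert A s) 0 l (lift F σ 0) (lift F σ 0) (L s) := by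
  have := hL.transit s hs
  rwa [hσ.lift_period] at this

theorem IsTransitFamily.contact_period (hσ : IsClosedGeodesic F σ l) {L : ℝ → Mod →L[ℝ] Mod}
    (hL : IsTransitFamily F σ A 0 l L) (s : ℝ) (X : Mod) (hX : IsContact F (lift F σ 0) X) :
    IsContact F (lift F σ 0) (L s X) := by
  have := hL.contact s X hX
  rwa [hσ.lift_period] at this

theorem IsTransitFamily.linearizedReturnMap_eq [T2Space S] (hF : IsFinslerMetric F)
    (hσ : IsClosedGeodesic F σ l) (hA : ContMDiff cotModel 𝓘(ℝ, ℝ) ∞ (quad A))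
    {L : ℝ → Mod →L[ℝ] Mod} (hL : IsTransitFamily F σ A 0 l L) {s : ℝ} (hs : PertDefined F A s)
    (X : contactPlane F (lift F σ 0)) :
    contactVec (linearizedReturnMap F (pert A s) l (lift F σ 0) X) = L s (contactVec X) := by
  rw [linearizedReturnMap_eq_of_transit hF (contMDiffAt_pert_of_pertDefined hA hs)
    hσ.length_pos.le (hσ.lift_mem hF 0) (hL.transit_period hσ hs) (hL.contact_period hσ s)]
  rfl

/-- The linearized return map of a perturbed Reeb flow is well defined and symplectic. -/
theorem IsAdmissible.returnMap_wellDefined [T2Space S] [CompactSpace S] (hF : IsFinslerMetric F)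
    (hσ : IsClosedGeodesic F σ l) (hA : IsAdmissible F (lift F σ) W A) {s : ℝ}
    (hs : PertDefined F A s) :
    (∃! P, IsLinearizedReturnMap F (pert A s) l (lift F σ 0) P) ∧
      IsSymplectic F (lift F σ 0) (linearizedReturnMap F (pert A s) l (lift F σ 0)) := by
  obtain ⟨L, hL, -⟩ := hA.exists_isTransitFamily hF hσ hσ.length_pos.le
  refine ⟨⟨_, isLinearizedReturnMap_of_transit (hσ.lift_mem hF 0) (hL.transit_period hσ hs)
    (hL.contact_period hσ s), fun P hP => ?_⟩, fun X Y => ?_⟩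
  · exact hP.unique hF (contMDiffAt_pert_of_pertDefined hA.smooth hs) hσ.length_pos.le
      (isLinearizedReturnMap_of_transit (hσ.lift_mem hF 0) (hL.transit_period hσ hs)
        (hL.contact_period hσ s))
  · have h1 := hL.symplectic s _ _ (isContact_contactVec X) (isContact_contactVec Y)
    rw [← hL.linearizedReturnMap_eq hF hσ hA.smooth hs,
      ← hL.linearizedReturnMap_eq hF hσ hA.smooth hs] at h1
    exact (extDerivOne_contactVec _ _).trans (h1.trans (extDerivOne_contactVec _ _).symm)

theorem pert_zero : pert A 0 = fun _ => 0 := by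
  funext e
  simp [pert]

theorem pertDefined_zero : PertDefined F A 0 := fun e _ => by simp

/-- The contact plane at a fixed point is cut out by two linear equations, and these pass to the
derivative of a curve in it. -/
theorem isContact_deriv (hF : IsFinslerMetric F) {e : CotBundle S} (he : e ∈ cosphere F)
    {Z : ℝ → Mod} {Z' : Mod} (h : ∀ s, IsContact F e (Z s)) (hZ : HasDerivAt Z Z' 0) :
    IsContact F e Z' := by
  have hs := mem_cotChart_source e
  rw [isContact_iff hF hs he, chartD_self]
  have hall := fun s => (isContact_iff hF hs he _).1 (h s)
  rw [chartD_self] at hall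
  constructor
  · have h1 := (fderiv ℝ (coordG F e.1) (cotChart e.1 e)).hasFDerivAt.comp_hasDerivAt (0 : ℝ) hZ
    have h2 : (fun s => fderiv ℝ (coordG F e.1) (cotChart e.1 e) (Z s)) = fun _ => 0 :=
      funext fun s => (hall s).tangent
    exact h1.unique (by
      change HasDerivAt (fun s => fderiv ℝ (coordG F e.1) (cotChart e.1 e) (Z s)) 0 0
      rw [h2]
      exact hasDerivAt_const _ _)
  · have h1 := (lam (cotChart e.1 e)).hasFDerivAt.comp_hasDerivAt (0 : ℝ) hZ
    have h2 : (fun s => lam (cotChart e.1 e) (Z s)) = fun _ => 0 :=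
      funext fun s => (hall s).kernel
    exact h1.unique (by
      change HasDerivAt (fun s => lam (cotChart e.1 e) (Z s)) 0 0
      rw [h2]
      exact hasDerivAt_const _ _)

/-- `contactVec` as a linear map. -/
def contactVecL (F : TangentBundle (𝓡 2) S → ℝ) (e : CotBundle S) : contactPlane F e →ₗ[ℝ] Mod where
  toFun := contactVec
  map_add' _ _ := rfl
  map_smul' _ _ := rfl

/-- Weak differentiability of the return map can be tested on any extension. -/
theorem hasEndDerivAtZero_of_eventuallyEq {e : CotBundle S}
    {P : ℝ → (contactPlane F e →ₗ[ℝ] contactPlane F e)} {D : contactPlane F e →ₗ[ℝ] contactPlane F e}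
    {L : ℝ → Mod →L[ℝ] Mod} {L' : Mod →L[ℝ] Mod}
    (h : ∀ᶠ s in 𝓝 (0 : ℝ), ∀ X, contactVec (P s X) = L s (contactVec X))
    (hL : HasDerivAt L L' 0) (hD : ∀ X, contactVec (D X) = L' (contactVec X)) :
    HasEndDerivAtZero P D :=
  hasEndDerivAtZero_of_injective (contactVecL F e) contactVec_injective h
    (fun X => (ContinuousLinearMap.apply ℝ Mod (contactVec X)).hasFDerivAt.comp_hasDerivAt (0 : ℝ) hL)
    hD

theorem IsTransitFamily.hasEndDerivAtZero [T2Space S] [CompactSpace S] (hF : IsFinslerMetric F)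
    (hσ : IsClosedGeodesic F σ l) (hA : ContMDiff cotModel 𝓘(ℝ, ℝ) ∞ (quad A))
    {L : ℝ → Mod →L[ℝ] Mod} (hL : IsTransitFamily F σ A 0 l L) {L' : Mod →L[ℝ] Mod}
    (hL' : HasDerivAt L L' 0)
    {D : contactPlane F (lift F σ 0) →ₗ[ℝ] contactPlane F (lift F σ 0)}
    (hD : ∀ X, contactVec (D X) = L' (contactVec X)) :
    HasEndDerivAtZero (fun s => linearizedReturnMap F (pert A s) l (lift F σ 0)) D := by
  refine hasEndDerivAtZero_of_eventuallyEq ?_ hL' hD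
  filter_upwards [eventually_pertDefined hF hA.continuous] with s hs X
  exact hL.linearizedReturnMap_eq hF hσ hA hs X

/-- The derivative of the return map exists and is tangent to the symplectic group. -/
theorem IsAdmissible.exists_hasEndDerivAtZero [T2Space S] [CompactSpace S]
    (hF : IsFinslerMetric F) (hσ : IsClosedGeodesic F σ l)
    (hA : IsAdmissible F (lift F σ) W A) :
    ∃ D ∈ symplecticTangent F (lift F σ 0) (linearizedReturnMap F (fun _ => 0) l (lift F σ 0)),
      HasEndDerivAtZero (fun s => linearizedReturnMap F (pert A s) l (lift F σ 0)) D := by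
  obtain ⟨L, hL, -⟩ := hA.exists_isTransitFamily hF hσ hσ.length_pos.le
  have hL' := hL.differentiable.hasDerivAt
  set L' := deriv L 0
  have happ : ∀ X : Mod, HasDerivAt (fun s => L s X) (L' X) 0 := fun X =>
    (ContinuousLinearMap.apply ℝ Mod X).hasFDerivAt.comp_hasDerivAt (0 : ℝ) hL'
  have hc : ∀ X, IsContact F (lift F σ 0) X → IsContact F (lift F σ 0) (L' X) := fun X hX =>
    isContact_deriv hF (hσ.lift_mem hF 0) (fun s => hL.contact_period hσ s X hX) (happ X)
  refine ⟨restrictContact L' hc, fun X Y => ?_,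
    hL.hasEndDerivAtZero hF hσ hA.smooth hL' fun _ => rfl⟩
  -- Differentiating `ω(L_s X, L_s Y) = ω(X, Y)` at `s = 0` gives the tangency equation.
  have h1 := (((happ (contactVec X)).hasDerivWithinAt (s := univ)).symp
    ((happ (contactVec Y)).hasDerivWithinAt (s := univ))).hasDerivAt univ_mem
  have h2 : (fun s => symp (L s (contactVec X)) (L s (contactVec Y))) =
      fun _ => symp (contactVec X) (contactVec Y) := funext fun s =>
    hL.symplectic s _ _ (isContact_contactVec X) (isContact_contactVec Y)
  rw [h2] at h1
  have h3 := h1.unique (hasDerivAt_const _ _)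
  have h4 := fun X => hL.linearizedReturnMap_eq hF hσ hA.smooth pertDefined_zero X
  rw [pert_zero] at h4
  rw [← h4, ← h4] at h3
  exact (congrArg₂ (· + ·) (extDerivOne_contactVec _ _) (extDerivOne_contactVec _ _)).trans h3

end ReturnMap

/-! ### The contact form `H (dz + x₁ dx₂)` and its Reeb field. -/

section CoordModel

attribute [local instance] continuousSMul_mod modDualNACG modDualNS modDualACG modDualACM
  modDualModule modDualTop modEndNACG modEndNS modDualDualNACG modDualDualNS

/-- The form `H (dz + x₁ dx₂)`. -/
def modelForm (H : ℝ × Plane → ℝ) (w u : ℝ × Plane) : ℝ := H w * (u.1 + w.2 0 * u.2 1)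

/-- A parametrization of the hypersurface `G = 1`, near a point, in which the contact form is
`H (dz + x₁ dx₂)`. -/
structure IsCoordModel (G : Mod → ℝ) (g : ℝ × Plane → Mod) (H : ℝ × Plane → ℝ)
    (w₀ : ℝ × Plane) : Prop where
  smooth : ContDiffAt ℝ 2 g w₀
  smooth_hypersurface : ContDiffAt ℝ 2 G (g w₀)
  smooth_factor : ContDiffAt ℝ 2 H w₀
  pos : 0 < H w₀
  unit : ∀ᶠ w in 𝓝 w₀, G (g w) = 1
  euler : ∀ᶠ z in 𝓝 (g w₀), fderiv ℝ G z (eul z) = G z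
  injective : ∀ᶠ w in 𝓝 w₀, Function.Injective (fderiv ℝ g w)
  pullback : ∀ᶠ w in 𝓝 w₀, ∀ u, lam (g w) (fderiv ℝ g w u) = modelForm H w u

/-- Dimension count: the image of `L` is three-dimensional and lies in a hyperplane of a
four-dimensional space. -/
theorem exists_eq_of_apply_eq_zero {L : ℝ × Plane →L[ℝ] Mod} (hL : Function.Injective L)
    {dG : Mod →L[ℝ] ℝ} (hG : dG ≠ 0) (h : ∀ u, dG (L u) = 0) {η : Mod} (hη : dG η = 0) :
    ∃ u, L u = η := by
  have h1 : L.toLinearMap.range ≤ dG.toLinearMap.ker := by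
    rintro _ ⟨u, rfl⟩
    exact h u
  have h2 : Module.finrank ℝ L.toLinearMap.range = 3 := by
    rw [LinearMap.finrank_range_of_inj hL]
    simp [Plane]
  have h3 := LinearMap.finrank_range_add_finrank_ker dG.toLinearMap
  have h4 : Module.finrank ℝ Mod = 4 := by
    have : Module.finrank ℝ (Plane →L[ℝ] ℝ) = 2 := by
      rw [← LinearMap.toContinuousLinearMap.finrank_eq]
      simp
    rw [Module.finrank_prod, this]
    simp
  have h5 : 0 < Module.finrank ℝ dG.toLinearMap.range := by
    rw [Module.finrank_pos_iff_exists_ne_zero]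
    obtain ⟨v, hv⟩ : ∃ v, dG v ≠ 0 := by
      by_contra! hcon
      exact hG (ContinuousLinearMap.ext hcon)
    exact ⟨⟨dG v, v, rfl⟩, fun h => hv (congrArg Subtype.val h)⟩
  have h6 : L.toLinearMap.range = dG.toLinearMap.ker :=
    Submodule.eq_of_le_of_finrank_le h1 (by omega)
  have h7 : η ∈ dG.toLinearMap.ker := hη
  rw [← h6] at h7
  exact h7

/-- The first and second coordinate vectors of the `x`-plane. -/
def modelVec (i : Fin 2) : ℝ × Plane := (0, EuclideanSpace.single i 1)

/-- The Reeb field of `H (dz + x₁ dx₂)`. -/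
def modelReeb (H : ℝ × Plane → ℝ) (w : ℝ × Plane) : ℝ × Plane :=
  ((H w)⁻¹ + (H w)⁻¹ ^ 2 * (w.2 0 * fderiv ℝ H w (modelVec 0))) • (1, 0) +
  ((H w)⁻¹ ^ 2 * (fderiv ℝ H w (modelVec 1) - w.2 0 * fderiv ℝ H w (1, 0))) • modelVec 0 -
  ((H w)⁻¹ ^ 2 * fderiv ℝ H w (modelVec 0)) • modelVec 1

theorem eq_sum_modelVec (u : ℝ × Plane) :
    u = u.1 • ((1, 0) : ℝ × Plane) + u.2 0 • modelVec 0 + u.2 1 • modelVec 1 := by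
  refine Prod.ext ?_ ?_
  · simp [modelVec]
  · have := plane_eq_sum u.2
    simpa [modelVec, Fin.sum_univ_two] using this

theorem modelForm_modelReeb {H : ℝ × Plane → ℝ} {w : ℝ × Plane} (hw : H w ≠ 0) :
    modelForm H w (modelReeb H w) = 1 := by
  simp [modelForm, modelReeb, modelVec]
  field_simp
  ring

theorem hasFDerivAt_modelForm {H : ℝ × Plane → ℝ} {w : ℝ × Plane} (hH : DifferentiableAt ℝ H w)
    (u v : ℝ × Plane) : fderiv ℝ (fun w => modelForm H w v) w u =
      fderiv ℝ H w u * (v.1 + w.2 0 * v.2 1) + H w * (u.2 0 * v.2 1) := by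
  have h1 : HasFDerivAt (fun w : ℝ × Plane => w.2 0)
      ((EuclideanSpace.proj 0 : Plane →L[ℝ] ℝ).comp (ContinuousLinearMap.snd ℝ ℝ Plane)) w :=
    ((EuclideanSpace.proj 0 : Plane →L[ℝ] ℝ).comp
      (ContinuousLinearMap.snd ℝ ℝ Plane)).hasFDerivAt
  have h2 : HasFDerivAt (fun w => modelForm H w v) _ w :=
    hH.hasFDerivAt.mul ((h1.mul_const (v.2 1)).const_add v.1)
  rw [h2.fderiv]
  simp
  ring

theorem modelReeb_kernel {H : ℝ × Plane → ℝ} {w : ℝ × Plane} (hH : DifferentiableAt ℝ H w)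
    (hw : H w ≠ 0) (v : ℝ × Plane) :
    fderiv ℝ (fun w => modelForm H w v) w (modelReeb H w) -
      fderiv ℝ (fun w' => modelForm H w' (modelReeb H w)) w v = 0 := by
  rw [hasFDerivAt_modelForm hH, hasFDerivAt_modelForm hH]
  set p := fderiv ℝ H w (modelVec 0) with hp
  set q := fderiv ℝ H w (modelVec 1) with hq
  set r := fderiv ℝ H w (1, 0) with hr
  have h1 : fderiv ℝ H w v = v.1 * r + v.2 0 * p + v.2 1 * q := by
    conv_lhs => rw [eq_sum_modelVec v]
    simp only [map_add, map_smul, smul_eq_mul, hp, hq, hr]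
  have h2 : fderiv ℝ H w (modelReeb H w) = r * (H w)⁻¹ := by
    simp only [modelReeb, map_add, map_sub, map_smul, smul_eq_mul, ← hp, ← hq, ← hr]
    ring
  rw [h1, h2]
  simp [modelReeb, modelVec, ← hr]
  have h3 : fderiv ℝ H w ((0 : ℝ), EuclideanSpace.single 0 (1 : ℝ)) = p := rfl
  have h4 : fderiv ℝ H w ((0 : ℝ), EuclideanSpace.single 1 (1 : ℝ)) = q := rfl
  rw [h3, h4]
  field_simp
  ring

namespace IsCoordModel

variable {G : Mod → ℝ} {g : ℝ × Plane → Mod} {H : ℝ × Plane → ℝ} {w₀ : ℝ × Plane}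
  (h : IsCoordModel G g H w₀)

include h

theorem eventually : ∀ᶠ w in 𝓝 w₀, IsCoordModel G g H w := by
  have hg := h.smooth.continuousAt
  filter_upwards [h.smooth.eventually (by simp),
    hg.eventually (h.smooth_hypersurface.eventually (by simp)),
    h.smooth_factor.eventually (by simp), h.smooth_factor.continuousAt.eventually_const_lt h.pos,
    h.unit.eventually_nhds, hg.eventually h.euler.eventually_nhds, h.injective.eventually_nhds,
    h.pullback.eventually_nhds] with w h1 h2 h3 h4 h5 h6 h7 h8
  exact ⟨h1, h2, h3, h4, h5, h6, h7, h8⟩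

theorem fderiv_eq_zero (u : ℝ × Plane) : fderiv ℝ G (g w₀) (fderiv ℝ g w₀ u) = 0 := by
  have h1 := (h.smooth_hypersurface.differentiableAt (by simp)).hasFDerivAt.comp w₀
    (h.smooth.differentiableAt (by simp)).hasFDerivAt
  have h2 := h1.unique ((hasFDerivAt_const (1 : ℝ) w₀).congr_of_eventuallyEq h.unit)
  exact congrArg (fun L : ℝ × Plane →L[ℝ] ℝ => L u) h2

theorem eul_ne_zero : fderiv ℝ G (g w₀) (eul (g w₀)) ≠ 0 := by
  rw [h.euler.self_of_nhds, h.unit.self_of_nhds]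
  exact one_ne_zero

theorem exists_eq {η : Mod} (hη : fderiv ℝ G (g w₀) η = 0) : ∃ u, fderiv ℝ g w₀ u = η :=
  exists_eq_of_apply_eq_zero h.injective.self_of_nhds
    (fun h0 => h.eul_ne_zero (by rw [h0]; rfl)) h.fderiv_eq_zero hη

theorem symp_fderiv (u v : ℝ × Plane) : symp (fderiv ℝ g w₀ u) (fderiv ℝ g w₀ v) =
      fderiv ℝ (fun w => modelForm H w v) w₀ u - fderiv ℝ (fun w => modelForm H w u) w₀ v := by
  have h2 : DifferentiableAt ℝ (fun w => (lam (g w)).comp (fderiv ℝ g w)) w₀ :=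
    (lam.differentiableAt.comp w₀ (h.smooth.differentiableAt (by simp))).clm_comp
      ((h.smooth.fderiv_right (m := 1) (by norm_num)).differentiableAt (by simp))
  have h3 : ∀ u v : ℝ × Plane, fderiv ℝ (fun w => (lam (g w)).comp (fderiv ℝ g w)) w₀ u v =
      fderiv ℝ (fun w => modelForm H w v) w₀ u := by
    intro u v
    have h4 := h2.hasFDerivAt.clm_apply (hasFDerivAt_const v w₀)
    have h5 : (fun w => modelForm H w v) =ᶠ[𝓝 w₀]
        fun w => (lam (g w)).comp (fderiv ℝ g w) v := by
      filter_upwards [h.pullback] with w hw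
      exact (hw v).symm
    rw [h5.fderiv_eq, h4.fderiv]
    simp
  rw [symp_fderiv_eq (β := fun w => (lam (g w)).comp (fderiv ℝ g w)) h.smooth
    (Eventually.of_forall fun w u => rfl) u v, h3, h3]

/-- The image of the model Reeb vector satisfies the defining conditions, since `g` pulls the
contact form back to the model form and its derivative fills the tangent space of the hypersurface.
Uniqueness of Reeb vectors finishes. -/
theorem reebField₀_eq : reebField₀ G (g w₀) = fderiv ℝ g w₀ (modelReeb H w₀) := by
  have hne : G (g w₀) ≠ 0 := by
    rw [h.unit.self_of_nhds]
    exact one_ne_zero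
  have h1 := isCoordReeb_reebField (G := G) (f := fun _ => 0) hne h.euler.self_of_nhds
  rw [reebField_eq_of_zero rfl (fderiv_const_apply (0 : ℝ))] at h1
  refine h1.unique h.eul_ne_zero ⟨h.fderiv_eq_zero _, ?_, fun η hη => ?_⟩
  · rw [h.pullback.self_of_nhds, modelForm_modelReeb h.pos.ne']
    simp
  · obtain ⟨v, rfl⟩ := h.exists_eq hη
    rw [h.symp_fderiv, modelReeb_kernel (h.smooth_factor.differentiableAt (by simp)) h.pos.ne']
    have : fderiv ℝ (fun _ : Mod => (0 : ℝ)) (g w₀) = 0 := fderiv_const_apply (0 : ℝ)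
    rw [this]
    simp

end IsCoordModel

/-- The linearization at a critical point of the Reeb field of `H (dz + x₁ dx₂)`. -/
theorem hasFDerivAt_modelReeb {H : ℝ × Plane → ℝ} {z l : ℝ} (hl : l ≠ 0)
    (hH : ContDiffAt ℝ 2 H (z, 0)) (h0 : H (z, 0) = l) (h1 : fderiv ℝ H (z, 0) = 0) :
    ∃ D : ℝ × Plane →L[ℝ] ℝ × Plane, HasFDerivAt (modelReeb H) D (z, 0) ∧
      ∀ x : Plane, D (0, x) =
        (l⁻¹ ^ 2 * fderiv ℝ (fderiv ℝ H) (z, 0) (0, x) (modelVec 1)) • modelVec 0 -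
        (l⁻¹ ^ 2 * fderiv ℝ (fderiv ℝ H) (z, 0) (0, x) (modelVec 0)) • modelVec 1 := by
  have hi : HasFDerivAt (fun w => (H w)⁻¹) (0 : ℝ × Plane →L[ℝ] ℝ) (z, 0) := by
    have := (hasDerivAt_inv (by rwa [h0])).comp_hasFDerivAt (z, (0 : Plane))
      (hH.differentiableAt (by simp)).hasFDerivAt
    rw [h1, smul_zero] at this
    exact this
  have hi2 : HasFDerivAt (fun w => (H w)⁻¹ ^ 2) (0 : ℝ × Plane →L[ℝ] ℝ) (z, 0) := by
    simpa using hi.pow 2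
  have hd : ∀ u, HasFDerivAt (fun w => fderiv ℝ H w u) _ (z, 0) := fun u =>
    ((hH.fderiv_right (m := 1) (by norm_num)).differentiableAt (by simp)).hasFDerivAt.clm_apply
      (hasFDerivAt_const u _)
  have hx : HasFDerivAt (fun w : ℝ × Plane => w.2 0)
      ((EuclideanSpace.proj 0 : Plane →L[ℝ] ℝ).comp (ContinuousLinearMap.snd ℝ ℝ Plane)) (z, 0) :=
    ((EuclideanSpace.proj 0 : Plane →L[ℝ] ℝ).comp
      (ContinuousLinearMap.snd ℝ ℝ Plane)).hasFDerivAt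
  refine ⟨_, (((hi.add (hi2.mul (hx.mul (hd (modelVec 0))))).smul_const ((1, 0) : ℝ × Plane)).add
    ((hi2.mul ((hd (modelVec 1)).sub (hx.mul (hd (1, 0))))).smul_const (modelVec 0))).sub
    ((hi2.mul (hd (modelVec 0))).smul_const (modelVec 1)), fun x => ?_⟩
  simp [h0, h1]

set_option synthInstance.maxHeartbeats 400000 in
/-- A map that takes a vector field to another one takes solutions of the linearized equation to
solutions. -/
theorem hasDerivAt_fderiv_of_semiconj {E E' : Type*} [NormedAddCommGroup E] [NormedSpace ℝ E]
    [NormedAddCommGroup E'] [NormedSpace ℝ E'] {g : E → E'} {X : E' → E'} {Y : E → E}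
    {B : E' →L[ℝ] E'} {D : E →L[ℝ] E} {c ρ : ℝ → E} {z l : ℝ}
    (hg : ContDiffAt ℝ 2 g (c z)) (hB : HasFDerivAt X B (g (c z))) (hD : HasFDerivAt Y D (c z))
    (h : ∀ᶠ w in 𝓝 (c z), X (g w) = fderiv ℝ g w (Y w)) (hc : HasDerivAt c (l • Y (c z)) z)
    (hρ : HasDerivAt ρ (l • D (ρ z)) z) :
    HasDerivAt (fun z => fderiv ℝ g (c z) (ρ z)) (l • B (fderiv ℝ g (c z) (ρ z))) z := by
  have hg2 : HasFDerivAt (fderiv ℝ g) (fderiv ℝ (fderiv ℝ g) (c z)) (c z) :=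
    ((hg.fderiv_right (m := 1) (by norm_num)).differentiableAt (by simp)).hasFDerivAt
  have h2 : HasFDerivAt (fun w => X (g w)) _ (c z) :=
    hB.comp (c z) (hg.differentiableAt (by simp)).hasFDerivAt
  have h3 : HasFDerivAt (fun w => fderiv ℝ g w (Y w)) _ (c z) := hg2.clm_apply hD
  -- The relation `X ∘ g = Dg · Y` is differentiated in the direction `ρ z`. Its term with the
  -- second derivative of `g` is, by symmetry, the one produced by the motion of the base point
  -- along `c`.
  have h5 := congrArg (fun L : E →L[ℝ] E' => L (ρ z))
    (h2.unique (h3.congr_of_eventuallyEq h))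
  have h6 : B (fderiv ℝ g (c z) (ρ z)) =
      fderiv ℝ g (c z) (D (ρ z)) + fderiv ℝ (fderiv ℝ g) (c z) (ρ z) (Y (c z)) := h5
  have hsym : fderiv ℝ (fderiv ℝ g) (c z) (ρ z) (Y (c z)) =
      fderiv ℝ (fderiv ℝ g) (c z) (Y (c z)) (ρ z) := hg.isSymmSndFDerivAt (by simp) _ _
  have h7 : HasDerivAt (fun z => fderiv ℝ g (c z) (ρ z)) _ z :=
    (hg2.comp_hasDerivAt z hc).clm_apply hρ
  refine h7.congr_deriv ?_
  rw [h6, hsym, smul_add, map_smul, map_smul, smul_apply, add_comm]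
  rfl

/-- On the core the Reeb field of the model is `l⁻¹ ∂_z`, as `dH = 0` there. In the variable `z` the
Reeb field is thus multiplied by `l`, which leaves a single factor `l⁻¹` in front of the Hessian of
`H`. -/
theorem IsCoordModel.hasDerivAt_fderiv {G : Mod → ℝ} {g : ℝ × Plane → Mod} {H : ℝ × Plane → ℝ}
    {z l : ℝ} (h : IsCoordModel G g H (z, 0)) {B : Mod →L[ℝ] Mod}
    (hB : HasFDerivAt (reebField₀ G) B (g (z, 0))) (h0 : H (z, 0) = l)
    (h1 : fderiv ℝ H (z, 0) = 0) {ρ : ℝ → Plane} {ρ' : Plane} (hρ : HasDerivAt ρ ρ' z)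
    (hρ' : ((0, ρ') : ℝ × Plane) =
      (l⁻¹ * fderiv ℝ (fderiv ℝ H) (z, 0) (0, ρ z) (modelVec 1)) • modelVec 0 -
        (l⁻¹ * fderiv ℝ (fderiv ℝ H) (z, 0) (0, ρ z) (modelVec 0)) • modelVec 1) :
    HasDerivAt (fun z => fderiv ℝ g (z, 0) (0, ρ z)) (l • B (fderiv ℝ g (z, 0) (0, ρ z))) z := by
  have hl : l ≠ 0 := by
    rw [← h0]
    exact h.pos.ne'
  obtain ⟨D, hD, hDx⟩ := hasFDerivAt_modelReeb hl h.smooth_factor h0 h1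
  have h6 : l • D (0, ρ z) = ((0, ρ') : ℝ × Plane) := by
    rw [hDx, hρ', smul_sub, smul_smul, smul_smul]
    congr 2 <;> field_simp
  have hid : l • modelReeb H (z, 0) = ((1, 0) : ℝ × Plane) := by
    simp [modelReeb, h0, h1, hl]
  have hc : HasDerivAt (fun z : ℝ => ((z, 0) : ℝ × Plane)) (l • modelReeb H (z, 0)) z := by
    rw [hid]
    exact (hasDerivAt_id z).prodMk (hasDerivAt_const z (0 : Plane))
  have hρ2 : HasDerivAt (fun z : ℝ => ((0, ρ z) : ℝ × Plane)) (l • D (0, ρ z)) z := by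
    rw [h6]
    exact (hasDerivAt_const z (0 : ℝ)).prodMk hρ
  exact hasDerivAt_fderiv_of_semiconj h.smooth hB hD
    (h.eventually.mono fun w hw => hw.reebField₀_eq) hc hρ2

set_option synthInstance.maxHeartbeats 400000 in
/-- The Hessian of the composition with a function that vanishes to first order. -/
theorem fderiv_fderiv_comp {E E' : Type*} [NormedAddCommGroup E] [NormedSpace ℝ E]
    [NormedAddCommGroup E'] [NormedSpace ℝ E'] {g : E → E'} {h : E' → ℝ} {w : E}
    (hg : ContDiffAt ℝ 2 g w) (hh : ContDiffAt ℝ 2 h (g w)) (h1 : fderiv ℝ h (g w) = 0) (u v : E) :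
    fderiv ℝ (fderiv ℝ fun w => h (g w)) w u v =
      fderiv ℝ (fderiv ℝ h) (g w) (fderiv ℝ g w u) (fderiv ℝ g w v) := by
  have h2 : fderiv ℝ (fun w => h (g w)) =ᶠ[𝓝 w] fun w => (fderiv ℝ h (g w)).comp (fderiv ℝ g w) := by
    filter_upwards [hg.eventually (by simp), hg.continuousAt.eventually (hh.eventually (by simp))]
      with w hw hw'
    exact ((hw'.differentiableAt (by simp)).hasFDerivAt.comp w
      (hw.differentiableAt (by simp)).hasFDerivAt).fderiv
  have h3 : HasFDerivAt (fderiv ℝ g) (fderiv ℝ (fderiv ℝ g) w) w :=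
    ((hg.fderiv_right (m := 1) (by norm_num)).differentiableAt (by simp)).hasFDerivAt
  have h4 : HasFDerivAt (fderiv ℝ h) (fderiv ℝ (fderiv ℝ h) (g w)) (g w) :=
    ((hh.fderiv_right (m := 1) (by norm_num)).differentiableAt (by simp)).hasFDerivAt
  have h5 : HasFDerivAt (fun w => (fderiv ℝ h (g w)).comp (fderiv ℝ g w)) _ w :=
    (h4.comp w (hg.differentiableAt (by simp)).hasFDerivAt).clm_comp h3
  rw [h2.fderiv_eq, h5.fderiv]
  simp [h1]

theorem IsCoordModel.symp_core {G : Mod → ℝ} {g : ℝ × Plane → Mod} {H : ℝ × Plane → ℝ}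
    {z : ℝ} (h : IsCoordModel G g H (z, 0)) (h1 : fderiv ℝ H (z, 0) = 0) (x x' : Plane) :
    symp (fderiv ℝ g (z, 0) (0, x)) (fderiv ℝ g (z, 0) (0, x')) =
      H (z, 0) * (x 0 * x' 1 - x 1 * x' 0) := by
  have hH := h.smooth_factor.differentiableAt (by simp)
  rw [h.symp_fderiv, hasFDerivAt_modelForm hH, hasFDerivAt_modelForm hH, h1]
  simp
  ring

/-- The Hessian of a function of `(z, x)` in the variables `x`. -/
theorem hessX_eq {k : ℝ × Plane → ℝ} {t : ℝ} (hk : ContDiffAt ℝ 2 k (t, 0)) (i j : Fin 2) :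
    hessX k t i j = fderiv ℝ (fderiv ℝ k) (t, 0) (modelVec i) (modelVec j) := by
  have hι : ∀ x : Plane, HasFDerivAt (fun x : Plane => ((t, x) : ℝ × Plane))
      (ContinuousLinearMap.inr ℝ ℝ Plane) x := fun x => hasFDerivAt_prodMk_right t x
  have h2 : fderiv ℝ (fun x : Plane => k (t, x)) =ᶠ[𝓝 0]
      fun x => (fderiv ℝ k (t, x)).comp (ContinuousLinearMap.inr ℝ ℝ Plane) := by
    filter_upwards [(hι 0).continuousAt.eventually (hk.eventually (by simp))] with x hx
    exact ((hx.differentiableAt (by simp)).hasFDerivAt.comp x (hι x)).fderiv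
  have h4 : HasFDerivAt (fderiv ℝ k) (fderiv ℝ (fderiv ℝ k) (t, 0)) (t, 0) :=
    ((hk.fderiv_right (m := 1) (by norm_num)).differentiableAt (by simp)).hasFDerivAt
  have h5 : HasFDerivAt (fun x : Plane => (fderiv ℝ k (t, x)).comp
      (ContinuousLinearMap.inr ℝ ℝ Plane)) _ 0 :=
    (h4.comp (0 : Plane) (hι 0)).clm_comp (hasFDerivAt_const _ _)
  rw [hessX, Matrix.of_apply, h2.fderiv_eq, h5.fderiv]
  simp [modelVec]

end CoordModel

theorem linear_ode_unique_Icc {E : Type*} [NormedAddCommGroup E] [NormedSpace ℝ E]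
    {B : ℝ → E →L[ℝ] E} (hB : Continuous B) {a b : ℝ} {x y : ℝ → E} (h : x a = y a)
    (hx : ∀ t ∈ Icc a b, HasDerivWithinAt x (B t (x t)) (Icc a b) t)
    (hy : ∀ t ∈ Icc a b, HasDerivWithinAt y (B t (y t)) (Icc a b) t) : EqOn x y (Icc a b) := by
  obtain ⟨M, hM⟩ := isCompact_Icc (a := a) (b := b) |>.exists_bound_of_continuousOn hB.continuousOn
  have hr : ∀ {x : ℝ → E}, (∀ t ∈ Icc a b, HasDerivWithinAt x (B t (x t)) (Icc a b) t) →
      ∀ t ∈ Ico a b, HasDerivWithinAt x (B t (x t)) (Ici t) t := fun hx t ht =>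
    (hx t (Ico_subset_Icc_self ht)).mono_of_mem_nhdsWithin (Icc_mem_nhdsGE_of_mem ht)
  refine ODE_solution_unique_of_mem_Icc_right (v := fun t x => B t x) (s := fun _ => univ)
    (K := Real.toNNReal M) (fun t ht => ?_)
    (fun s hs => (hx s hs).continuousWithinAt) (hr hx) (fun _ _ => trivial)
    (fun s hs => (hy s hs).continuousWithinAt) (hr hy) (fun _ _ => trivial) h
  have hM0 : 0 ≤ M := (norm_nonneg _).trans (hM t (Ico_subset_Icc_self ht))
  exact ((B t).lipschitz.weaken (by
    rw [← NNReal.coe_le_coe, Real.coe_toNNReal _ hM0]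
    exact hM t (Ico_subset_Icc_self ht))).lipschitzOnWith

/-! ### Linearized flows and the pairing in the local model. -/

section ModelFamily

attribute [local instance] cotTopology cotChartedSpace cot_isManifold cot_isManifold_one
  continuousSMul_mod modDualNACG modDualNS modDualACG modDualACM
  modDualModule modDualTop modEndNACG modEndNS modDualDualNACG modDualDualNS

variable {S : Type*} [TopologicalSpace S] [ChartedSpace Plane S] [IsManifold (𝓡 2) ∞ S]
  {F : TangentBundle (𝓡 2) S → ℝ} {σ : ℝ → S} {l : ℝ} {W : Set S} {U₁ : Set (CotBundle S)}
  {A : (q : S) → LinearMap.BilinForm ℝ (Cot q)} {q₀ : S} {δ : ℝ} {Φ : ℝ × Plane → CotBundle S}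
  {H : ℝ × Plane → ℝ}

/-- The derivative of a parametrization of a part of the cotangent bundle. -/
def modelD (Φ : ℝ × Plane → CotBundle S) (w : ℝ × Plane) : ℝ × Plane →L[ℝ] Mod :=
  mfderiv 𝓘(ℝ, ℝ × Plane) cotModel Φ w

/-- The Hessian of a function of `(z, x)` in the variables `x` at `x = 0`, as a bilinear form. -/
def modelHess (k : ℝ × Plane → ℝ) (z : ℝ) (x x' : Plane) : ℝ :=
  fderiv ℝ (fderiv ℝ k) (z, 0) (0, x) (0, x')

/-- The linearization of the Reeb field of `H (dz + x₁ dx₂)` along `x = 0`. -/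
def modelB (l : ℝ) (H : ℝ × Plane → ℝ) (z : ℝ) : Plane →L[ℝ] Plane :=
  l⁻¹ • (((fderiv ℝ (fderiv ℝ H) (z, 0)).flip (modelVec 1)).comp
      (ContinuousLinearMap.inr ℝ ℝ Plane)).smulRight (EuclideanSpace.single 0 (1 : ℝ) : Plane) -
    l⁻¹ • (((fderiv ℝ (fderiv ℝ H) (z, 0)).flip (modelVec 0)).comp
      (ContinuousLinearMap.inr ℝ ℝ Plane)).smulRight (EuclideanSpace.single 1 (1 : ℝ) : Plane)

/-- The images of constant vectors under the linearized flow of the local model. -/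
def modelFrame (Φ : ℝ × Plane → CotBundle S) (R : ℝ → Plane →L[ℝ] Plane) (z : ℝ) (x : Plane) : Mod :=
  modelD Φ (z, 0) (0, R z x)

namespace IsLocalModel

variable (hΦ : IsLocalModel F (lift F σ) l U₁ δ Φ H)

include hΦ

theorem eventually_ball (z : ℝ) : ∀ᶠ w : ℝ × Plane in 𝓝 (z, 0), w.2 ∈ Metric.ball (0 : Plane) δ :=
  continuous_snd.continuousAt.eventually (Metric.ball_mem_nhds _ hΦ.radius_pos)

theorem contMDiffAt {w : ℝ × Plane} (hw : w.2 ∈ Metric.ball (0 : Plane) δ) :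
    ContMDiffAt 𝓘(ℝ, ℝ × Plane) cotModel ∞ Φ w :=
  hΦ.smooth.contMDiffAt ((isOpen_univ.prod Metric.isOpen_ball).mem_nhds ⟨trivial, hw⟩)

theorem contDiffAt_factor {w : ℝ × Plane} (hw : w.2 ∈ Metric.ball (0 : Plane) δ) :
    ContDiffAt ℝ ∞ H w :=
  hΦ.factor_smooth.contDiffAt ((isOpen_univ.prod Metric.isOpen_ball).mem_nhds ⟨trivial, hw⟩)

theorem zero_mem : (0 : Plane) ∈ Metric.ball (0 : Plane) δ :=
  Metric.mem_ball_self hΦ.radius_pos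

theorem contDiffAt_coord {w : ℝ × Plane} (hw : w.2 ∈ Metric.ball (0 : Plane) δ)
    (hs : Φ w ∈ (cotChart q₀).source) : ContDiffAt ℝ ∞ (fun w => cotChart q₀ (Φ w)) w :=
  ((contMDiffAt_cotChart hs).comp w (hΦ.contMDiffAt hw)).contDiffAt

theorem fderiv_coord {w : ℝ × Plane} (hw : w.2 ∈ Metric.ball (0 : Plane) δ)
    (hs : Φ w ∈ (cotChart q₀).source) (u : ℝ × Plane) :
    fderiv ℝ (fun w => cotChart q₀ (Φ w)) w u = chartD q₀ (Φ w) (modelD Φ w u) := by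
  have h1 := (hasMFDerivAt_cotChart hs).comp w
    ((hΦ.contMDiffAt hw).mdifferentiableAt (by simp)).hasMFDerivAt
  have h2 : HasFDerivAt (fun w => cotChart q₀ (Φ w)) ((chartD q₀ (Φ w)).comp (modelD Φ w)) w :=
    h1.hasFDerivAt
  rw [h2.fderiv]
  rfl

theorem eventually_source {z : ℝ} (hs : Φ (z, 0) ∈ (cotChart q₀).source) :
    ∀ᶠ w in 𝓝 (z, (0 : Plane)), Φ w ∈ (cotChart q₀).source :=
  (hΦ.contMDiffAt (w := (z, 0)) hΦ.zero_mem).continuousAt.eventually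
    ((isOpen_cotChart_source q₀).mem_nhds hs)

theorem isCoordModel (hF : IsFinslerMetric F) {z : ℝ} (hs : Φ (z, 0) ∈ (cotChart q₀).source) :
    IsCoordModel (coordG F q₀) (fun w => cotChart q₀ (Φ w)) H (z, 0) := by
  have hΦ0 := hΦ.mem_cosphere z 0 hΦ.zero_mem
  have hev := (hΦ.eventually_ball z).and (hΦ.eventually_source hs)
  have ht := (cotChart q₀).map_source hs
  have hp := snd_cotChart_ne_zero hs (covec_ne_zero hF hΦ0)
  refine ⟨(hΦ.contDiffAt_coord (w := (z, 0)) hΦ.zero_mem hs).of_le two_le_infty,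
    (contDiffAt_coordG hF ht hp).of_le two_le_infty,
    (hΦ.contDiffAt_factor (w := (z, 0)) hΦ.zero_mem).of_le two_le_infty, hΦ.factor_pos z 0 hΦ.zero_mem,
    hev.mono fun w hw => ?_, ?_, hev.mono fun w hw => ?_, hev.mono fun w hw u => ?_⟩
  · exact (coordFun_apply _ hw.2).trans (hΦ.mem_cosphere w.1 w.2 hw.1)
  · filter_upwards [(isOpen_cotChart_target q₀).mem_nhds ht,
      continuous_snd.continuousAt.eventually_ne hp] with z hz hz'
    exact fderiv_coordG_eul hF hz hz'
  · intro u v huv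
    rw [hΦ.fderiv_coord hw.1 hw.2, hΦ.fderiv_coord hw.1 hw.2] at huv
    have := congrArg (parD q₀ (cotChart q₀ (Φ w))) huv
    rw [parD_chartD' hw.2, parD_chartD' hw.2] at this
    exact hΦ.immersive w.1 w.2 hw.1 this
  · rw [hΦ.fderiv_coord hw.1 hw.2, ← liouville_chartD hw.2]
    exact hΦ.pullback w.1 w.2 hw.1 u.1 u.2

theorem core_div (hl : l ≠ 0) (t : ℝ) : Φ (t / l, 0) = lift F σ t := by
  rw [hΦ.core, mul_div_cancel₀ t hl]

theorem isContact_modelD (hF : IsFinslerMetric F) (z : ℝ) (x : Plane) :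
    IsContact F (Φ (z, 0)) (modelD Φ (z, 0) (0, x)) := by
  have hs := mem_cotChart_source (Φ (z, 0))
  have hm := hΦ.isCoordModel hF hs
  rw [isContact_iff hF hs (hΦ.mem_cosphere z 0 hΦ.zero_mem), ← hΦ.fderiv_coord (w := (z, 0)) hΦ.zero_mem hs]
  refine ⟨hm.fderiv_eq_zero _, ?_⟩
  rw [hm.pullback.self_of_nhds]
  simp [modelForm]

theorem symp_modelD (hF : IsFinslerMetric F) (z : ℝ) (x x' : Plane) :
    symp (modelD Φ (z, 0) (0, x)) (modelD Φ (z, 0) (0, x')) = l * (x 0 * x' 1 - x 1 * x' 0) := by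
  have hs := mem_cotChart_source (Φ (z, 0))
  rw [← symp_chartD hs, ← hΦ.fderiv_coord (w := (z, 0)) hΦ.zero_mem hs, ← hΦ.fderiv_coord (w := (z, 0)) hΦ.zero_mem hs,
    (hΦ.isCoordModel hF hs).symp_core (hΦ.factor_deriv_core z), hΦ.factor_core]

/-- A tangent vector comes from some `(ζ, x)`; on the core the contact form of its image is `H ζ`,
so a contact vector has `ζ = 0`. -/
theorem exists_modelD_eq (hF : IsFinslerMetric F) {z : ℝ} {X : Mod}
    (hX : IsContact F (Φ (z, 0)) X) : ∃ x : Plane, modelD Φ (z, 0) (0, x) = X := by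
  have hs := mem_cotChart_source (Φ (z, 0))
  have hm := hΦ.isCoordModel hF hs
  have h1 := (isContact_iff hF hs (hΦ.mem_cosphere z 0 hΦ.zero_mem) X).1 hX
  obtain ⟨⟨ζ, x⟩, hu⟩ := hm.exists_eq h1.tangent
  have h2 := h1.kernel
  rw [← hu, hm.pullback.self_of_nhds] at h2
  have h3 : ζ = 0 := by
    have h4 : H (z, 0) * (ζ + (0 : Plane) 0 * x 1) = 0 := h2
    rcases mul_eq_zero.1 h4 with h | h
    · exact absurd h (hΦ.factor_pos z 0 hΦ.zero_mem).ne'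
    · simpa using h
  rw [hΦ.fderiv_coord (w := (z, 0)) hΦ.zero_mem hs, chartD_self] at hu
  rw [h3] at hu
  exact ⟨x, hu⟩

theorem contDiffAt_pertVelocity (hA : ContMDiff cotModel 𝓘(ℝ, ℝ) ∞ (quad A)) (z : ℝ) :
    ContDiffAt ℝ ∞ (pertVelocity A ∘ Φ) (z, 0) := by
  have h1 : ContDiffAt ℝ ∞ (fun w => quad A (Φ w)) (z, 0) :=
    ((hA _).comp (z, (0 : Plane)) (hΦ.contMDiffAt (w := (z, 0)) hΦ.zero_mem)).contDiffAt
  exact contDiffAt_const.mul h1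

end IsLocalModel

/-- A family of linearized flows that is described by a local model. -/
structure IsModelFamily (F : TangentBundle (𝓡 2) S → ℝ) (σ : ℝ → S)
    (A : (q : S) → LinearMap.BilinForm ℝ (Cot q)) (E : ℝ → Plane → Mod)
    (Q : ℝ → Plane → Plane → ℝ) (a b : ℝ) (L : ℝ → Mod →L[ℝ] Mod) : Prop
    extends IsTransitFamily F σ A a b L where
  frame : ∀ x, L 0 (E a x) = E b x
  pairing : ∀ x x', symp (deriv L 0 (E a x)) (E b x') = ∫ t in a..b, Q t x x'

/-- The product rule for the composition gives two terms. One is the pairing over the second arc; in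
the other the symplectic map of the second arc acts on both arguments and drops out, leaving the
pairing over the first arc. -/
theorem IsModelFamily.comp (hF : IsFinslerMetric F) (hσ : IsClosedGeodesic F σ l)
    (hA : ContMDiff cotModel 𝓘(ℝ, ℝ) ∞ (quad A)) {E : ℝ → Plane → Mod}
    {Q : ℝ → Plane → Plane → ℝ} {a b d : ℝ} (hab : a ≤ b) (hbd : b ≤ d)
    (hE : ∀ x, IsContact F (lift F σ a) (E a x))
    (hQ : ∀ x x', Continuous fun t => Q t x x') {L L' : ℝ → Mod →L[ℝ] Mod}
    (h : IsModelFamily F σ A E Q a b L) (h' : IsModelFamily F σ A E Q b d L') :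
    IsModelFamily F σ A E Q a d fun s => (L' s).comp (L s) where
  toIsTransitFamily := h.toIsTransitFamily.comp hF hσ hA hab hbd h'.toIsTransitFamily
  frame x := by rw [ContinuousLinearMap.comp_apply, h.frame, h'.frame]
  pairing x x' := by
    have happ : ∀ X : Mod, HasDerivAt (fun s => L s X) (deriv L 0 X) 0 := fun X =>
      (ContinuousLinearMap.apply ℝ Mod X).hasFDerivAt.comp_hasDerivAt (0 : ℝ)
        h.differentiable.hasDerivAt
    have hb : ∀ x, IsContact F (lift F σ b) (E b x) := fun x => by
      rw [← h.frame]
      exact h.contact 0 _ (hE x)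
    have h1 : IsContact F (lift F σ b) (deriv L 0 (E a x)) :=
      isContact_deriv hF (hσ.lift_mem hF b) (fun s => h.contact s _ (hE x)) (happ _)
    rw [(h'.differentiable.hasDerivAt.clm_comp h.differentiable.hasDerivAt).deriv, add_apply,
      ContinuousLinearMap.comp_apply, ContinuousLinearMap.comp_apply, symp_add_left, h.frame,
      h'.pairing, ← h'.frame, h'.symplectic 0 _ _ h1 (hb x'), h.pairing, add_comm]
    exact intervalIntegral.integral_add_adjacent_intervals ((hQ x x').intervalIntegrable _ _)
      ((hQ x x').intervalIntegrable _ _)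

/-- The Hessians of the velocity of the perturbation, along the linearized flow. -/
def modelForcing (A : (q : S) → LinearMap.BilinForm ℝ (Cot q)) (Φ : ℝ × Plane → CotBundle S)
    (l : ℝ) (R : ℝ → Plane →L[ℝ] Plane) (t : ℝ) (x x' : Plane) : ℝ :=
  modelHess (pertVelocity A ∘ Φ) (t / l) (R (t / l) x) (R (t / l) x')

theorem IsLocalModel.continuous_modelForcing (hΦ : IsLocalModel F (lift F σ) l U₁ δ Φ H)
    (hA : ContMDiff cotModel 𝓘(ℝ, ℝ) ∞ (quad A)) {R : ℝ → Plane →L[ℝ] Plane}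
    (hR : Continuous R) (x x' : Plane) : Continuous fun t => modelForcing A Φ l R t x x' := by
  have h1 : Continuous fun z => fderiv ℝ (fderiv ℝ (pertVelocity A ∘ Φ)) (z, (0 : Plane)) := by
    refine continuous_iff_continuousAt.2 fun z => ?_
    have h2 := (((hΦ.contDiffAt_pertVelocity hA z).fderiv_right (m := ∞) (by simp)).fderiv_right
      (m := ∞) (by simp)).continuousAt
    exact h2.comp (f := fun z : ℝ => (z, (0 : Plane))) (by fun_prop)
  have h3 : ∀ x, Continuous fun z => ((0, R z x) : ℝ × Plane) := fun x =>
    continuous_const.prodMk (hR.clm_apply continuous_const)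
  exact ((h1.clm_apply (h3 x)).clm_apply (h3 x')).comp (continuous_id.div_const l)

/-- Frames transported by `R` solve the linearized equation in the chart, so by uniqueness they are
the unperturbed linearized flow. The Hessian of `h` on these solutions is the Hessian of `h ∘ Φ` on
`R x`, because `dh` vanishes along the orbit. The argument `t / l` converts Reeb time into the
coordinate `z`. -/
theorem IsAdmissible.exists_isModelFamily_of_chart [CompactSpace S] (hF : IsFinslerMetric F)
    (hσ : IsClosedGeodesic F σ l) (hA : IsAdmissible F (lift F σ) W A)
    (hΦ : IsLocalModel F (lift F σ) l U₁ δ Φ H) {R : ℝ → Plane →L[ℝ] Plane}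
    (hR : ∀ z, HasDerivAt R (modelB l H z * R z) z) {a b : ℝ} (hab : a ≤ b)
    (hsrc : ∀ t ∈ Icc a b, σ t ∈ (extChartAt (𝓡 2) q₀).source) :
    ∃ L, IsModelFamily F σ A (fun t => modelFrame Φ R (t / l)) (modelForcing A Φ l R) a b L := by
  have hl := hσ.length_pos.ne'
  have hG := hσ.isCoordOrbit hF hab hsrc
  have hh := hA.isCoordPert hF hσ hab hsrc
  obtain ⟨L, hL, -, D, hD, hpair⟩ := hG.exists_linearFlow hh hab
  have hfam := hA.isTransitFamily_of_linearFlow hF hσ hab hsrc hL hD.differentiableAt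
  set y := coordLift F σ q₀ hab with hy
  set g : ℝ × Plane → Mod := fun w => cotChart q₀ (Φ w) with hg
  have hst : ∀ t ∈ Icc a b, Φ (t / l, 0) ∈ (cotChart q₀).source := fun t ht => by
    rw [hΦ.core_div hl]
    exact mem_cotChart_lift.2 (hsrc t ht)
  have hgy : ∀ t ∈ Icc a b, g (t / l, 0) = y t := fun t ht => by
    rw [hy, coordLift_of_mem hab ht, hg, ← hΦ.core_div hl]
  set Z : Plane → ℝ → Mod := fun x t => fderiv ℝ g (t / l, 0) (0, R (t / l) x) with hZ
  have hZE : ∀ t ∈ Icc a b, ∀ x, Z x t = chartD q₀ (lift F σ t) (modelFrame Φ R (t / l) x) := by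
    intro t ht x
    rw [← hΦ.core_div hl]
    exact hΦ.fderiv_coord (w := (t / l, 0)) hΦ.zero_mem (hst t ht) _
  have hZd : ∀ x, ∀ t ∈ Icc a b, HasDerivWithinAt (Z x) (linB₀ (coordG F q₀) y t (Z x t))
      (Icc a b) t := by
    intro x t ht
    have hB : HasFDerivAt (reebField₀ (coordG F q₀)) (linB₀ (coordG F q₀) y t) (g (t / l, 0)) := by
      rw [hgy t ht]
      exact hG.hasFDerivAt_reebField₀ t
    have hρ : HasDerivAt (fun z => R z x) (modelB l H (t / l) (R (t / l) x)) (t / l) :=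
      (ContinuousLinearMap.apply ℝ Plane x).hasFDerivAt.comp_hasDerivAt (t / l) (hR (t / l))
    have h1 := (hΦ.isCoordModel hF (hst t ht)).hasDerivAt_fderiv hB (hΦ.factor_core _)
      (hΦ.factor_deriv_core _) hρ (by simp [modelB, modelVec, smul_smul])
    have h2 := h1.scomp t ((hasDerivAt_id t).div_const l)
    rw [smul_smul, one_div, inv_mul_cancel₀ hl, one_smul] at h2
    exact h2.hasDerivWithinAt
  have hLZ : ∀ x, ∀ t ∈ Icc a b, L 0 t (Z x a) = Z x t := by
    intro x t ht
    refine linear_ode_unique_Icc (x := fun t => L 0 t (Z x a)) hG.continuous_linB₀ ?_ (fun t ht => ?_) (hZd x) ht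
    · rw [hL.initial]
      rfl
    · have := hL.apply 0 (Z x a) t ht
      rwa [add_apply, smul_apply, zero_smul, add_zero] at this
  have ha := left_mem_Icc.2 hab
  have hb := right_mem_Icc.2 hab
  have hsb : lift F σ b ∈ (cotChart q₀).source := mem_cotChart_lift.2 (hsrc b hb)
  have hd : HasDerivAt (fun s => ((parD q₀ (cotChart q₀ (lift F σ b))).comp (L s b)).comp
      (chartD q₀ (lift F σ a))) (((parD q₀ (cotChart q₀ (lift F σ b))).comp D).comp
      (chartD q₀ (lift F σ a))) 0 := by
    have := ((hasDerivAt_const (0 : ℝ) (parD q₀ (cotChart q₀ (lift F σ b)))).clm_comp hD).clm_comp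
      (hasDerivAt_const (0 : ℝ) (chartD q₀ (lift F σ a)))
    refine this.congr_deriv ?_
    simp
  refine ⟨_, hfam, fun x => ?_, fun x x' => ?_⟩
  · simp only [ContinuousLinearMap.comp_apply]
    rw [← hZE a ha, hLZ x b hb, hZE b hb, parD_chartD' hsb]
  · rw [hd.deriv]
    simp only [ContinuousLinearMap.comp_apply]
    rw [← symp_chartD hsb, chartD_parD' hsb, ← hZE a ha, ← hZE b hb, ← hLZ x' b hb]
    have hc : ∀ x, IsContactVector (coordG F q₀) (y a) (Z x a) := by
      intro x
      have h1 := hΦ.isContact_modelD hF (a / l) (R (a / l) x)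
      have h2 := (isContact_iff hF (hst a ha) (hΦ.mem_cosphere _ 0 hΦ.zero_mem) _).1 h1
      rw [← hΦ.fderiv_coord (w := (a / l, 0)) hΦ.zero_mem (hst a ha)] at h2
      rw [← hgy a ha]
      exact h2
    rw [hpair _ _ (hc x) (hc x')]
    refine intervalIntegral.integral_congr fun t ht => ?_
    rw [uIcc_of_le hab] at ht
    rw [hLZ x t ht, hLZ x' t ht, ← hgy t ht]
    have h3 : (pertVelocity A ∘ Φ) =ᶠ[𝓝 (t / l, (0 : Plane))]
        fun w => coordFun q₀ (pertVelocity A) (g w) := by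
      filter_upwards [hΦ.eventually_source (hst t ht)] with w hw
      exact (coordFun_apply _ hw).symm
    have h4 : fderiv ℝ (fderiv ℝ (pertVelocity A ∘ Φ)) (t / l, (0 : Plane)) =
        fderiv ℝ (fderiv ℝ fun w => coordFun q₀ (pertVelocity A) (g w)) (t / l, (0 : Plane)) :=
      (h3.fderiv (𝕜 := ℝ)).fderiv_eq
    rw [modelForcing, modelHess, h4]
    refine (fderiv_fderiv_comp ((hΦ.contDiffAt_coord (w := (t / l, 0)) hΦ.zero_mem
      (hst t ht)).of_le two_le_infty) ?_ ?_ _ _).symm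
    · change ContDiffAt ℝ 2 _ (g (t / l, 0))
      rw [hgy t ht]
      exact (hh.smooth t).of_le two_le_infty
    · change fderiv ℝ _ (g (t / l, 0)) = 0
      rw [hgy t ht]
      exact hh.deriv_zero t

theorem IsAdmissible.exists_isModelFamily [CompactSpace S] (hF : IsFinslerMetric F)
    (hσ : IsClosedGeodesic F σ l) (hA : IsAdmissible F (lift F σ) W A)
    (hΦ : IsLocalModel F (lift F σ) l U₁ δ Φ H) {R : ℝ → Plane →L[ℝ] Plane}
    (hR : ∀ z, HasDerivAt R (modelB l H z * R z) z) {a b : ℝ} (hab : a ≤ b) :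
    ∃ L, IsModelFamily F σ A (fun t => modelFrame Φ R (t / l)) (modelForcing A Φ l R) a b L := by
  have hl := hσ.length_pos.ne'
  obtain ⟨t, ht0, htm, ⟨m, hm⟩, hcov⟩ := exists_monotone_Icc_subset_open_cover_Icc hab
    (c := fun q₀ : S => {u : Icc a b | σ u ∈ (extChartAt (𝓡 2) q₀).source})
    (fun q₀ => (isOpen_extChartAt_source q₀).preimage
      (hσ.smooth.continuous.comp continuous_subtype_val))
    (fun u _ => mem_iUnion.2 ⟨σ u, mem_extChartAt_source (σ u)⟩)
  have hind : ∀ n, ∃ L, IsModelFamily F σ A (fun t => modelFrame Φ R (t / l))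
      (modelForcing A Φ l R) a (t n) L := by
    intro n
    induction n with
    | zero =>
      rw [ht0]
      exact hA.exists_isModelFamily_of_chart hF hσ hΦ hR (q₀ := σ a) le_rfl fun u hu => by
        rw [Icc_self] at hu
        rw [hu]
        exact mem_extChartAt_source (σ a)
    | succ n ih =>
      obtain ⟨L, hL⟩ := ih
      obtain ⟨q₀, hq₀⟩ := hcov n
      have hle : (t n : ℝ) ≤ t (n + 1) := htm (Nat.le_succ n)
      obtain ⟨L', hL'⟩ := hA.exists_isModelFamily_of_chart hF hσ hΦ hR (q₀ := q₀) hle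
        fun u hu => hq₀ (show (⟨u, (t n).2.1.trans hu.1, hu.2.trans (t (n + 1)).2.2⟩ : Icc a b) ∈
          Icc (t n) (t (n + 1)) from hu)
      refine ⟨_, hL.comp hF hσ hA.smooth (t n).2.1 hle (fun x => ?_) (fun x x' =>
        hΦ.continuous_modelForcing hA.smooth
          (continuous_iff_continuousAt.2 fun z => (hR z).continuousAt) x x') hL'⟩
      rw [← hΦ.core_div hl]
      exact hΦ.isContact_modelD hF _ _
  obtain ⟨L, hL⟩ := hind m
  rw [hm m le_rfl] at hL
  exact ⟨L, hL⟩

end ModelFamily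

/-! ### Matrices of the model flow. -/

/-- The basis vectors of the plane. -/
abbrev basisVec (i : Fin 2) : Plane := EuclideanSpace.single i (1 : ℝ)

theorem hessX_symm {k : ℝ × Plane → ℝ} {z : ℝ} (hk : ContDiffAt ℝ 2 k (z, 0)) (i j : Fin 2) :
    hessX k z i j = hessX k z j i := by
  rw [hessX_eq hk, hessX_eq hk]
  exact hk.isSymmSndFDerivAt (by simp) _ _

theorem modelHess_eq {k : ℝ × Plane → ℝ} {z : ℝ} (hk : ContDiffAt ℝ 2 k (z, 0)) (x x' : Plane) :
    modelHess k z x x' = x 0 * x' 0 * hessX k z 0 0 + x 0 * x' 1 * hessX k z 0 1 +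
      x 1 * x' 0 * hessX k z 1 0 + x 1 * x' 1 * hessX k z 1 1 := by
  have h : ∀ x : Plane, ((0, x) : ℝ × Plane) = x 0 • modelVec 0 + x 1 • modelVec 1 := fun x => by
    simpa using eq_sum_modelVec (0, x)
  rw [modelHess, h x, h x']
  simp only [map_add, map_smul, add_apply, smul_apply, hessX_eq hk, smul_eq_mul]
  ring

theorem modelB_zero (l : ℝ) (H : ℝ × Plane → ℝ) (z : ℝ) (x : Plane) :
    modelB l H z x 0 = l⁻¹ * modelHess H z x (basisVec 1) := by
  simp [modelB, modelHess, modelVec, basisVec]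

theorem modelB_one (l : ℝ) (H : ℝ × Plane → ℝ) (z : ℝ) (x : Plane) :
    modelB l H z x 1 = -(l⁻¹ * modelHess H z x (basisVec 0)) := by
  simp [modelB, modelHess, modelVec, basisVec]

theorem stdJ_mul_zero (M : Matrix (Fin 2) (Fin 2) ℝ) (j : Fin 2) : (stdJ * M) 0 j = -M 1 j := by
  simp [stdJ, Matrix.mul_apply, Fin.sum_univ_two]

theorem stdJ_mul_one (M : Matrix (Fin 2) (Fin 2) ℝ) (j : Fin 2) : (stdJ * M) 1 j = M 0 j := by
  simp [stdJ, Matrix.mul_apply, Fin.sum_univ_two]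

/-- The matrix of an endomorphism of the plane. -/
def planeMatrix (R : Plane →L[ℝ] Plane) : Matrix (Fin 2) (Fin 2) ℝ :=
  Matrix.of fun i j => R (basisVec j) i

theorem isFundamentalSolution_planeMatrix {l : ℝ} {H : ℝ × Plane → ℝ}
    (hH : ∀ z, ContDiffAt ℝ 2 H (z, 0)) {R : ℝ → Plane →L[ℝ] Plane} (h0 : R 0 = 1)
    (hR : ∀ z, HasDerivAt R (modelB l H z * R z) z) :
    IsFundamentalSolution l H fun z => planeMatrix (R z) := by
  refine ⟨?_, fun z i j => ?_⟩
  · ext i j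
    simp [planeMatrix, h0, Matrix.one_apply]
  · have h1 : HasDerivAt (fun z => R z (basisVec j)) (modelB l H z (R z (basisVec j))) z :=
      (ContinuousLinearMap.apply ℝ Plane (basisVec j)).hasFDerivAt.comp_hasDerivAt z (hR z)
    have h2 : HasDerivAt (fun z => R z (basisVec j) i) (modelB l H z (R z (basisVec j)) i) z :=
      (EuclideanSpace.proj i : Plane →L[ℝ] ℝ).hasFDerivAt.comp_hasDerivAt z h1
    refine h2.congr_deriv ?_
    have hs := hessX_symm (hH z) 0 1
    fin_cases i
    · refine (modelB_zero l H z _).trans ?_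
      rw [modelHess_eq (hH z)]
      simp only [Matrix.mul_assoc, Matrix.smul_apply, stdJ_mul_zero, Fin.zero_eta]
      simp [planeMatrix, Matrix.mul_apply, Fin.sum_univ_two, hs]
      ring
    · refine (modelB_one l H z _).trans ?_
      rw [modelHess_eq (hH z)]
      simp only [Matrix.mul_assoc, Matrix.smul_apply, stdJ_mul_one, Fin.mk_one]
      simp [planeMatrix, Matrix.mul_apply, Fin.sum_univ_two, hs]
      exact Or.inl (by ring)

/-- The product of `J` with a symmetric matrix has trace zero. -/
theorem IsFundamentalSolution.det_eq_one {l : ℝ} {H : ℝ × Plane → ℝ}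
    {R : ℝ → Matrix (Fin 2) (Fin 2) ℝ} (hR : IsFundamentalSolution l H R)
    (hH : ∀ z, ContDiffAt ℝ 2 H (z, 0)) (z : ℝ) : (R z).det = 1 := by
  have h1 : ∀ z, HasDerivAt (fun z => (R z).det) 0 z := by
    intro z
    have h2 := ((hR.2 z 0 0).mul (hR.2 z 1 1)).sub ((hR.2 z 0 1).mul (hR.2 z 1 0))
    have h3 : (fun z => (R z).det) = fun z => R z 0 0 * R z 1 1 - R z 0 1 * R z 1 0 :=
      funext fun z => Matrix.det_fin_two _
    rw [h3]
    refine h2.congr_deriv ?_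
    have hs := hessX_symm (hH z) 0 1
    simp only [Matrix.mul_assoc, Matrix.smul_apply, stdJ_mul_zero, stdJ_mul_one, smul_eq_mul]
    simp only [Matrix.mul_apply, Fin.sum_univ_two, hs]
    ring
  have h4 := is_const_of_deriv_eq_zero (fun z => (h1 z).differentiableAt) (fun z => (h1 z).deriv) z 0
  rw [h4, hR.1, Matrix.det_one]

/-- The product of matrices in the derivative formula, paired with the return map. -/
theorem pairing_derivMatrix {P R K h : Matrix (Fin 2) (Fin 2) ℝ} (hP : P.det = 1) (hR : R.det = 1)
    (hK : K = -(stdJ * h)) (hh : h 0 1 = h 1 0) (j k : Fin 2) :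
    (P * R⁻¹ * K * R) 0 j * P 1 k - (P * R⁻¹ * K * R) 1 j * P 0 k = (R.transpose * h * R) j k := by
  have hi : R⁻¹ = R.adjugate := by
    rw [Matrix.inv_def, hR]
    simp
  rw [Matrix.det_fin_two] at hP
  have hK0 : ∀ j, K 0 j = h 1 j := fun j => by
    rw [hK, Matrix.neg_apply, stdJ_mul_zero, neg_neg]
  have hK1 : ∀ j, K 1 j = -h 0 j := fun j => by
    rw [hK, Matrix.neg_apply, stdJ_mul_one]
  -- The adjugate is the adjoint of `R` for the area form, so `R⁻¹` moves to the other argument;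
  -- each entry is then `det P` times the corresponding entry of `Rᵀ h R`.
  rw [hi, Matrix.adjugate_fin_two]
  fin_cases j <;> fin_cases k <;>
    simp [Matrix.mul_apply, Fin.sum_univ_two, hK0, hK1, hh]
  · linear_combination (R 0 0 * (h 0 0 * R 0 0 + h 1 0 * R 1 0) +
      R 1 0 * (h 1 0 * R 0 0 + h 1 1 * R 1 0)) * hP
  · linear_combination (R 0 1 * (h 0 0 * R 0 0 + h 1 0 * R 1 0) +
      R 1 1 * (h 1 0 * R 0 0 + h 1 1 * R 1 0)) * hP
  · linear_combination (R 0 0 * (h 0 0 * R 0 1 + h 1 0 * R 1 1) +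
      R 1 0 * (h 1 0 * R 0 1 + h 1 1 * R 1 1)) * hP
  · linear_combination (R 0 1 * (h 0 0 * R 0 1 + h 1 0 * R 1 1) +
      R 1 1 * (h 1 0 * R 0 1 + h 1 1 * R 1 1)) * hP

theorem toMatrix_eq_of_toLin {V : Type*} [AddCommGroup V] [Module ℝ V]
    (b : Module.Basis (Fin 2) ℝ V) {P : V →ₗ[ℝ] V} {M : Matrix (Fin 2) (Fin 2) ℝ}
    (h : ∀ j, P (b j) = Matrix.toLin b b M (b j)) : LinearMap.toMatrix b b P = M := by
  rw [b.ext h, LinearMap.toMatrix_toLin]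

/-! ### The derivative of the return map in the local model. -/

section LocalModel

attribute [local instance] cotTopology cotChartedSpace cot_isManifold cot_isManifold_one
  continuousSMul_mod modDualNACG modDualNS modDualACG modDualACM
  modDualModule modDualTop modEndNACG modEndNS modDualDualNACG modDualDualNS

variable {S : Type*} [TopologicalSpace S] [ChartedSpace Plane S] [IsManifold (𝓡 2) ∞ S]
  {F : TangentBundle (𝓡 2) S → ℝ} {σ : ℝ → S} {l : ℝ} {W : Set S} {U₁ : Set (CotBundle S)}
  {A : (q : S) → LinearMap.BilinForm ℝ (Cot q)} {q₀ : S} {δ : ℝ} {Φ : ℝ × Plane → CotBundle S}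
  {H : ℝ × Plane → ℝ}

namespace IsLocalModel

variable (hΦ : IsLocalModel F (lift F σ) l U₁ δ Φ H)

include hΦ

theorem contDiffAt_factor_core (z : ℝ) : ContDiffAt ℝ 2 H (z, 0) :=
  (hΦ.contDiffAt_factor (w := (z, 0)) hΦ.zero_mem).of_le two_le_infty

theorem continuous_modelB : Continuous (modelB l H) := by
  have h1 : Continuous fun z => fderiv ℝ (fderiv ℝ H) (z, (0 : Plane)) := by
    refine continuous_iff_continuousAt.2 fun z => ?_
    have h2 := (((hΦ.contDiffAt_factor (w := (z, 0)) hΦ.zero_mem).fderiv_right (m := ∞)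
      (by simp)).fderiv_right (m := ∞) (by simp)).continuousAt
    exact h2.comp (f := fun z : ℝ => (z, (0 : Plane))) (by fun_prop)
  refine continuous_clm_apply.2 fun x => ?_
  have h3 : ∀ v, Continuous fun z => fderiv ℝ (fderiv ℝ H) (z, (0 : Plane)) (0, x) v := fun v =>
    (h1.clm_apply continuous_const).clm_apply continuous_const
  exact (((h3 (modelVec 1)).smul continuous_const).const_smul l⁻¹).sub
    (((h3 (modelVec 0)).smul continuous_const).const_smul l⁻¹)

/-- As `U₁` is relatively open and `Φ` takes values in the hypersurface, `H` is constant near `(z,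
0)`, and its Hessian vanishes. -/
theorem modelB_eq_zero (hU₁ : ∃ O : Set (CotBundle S), IsOpen O ∧ U₁ = O ∩ cosphere F) {z : ℝ}
    (hz : Φ (z, 0) ∈ U₁) : modelB l H z = 0 := by
  obtain ⟨O, hO, rfl⟩ := hU₁
  have h1 : H =ᶠ[𝓝 (z, (0 : Plane))] fun _ => l := by
    filter_upwards [hΦ.eventually_ball z, (hΦ.contMDiffAt (w := (z, 0)) hΦ.zero_mem).continuousAt
      (hO.mem_nhds hz.1)] with w hw hw'
    exact hΦ.factor_const w.1 w.2 hw ⟨hw', hΦ.mem_cosphere w.1 w.2 hw⟩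
  have h2 : fderiv ℝ (fderiv ℝ H) (z, (0 : Plane)) = 0 := by
    have h3 : fderiv ℝ H =ᶠ[𝓝 (z, (0 : Plane))] fun _ => 0 := by
      filter_upwards [h1.eventuallyEq_nhds] with w hw
      rw [hw.fderiv_eq]
      exact fderiv_const_apply _
    rw [h3.fderiv_eq]
    exact fderiv_const_apply _
  ext x
  simp [modelB, h2]

theorem modelHess_eq_zero {z : ℝ} (hz : ∀ᶠ q in 𝓝 (σ (l * z)), A q = 0) :
    modelHess (pertVelocity A ∘ Φ) z = 0 := by
  have hc : Φ (z, 0) = lift F σ (l * z) := hΦ.core z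
  have h1 : pertVelocity A ∘ Φ =ᶠ[𝓝 (z, (0 : Plane))] fun _ => 0 := by
    have h2 : ContinuousAt (fun w => (Φ w).1) (z, (0 : Plane)) :=
      (FiberBundle.continuous_proj (Plane →L[ℝ] ℝ) (fun q : S => Cot q)).continuousAt.comp
        (hΦ.contMDiffAt (w := (z, 0)) hΦ.zero_mem).continuousAt
    have h3 : (Φ (z, 0)).1 = σ (l * z) := by rw [hc]; rfl
    rw [ContinuousAt, h3] at h2
    filter_upwards [h2.eventually hz] with w hw
    simp only [Function.comp, pertVelocity]
    rw [hw]
    simp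
  have h2 : fderiv ℝ (fderiv ℝ (pertVelocity A ∘ Φ)) (z, (0 : Plane)) = 0 := by
    have h3 : fderiv ℝ (pertVelocity A ∘ Φ) =ᶠ[𝓝 (z, (0 : Plane))] fun _ => 0 := by
      filter_upwards [h1.eventuallyEq_nhds] with w hw
      rw [hw.fderiv_eq]
      exact fderiv_const_apply _
    rw [h3.fderiv_eq]
    exact fderiv_const_apply _
  funext x x'
  simp [modelHess, h2]

/-- Both derivatives are read in one fixed chart, where periodicity of `Φ` compares them. The frame
after one turn is therefore expressed in the initial basis, and the return map has the matrix
`R(1)`. -/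
theorem modelD_period : modelD Φ (1, 0) = modelD Φ (0, 0) := by
  have hp : Φ (1, 0) = Φ (0, 0) := by
    have := hΦ.periodic 0 0 hΦ.zero_mem
    rwa [zero_add] at this
  have hs := mem_cotChart_source (Φ (0, 0))
  have hs' : Φ (1, 0) ∈ (cotChart (Φ (0, 0)).1).source := by rwa [hp]
  refine ContinuousLinearMap.ext fun u => ?_
  have h1 := hΦ.fderiv_coord (w := (0, 0)) hΦ.zero_mem hs u
  have h2 := hΦ.fderiv_coord (w := (1, 0)) hΦ.zero_mem hs' u
  rw [hp] at h2
  rw [chartD_self] at h1 h2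
  refine h2.symm.trans (Eq.trans ?_ h1)
  have h3 : (fun w => cotChart (Φ (0, 0)).1 (Φ w)) =ᶠ[𝓝 (0, (0 : Plane))]
      fun w => cotChart (Φ (0, 0)).1 (Φ (w + (1, 0))) := by
    filter_upwards [hΦ.eventually_ball 0] with w hw
    have h4 : Φ (w + (1, 0)) = Φ w := by
      have := hΦ.periodic w.1 w.2 hw
      rw [← this]
      congr 1
      exact Prod.ext rfl (add_zero _)
    rw [h4]
  rw [h3.fderiv_eq, fderiv_comp_add_right (f := fun w => cotChart (Φ (0, 0)).1 (Φ w))]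
  congr 2
  simp

theorem core_zero : Φ (0, 0) = lift F σ 0 := by
  have := hΦ.core 0
  rwa [mul_zero] at this

theorem isContact_core (hF : IsFinslerMetric F) (x : Plane) :
    IsContact F (lift F σ 0) (modelD Φ (0, 0) (0, x)) := by
  have := hΦ.isContact_modelD hF 0 x
  rwa [hΦ.core_zero] at this

theorem exists_core_eq (hF : IsFinslerMetric F) (X : contactPlane F (lift F σ 0)) :
    ∃ x : Plane, modelD Φ (0, 0) (0, x) = contactVec X := by
  have h : IsContact F (Φ (0, 0)) (contactVec X) := by
    rw [hΦ.core_zero]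
    exact X.2
  exact hΦ.exists_modelD_eq hF h

/-- The basis of the contact plane given by the local model. -/
theorem exists_basis (hF : IsFinslerMetric F) :
    ∃ b : Module.Basis (Fin 2) ℝ (contactPlane F (lift F σ 0)),
      ∀ i, contactVec (b i) = modelD Φ (0, 0) (0, basisVec i) := by
  set v : Fin 2 → contactPlane F (lift F σ 0) := fun i => ⟨_, hΦ.isContact_core hF (basisVec i)⟩
  have hsum : ∀ c : Fin 2 → ℝ, contactVec (∑ i, c i • v i) =
      modelD Φ (0, 0) (0, ∑ i, c i • basisVec i) := by
    intro c
    have h1 : ((0, ∑ i, c i • basisVec i) : ℝ × Plane) =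
        c 0 • (0, basisVec 0) + c 1 • (0, basisVec 1) := by
      simp [Fin.sum_univ_two]
    rw [h1, map_add, map_smul, map_smul, Fin.sum_univ_two]
    rfl
  have hli : LinearIndependent ℝ v := by
    rw [Fintype.linearIndependent_iff]
    intro c hc
    have h1 := hsum c
    rw [hc] at h1
    have h2 : modelD Φ (0, 0) (0, ∑ i, c i • basisVec i) = modelD Φ (0, 0) 0 := by
      rw [map_zero]
      exact h1.symm
    have h3 := congrArg Prod.snd (hΦ.immersive 0 0 hΦ.zero_mem h2)
    intro i
    have h4 := congrArg (fun x : Plane => x i) h3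
    fin_cases i <;> simpa [Fin.sum_univ_two, basisVec] using h4
  have hsp : ⊤ ≤ Submodule.span ℝ (range v) := by
    intro X _
    obtain ⟨x, hx⟩ := hΦ.exists_core_eq hF X
    have h1 : X = ∑ i, x i • v i := by
      refine contactVec_injective ?_
      rw [hsum, ← hx, ← plane_eq_sum]
    rw [h1]
    exact Submodule.sum_mem _ fun i _ => Submodule.smul_mem _ _ (Submodule.subset_span ⟨i, rfl⟩)
  refine ⟨Module.Basis.mk hli hsp, fun i => ?_⟩
  rw [Module.Basis.mk_apply]
  rfl

theorem continuous_modelHess (hA : ContMDiff cotModel 𝓘(ℝ, ℝ) ∞ (quad A))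
    {R : ℝ → Plane →L[ℝ] Plane} (hR : Continuous R) (x x' : Plane) :
    Continuous fun z => modelHess (pertVelocity A ∘ Φ) z (R z x) (R z x') := by
  have hl : l ≠ 0 := by
    rw [← hΦ.factor_core 0]
    exact (hΦ.factor_pos 0 0 hΦ.zero_mem).ne'
  refine ((hΦ.continuous_modelForcing hA hR x x').comp (continuous_const_mul l)).congr fun z => ?_
  simp only [Function.comp, modelForcing]
  rw [mul_div_cancel_left₀ _ hl]

/-- The integral of the Hessians along the linearized flow reduces to the arc that carries the
perturbation, on which the linearized flow is constant. -/
theorem integral_modelForcing (hl : 0 < l) {R : ℝ → Plane →L[ℝ] Plane}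
    (hR : ∀ z, HasDerivAt R (modelB l H z * R z) z) {t₀ ε : ℝ} (hε : 0 < ε) (hleft : 0 ≤ t₀ - ε)
    (hright : t₀ + ε ≤ 1) (hU₁ : ∃ O : Set (CotBundle S), IsOpen O ∧ U₁ = O ∩ cosphere F)
    (harc : ∀ z ∈ Ioo (t₀ - ε) (t₀ + ε), Φ (z, 0) ∈ U₁)
    (hA : ContMDiff cotModel 𝓘(ℝ, ℝ) ∞ (quad A))
    (hA0 : ∀ z ∈ Icc 0 1, z ∉ Ioo (t₀ - ε) (t₀ + ε) → ∀ᶠ q in 𝓝 (σ (l * z)), A q = 0)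
    (x x' : Plane) : ∫ t in 0..l, modelForcing A Φ l R t x x' =
      l * ∫ z in (t₀ - ε)..(t₀ + ε), modelHess (pertVelocity A ∘ Φ) z (R t₀ x) (R t₀ x') := by
  -- On the open arc this holds because `H` is locally constant; continuity extends it to the
  -- endpoints, so `R` is constant on the closed interval.
  have hB0 : ∀ z ∈ Icc (t₀ - ε) (t₀ + ε), modelB l H z = 0 := by
    have h1 : IsClosed {z | modelB l H z = 0} := isClosed_eq hΦ.continuous_modelB continuous_const
    have h2 := h1.closure_subset_iff.2 fun z hz => hΦ.modelB_eq_zero hU₁ (harc z hz)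
    rwa [closure_Ioo (by linarith)] at h2
  have hRc : ∀ z ∈ Icc (t₀ - ε) (t₀ + ε), R z = R t₀ := by
    have h1 : ∀ z ∈ Icc (t₀ - ε) (t₀ + ε), R z = R (t₀ - ε) := fun z hz =>
      eq_left_of_hasDerivWithinAt_zero (fun u hu => by
        have := (hR u).hasDerivWithinAt (s := Icc (t₀ - ε) (t₀ + ε))
        rwa [hB0 u hu, zero_mul] at this) hz
    intro z hz
    rw [h1 z hz, h1 t₀ ⟨by linarith, by linarith⟩]
  have hRcont : Continuous R := continuous_iff_continuousAt.2 fun z => (hR z).continuousAt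
  set f : ℝ → ℝ := fun z => modelHess (pertVelocity A ∘ Φ) z (R z x) (R z x') with hf
  have hfc : Continuous f := hΦ.continuous_modelHess hA hRcont x x'
  -- This factor `l` from the substitution `t = l z` will cancel the factor `l` in `symp_modelD`.
  have h1 : ∫ t in 0..l, modelForcing A Φ l R t x x' = l * ∫ z in 0..1, f z := by
    have := intervalIntegral.integral_comp_div (a := 0) (b := l) f hl.ne'
    rw [zero_div, div_self hl.ne', smul_eq_mul] at this
    exact this
  have hz : ∀ z ∈ Icc (0 : ℝ) 1, z ∉ Ioo (t₀ - ε) (t₀ + ε) → f z = 0 := fun z hz hz' => by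
    rw [hf]
    simp only [hΦ.modelHess_eq_zero (hA0 z hz hz')]
    rfl
  have hint := fun a b => hfc.intervalIntegrable (μ := MeasureTheory.volume) a b
  rw [h1, ← intervalIntegral.integral_add_adjacent_intervals (hint 0 (t₀ - ε)) (hint _ 1),
    ← intervalIntegral.integral_add_adjacent_intervals (hint (t₀ - ε) (t₀ + ε)) (hint _ 1),
    intervalIntegral.integral_congr (g := fun _ => (0 : ℝ)) (a := 0) (b := t₀ - ε),
    intervalIntegral.integral_congr (g := fun _ => (0 : ℝ)) (a := t₀ + ε) (b := 1)]
  · rw [intervalIntegral.integral_zero, intervalIntegral.integral_zero, zero_add, add_zero]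
    congr 1
    refine intervalIntegral.integral_congr fun z hz => ?_
    rw [uIcc_of_le (by linarith)] at hz
    simp only [hf, hRc z hz]
  · intro z hz'
    rw [uIcc_of_le hright] at hz'
    exact hz z ⟨by linarith [hz'.1], hz'.2⟩ fun h => by linarith [h.2, hz'.1]
  · intro z hz'
    rw [uIcc_of_le hleft] at hz'
    exact hz z ⟨hz'.1, by linarith [hz'.2]⟩ fun h => by linarith [h.1, hz'.2]

theorem integral_modelHess (hA : ContMDiff cotModel 𝓘(ℝ, ℝ) ∞ (quad A)) (a b : ℝ)
    (h : Matrix (Fin 2) (Fin 2) ℝ)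
    (hh : ∀ i j, h i j = ∫ z in a..b, hessX (pertVelocity A ∘ Φ) z i j)
    (R : Plane →L[ℝ] Plane) (j k : Fin 2) :
    ∫ z in a..b, modelHess (pertVelocity A ∘ Φ) z (R (basisVec j)) (R (basisVec k)) =
      ((planeMatrix R).transpose * h * planeMatrix R) j k := by
  have hk : ∀ z, ContDiffAt ℝ 2 (pertVelocity A ∘ Φ) (z, 0) := fun z =>
    (hΦ.contDiffAt_pertVelocity hA z).of_le two_le_infty
  have hc : ∀ i j, IntervalIntegrable (fun z => hessX (pertVelocity A ∘ Φ) z i j)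
      MeasureTheory.volume a b := by
    intro i j
    refine Continuous.intervalIntegrable ?_ _ _
    refine (hΦ.continuous_modelHess (R := fun _ => 1) hA continuous_const
      (basisVec i) (basisVec j)).congr fun z => ?_
    rw [hessX_eq (hk z)]
    rfl
  simp only [modelHess_eq (hk _)]
  rw [intervalIntegral.integral_add, intervalIntegral.integral_add, intervalIntegral.integral_add]
  · simp only [intervalIntegral.integral_const_mul, ← hh]
    simp [Matrix.mul_apply, Fin.sum_univ_two, planeMatrix]
    ring
  all_goals
    first
    | exact (hc _ _).const_mul _
    | exact ((hc _ _).const_mul _).add ((hc _ _).const_mul _)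
    | exact (((hc _ _).const_mul _).add ((hc _ _).const_mul _)).add ((hc _ _).const_mul _)

set_option maxHeartbeats 1000000 in
/-- The derivative of the return map in the basis given by the local model. -/
theorem hasEndDerivAtZero [T2Space S] [CompactSpace S] (hF : IsFinslerMetric F)
    (hσ : IsClosedGeodesic F σ l) (hA : IsAdmissible F (lift F σ) W A)
    {R : ℝ → Plane →L[ℝ] Plane} (hR0 : R 0 = 1)
    (hR : ∀ z, HasDerivAt R (modelB l H z * R z) z) {t₀ ε : ℝ} (hε : 0 < ε) (hleft : 0 ≤ t₀ - ε)
    (hright : t₀ + ε ≤ 1) (hU₁ : ∃ O : Set (CotBundle S), IsOpen O ∧ U₁ = O ∩ cosphere F)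
    (harc : ∀ z ∈ Ioo (t₀ - ε) (t₀ + ε), Φ (z, 0) ∈ U₁)
    (hA0 : ∀ z ∈ Icc 0 1, z ∉ Ioo (t₀ - ε) (t₀ + ε) → ∀ᶠ q in 𝓝 (σ (l * z)), A q = 0)
    {b : Module.Basis (Fin 2) ℝ (contactPlane F (lift F σ 0))}
    (hb : ∀ i, contactVec (b i) = modelD Φ (0, 0) (0, basisVec i)) :
    (∀ j, contactVec (linearizedReturnMap F (pert A 0) l (lift F σ 0) (b j)) =
      modelD Φ (0, 0) (0, planeMatrix (R 1) 0 j • basisVec 0 + planeMatrix (R 1) 1 j • basisVec 1)) ∧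
    ∀ (N : Matrix (Fin 2) (Fin 2) ℝ) (D : contactPlane F (lift F σ 0) →ₗ[ℝ] contactPlane F (lift F σ 0)),
      N = planeMatrix (R 1) * (planeMatrix (R t₀))⁻¹ *
        hessIntegral (pertVelocity A ∘ Φ) (t₀ - ε) (t₀ + ε) * planeMatrix (R t₀) →
      (∀ j, contactVec (D (b j)) =
        modelD Φ (0, 0) (0, N 0 j • basisVec 0 + N 1 j • basisVec 1)) →
      HasEndDerivAtZero (fun s => linearizedReturnMap F (pert A s) l (lift F σ 0)) D := by
  obtain ⟨L, hL⟩ := hA.exists_isModelFamily hF hσ hΦ hR hσ.length_pos.le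
  have hfs := isFundamentalSolution_planeMatrix hΦ.contDiffAt_factor_core hR0 hR
  have hdet := hfs.det_eq_one hΦ.contDiffAt_factor_core
  have hfr0 : ∀ x, modelFrame Φ R (0 / l) x = modelD Φ (0, 0) (0, x) := fun x => by
    rw [zero_div, modelFrame, hR0]
    rfl
  have hfr1 : ∀ x, modelFrame Φ R (l / l) x = modelD Φ (0, 0) (0, R 1 x) := fun x => by
    rw [div_self hσ.length_pos.ne', modelFrame, hΦ.modelD_period]
  have hframe : ∀ x, L 0 (modelD Φ (0, 0) (0, x)) = modelD Φ (0, 0) (0, R 1 x) := fun x => by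
    rw [← hfr0, ← hfr1]
    exact hL.frame x
  have hpair : ∀ x x', symp (deriv L 0 (modelD Φ (0, 0) (0, x))) (modelD Φ (0, 0) (0, R 1 x')) =
      ∫ t in 0..l, modelForcing A Φ l R t x x' := fun x x' => by
    rw [← hfr0, ← hfr1]
    exact hL.pairing x x'
  constructor
  · intro j
    rw [hL.linearizedReturnMap_eq hF hσ hA.smooth pertDefined_zero, hb, hframe]
    congr 2
    have := plane_eq_sum (R 1 (basisVec j))
    rwa [Fin.sum_univ_two] at this
  intro N D hN hDN
  set h : Matrix (Fin 2) (Fin 2) ℝ := Matrix.of fun i j =>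
    ∫ z in (t₀ - ε)..(t₀ + ε), hessX (pertVelocity A ∘ Φ) z i j with hh
  have hk : ∀ z, ContDiffAt ℝ 2 (pertVelocity A ∘ Φ) (z, 0) := fun z =>
    (hΦ.contDiffAt_pertVelocity hA.smooth z).of_le two_le_infty
  have hK : hessIntegral (pertVelocity A ∘ Φ) (t₀ - ε) (t₀ + ε) = -(stdJ * h) := by
    ext i j
    rw [Matrix.neg_apply]
    fin_cases i
    · simp only [Fin.zero_eta, hessIntegral, Matrix.of_apply, stdJ_mul_zero,
        intervalIntegral.integral_neg, hh]
    · simp only [Fin.mk_one, hessIntegral, Matrix.of_apply, stdJ_mul_one, hh]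
  have hsymm : h 0 1 = h 1 0 := intervalIntegral.integral_congr fun z _ => hessX_symm (hk z) 0 1
  have hL' := hL.differentiable.hasDerivAt
  have hcon : ∀ X, IsContact F (lift F σ 0) X → IsContact F (lift F σ 0) (deriv L 0 X) :=
    fun X hX => isContact_deriv hF (hσ.lift_mem hF 0) (fun s => hL.contact_period hσ s X hX)
      ((ContinuousLinearMap.apply ℝ Mod X).hasFDerivAt.comp_hasDerivAt (0 : ℝ) hL')
  have hD : D = restrictContact (deriv L 0) hcon := by
    refine b.ext fun j => contactVec_injective ?_
    obtain ⟨x, hx⟩ := hΦ.exists_core_eq hF (restrictContact (deriv L 0) hcon (b j))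
    rw [hDN, ← hx]
    rw [contactVec_restrictContact, hb] at hx
    -- The `j`-th column of the true derivative and that of the candidate `N` have the same area
    -- pairing with the columns of `R(1)`. As `det R(1) = 1`, Cramer's rule recovers both components
    -- from the cases `k = 0, 1`.
    have h1 : ∀ k, x 0 * planeMatrix (R 1) 1 k - x 1 * planeMatrix (R 1) 0 k =
        N 0 j * planeMatrix (R 1) 1 k - N 1 j * planeMatrix (R 1) 0 k := by
      intro k
      rw [hN, pairing_derivMatrix (hdet 1) (hdet t₀) hK hsymm,
        ← hΦ.integral_modelHess hA.smooth (t₀ - ε) (t₀ + ε) h (fun i j => rfl)]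
      have h2 := hpair (basisVec j) (basisVec k)
      rw [← hx, hΦ.symp_modelD hF, hΦ.integral_modelForcing hσ.length_pos hR hε hleft hright hU₁
        harc hA.smooth hA0] at h2
      exact mul_left_cancel₀ hσ.length_pos.ne' h2
    have h3 := hdet 1
    rw [Matrix.det_fin_two] at h3
    have h4 : x 0 = N 0 j := by
      linear_combination (x 0 - N 0 j) * (-h3) + planeMatrix (R 1) 0 0 * h1 1 -
        planeMatrix (R 1) 0 1 * h1 0
    have h5 : x 1 = N 1 j := by
      linear_combination (x 1 - N 1 j) * (-h3) + planeMatrix (R 1) 1 0 * h1 1 -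
        planeMatrix (R 1) 1 1 * h1 0
    congr 2
    rw [plane_eq_sum x, Fin.sum_univ_two, h4, h5]
  exact hL.hasEndDerivAtZero hF hσ hA.smooth hL' fun X => by
    rw [hD]
    rfl

theorem exists_fundamentalFlow : ∃ R : ℝ → Plane →L[ℝ] Plane, R 0 = 1 ∧
    ∀ z, HasDerivAt R (modelB l H z * R z) z := by
  obtain ⟨R, -, h0, hR, -⟩ := exists_fundamental (modelB l H) hΦ.continuous_modelB 0
  exact ⟨R, h0, hR⟩

end IsLocalModel

/-- An admissible perturbation vanishes near the part of the geodesic outside of the arc. -/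
theorem IsAdmissible.eventually_eq_zero (hσ : IsClosedGeodesic F σ l)
    (hA : IsAdmissible F (lift F σ) (TotalSpace.proj '' U₁) A) {t₀ ε : ℝ} (hleft : 0 ≤ t₀ - ε)
    (hU₁σ : ∀ t ∈ Ico 0 l, σ t ∈ TotalSpace.proj '' U₁ →
      t ∈ Ioo (l * (t₀ - ε)) (l * (t₀ + ε))) :
    ∀ z ∈ Icc (0 : ℝ) 1, z ∉ Ioo (t₀ - ε) (t₀ + ε) → ∀ᶠ q in 𝓝 (σ (l * z)), A q = 0 := by
  have hl := hσ.length_pos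
  have key : ∀ q, q ∉ TotalSpace.proj '' U₁ → ∀ᶠ q' in 𝓝 q, A q' = 0 := by
    intro q hq
    have h1 : q ∈ (closure {q | A q ≠ 0})ᶜ := fun h => hq (hA.support h)
    filter_upwards [isClosed_closure.isOpen_compl.mem_nhds h1] with q' hq'
    by_contra h
    exact hq' (subset_closure h)
  intro z hz hz'
  refine key _ fun h => ?_
  rcases hz.2.lt_or_eq with h1 | rfl
  · have h2 := hU₁σ (l * z) ⟨mul_nonneg hl.le hz.1, by nlinarith⟩ h
    exact hz' ⟨lt_of_mul_lt_mul_left h2.1 hl.le, lt_of_mul_lt_mul_left h2.2 hl.le⟩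
  -- At `z = 1` the hypothesis on times in `[0, l)` is used at time `0`, which is not in the open
  -- arc because `t₀ - ε ≥ 0`.
  · have h2 : σ (l * 1) = σ 0 := by
      have := hσ.periodic 0
      rwa [zero_add, ← mul_one l] at this
    rw [h2] at h
    have h3 := hU₁σ 0 ⟨le_rfl, hl⟩ h
    have h4 := mul_nonneg hl.le hleft
    linarith [h3.1]

end LocalModel

section Formula

variable {S : Type*} [TopologicalSpace S] [ChartedSpace Plane S] [IsManifold (𝓡 2) ∞ S]
  {F : TangentBundle (𝓡 2) S → ℝ} {σ : ℝ → S} {l : ℝ} {U₁ : Set (CotBundle S)}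
  {δ : ℝ} {Φ : ℝ × Plane → CotBundle S} {H : ℝ × Plane → ℝ}

theorem contactVec_toLin {b : Module.Basis (Fin 2) ℝ (contactPlane F (lift F σ 0))}
    (hb : ∀ i, contactVec (b i) = modelD Φ (0, 0) (0, basisVec i))
    (M : Matrix (Fin 2) (Fin 2) ℝ) (j : Fin 2) :
    contactVec (Matrix.toLin b b M (b j)) =
      modelD Φ (0, 0) (0, M 0 j • basisVec 0 + M 1 j • basisVec 1) := by
  have h1 : ((0, M 0 j • basisVec 0 + M 1 j • basisVec 1) : ℝ × Plane) =
      M 0 j • (0, basisVec 0) + M 1 j • (0, basisVec 1) := by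
    simp
  have h2 : modelD Φ (0, 0) (0, M 0 j • basisVec 0 + M 1 j • basisVec 1) =
      M 0 j • contactVec (b 0) + M 1 j • contactVec (b 1) := by
    rw [h1, map_add, map_smul, map_smul, hb, hb]
  exact (congrArg contactVec ((Matrix.toLin_self b b M j).trans (Fin.sum_univ_two _))).trans h2.symm

set_option maxHeartbeats 1000000 in
/-- The formula for the derivative of the return map in a local model. -/
theorem IsLocalModel.exists_derivative_formula [T2Space S] [CompactSpace S]
    (hΦ : IsLocalModel F (lift F σ) l U₁ δ Φ H) (hF : IsFinslerMetric F)
    (hσ : IsClosedGeodesic F σ l) {t₀ ε : ℝ} (hε : 0 < ε) (hleft : 0 ≤ t₀ - ε)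
    (hright : t₀ + ε ≤ 1) (hU₁ : ∃ O : Set (CotBundle S), IsOpen O ∧ U₁ = O ∩ cosphere F)
    (hU₁γ : U₁ ∩ range (lift F σ) = lift F σ '' Ioo (l * (t₀ - ε)) (l * (t₀ + ε)))
    (hU₁σ : ∀ t ∈ Ico 0 l, σ t ∈ TotalSpace.proj '' U₁ →
      t ∈ Ioo (l * (t₀ - ε)) (l * (t₀ + ε))) :
    ∃ b : Module.Basis (Fin 2) ℝ (contactPlane F (lift F σ 0)),
      (∀ i : Fin 2,
        (⟨lift F σ 0, (b i : TangentSpace cotModel (lift F σ 0))⟩ :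
            TangentBundle cotModel (CotBundle S)) =
          ⟨Φ (0, 0), mfderiv 𝓘(ℝ, ℝ × Plane) cotModel Φ (0, 0)
            ((0, EuclideanSpace.single i 1) : ℝ × Plane)⟩) ∧
      ∃ R₀ : ℝ → Matrix (Fin 2) (Fin 2) ℝ, IsFundamentalSolution l H R₀ ∧
        ∀ A : (q : S) → LinearMap.BilinForm ℝ (Cot q),
          IsAdmissible F (lift F σ) (TotalSpace.proj '' U₁) A →
          HasEndDerivAtZero (fun s => linearizedReturnMap F (pert A s) l (lift F σ 0))
            (Matrix.toLin b b
              (LinearMap.toMatrix b b (linearizedReturnMap F (pert A 0) l (lift F σ 0)) *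
                (R₀ t₀)⁻¹ * hessIntegral (pertVelocity A ∘ Φ) (t₀ - ε) (t₀ + ε) * R₀ t₀)) := by
  obtain ⟨b, hb⟩ := hΦ.exists_basis hF
  obtain ⟨R, hR0, hR⟩ := hΦ.exists_fundamentalFlow
  refine ⟨b, fun i => ?_, fun z => planeMatrix (R z),
    isFundamentalSolution_planeMatrix hΦ.contDiffAt_factor_core hR0 hR, fun A hA => ?_⟩
  · have key : ∀ (e e' : CotBundle S) (v v' : Mod), e = e' → v = v' →
        (⟨e, v⟩ : TangentBundle cotModel (CotBundle S)) = ⟨e', v'⟩ := by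
      rintro _ _ _ _ rfl rfl
      rfl
    exact key _ _ _ _ hΦ.core_zero.symm (hb i)
  · have h1 : ∀ z ∈ Ioo (t₀ - ε) (t₀ + ε), Φ (z, 0) ∈ U₁ := fun z hz => by
      have h1 : lift F σ (l * z) ∈ lift F σ '' Ioo (l * (t₀ - ε)) (l * (t₀ + ε)) :=
        ⟨_, ⟨mul_lt_mul_of_pos_left hz.1 hσ.length_pos, mul_lt_mul_of_pos_left hz.2 hσ.length_pos⟩,
          rfl⟩
      rw [← hU₁γ] at h1
      rw [hΦ.core]
      exact h1.1
    obtain ⟨h2, h3⟩ := hΦ.hasEndDerivAtZero hF hσ hA hR0 hR hε hleft hright hU₁ h1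
      (hA.eventually_eq_zero hσ hleft hU₁σ) hb
    have h5 := toMatrix_eq_of_toLin b fun j =>
      contactVec_injective ((h2 j).trans (contactVec_toLin hb (planeMatrix (R 1)) j).symm)
    exact h3 _ _ (congrArg (fun M => M * (planeMatrix (R t₀))⁻¹ *
      hessIntegral (pertVelocity A ∘ Φ) (t₀ - ε) (t₀ + ε) * planeMatrix (R t₀)) h5)
      fun j => contactVec_toLin hb _ j

end Formula

/-! ### Linear algebra for the choice of coefficients. -/

/-- Averages of matrices close to an invertible one are invertible. -/
theorem exists_det_integral_ne_zero {n : ℕ} {K : ℝ → Fin n → Fin n → ℝ} (hK : Continuous K) {t₀ : ℝ}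
    (h : (Matrix.of (K t₀)).det ≠ 0) : ∃ r > 0, ∀ (ψ : ℝ → ℝ) (a b : ℝ), a ≤ b → Continuous ψ →
      (∀ t, 0 ≤ ψ t) → (∀ t ∈ Icc a b, ψ t ≠ 0 → |t - t₀| < r) → 0 < ∫ t in a..b, ψ t →
      (Matrix.of fun i j => ∫ t in a..b, ψ t * K t i j).det ≠ 0 := by
  have hdet : Continuous fun k : Fin n → Fin n → ℝ => (Matrix.of k).det :=
    Continuous.matrix_det (continuous_pi fun i => continuous_pi fun j =>
      (continuous_apply j).comp (continuous_apply i))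
  obtain ⟨η, hη, hball⟩ := Metric.isOpen_iff.1 (isOpen_ne_fun hdet continuous_const) (K t₀) h
  obtain ⟨r, hr, hKr⟩ := Metric.continuousAt_iff.1 (hK.continuousAt (x := t₀)) (η / 2) (by linarith)
  refine ⟨r, hr, fun ψ a b hab hψ h0 hsupp hpos => ?_⟩
  set m := ∫ t in a..b, ψ t with hm
  have hKij : ∀ i j, Continuous fun t => K t i j := fun i j =>
    (continuous_apply j).comp ((continuous_apply i).comp hK)
  -- The normalized average stays within `η / 2` of `K t₀`, since the weight is supported where `K`
  -- does. Dividing by the mass `m` does not affect the nonvanishing of the determinant.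
  have h1 : (fun i j => m⁻¹ * ∫ t in a..b, ψ t * K t i j) ∈ Metric.ball (K t₀) η := by
    rw [Metric.mem_ball]
    refine lt_of_le_of_lt ((dist_pi_le_iff (by linarith)).2 fun i =>
      (dist_pi_le_iff (by linarith)).2 fun j => ?_) (half_lt_self hη)
    have h2 : ∫ t in a..b, ψ t * (K t i j - K t₀ i j) =
        (∫ t in a..b, ψ t * K t i j) - m * K t₀ i j := by
      simp only [mul_sub]
      rw [intervalIntegral.integral_sub, intervalIntegral.integral_mul_const]
      · exact (hψ.mul (hKij i j)).intervalIntegrable _ _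
      · exact (hψ.mul continuous_const).intervalIntegrable _ _
    have h3 : |∫ t in a..b, ψ t * (K t i j - K t₀ i j)| ≤ ∫ t in a..b, ψ t * (η / 2) := by
      refine (intervalIntegral.abs_integral_le_integral_abs hab).trans
        (intervalIntegral.integral_mono_on hab ?_ ?_ fun t ht => ?_)
      · exact (hψ.mul ((hKij i j).sub continuous_const)).abs.intervalIntegrable _ _
      · exact (hψ.mul continuous_const).intervalIntegrable _ _
      · rw [abs_mul, abs_of_nonneg (h0 t)]
        rcases eq_or_ne (ψ t) 0 with h4 | h4
        · rw [h4, zero_mul, zero_mul]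
        · refine mul_le_mul_of_nonneg_left ?_ (h0 t)
          have h5 := hKr (by rw [Real.dist_eq]; exact hsupp t ht h4)
          exact ((dist_le_pi_dist (K t i) (K t₀ i) j).trans
            (dist_le_pi_dist (K t) (K t₀) i)).trans h5.le
    rw [h2, intervalIntegral.integral_mul_const, ← hm] at h3
    rw [Real.dist_eq]
    have h6 : m⁻¹ * (∫ t in a..b, ψ t * K t i j) - K t₀ i j =
        m⁻¹ * ((∫ t in a..b, ψ t * K t i j) - m * K t₀ i j) := by
      field_simp
    rw [h6, abs_mul, abs_of_pos (inv_pos.2 hpos)]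
    calc m⁻¹ * _ ≤ m⁻¹ * (m * (η / 2)) := mul_le_mul_of_nonneg_left h3 (inv_pos.2 hpos).le
      _ = η / 2 := by field_simp
  have h7 : (Matrix.of fun i j => m⁻¹ * ∫ t in a..b, ψ t * K t i j) =
      m⁻¹ • Matrix.of fun i j => ∫ t in a..b, ψ t * K t i j := rfl
  have h8 := hball h1
  rw [mem_ofPred_eq, h7, Matrix.det_smul] at h8
  exact right_ne_zero_of_mul h8

/-- The matrix of the action of a change of basis on quadratic forms in two variables. -/
def symSq (x y : ℝ × ℝ) : Fin 3 → Fin 3 → ℝ :=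
  ![![x.1 * x.1, 2 * (x.1 * x.2), x.2 * x.2],
    ![x.1 * y.1, x.1 * y.2 + x.2 * y.1, x.2 * y.2],
    ![y.1 * y.1, 2 * (y.1 * y.2), y.2 * y.2]]

/-- The symmetric square of a 2 by 2 matrix has the cube of its determinant as determinant, so it is
invertible together with the matrix. -/
theorem det_symSq (x y : ℝ × ℝ) : (Matrix.of (symSq x y)).det = (x.1 * y.2 - x.2 * y.1) ^ 3 := by
  rw [Matrix.det_fin_three]
  simp [symSq]
  ring

/-! ### Hessians of quadratic polynomials in functions that vanish at a point. -/

section SecondDerivative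

variable {E : Type*} [NormedAddCommGroup E] [NormedSpace ℝ E] {f g ψ : E → ℝ} {y : E}

theorem hasFDerivAt_mul_of_eq_zero (hf : DifferentiableAt ℝ f y) (hg : DifferentiableAt ℝ g y)
    (hf0 : f y = 0) (hg0 : g y = 0) : HasFDerivAt (fun z => f z * g z) (0 : E →L[ℝ] ℝ) y := by
  have h : HasFDerivAt (fun z => f z * g z) _ y := hf.hasFDerivAt.mul hg.hasFDerivAt
  exact h.congr_fderiv (by rw [hf0, hg0, zero_smul, zero_smul, add_zero])

theorem fderiv_fderiv_mul (hf : ContDiffAt ℝ 2 f y) (hg : ContDiffAt ℝ 2 g y) (hf0 : f y = 0)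
    (hg0 : g y = 0) (u v : E) : fderiv ℝ (fderiv ℝ fun z => f z * g z) y u v =
      fderiv ℝ f y u * fderiv ℝ g y v + fderiv ℝ g y u * fderiv ℝ f y v := by
  have h1 : fderiv ℝ (fun z => f z * g z) =ᶠ[𝓝 y]
      fun z => f z • fderiv ℝ g z + g z • fderiv ℝ f z := by
    filter_upwards [hf.eventually (by simp), hg.eventually (by simp)] with z hz hz'
    exact ((hz.differentiableAt (by simp)).hasFDerivAt.mul
      (hz'.differentiableAt (by simp)).hasFDerivAt).fderiv
  have hd : ∀ {k : E → ℝ}, ContDiffAt ℝ 2 k y →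
      HasFDerivAt (fderiv ℝ k) (fderiv ℝ (fderiv ℝ k) y) y := fun hk =>
    ((hk.fderiv_right (m := 1) (by norm_num)).differentiableAt (by simp)).hasFDerivAt
  have h2 : HasFDerivAt (fun z => f z • fderiv ℝ g z + g z • fderiv ℝ f z) _ y :=
    ((hf.differentiableAt (by simp)).hasFDerivAt.smul (hd hg)).add
      ((hg.differentiableAt (by simp)).hasFDerivAt.smul (hd hf))
  rw [h1.fderiv_eq, h2.fderiv, hf0, hg0, zero_smul, zero_smul, zero_add, zero_add]
  simp

/-- A quadratic polynomial in two functions. -/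
def quadPoly (k : Fin 3 → ℝ) (a b : ℝ) : ℝ := k 0 * (a * a) + 2 * k 1 * (a * b) + k 2 * (b * b)

theorem hasFDerivAt_quadPoly (k : Fin 3 → ℝ) (hψ : DifferentiableAt ℝ ψ y)
    (hf : DifferentiableAt ℝ f y) (hg : DifferentiableAt ℝ g y) (hf0 : f y = 0) (hg0 : g y = 0) :
    HasFDerivAt (fun z => ψ z * quadPoly k (f z) (g z)) (0 : E →L[ℝ] ℝ) y := by
  have h1 := ((((hasFDerivAt_mul_of_eq_zero hf hf hf0 hf0).const_mul (k 0)).add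
    ((hasFDerivAt_mul_of_eq_zero hf hg hf0 hg0).const_mul (2 * k 1))).add
    ((hasFDerivAt_mul_of_eq_zero hg hg hg0 hg0).const_mul (k 2)))
  have h2 : HasFDerivAt (fun z => ψ z * quadPoly k (f z) (g z)) _ y := hψ.hasFDerivAt.mul h1
  exact h2.congr_fderiv (by simp [hf0, hg0, quadPoly])

theorem fderiv_fderiv_quadPoly (k : Fin 3 → ℝ) (hψ : ContDiffAt ℝ 2 ψ y)
    (hf : ContDiffAt ℝ 2 f y) (hg : ContDiffAt ℝ 2 g y) (hf0 : f y = 0) (hg0 : g y = 0) (u v : E) :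
    fderiv ℝ (fderiv ℝ fun z => ψ z * quadPoly k (f z) (g z)) y u v =
      2 * ψ y * (k 0 * (fderiv ℝ f y u * fderiv ℝ f y v) +
        k 1 * (fderiv ℝ f y u * fderiv ℝ g y v + fderiv ℝ g y u * fderiv ℝ f y v) +
        k 2 * (fderiv ℝ g y u * fderiv ℝ g y v)) := by
  -- The polynomial is split as `F₁ f + F₂ g`, a sum of products of functions vanishing at `y`,
  -- whose Hessians involve first derivatives only.
  set F₁ : E → ℝ := fun z => ψ z * (k 0 * f z + k 1 * g z) with hF₁
  set F₂ : E → ℝ := fun z => ψ z * (k 1 * f z + k 2 * g z) with hF₂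
  have hs₁ : ContDiffAt ℝ 2 F₁ y := by fun_prop
  have hs₂ : ContDiffAt ℝ 2 F₂ y := by fun_prop
  have hd : ∀ a b, fderiv ℝ (fun z => ψ z * (a * f z + b * g z)) y =
      ψ y • (a • fderiv ℝ f y + b • fderiv ℝ g y) := by
    intro a b
    have h1 : HasFDerivAt (fun z => ψ z * (a * f z + b * g z)) _ y :=
      (hψ.differentiableAt (by simp)).hasFDerivAt.mul
      (((hf.differentiableAt (by simp)).hasFDerivAt.const_mul a).add
        ((hg.differentiableAt (by simp)).hasFDerivAt.const_mul b))
    rw [h1.fderiv]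
    simp [hf0, hg0]
  have hz₁ : F₁ y = 0 := by simp [hF₁, hf0, hg0]
  have hz₂ : F₂ y = 0 := by simp [hF₂, hf0, hg0]
  have hsum : (fun z => ψ z * quadPoly k (f z) (g z)) = fun z => F₁ z * f z + F₂ z * g z := by
    funext z
    simp only [hF₁, hF₂, quadPoly]
    ring
  have h3 : fderiv ℝ (fun z => F₁ z * f z + F₂ z * g z) =ᶠ[𝓝 y]
      fun z => fderiv ℝ (fun z => F₁ z * f z) z + fderiv ℝ (fun z => F₂ z * g z) z := by
    filter_upwards [(hs₁.mul hf).eventually (by simp), (hs₂.mul hg).eventually (by simp)]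
      with z hz hz'
    exact ((hz.differentiableAt (by simp)).hasFDerivAt.add
      (hz'.differentiableAt (by simp)).hasFDerivAt).fderiv
  have h4 : ∀ {k : E → ℝ}, ContDiffAt ℝ 2 k y → HasFDerivAt (fderiv ℝ k) (fderiv ℝ (fderiv ℝ k) y) y :=
    fun hk => ((hk.fderiv_right (m := 1) (by norm_num)).differentiableAt (by simp)).hasFDerivAt
  have h5 : HasFDerivAt (fun z => fderiv ℝ (fun z => F₁ z * f z) z +
      fderiv ℝ (fun z => F₂ z * g z) z) _ y := (h4 (hs₁.mul hf)).add (h4 (hs₂.mul hg))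
  rw [hsum, h3.fderiv_eq, h5.fderiv, add_apply, add_apply]
  refine (congrArg₂ (· + ·) (fderiv_fderiv_mul hs₁ hf hz₁ hf0 u v)
    (fderiv_fderiv_mul hs₂ hg hz₂ hg0 u v)).trans ?_
  rw [hd, hd]
  simp
  ring

end SecondDerivative

/-! ### Quadratic fields built from vector fields in a chart. -/

section ChartField

attribute [local instance] cotTopology cotChartedSpace cot_isManifold cot_isManifold_one
  continuousSMul_mod modDualNACG modDualNS modDualACG modDualACM
  modDualModule modDualTop modEndNACG modEndNS modDualDualNACG modDualDualNS

variable {S : Type*} [TopologicalSpace S] [ChartedSpace Plane S]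

/-- The evaluation of covectors at a vector. -/
def evalVec (q : S) (v : Plane) : Cot q →ₗ[ℝ] ℝ where
  toFun p := p v
  map_add' _ _ := rfl
  map_smul' _ _ := rfl

open Classical in
/-- A field of symmetric bilinear forms built in a chart from a cut-off function `ψ` and two
vector fields. -/
def chartField (q₀ : S) (ψ : Plane → ℝ) (m : Fin 2 → Plane → Plane) (k : Fin 3 → ℝ) (q : S) :
    LinearMap.BilinForm ℝ (Cot q) :=
  let x := extChartAt (𝓡 2) q₀ q
  let ev := fun i => evalVec q (tanPar q₀ x (m i x))
  if q ∈ (extChartAt (𝓡 2) q₀).source then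
    ψ x • (k 0 • LinearMap.BilinForm.linMulLin (ev 0) (ev 0) +
      k 1 • (LinearMap.BilinForm.linMulLin (ev 0) (ev 1) + LinearMap.BilinForm.linMulLin (ev 1) (ev 0)) +
      k 2 • LinearMap.BilinForm.linMulLin (ev 1) (ev 1))
  else 0

variable {q₀ : S} {ψ : Plane → ℝ} {m : Fin 2 → Plane → Plane} {k : Fin 3 → ℝ}

theorem chartField_symm (q : S) (p p' : Cot q) :
    chartField q₀ ψ m k q p p' = chartField q₀ ψ m k q p' p := by
  unfold chartField
  split_ifs
  · simp
    ring
  · rfl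

theorem chartField_eq_zero {q : S} (hq : q ∈ (extChartAt (𝓡 2) q₀).source →
    ψ (extChartAt (𝓡 2) q₀ q) = 0) : chartField q₀ ψ m k q = 0 := by
  unfold chartField
  split_ifs with h
  · simp only [hq h, zero_smul]
  · rfl

variable [IsManifold (𝓡 2) ∞ S]

/-- The field of bilinear forms in coordinates. -/
def coordField (ψ : Plane → ℝ) (m : Fin 2 → Plane → Plane) (k : Fin 3 → ℝ) (y : Mod) : ℝ :=
  ψ y.1 * quadPoly k (y.2 (m 0 y.1)) (y.2 (m 1 y.1))

theorem coordFun_chartField {y : Mod} (hy : y ∈ (cotChart q₀).target) :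
    coordFun q₀ (quad (chartField q₀ ψ m k)) y = coordField ψ m k y := by
  have hx := mem_cotChart_target.1 hy
  have hs := (extChartAt (𝓡 2) q₀).map_target hx
  have hr := (extChartAt (𝓡 2) q₀).right_inv hx
  have hv : ∀ v, tanChart q₀ ((extChartAt (𝓡 2) q₀).symm y.1) (tanPar q₀ y.1 v) = v := fun v =>
    congrArg (fun L : Plane →L[ℝ] Plane => L v) (tanChart_comp_tanPar hx)
  rw [coordFun, cotChart_symm_apply hy]
  simp only [quad, chartField, if_pos hs, hr]
  have hev : ∀ i, evalVec ((extChartAt (𝓡 2) q₀).symm y.1) (tanPar q₀ y.1 (m i y.1))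
      (y.2.comp (tanChart q₀ ((extChartAt (𝓡 2) q₀).symm y.1))) = y.2 (m i y.1) := fun i =>
    congrArg y.2 (hv _)
  simp only [LinearMap.smul_apply, LinearMap.add_apply, LinearMap.BilinForm.linMulLin_apply,
    smul_eq_mul, coordField, quadPoly]
  erw [hev 0, hev 1]
  ring

end ChartField

/-- Near a regular moment, time is a smooth function of the value of a smooth function. -/
theorem exists_smooth_inverse {g : ℝ → ℝ} {t₀ ρ : ℝ} (hρ : 0 < ρ)
    (hg : ∀ t ∈ Metric.ball t₀ ρ, ContDiffAt ℝ ∞ g t) (h : deriv g t₀ ≠ 0) :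
    ∃ (τ : ℝ → ℝ) (N : Set ℝ), IsOpen N ∧ g t₀ ∈ N ∧ (∀ x ∈ N, τ x ∈ Metric.ball t₀ ρ) ∧
      (∀ x ∈ N, ContDiffAt ℝ ∞ τ x) ∧ ∀ᶠ t in 𝓝 t₀, τ (g t) = t := by
  have h0 := hg t₀ (Metric.mem_ball_self hρ)
  have hd : HasFDerivAt g
      (ContinuousLinearEquiv.unitsEquivAut ℝ (Units.mk0 _ h) : ℝ →L[ℝ] ℝ) t₀ := by
    have := ((h0.differentiableAt (by simp)).hasDerivAt).hasFDerivAt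
    refine this.congr_fderiv ?_
    ext
    simp
  set e := h0.toOpenPartialHomeomorph g hd (by simp) with he
  have hcoe : (e : ℝ → ℝ) = g := h0.toOpenPartialHomeomorph_coe hd (by simp)
  have hmem : t₀ ∈ e.source := h0.mem_toOpenPartialHomeomorph_source hd (by simp)
  have hcd : ContinuousAt (deriv g) t₀ :=
    (h0.continuousAt_fderiv (by simp)).clm_apply continuousAt_const
  obtain ⟨r, hr, hne⟩ := Metric.eventually_nhds_iff_ball.1 (hcd.eventually_ne h)
  have hsub : Metric.ball t₀ (min ρ r) ⊆ Metric.ball t₀ ρ :=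
    Metric.ball_subset_ball (min_le_left _ _)
  have hleft : ∀ t ∈ e.source, e.symm (g t) = t := fun t ht => by
    rw [← hcoe]
    exact e.left_inv ht
  -- The inverse is smooth at a point only if `g` is smooth with nonzero derivative at its preimage;
  -- the radii `ρ` and `r` secure these two conditions on all of `N`.
  refine ⟨e.symm, e.target ∩ e.symm ⁻¹' Metric.ball t₀ (min ρ r),
    e.symm.isOpen_inter_preimage Metric.isOpen_ball, ⟨?_, ?_⟩, fun x hx => hsub hx.2,
    fun x hx => ?_, ?_⟩
  · rw [← hcoe]
    exact e.map_source hmem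
  · rw [mem_preimage, hleft _ hmem]
    exact Metric.mem_ball_self (lt_min hρ hr)
  · have h1 := hg _ (hsub hx.2)
    refine e.contDiffAt_symm_deriv (hne _ (Metric.ball_subset_ball (min_le_right _ _) hx.2)) hx.1 ?_
      ?_
    · rw [hcoe]
      exact (h1.differentiableAt (by simp)).hasDerivAt
    · rwa [hcoe]
  · filter_upwards [e.open_source.mem_nhds hmem] with t ht using hleft t ht

/-! ### Two vector fields that detect transverse position and momentum. -/

section Coordinates

attribute [local instance] continuousSMul_mod modDualNACG modDualNS modDualACG modDualACM
  modDualModule modDualTop modEndNACG modEndNS modDualDualNACG modDualDualNS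

/-- A vector spanning the kernel of a covector. -/
def kernelVec : (Plane →L[ℝ] ℝ) →L[ℝ] Plane :=
  (ContinuousLinearMap.apply ℝ ℝ (EuclideanSpace.single 1 1 : Plane)).smulRight
      (EuclideanSpace.single 0 1 : Plane) -
    (ContinuousLinearMap.apply ℝ ℝ (EuclideanSpace.single 0 1 : Plane)).smulRight
      (EuclideanSpace.single 1 1 : Plane)

theorem apply_kernelVec (p p' : Plane →L[ℝ] ℝ) : p' (kernelVec p) =
    p (EuclideanSpace.single 1 1) * p' (EuclideanSpace.single 0 1) -
      p (EuclideanSpace.single 0 1) * p' (EuclideanSpace.single 1 1) := by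
  simp [kernelVec]

theorem exists_eq_smul_of_apply_kernelVec {p p' : Plane →L[ℝ] ℝ} {v : Plane} (hv : p v = 1)
    (h : p' (kernelVec p) = 0) : p' = p' v • p := by
  rw [apply_kernelVec] at h
  rw [plane_eq_sum v] at hv ⊢
  simp only [Fin.sum_univ_two, map_add, map_smul, smul_eq_mul] at hv ⊢
  rw [dual_eq_sum p']
  conv_rhs => rw [dual_eq_sum p]
  simp only [Fin.sum_univ_two, smul_add, smul_smul]
  congr 2
  · simp
    linear_combination (v 1) * h - p' (EuclideanSpace.single 0 1) * hv
  · simp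
    linear_combination (-v 0) * h - p' (EuclideanSpace.single 1 1) * hv

/-- The determinant with a vector. -/
def detWith (v : Plane) : Plane →L[ℝ] ℝ :=
  v 1 • EuclideanSpace.proj 0 - v 0 • EuclideanSpace.proj 1

theorem detWith_apply (v z : Plane) : detWith v z = v 1 * z 0 - v 0 * z 1 := by
  simp [detWith]

theorem eq_smul_of_detWith {v z : Plane} (h : detWith v z = 0) :
    (v 0 ^ 2 + v 1 ^ 2) • z = (v 0 * z 0 + v 1 * z 1) • v := by
  rw [detWith_apply] at h
  ext i
  fin_cases i
  · simp
    linear_combination v 1 * h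
  · simp
    linear_combination (-v 0) * h

theorem hasFDerivAt_apply_field {m : Plane → Plane} {m' : Plane →L[ℝ] Plane} {y : Mod}
    (h : HasFDerivAt m m' y.1) (Z : Mod) :
    fderiv ℝ (fun y : Mod => y.2 (m y.1)) y Z = Z.2 (m y.1) + y.2 (m' Z.1) := by
  have h1 : HasFDerivAt (fun y : Mod => m y.1) (m'.comp (ContinuousLinearMap.fst ℝ _ _)) y :=
    h.comp y hasFDerivAt_fst
  have h2 : HasFDerivAt (fun y : Mod => y.2 (m y.1)) _ y :=
    (hasFDerivAt_snd (E := Plane) (F := Plane →L[ℝ] ℝ)).clm_apply h1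
  rw [h2.fderiv]
  simp [add_comm]

/-- Two vector fields in the plane, annihilated by a given covector field along a curve, whose
symbols have independent differentials on the contact plane at a given moment. -/
theorem exists_transversal_fields {c : ℝ → Plane} {p : ℝ → Plane →L[ℝ] ℝ} {t₀ ρ : ℝ} (hρ : 0 < ρ)
    (hc : ∀ t ∈ Metric.ball t₀ ρ, ContDiffAt ℝ ∞ c t)
    (hp : ∀ t ∈ Metric.ball t₀ ρ, ContDiffAt ℝ ∞ p t) (h1 : p t₀ (deriv c t₀) = 1) :
    ∃ (m : Fin 2 → Plane → Plane) (N : Set Plane), IsOpen N ∧ c t₀ ∈ N ∧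
      (∀ i, ∀ x ∈ N, ContDiffAt ℝ ∞ (m i) x) ∧ (∀ᶠ t in 𝓝 t₀, ∀ i, p t (m i (c t)) = 0) ∧
      ∀ Z : Mod, p t₀ Z.1 = 0 →
        (∀ i, fderiv ℝ (fun y : Mod => y.2 (m i y.1)) (c t₀, p t₀) Z = 0) →
        Z.1 = 0 ∧ ∃ s : ℝ, Z.2 = s • p t₀ := by
  have ht₀ := Metric.mem_ball_self (x := t₀) hρ
  set v := deriv c t₀ with hv
  have hv0 : v ≠ 0 := by
    intro h
    rw [h, map_zero] at h1
    exact zero_ne_one h1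
  have hsq : v 0 ^ 2 + v 1 ^ 2 ≠ 0 := by
    intro h
    refine hv0 ?_
    have h2 : v 0 = 0 := by nlinarith [sq_nonneg (v 0), sq_nonneg (v 1)]
    have h3 : v 1 = 0 := by nlinarith [sq_nonneg (v 0), sq_nonneg (v 1)]
    ext i
    fin_cases i
    · exact h2
    · exact h3
  -- The inner product with the velocity has nonzero derivative along the curve at `t₀`, so time
  -- becomes a smooth function `τ ∘ α` of position near `c t₀`.
  set α : Plane →L[ℝ] ℝ := v 0 • EuclideanSpace.proj 0 + v 1 • EuclideanSpace.proj 1 with hα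
  have hcd : HasDerivAt c v t₀ := ((hc t₀ ht₀).differentiableAt (by simp)).hasDerivAt
  have hgd : deriv (fun t => α (c t)) t₀ ≠ 0 := by
    have h2 : HasDerivAt (fun t => α (c t)) (α v) t₀ := α.hasFDerivAt.comp_hasDerivAt t₀ hcd
    rw [h2.deriv]
    simpa [hα, ← sq] using hsq
  obtain ⟨τ, N, hN, hmem, hball, hτ, hinv⟩ := exists_smooth_inverse (g := fun t => α (c t)) hρ
    (fun t ht => α.contDiff.contDiffAt.comp t (hc t ht)) hgd
  have hτα : ∀ x ∈ α ⁻¹' N, ContDiffAt ℝ ∞ (fun x => τ (α x)) x := fun x hx =>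
    (hτ _ hx).comp x α.contDiff.contDiffAt
  have hcτ : ∀ x ∈ α ⁻¹' N, ContDiffAt ℝ ∞ (fun x => c (τ (α x))) x := fun x hx =>
    (hc _ (hball _ hx)).comp x (hτα x hx)
  have hpτ : ∀ x ∈ α ⁻¹' N, ContDiffAt ℝ ∞ (fun x => p (τ (α x))) x := fun x hx =>
    (hp _ (hball _ hx)).comp x (hτα x hx)
  have hτ₀ : τ (α (c t₀)) = t₀ := hinv.self_of_nhds
  -- The first field is the velocity vector times a function vanishing on the curve, so its symbol
  -- measures transverse displacement. The second spans the kernel of the covector transported along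
  -- `α`, so its symbol measures the change of direction of the covector.
  set m : Fin 2 → Plane → Plane :=
    ![fun x => detWith v (x - c (τ (α x))) • v, fun x => kernelVec (p (τ (α x)))] with hm
  have hm0 : ContDiffOn ℝ ∞ (m 0) (α ⁻¹' N) := fun x hx =>
    (((detWith v).contDiff.contDiffAt.comp x (contDiffAt_id.sub (hcτ x hx))).smul
      contDiffAt_const).contDiffWithinAt
  have hm1 : ∀ x ∈ α ⁻¹' N, ContDiffAt ℝ ∞ (m 1) x := fun x hx =>
    kernelVec.contDiff.contDiffAt.comp x (hpτ x hx)
  have hopen : IsOpen (α ⁻¹' N) := hN.preimage α.continuous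
  have hd0 : HasFDerivAt (m 0) ((detWith v).smulRight v) (c t₀) := by
    have h2 : HasFDerivAt (fun x => τ (α x)) (fderiv ℝ (fun x => τ (α x)) (c t₀)) (c t₀) :=
      ((hτα _ hmem).differentiableAt (by simp)).hasFDerivAt
    have h3 : HasFDerivAt (fun x => c (τ (α x)))
        ((ContinuousLinearMap.smulRight (1 : ℝ →L[ℝ] ℝ) v).comp
          (fderiv ℝ (fun x => τ (α x)) (c t₀))) (c t₀) := by
      have h4 : HasFDerivAt c (ContinuousLinearMap.smulRight (1 : ℝ →L[ℝ] ℝ) v)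
          (τ (α (c t₀))) := by
        rw [hτ₀]
        exact hcd.hasFDerivAt
      exact h4.comp (c t₀) h2
    have h5 : HasFDerivAt (m 0) _ (c t₀) :=
      (((detWith v).hasFDerivAt.comp (c t₀) ((hasFDerivAt_id _).sub h3)).smul_const v)
    refine h5.congr_fderiv ?_
    refine ContinuousLinearMap.ext fun z => ?_
    have h6 : detWith v v = 0 := by
      rw [detWith_apply]
      ring
    simp [h6]
  have hz0 : m 0 (c t₀) = 0 := by
    change detWith v (c t₀ - c (τ (α (c t₀)))) • v = 0
    rw [hτ₀, sub_self, map_zero, zero_smul]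
  have hz1 : m 1 (c t₀) = kernelVec (p t₀) := by
    change kernelVec (p (τ (α (c t₀)))) = _
    rw [hτ₀]
  refine ⟨m, α ⁻¹' N, hopen, hmem, fun i => ?_, ?_, fun Z hZ h => ?_⟩
  · fin_cases i
    · exact fun x hx => (hm0 x hx).contDiffAt (hopen.mem_nhds hx)
    · exact hm1
  · filter_upwards [hinv] with t ht i
    fin_cases i
    · change p t (detWith v (c t - c (τ (α (c t)))) • v) = 0
      rw [ht, sub_self, map_zero, zero_smul, map_zero]
    · change p t (kernelVec (p (τ (α (c t))))) = 0
      rw [ht, apply_kernelVec]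
      ring
  -- The first equation makes `Z.1` parallel to the velocity, on which `p t₀` is `1`; as `p t₀`
  -- kills `Z.1`, it is zero. The second equation then says that `Z.2` vanishes on the kernel of `p
  -- t₀`.
  · have h2 := h 0
    rw [hasFDerivAt_apply_field (y := (c t₀, p t₀)) hd0, hz0, map_zero, zero_add,
      ContinuousLinearMap.smulRight_apply, map_smul, h1, smul_eq_mul, mul_one] at h2
    have h3 : Z.1 = 0 := by
      have h4 := eq_smul_of_detWith h2
      have h5 := congrArg (p t₀) h4
      rw [map_smul, map_smul, hZ, h1, smul_zero, smul_eq_mul, mul_one] at h5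
      rw [← h5, zero_smul] at h4
      exact (smul_eq_zero.1 h4).resolve_left hsq
    refine ⟨h3, Z.2 v, exists_eq_smul_of_apply_kernelVec h1 ?_⟩
    have h6 := h 1
    rw [hasFDerivAt_apply_field (y := (c t₀, p t₀))
      ((hm1 _ hmem).differentiableAt (by simp)).hasFDerivAt, h3, map_zero, map_zero, add_zero,
      hz1] at h6
    exact h6

end Coordinates

/-! ### Admissibility of the fields. -/

section ChartField

attribute [local instance] cotTopology cotChartedSpace cot_isManifold cot_isManifold_one
  continuousSMul_mod modDualNACG modDualNS modDualACG modDualACM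
  modDualModule modDualTop modEndNACG modEndNS modDualDualNACG modDualDualNS

theorem contDiffAt_apply_field {m : Plane → Plane} {y : Mod} {n : WithTop ℕ∞}
    (hm : ContDiffAt ℝ n m y.1) : ContDiffAt ℝ n (fun y : Mod => y.2 (m y.1)) y :=
  (contDiffAt_snd (E := Plane) (F := Plane →L[ℝ] ℝ)).clm_apply (hm.comp y contDiffAt_fst)

theorem contDiffAt_coordField {ψ : Plane → ℝ} {m : Fin 2 → Plane → Plane} {k : Fin 3 → ℝ} {y : Mod}
    (hψ : ContDiffAt ℝ ∞ ψ y.1) (hm : ∀ i, ContDiffAt ℝ ∞ (m i) y.1) :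
    ContDiffAt ℝ ∞ (coordField ψ m k) y := by
  have h0 := contDiffAt_apply_field (hm 0)
  have h1 := contDiffAt_apply_field (hm 1)
  have h2 : ContDiffAt ℝ ∞ (fun y : Mod => ψ y.1) y := hψ.comp y contDiffAt_fst
  exact h2.mul (((contDiffAt_const.mul (h0.mul h0)).add (contDiffAt_const.mul (h0.mul h1))).add
    (contDiffAt_const.mul (h1.mul h1)))

variable {S : Type*} [TopologicalSpace S] [ChartedSpace Plane S] [IsManifold (𝓡 2) ∞ S]
  {F : TangentBundle (𝓡 2) S → ℝ} {σ : ℝ → S} {l : ℝ} {W K : Set S} {q₀ : S}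
  {ψ : Plane → ℝ} {m : Fin 2 → Plane → Plane} {k : Fin 3 → ℝ}

theorem coordFun_chartField_eventuallyEq {y : Mod} (hy : y ∈ (cotChart q₀).target) :
    coordFun q₀ (quad (chartField q₀ ψ m k)) =ᶠ[𝓝 y] coordField ψ m k := by
  filter_upwards [(isOpen_cotChart_target q₀).mem_nhds hy] with z hz using coordFun_chartField hz

theorem chartField_eq_zero_of_notMem
    (hψK : ∀ q ∈ (extChartAt (𝓡 2) q₀).source, ψ (extChartAt (𝓡 2) q₀ q) ≠ 0 → q ∈ K) {q : S}
    (hq : q ∉ K) : chartField q₀ ψ m k q = 0 :=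
  chartField_eq_zero fun hs => by
    by_contra h
    exact hq (hψK q hs h)

/-- Over `K` the symbols of both vector fields vanish on the orbit, so a quadratic polynomial in
them vanishes to first order. Off the closed set `K` the field is zero nearby, which also makes it
smooth outside the chart. -/
theorem isAdmissible_chartField (hK : IsClosed K) (hKs : K ⊆ (extChartAt (𝓡 2) q₀).source)
    (hKW : K ⊆ W) (hψ : ContDiff ℝ ∞ ψ)
    (hψK : ∀ q ∈ (extChartAt (𝓡 2) q₀).source, ψ (extChartAt (𝓡 2) q₀ q) ≠ 0 → q ∈ K)
    (hm : ∀ i, ∀ q ∈ K, ContDiffAt ℝ ∞ (m i) (extChartAt (𝓡 2) q₀ q))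
    (hv : ∀ t, σ t ∈ K → ∀ i, (cotChart q₀ (lift F σ t)).2 (m i (coordCurve q₀ σ t)) = 0) :
    IsAdmissible F (lift F σ) W (chartField q₀ ψ m k) := by
  have hfst : ∀ e : CotBundle S, e.1 ∈ K → (cotChart q₀ e).1 = extChartAt (𝓡 2) q₀ e.1 :=
    fun e he => by rw [cotChart_apply (hKs he)]
  have hsrc : ∀ e : CotBundle S, e.1 ∈ K → e ∈ (cotChart q₀).source := fun e he => by
    rw [cotChart_source]
    exact hKs he
  have hout : ∀ e : CotBundle S, e.1 ∉ K → quad (chartField q₀ ψ m k) =ᶠ[𝓝 e] fun _ => 0 := by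
    intro e he
    have h1 : ContinuousAt (fun e : CotBundle S => e.1) e :=
      (FiberBundle.continuous_proj (Plane →L[ℝ] ℝ) (fun q : S => Cot q)).continuousAt
    filter_upwards [h1.eventually (hK.isOpen_compl.mem_nhds he)] with e' he'
    rw [quad, chartField_eq_zero_of_notMem hψK he']
    rfl
  have hfield : ∀ e : CotBundle S, e.1 ∈ K →
      ContDiffAt ℝ ∞ (coordField ψ m k) (cotChart q₀ e) := fun e he =>
    contDiffAt_coordField hψ.contDiffAt fun i => by
      rw [hfst e he]
      exact hm i _ he
  refine ⟨chartField_symm, fun e => ?_, ?_, fun s hs t => ?_⟩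
  · by_cases he : e.1 ∈ K
    · refine contMDiffAt_of_coordFun le_rfl (hsrc e he) ?_
      exact (hfield e he).congr_of_eventuallyEq
        (coordFun_chartField_eventuallyEq ((cotChart q₀).map_source (hsrc e he)))
    · exact contMDiffAt_const.congr_of_eventuallyEq (hout e he)
  · refine (closure_minimal (fun q hq => ?_) hK).trans hKW
    by_contra h
    exact hq (chartField_eq_zero_of_notMem hψK h)
  · set e := lift F σ t with he
    by_cases hK' : σ t ∈ K
    · have hy := (cotChart q₀).map_source (hsrc e hK')
      have hev := coordFun_chartField_eventuallyEq (ψ := ψ) (m := m) (k := k) hy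
      have h0 : ∀ i, (cotChart q₀ e).2 (m i (cotChart q₀ e).1) = 0 := fun i => by
        rw [hfst e hK']
        exact hv t hK' i
      have hd : ∀ i, DifferentiableAt ℝ (fun y : Mod => y.2 (m i y.1)) (cotChart q₀ e) := fun i =>
        (contDiffAt_apply_field (n := ∞) (by rw [hfst e hK']; exact hm i _ hK')).differentiableAt
          (by simp)
      have h1 : HasFDerivAt (coordField ψ m k) (0 : Mod →L[ℝ] ℝ) (cotChart q₀ e) :=
        hasFDerivAt_quadPoly k ((hψ.contDiffAt.comp (cotChart q₀ e)
          contDiffAt_fst).differentiableAt (by simp)) (hd 0) (hd 1) (h0 0) (h0 1)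
      have h2 := h1.congr_of_eventuallyEq hev
      have h3 : coordFun q₀ (quad (chartField q₀ ψ m k)) (cotChart q₀ e) = 0 := by
        rw [hev.self_of_nhds, coordField, h0, h0]
        simp [quadPoly]
      have h4 : HasFDerivAt (coordFun q₀ (pert (chartField q₀ ψ m k) s)) (0 : Mod →L[ℝ] ℝ)
          (cotChart q₀ e) := by
        have h5 := hasFDerivAt_coordPert (s := s) h2.differentiableAt (by rw [h3]; simp)
        rw [h2.fderiv, smul_zero] at h5
        exact h5
      refine ⟨?_, fun X _ => ?_⟩
      · rw [← coordFun_apply (q₀ := q₀) (pert (chartField q₀ ψ m k) s) (hsrc e hK'), coordFun_pert, coordPert, h3]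
        simp
      · refine (cotD_of_coordFun (hsrc e hK') h4.differentiableAt X).trans ?_
        rw [h4.fderiv]
        rfl
    · have h1 : pert (chartField q₀ ψ m k) s =ᶠ[𝓝 e] fun _ => 0 := by
        filter_upwards [hout e hK'] with e' h2
        have h3 : pert (chartField q₀ ψ m k) s e' =
          -(1 / 2) * Real.log (1 + s * quad (chartField q₀ ψ m k) e') := rfl
        rw [h3, h2]
        simp
      refine ⟨h1.self_of_nhds, fun X _ => ?_⟩
      rw [h1.mfderiv_eq, mfderiv_const]
      rfl

end ChartField

/-! ### The pairing for perturbations supported over an arc in one chart. -/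

section Pairing

attribute [local instance] cotTopology cotChartedSpace cot_isManifold cot_isManifold_one
  continuousSMul_mod modDualNACG modDualNS modDualACG modDualACM
  modDualModule modDualTop modEndNACG modEndNS modDualDualNACG modDualDualNS

theorem exists_continuous_flow {E : Type*} [NormedAddCommGroup E] [NormedSpace ℝ E]
    [FiniteDimensional ℝ E] {B : ℝ → E →L[ℝ] E} (hB : Continuous B) {a b : ℝ} (hab : a ≤ b) :
    ∃ W : E → ℝ → E, ∀ X, W X a = X ∧ ∀ t, HasDerivAt (W X) (B t (W X t)) t := by
  obtain ⟨W, V, hW0, hW, -⟩ := exists_linear_flow_family hB hB hab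
  refine ⟨fun X t => W 0 t X, fun X => ⟨by simp only [hW0]; rfl, fun t => ?_⟩⟩
  have h := (ContinuousLinearMap.apply ℝ E X).hasFDerivAt.comp_hasDerivAt t (hW 0 t)
  rw [zero_smul, add_zero] at h
  exact h

theorem add_zero_smul_apply {E : Type*} [NormedAddCommGroup E] [NormedSpace ℝ E] (B C : E →L[ℝ] E)
    (X : E) : (B + (0 : ℝ) • C) X = B X := by
  rw [zero_smul, add_zero]

variable {S : Type*} [TopologicalSpace S] [ChartedSpace Plane S] [IsManifold (𝓡 2) ∞ S]
  {F : TangentBundle (𝓡 2) S → ℝ} {σ : ℝ → S} {l : ℝ} {W : Set S} {q₀ : S}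

/-- The zero perturbation provides the unperturbed linearized flow before any field `A` has been
selected. -/
theorem isAdmissible_zero (q₀ : S) (k : Fin 3 → ℝ) (m : Fin 2 → Plane → Plane) :
    IsAdmissible F (lift F σ) W (chartField q₀ (fun _ => 0) m k) :=
  isAdmissible_chartField isClosed_empty (empty_subset _) (empty_subset _) contDiff_const
    (fun _ _ h => absurd rfl h) (fun _ _ h => absurd h (notMem_empty _))
    fun _ h => absurd h (notMem_empty _)

theorem IsTransitFamily.apply_zero_eq [T2Space S] (hF : IsFinslerMetric F)
    (hσ : IsClosedGeodesic F σ l) {A A' : (q : S) → LinearMap.BilinForm ℝ (Cot q)} {a b : ℝ}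
    (hab : a ≤ b) {L L' : ℝ → Mod →L[ℝ] Mod} (h : IsTransitFamily F σ A a b L)
    (h' : IsTransitFamily F σ A' a b L') {X : Mod} (hX : IsContact F (lift F σ a) X) :
    L 0 X = L' 0 X := by
  have h1 := h.transit 0 pertDefined_zero
  have h2 := h'.transit 0 pertDefined_zero
  rw [pert_zero] at h1 h2
  exact h1.unique hF (fun e _ => contMDiffAt_const) hab (hσ.lift_mem hF a) h2 hX.1

set_option maxHeartbeats 1000000 in
/-- The derivative of the return map, for perturbations supported over an arc inside a chart. -/
theorem IsClosedGeodesic.exists_pairing [T2Space S] [CompactSpace S] (hF : IsFinslerMetric F)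
    (hσ : IsClosedGeodesic F σ l) {a b : ℝ} (h0a : 0 ≤ a) (hab : a ≤ b) (hbl : b ≤ l)
    (hsrc : ∀ t ∈ Icc a b, σ t ∈ (extChartAt (𝓡 2) q₀).source) :
    ∃ Z : Mod → ℝ → Mod, (∀ X, Continuous (Z X)) ∧
      (∀ X, IsContact F (lift F σ 0) X → ∀ t ∈ Icc a b,
        IsContactVector (coordG F q₀) (coordLift F σ q₀ hab t) (Z X t)) ∧
      (∀ X Y, IsContact F (lift F σ 0) X → IsContact F (lift F σ 0) Y → ∀ t ∈ Icc a b,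
        symp (Z X t) (Z Y t) = symp X Y) ∧
      ∀ A : (q : S) → LinearMap.BilinForm ℝ (Cot q), IsAdmissible F (lift F σ) W A →
        (∀ t ∈ Icc 0 a ∪ Icc b l, ∀ᶠ q in 𝓝 (σ t), A q = 0) →
        ∃ D : contactPlane F (lift F σ 0) →ₗ[ℝ] contactPlane F (lift F σ 0),
          HasEndDerivAtZero (fun s => linearizedReturnMap F (pert A s) l (lift F σ 0)) D ∧
          ∀ X Y, symp (contactVec (D X))
              (contactVec (linearizedReturnMap F (fun _ => 0) l (lift F σ 0) Y)) =
            ∫ t in a..b, fderiv ℝ (fderiv ℝ (coordFun q₀ (pertVelocity A)))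
              (coordLift F σ q₀ hab t) (Z (contactVec X) t) (Z (contactVec Y) t) := by
  have hG := hσ.isCoordOrbit hF hab hsrc
  have hB := hG.continuous_linB₀
  obtain ⟨V, hV⟩ := exists_continuous_flow hB hab
  obtain ⟨N, hN, -⟩ := (isAdmissible_zero (F := F) (σ := σ) (W := W) q₀ 0 0).exists_isTransitFamily
    hF hσ h0a
  have hsa : lift F σ a ∈ (cotChart q₀).source :=
    mem_cotChart_lift.2 (hsrc a (left_mem_Icc.2 hab))
  have hsb : lift F σ b ∈ (cotChart q₀).source :=
    mem_cotChart_lift.2 (hsrc b (right_mem_Icc.2 hab))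
  have hya : coordLift F σ q₀ hab a = cotChart q₀ (lift F σ a) :=
    coordLift_of_mem hab (left_mem_Icc.2 hab)
  have hhz := (isAdmissible_zero (F := F) (σ := σ) (W := W) q₀ 0 0).isCoordPert hF hσ hab hsrc
  -- The unperturbed transport of `X` along the arc must not depend on `A`, because the coefficients
  -- of `A` are solved for afterwards; hence the transport up to `a` comes from the zero field. On
  -- contact vectors it agrees with the transport obtained from any `A`.
  let Z : Mod → ℝ → Mod := fun X => V (chartD q₀ (lift F σ a) (N 0 X))
  have hZode : ∀ X, ∀ t ∈ Icc a b, HasDerivWithinAt (Z X)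
      (linB₀ (coordG F q₀) (coordLift F σ q₀ hab) t (Z X t)) (Icc a b) t := fun X t _ =>
    ((hV _).2 t).hasDerivWithinAt
  have hZode' : ∀ X, ∀ t ∈ Icc a b, HasDerivWithinAt (Z X)
      ((linB₀ (coordG F q₀) (coordLift F σ q₀ hab) t + (0 : ℝ) • linB₁ (coordG F q₀)
        (coordFun q₀ (pertVelocity (chartField q₀ (fun _ => 0) 0 0))) (coordLift F σ q₀ hab) t)
        (Z X t)) (Icc a b) t := fun X t ht => by
    rw [add_zero_smul_apply]
    exact hZode X t ht
  have hZa : ∀ X, Z X a = chartD q₀ (lift F σ a) (N 0 X) := fun X => (hV _).1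
  have hZc : ∀ X, IsContact F (lift F σ 0) X →
      IsContactVector (coordG F q₀) (coordLift F σ q₀ hab a) (Z X a) := fun X hX => by
    rw [hya, hZa]
    exact (isContact_iff hF hsa (hσ.lift_mem hF a) _).1 (hN.contact 0 X hX)
  refine ⟨Z, fun X => continuous_iff_continuousAt.2 fun t => ((hV _).2 t).continuousAt,
    fun X hX t ht => hG.isContactVector_of_ode hhz (hZode' X) (hZc X hX) ht,
    fun X Y hX hY t ht => ?_, fun A hA hA0 => ?_⟩
  · rw [hG.symp_eq hhz (hZode' X) (hZode' Y) (hZc X hX) (hZc Y hY) ht, hZa, hZa, symp_chartD hsa]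
    exact hN.symplectic 0 X Y hX hY
  have hh := hA.isCoordPert hF hσ hab hsrc
  obtain ⟨L₁, hL₁, hL₁c⟩ := hA.exists_isTransitFamily hF hσ h0a
  obtain ⟨L₃, hL₃, hL₃c⟩ := hA.exists_isTransitFamily hF hσ hbl
  obtain ⟨M, hM, -, D, hD, hDs⟩ := hG.exists_linearFlow hh hab
  have hL₂ := hA.isTransitFamily_of_linearFlow hF hσ hab hsrc hM hD.differentiableAt
  let L₂ : ℝ → Mod →L[ℝ] Mod := fun s =>
    ((parD q₀ (cotChart q₀ (lift F σ b))).comp (M s b)).comp (chartD q₀ (lift F σ a))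
  -- The first and the third factor do not depend on `s`, so only the middle arc is differentiated;
  -- the third factor is symplectic and drops out of the pairing.
  have hL := (hL₁.comp hF hσ hA.smooth h0a hab hL₂).comp hF hσ hA.smooth (h0a.trans hab) hbl hL₃
  have h1c : ∀ s, L₁ s = L₁ 0 := hL₁c fun t ht => hA0 t (Or.inl ht)
  have h3c : ∀ s, L₃ s = L₃ 0 := hL₃c fun t ht => hA0 t (Or.inr ht)
  have hLd := hL.differentiable.hasDerivAt
  let Lf : ℝ → Mod →L[ℝ] Mod := fun s => (L₃ s).comp ((L₂ s).comp (L₁ s))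
  let L' := deriv Lf 0
  have happ : ∀ X : Mod, HasDerivAt (fun s => Lf s X) (L' X) 0 := fun X =>
    (ContinuousLinearMap.apply ℝ Mod X).hasFDerivAt.comp_hasDerivAt (0 : ℝ) hLd
  have h2app : ∀ X : Mod, HasDerivAt (fun s => L₂ s X)
      (parD q₀ (cotChart q₀ (lift F σ b)) (D (chartD q₀ (lift F σ a) X))) 0 := fun X =>
    (parD q₀ (cotChart q₀ (lift F σ b))).hasFDerivAt.comp_hasDerivAt (0 : ℝ)
      ((ContinuousLinearMap.apply ℝ Mod
        (chartD q₀ (lift F σ a) X)).hasFDerivAt.comp_hasDerivAt (0 : ℝ) hD)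
  have hc : ∀ X, IsContact F (lift F σ 0) X → IsContact F (lift F σ 0) (L' X) := fun X hX =>
    isContact_deriv hF (hσ.lift_mem hF 0) (fun s => hL.contact_period hσ s X hX) (happ X)
  have hval : ∀ X, L' X = L₃ 0 (parD q₀ (cotChart q₀ (lift F σ b))
      (D (chartD q₀ (lift F σ a) (L₁ 0 X)))) := fun X => by
    refine (happ X).unique ?_
    have h := (L₃ 0).hasFDerivAt.comp_hasDerivAt (0 : ℝ) (h2app (L₁ 0 X))
    have heq : (fun s => Lf s X) = (L₃ 0) ∘ fun s => L₂ s (L₁ 0 X) := by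
      funext s
      change L₃ s (L₂ s (L₁ s X)) = L₃ 0 (L₂ s (L₁ 0 X))
      rw [h1c s, h3c s]
    rw [heq]
    exact h
  refine ⟨restrictContact L' hc, hL.hasEndDerivAtZero hF hσ hA.smooth hLd fun _ => rfl,
    fun X Y => ?_⟩
  have hX := isContact_contactVec X
  have hY := isContact_contactVec Y
  have hP := hL.linearizedReturnMap_eq hF hσ hA.smooth pertDefined_zero Y
  rw [pert_zero] at hP
  rw [hP, contactVec_restrictContact, hval]
  have h1X := hL₁.contact 0 _ hX
  have h1Y := hL₁.contact 0 _ hY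
  have hN1 : ∀ X, IsContact F (lift F σ 0) X → N 0 X = L₁ 0 X := fun X hX =>
    hN.apply_zero_eq hF hσ h0a hL₁ hX
  have h2 : IsContact F (lift F σ b) (parD q₀ (cotChart q₀ (lift F σ b))
      (D (chartD q₀ (lift F σ a) (L₁ 0 (contactVec X))))) :=
    isContact_deriv hF (hσ.lift_mem hF b) (fun s => hL₂.contact s _ h1X) (h2app _)
  have h3 : Lf 0 (contactVec Y) = L₃ 0 (L₂ 0 (L₁ 0 (contactVec Y))) := rfl
  have h4 : L₂ 0 (L₁ 0 (contactVec Y)) = parD q₀ (cotChart q₀ (lift F σ b))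
      (M 0 b (chartD q₀ (lift F σ a) (L₁ 0 (contactVec Y)))) := rfl
  rw [h3, hL₃.symplectic 0 _ _ h2 (hL₂.contact 0 _ h1Y), h4,
    symp_parD ((cotChart q₀).map_source hsb)]
  have hcv : ∀ X, IsContact F (lift F σ a) X →
      IsContactVector (coordG F q₀) (coordLift F σ q₀ hab a) (chartD q₀ (lift F σ a) X) :=
    fun X hX => by
      rw [hya]
      exact (isContact_iff hF hsa (hσ.lift_mem hF a) _).1 hX
  rw [hDs _ _ (hcv _ h1X) (hcv _ h1Y)]
  have hMZ : ∀ X, IsContact F (lift F σ 0) X → ∀ t ∈ Icc a b,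
      M 0 t (chartD q₀ (lift F σ a) (L₁ 0 X)) = Z X t := fun X hX t ht => by
    refine linear_ode_unique_Icc (x := fun t => M 0 t (chartD q₀ (lift F σ a) (L₁ 0 X))) hB ?_ (fun u hu => ?_) (hZode X) ht
    · rw [hM.initial, hZa, hN1 X hX]
      rfl
    · have := hM.apply 0 (chartD q₀ (lift F σ a) (L₁ 0 X)) u hu
      rwa [add_zero_smul_apply] at this
  refine intervalIntegral.integral_congr fun t ht => ?_
  rw [uIcc_of_le hab] at ht
  rw [hMZ _ hX t ht, hMZ _ hY t ht]

end Pairing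

/-! ### Alternating forms on a plane. -/

section Form

variable {V : Type*} [AddCommGroup V] [Module ℝ V]

theorem form_basis_eq_zero (β : V →ₗ[ℝ] V →ₗ[ℝ] ℝ) (hβ : ∀ x, β x x = 0)
    (b : Module.Basis (Fin 2) ℝ V) (h : β (b 0) (b 1) = 0) (x : V) : β (b 0) x = 0 := by
  rw [← b.sum_repr x, Fin.sum_univ_two]
  simp [hβ, h]

theorem form_eq_zero_of_pair (hV : Module.finrank ℝ V = 2) (β : V →ₗ[ℝ] V →ₗ[ℝ] ℝ)
    (hβ : ∀ x, β x x = 0) {U : Fin 2 → V} (hU : β (U 0) (U 1) ≠ 0) {v : V}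
    (h : ∀ i, β v (U i) = 0) (x : V) : β v x = 0 := by
  have hli : LinearIndependent ℝ U := by
    refine Fintype.linearIndependent_iff.2 fun g hg i => ?_
    rw [Fin.sum_univ_two] at hg
    have h2 := congrArg (fun z => β z (U 1)) hg
    have h3 := congrArg (fun z => β (U 0) z) hg
    simp only [map_add, map_smul, LinearMap.add_apply, LinearMap.smul_apply, hβ, smul_eq_mul,
      mul_zero, add_zero, zero_add, map_zero, LinearMap.zero_apply] at h2 h3
    fin_cases i
    · exact (mul_eq_zero.1 h2).resolve_right hU
    · exact (mul_eq_zero.1 h3).resolve_right hU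
  set b := basisOfLinearIndependentOfCardEqFinrank hli (by rw [hV, Fintype.card_fin]) with hb
  have hbU : ∀ i, b i = U i := fun i => by rw [hb, coe_basisOfLinearIndependentOfCardEqFinrank]
  rw [← b.sum_repr x, Fin.sum_univ_two]
  simp [hbU, h]

end Form

/-! ### Dimension and nondegeneracy of the contact plane. -/

section ContactPlane

attribute [local instance] cotTopology cotChartedSpace cot_isManifold cot_isManifold_one
  continuousSMul_mod modDualNACG modDualNS modDualACG modDualACM
  modDualModule modDualTop modEndNACG modEndNS modDualDualNACG modDualDualNS

theorem finrank_ker_prod {dG dH : Mod →L[ℝ] ℝ} {u v : Mod} (hu : dG u ≠ 0) (hu' : dH u = 0)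
    (hv : dG v = 0) (hv' : dH v ≠ 0) :
    Module.finrank ℝ (dG.toLinearMap.ker ⊓ dH.toLinearMap.ker : Submodule ℝ Mod) = 2 := by
  have h1 := LinearMap.finrank_range_add_finrank_ker (dG.toLinearMap.prod dH.toLinearMap)
  have h2 : (dG.toLinearMap.prod dH.toLinearMap).range = ⊤ := by
    rw [eq_top_iff]
    rintro ⟨x, y⟩ -
    refine ⟨(x / dG u) • u + (y / dH v) • v, ?_⟩
    simp [hu', hv, div_mul_cancel₀ _ hu, div_mul_cancel₀ _ hv']
  have h4 : Module.finrank ℝ Mod = 4 := by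
    have : Module.finrank ℝ (Plane →L[ℝ] ℝ) = 2 := by
      rw [← LinearMap.toContinuousLinearMap.finrank_eq]
      simp
    rw [Module.finrank_prod, this]
    simp
  have h5 : Module.finrank ℝ (⊤ : Submodule ℝ (ℝ × ℝ)) = 2 := by
    rw [finrank_top]
    simp
  rw [h2, h5, h4, LinearMap.ker_prod] at h1
  omega

variable {S : Type*} [TopologicalSpace S] [ChartedSpace Plane S] [IsManifold (𝓡 2) ∞ S]
  {F : TangentBundle (𝓡 2) S → ℝ}

theorem coordG_self (hF : IsFinslerMetric F) {e : CotBundle S} (he : e ∈ cosphere F) :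
    fderiv ℝ (coordG F e.1) (cotChart e.1 e) (eul (cotChart e.1 e)) = 1 := by
  have hs := mem_cotChart_source e
  rw [fderiv_coordG_eul hF ((cotChart e.1).map_source hs)
    (snd_cotChart_ne_zero hs (covec_ne_zero hF he))]
  exact (coordFun_apply _ hs).trans he

theorem finrank_contactPlane (hF : IsFinslerMetric F) {e : CotBundle S} (he : e ∈ cosphere F) :
    Module.finrank ℝ (contactPlane F e) = 2 := by
  have hs := mem_cotChart_source e
  have h1 := coordG_self hF he
  set dG := fderiv ℝ (coordG F e.1) (cotChart e.1 e) with hdG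
  set y := cotChart e.1 e with hy
  have h2 : (contactPlane F e : Submodule ℝ Mod) =
      dG.toLinearMap.ker ⊓ (lam y).toLinearMap.ker := by
    ext X
    have h3 : X ∈ (contactPlane F e : Submodule ℝ Mod) ↔ IsContact F e X := Iff.rfl
    refine (h3.trans (isContact_iff hF hs he X)).trans ?_
    rw [chartD_self]
    exact ⟨fun h => ⟨h.1, h.2⟩, fun h => ⟨h.1, h.2⟩⟩
  have h4 : lam y (eul y) = 0 := by
    rw [← symp_eul]
    have := symp_swap (eul y) (eul y)
    linarith
  have h5 : lam y (sharp dG) ≠ 0 := by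
    rw [lam_sharp, h1]
    exact one_ne_zero
  have h6 := finrank_ker_prod (dG := dG) (dH := lam y) (u := eul y) (v := sharp dG)
    (by rw [h1]; exact one_ne_zero) h4 (apply_sharp_self dG) h5
  rw [← h2] at h6
  exact h6

theorem eq_zero_of_symp_contactVec (hF : IsFinslerMetric F) {e : CotBundle S} (he : e ∈ cosphere F)
    {V : contactPlane F e} (h : ∀ X : contactPlane F e, symp (contactVec V) (contactVec X) = 0) :
    V = 0 := by
  have hs := mem_cotChart_source e
  have h1 := coordG_self hF he
  have hV := (isContact_iff hF hs he _).1 (isContact_contactVec V)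
  rw [chartD_self] at hV
  have h2 : contactVec V = 0 := by
    refine eq_zero_of_symp_contact (by rw [h1]; exact one_ne_zero) hV.1 hV.2 fun W hW hW' => ?_
    have hWc : IsContact F e W := by
      rw [isContact_iff hF hs he, chartD_self]
      exact ⟨hW, hW'⟩
    exact h ⟨W, hWc⟩
  exact contactVec_injective h2

theorem symp_self (Z : Mod) : symp Z Z = 0 := by
  have := symp_swap Z Z
  linarith

/-- The symplectic form on the contact plane. -/
def sympForm (F : TangentBundle (𝓡 2) S → ℝ) (e : CotBundle S) :
    contactPlane F e →ₗ[ℝ] contactPlane F e →ₗ[ℝ] ℝ :=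
  LinearMap.mk₂ ℝ (fun X Y => symp (contactVec X) (contactVec Y))
    (fun _ _ _ => symp_add_left _ _ _) (fun _ _ _ => symp_smul_left _ _ _)
    (fun _ _ _ => symp_add_right _ _ _) (fun _ _ _ => symp_smul_right _ _ _)

theorem symp_basis_ne_zero (hF : IsFinslerMetric F) {e : CotBundle S} (he : e ∈ cosphere F)
    (b : Module.Basis (Fin 2) ℝ (contactPlane F e)) :
    symp (contactVec (b 0)) (contactVec (b 1)) ≠ 0 := fun h =>
  b.ne_zero 0 (eq_zero_of_symp_contactVec hF he fun X =>
    form_basis_eq_zero (sympForm F e) (fun X => symp_self (contactVec X)) b h X)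

theorem eq_zero_of_symp_pair (hF : IsFinslerMetric F) {e : CotBundle S} (he : e ∈ cosphere F)
    {U : Fin 2 → contactPlane F e} (hU : symp (contactVec (U 0)) (contactVec (U 1)) ≠ 0)
    {V : contactPlane F e} (h : ∀ i, symp (contactVec V) (contactVec (U i)) = 0) : V = 0 :=
  eq_zero_of_symp_contactVec hF he fun X =>
    form_eq_zero_of_pair (finrank_contactPlane hF he) (sympForm F e)
      (fun X => symp_self (contactVec X)) hU h X

end ContactPlane

/-! ### Transversal fields at a point of the geodesic. -/

section Transversal

attribute [local instance] cotTopology cotChartedSpace cot_isManifold cot_isManifold_one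
  continuousSMul_mod modDualNACG modDualNS modDualACG modDualACM
  modDualModule modDualTop modEndNACG modEndNS modDualDualNACG modDualDualNS

variable {S : Type*} [TopologicalSpace S] [ChartedSpace Plane S] [IsManifold (𝓡 2) ∞ S]
  {F : TangentBundle (𝓡 2) S → ℝ} {σ : ℝ → S} {l : ℝ}

/-- The projection of the unit cotangent bundle is open. -/
theorem image_proj_mem_nhds (hF : IsFinslerMetric F) {O : Set (CotBundle S)} (hO : IsOpen O)
    {e : CotBundle S} (he : e ∈ O ∩ cosphere F) :
    TotalSpace.proj '' (O ∩ cosphere F) ∈ 𝓝 e.1 := by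
  have hs := mem_cotChart_source e
  have hq := mem_extChartAt_source (I := 𝓡 2) e.1
  have hp := snd_cotChart_ne_zero hs (covec_ne_zero hF he.2)
  have hy := (cotChart e.1).map_source hs
  set y := cotChart e.1 e with hydef
  have hG1 : coordG F e.1 y = 1 := (coordFun_apply _ hs).trans he.2
  have hy1 : y.1 = extChartAt (𝓡 2) e.1 e.1 := by rw [hydef, cotChart_apply hq]
  -- A continuous local section through `e`: the coordinates of the covector are kept fixed and
  -- rescaled to unit length.
  set g : Plane → Mod := fun x => (x, (coordG F e.1 (x, y.2))⁻¹ • y.2) with hg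
  have hgy : g y.1 = y := by
    simp only [hg]
    rw [hG1, inv_one, one_smul]
  have hgc : ContinuousAt g y.1 := by
    have h1 : ContinuousAt (fun x : Plane => coordG F e.1 (x, y.2)) y.1 :=
      ContinuousAt.comp (f := fun x : Plane => ((x, y.2) : Mod)) (g := coordG F e.1)
        (contDiffAt_coordG hF hy hp).continuousAt (by fun_prop)
    refine continuousAt_id.prodMk ((h1.inv₀ ?_).smul continuousAt_const)
    rw [hG1]
    exact one_ne_zero
  have hgO : ∀ᶠ x in 𝓝 y.1, (cotChart e.1).symm (g x) ∈ O := by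
    have h1 : ContinuousAt (fun x => (cotChart e.1).symm (g x)) y.1 := by
      refine ContinuousAt.comp (f := g) (g := (cotChart e.1).symm) ?_ hgc
      rw [hgy]
      exact (contMDiffAt_cotChart_symm hy).continuousAt
    refine h1.eventually (hO.mem_nhds ?_)
    change (cotChart e.1).symm (g y.1) ∈ O
    rw [hgy, (cotChart e.1).left_inv hs]
    exact he.1
  have hc : Tendsto (extChartAt (𝓡 2) e.1) (𝓝 e.1) (𝓝 y.1) := by
    rw [hy1]
    exact continuousAt_extChartAt e.1
  filter_upwards [hc.eventually hgO, (isOpen_extChartAt_source e.1).mem_nhds hq] with q hqO hqs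
  have hxt := (extChartAt (𝓡 2) e.1).map_source hqs
  set x := extChartAt (𝓡 2) e.1 q with hx
  have hgt : g x ∈ (cotChart e.1).target := mem_cotChart_target.2 hxt
  have hxt' : ((x, y.2) : Mod) ∈ (cotChart e.1).target := mem_cotChart_target.2 hxt
  refine ⟨(cotChart e.1).symm (g x), ⟨hqO, ?_⟩, ?_⟩
  · have hpos := coordG_pos hF hxt' hp
    have h1 : coordG F e.1 (g x) = 1 := by
      have := (hF.isCoordDual e.1).homogeneous (x, y.2) _ hxt hp (inv_pos.2 hpos)
      exact this.trans (inv_mul_cancel₀ hpos.ne')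
    exact h1
  · rw [cotChart_symm_proj hgt]
    exact (extChartAt (𝓡 2) e.1).left_inv hqs

theorem IsClosedGeodesic.apply_deriv_coordCurve (hF : IsFinslerMetric F)
    (hσ : IsClosedGeodesic F σ l) (t : ℝ) :
    (cotChart (σ t) (lift F σ t)).2 (deriv (coordCurve (σ t) σ) t) = 1 := by
  obtain ⟨ξ, hξ, -, h1, -⟩ := hσ.isCoordReeb_lift hF t
  have h2 : coordCurve (σ t) σ =ᶠ[𝓝 t] fun s => (cotChart (σ t) (lift F σ s)).1 := by
    filter_upwards [hσ.eventually_mem (mem_extChartAt_source (I := 𝓡 2) (σ t))] with s hs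
    rw [cotChart_apply (e := lift F σ s) hs]
    rfl
  have h3 : HasDerivAt (fun s => (cotChart (σ t) (lift F σ s)).1) ξ.1 t :=
    (hasFDerivAt_fst (𝕜 := ℝ) (E := Plane) (F := Plane →L[ℝ] ℝ)).comp_hasDerivAt t hξ
  rw [h2.deriv_eq, h3.deriv]
  exact h1

/-- Vector fields near a point of the geodesic, annihilated by the lift, whose symbols have
independent differentials on the contact plane. -/
theorem IsClosedGeodesic.exists_transversal_fields (hF : IsFinslerMetric F)
    (hσ : IsClosedGeodesic F σ l) (t₀ : ℝ) :
    ∃ (m : Fin 2 → Plane → Plane) (N : Set Plane), IsOpen N ∧ coordCurve (σ t₀) σ t₀ ∈ N ∧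
      (∀ i, ∀ x ∈ N, ContDiffAt ℝ ∞ (m i) x) ∧
      (∀ᶠ t in 𝓝 t₀, σ t ∈ (extChartAt (𝓡 2) (σ t₀)).source ∧ coordCurve (σ t₀) σ t ∈ N ∧
        ∀ i, (cotChart (σ t₀) (lift F σ t)).2 (m i (coordCurve (σ t₀) σ t)) = 0) ∧
      ∀ Z, IsContactVector (coordG F (σ t₀)) (cotChart (σ t₀) (lift F σ t₀)) Z →
        (∀ i, fderiv ℝ (fun y : Mod => y.2 (m i y.1)) (cotChart (σ t₀) (lift F σ t₀)) Z = 0) →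
        Z = 0 := by
  have hq := mem_extChartAt_source (I := 𝓡 2) (σ t₀)
  obtain ⟨ρ, hρ, hball⟩ := Metric.eventually_nhds_iff_ball.1 (hσ.eventually_mem hq)
  have hy1 : ∀ t, σ t ∈ (extChartAt (𝓡 2) (σ t₀)).source →
      (cotChart (σ t₀) (lift F σ t)).1 = coordCurve (σ t₀) σ t := fun t ht => by
    rw [cotChart_apply (e := lift F σ t) ht]
    rfl
  obtain ⟨m, N, hN, hmem, hm, hz, hinj⟩ := Finsler.exists_transversal_fields
    (c := coordCurve (σ t₀) σ) (p := fun t => (cotChart (σ t₀) (lift F σ t)).2) hρ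
    (fun t ht => hσ.contDiffAt_coordCurve (hball t ht))
    (fun t ht => contDiffAt_snd.comp t (hσ.contDiffAt_cotChart_lift hF (hball t ht)))
    (hσ.apply_deriv_coordCurve hF t₀)
  refine ⟨m, N, hN, hmem, hm, ?_, fun Z hZ h => ?_⟩
  · filter_upwards [hσ.eventually_mem hq, hz, (hσ.contDiffAt_coordCurve
      hq).continuousAt.eventually_mem (hN.mem_nhds hmem)] with t h1 h2 h3 using ⟨h1, h3, h2⟩
  · have hys : lift F σ t₀ ∈ (cotChart (σ t₀)).source := mem_cotChart_lift.2 hq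
    have hyeq : cotChart (σ t₀) (lift F σ t₀) =
        (coordCurve (σ t₀) σ t₀, (cotChart (σ t₀) (lift F σ t₀)).2) :=
      Prod.ext (hy1 t₀ hq) rfl
    have hE := fderiv_coordG_eul hF ((cotChart (σ t₀)).map_source hys)
      (snd_cotChart_ne_zero hys (covec_ne_zero hF (hσ.lift_mem hF t₀)))
    have hG1 : coordG F (σ t₀) (cotChart (σ t₀) (lift F σ t₀)) = 1 :=
      (coordFun_apply _ hys).trans (hσ.lift_mem hF t₀)
    obtain ⟨h1, s, h2⟩ := hinj Z hZ.kernel fun i => by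
      rw [← hyeq]
      exact h i
    -- The only direction left by the coordinate lemma is the radial one, and it is not tangent to
    -- the hypersurface.
    have h3 : Z = s • eul (cotChart (σ t₀) (lift F σ t₀)) :=
      Prod.ext (h1.trans (smul_zero s).symm) h2
    have h4 := hZ.tangent
    rw [h3, map_smul, hE, hG1, smul_eq_mul, mul_one] at h4
    rw [h3, h4, zero_smul]

end Transversal

/-- The integrals are linear in constant coefficients, so the coefficients are found by inverting
the integrated matrix. -/
theorem exists_coefficients {K : ℝ → Fin 3 → Fin 3 → ℝ} (hK : Continuous K) {ψ : ℝ → ℝ}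
    (hψ : Continuous ψ) {a b : ℝ}
    (h : (Matrix.of fun i j => ∫ t in a..b, ψ t * K t i j).det ≠ 0) (v : Fin 3 → ℝ) :
    ∃ k : Fin 3 → ℝ, ∀ i, ∫ t in a..b, ψ t * (∑ j, K t i j * k j) = v i := by
  set M : Matrix (Fin 3) (Fin 3) ℝ := Matrix.of fun i j => ∫ t in a..b, ψ t * K t i j with hM
  refine ⟨M⁻¹.mulVec v, fun i => ?_⟩
  set k := M⁻¹.mulVec v with hk
  have h1 : M.mulVec k = v := by
    rw [hk, Matrix.mulVec_mulVec, Matrix.mul_nonsing_inv _ (isUnit_iff_ne_zero.2 h),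
      Matrix.one_mulVec]
  have h2 : ∀ t, ψ t * (∑ j, K t i j * k j) = ∑ j, ψ t * K t i j * k j := fun t => by
    rw [Finset.mul_sum]
    exact Finset.sum_congr rfl fun j _ => by ring
  simp only [h2]
  rw [intervalIntegral.integral_finsetSum]
  · simp only [intervalIntegral.integral_mul_const]
    rw [← congrFun h1 i]
    rfl
  · intro j _
    have hKij : Continuous fun t => K t i j :=
      (continuous_apply j).comp ((continuous_apply i).comp hK)
    exact ((hψ.mul hKij).mul continuous_const).intervalIntegrable _ _

/-! ### Localization near a regular point of the geodesic. -/

section Cutoff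

variable {S : Type*} [TopologicalSpace S] [T2Space S] [ChartedSpace Plane S]

/-- A cut-off function in a chart, supported in a small compact set. -/
theorem exists_chart_cutoff (q₀ : S) {O : Set S} (hO : O ∈ 𝓝 q₀) :
    ∃ (ψ : Plane → ℝ) (K : Set S), ContDiff ℝ ∞ ψ ∧ (∀ x, 0 ≤ ψ x) ∧
      0 < ψ (extChartAt (𝓡 2) q₀ q₀) ∧ IsClosed K ∧ K ⊆ (extChartAt (𝓡 2) q₀).source ∧ K ⊆ O ∧
      ∀ q ∈ (extChartAt (𝓡 2) q₀).source, ψ (extChartAt (𝓡 2) q₀ q) ≠ 0 → q ∈ K := by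
  set x₀ := extChartAt (𝓡 2) q₀ q₀ with hx₀
  have h1 : ∀ᶠ x in 𝓝 x₀, x ∈ (extChartAt (𝓡 2) q₀).target ∧ (extChartAt (𝓡 2) q₀).symm x ∈ O := by
    have h2 : Tendsto (extChartAt (𝓡 2) q₀).symm (𝓝 x₀) (𝓝 q₀) := by
      have := continuousAt_extChartAt_symm (I := 𝓡 2) q₀
      rwa [ContinuousAt, (extChartAt (𝓡 2) q₀).left_inv (mem_extChartAt_source q₀)] at this
    have h3 : ∀ᶠ x in 𝓝 x₀, x ∈ (extChartAt (𝓡 2) q₀).target := extChartAt_target_mem_nhds q₀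
    exact h3.and (h2.eventually hO)
  obtain ⟨R, hR, hball⟩ := Metric.nhds_basis_closedBall.mem_iff.1 h1
  let f : ContDiffBump x₀ := ⟨R / 2, R, by linarith, by linarith⟩
  refine ⟨f, (extChartAt (𝓡 2) q₀).symm '' Metric.closedBall x₀ R, f.contDiff, fun x => f.nonneg,
    ?_, ?_, ?_, ?_, fun q hq h => ?_⟩
  · exact f.pos_of_mem_ball (Metric.mem_ball_self hR)
  · refine ((isCompact_closedBall x₀ R).image_of_continuousOn ?_).isClosed
    exact (continuousOn_extChartAt_symm q₀).mono fun x hx => (hball hx).1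
  · rintro _ ⟨x, hx, rfl⟩
    exact (extChartAt (𝓡 2) q₀).map_target (hball hx).1
  · rintro _ ⟨x, hx, rfl⟩
    exact (hball hx).2
  · have h3 : extChartAt (𝓡 2) q₀ q ∈ Function.support f := h
    rw [f.support_eq] at h3
    exact ⟨_, Metric.ball_subset_closedBall h3, (extChartAt (𝓡 2) q₀).left_inv hq⟩

end Cutoff

section Geodesic

variable {S : Type*} [TopologicalSpace S] [T2Space S] [ChartedSpace Plane S]
  [IsManifold (𝓡 2) ∞ S] {F : TangentBundle (𝓡 2) S → ℝ} {σ : ℝ → S} {l : ℝ}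

/-- Near a simple point of the geodesic, only nearby times occur. -/
theorem IsClosedGeodesic.exists_nhds_disjoint (hσ : IsClosedGeodesic F σ l) {t₁ : ℝ}
    (h0 : 0 < t₁) (hreg : ∀ t ∈ Ico 0 l, σ t = σ t₁ → t = t₁) {r : ℝ} (hr : 0 < r) (hl : t₁ < l) :
    ∃ O ∈ 𝓝 (σ t₁), ∀ t ∈ Icc 0 l, σ t ∈ O → |t - t₁| < r := by
  -- The times away from `t₁` have a compact image, which misses `σ t₁` by regularity; its
  -- complement is the neighbourhood. The endpoint `l` is identified with `0`.
  have hc : IsCompact (Icc 0 l \ Metric.ball t₁ r) := isCompact_Icc.diff Metric.isOpen_ball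
  refine ⟨(σ '' (Icc 0 l \ Metric.ball t₁ r))ᶜ,
    (hc.image hσ.smooth.continuous).isClosed.isOpen_compl.mem_nhds ?_, fun t ht h => ?_⟩
  · rintro ⟨t, ⟨ht, htr⟩, heq⟩
    refine htr ?_
    rcases ht.2.lt_or_eq with h | h
    · rw [hreg t ⟨ht.1, h⟩ heq]
      exact Metric.mem_ball_self hr
    · have h2 : σ t = σ 0 := by
        have := hσ.periodic 0
        rwa [zero_add, ← h] at this
      exact absurd (hreg 0 ⟨le_rfl, h0.trans hl⟩ (h2.symm.trans heq)) h0.ne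
  · by_contra hcon
    exact h ⟨t, ⟨ht, fun hb => hcon (by rwa [Metric.mem_ball, Real.dist_eq] at hb)⟩, rfl⟩

end Geodesic

/-! ### Hessians of the fields in terms of symbols. -/

section Hessian

attribute [local instance] cotTopology cotChartedSpace cot_isManifold cot_isManifold_one
  continuousSMul_mod modDualNACG modDualNS modDualACG modDualACM
  modDualModule modDualTop modEndNACG modEndNS modDualDualNACG modDualDualNS

variable {S : Type*} [TopologicalSpace S] [ChartedSpace Plane S] [IsManifold (𝓡 2) ∞ S]
  {q₀ : S} {ψ : Plane → ℝ} {m : Fin 2 → Plane → Plane} {k : Fin 3 → ℝ}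

/-- The symbol of a pair of vector fields, differentiated at a point. -/
def symbolD (m : Fin 2 → Plane → Plane) (y Z : Mod) : ℝ × ℝ :=
  (fderiv ℝ (fun y : Mod => y.2 (m 0 y.1)) y Z, fderiv ℝ (fun y : Mod => y.2 (m 1 y.1)) y Z)

theorem fderiv_fderiv_chartField {y : Mod} (hy : y ∈ (cotChart q₀).target)
    (hA : ContMDiff cotModel 𝓘(ℝ, ℝ) ∞ (quad (chartField q₀ ψ m k)))
    (hψ : ContDiff ℝ ∞ ψ) (hm : ∀ i, ContDiffAt ℝ ∞ (m i) y.1) (h0 : ∀ i, y.2 (m i y.1) = 0)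
    (Z Z' : Mod) :
    fderiv ℝ (fderiv ℝ (coordFun q₀ (pertVelocity (chartField q₀ ψ m k)))) y Z Z' =
      -(ψ y.1 * (k 0 * ((symbolD m y Z).1 * (symbolD m y Z').1) +
        k 1 * ((symbolD m y Z).1 * (symbolD m y Z').2 +
          (symbolD m y Z).2 * (symbolD m y Z').1) +
        k 2 * ((symbolD m y Z).2 * (symbolD m y Z').2))) := by
  have hψ' : ContDiffAt ℝ 2 (fun y : Mod => ψ y.1) y :=
    (hψ.of_le two_le_infty).contDiffAt.comp y contDiffAt_fst
  have hs : ∀ i, ContDiffAt ℝ 2 (fun y : Mod => y.2 (m i y.1)) y := fun i =>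
    contDiffAt_apply_field ((hm i).of_le two_le_infty)
  have h1 : fderiv ℝ (coordFun q₀ (quad (chartField q₀ ψ m k))) =ᶠ[𝓝 y]
      fderiv ℝ (coordField ψ m k) := (coordFun_chartField_eventuallyEq hy).fderiv
  rw [fderiv_fderiv_coordFun_pertVelocity hA hy, h1.fderiv_eq, smul_apply, smul_apply]
  have h2 := fderiv_fderiv_quadPoly k hψ' (hs 0) (hs 1) (h0 0) (h0 1) Z Z'
  have h3 : coordField ψ m k = fun z : Mod => ψ z.1 * quadPoly k (z.2 (m 0 z.1)) (z.2 (m 1 z.1)) :=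
    rfl
  rw [h3, h2, smul_eq_mul]
  simp only [symbolD]
  ring

theorem continuous_symbolD {y Z : ℝ → Mod} (hy : Continuous y) (hZ : Continuous Z)
    (hm : ∀ t i, ContDiffAt ℝ ∞ (m i) (y t).1) : Continuous fun t => symbolD m (y t) (Z t) := by
  have h1 : ∀ i, Continuous fun t => fderiv ℝ (fun y : Mod => y.2 (m i y.1)) (y t) (Z t) := by
    intro i
    refine Continuous.clm_apply ?_ hZ
    refine continuous_iff_continuousAt.2 fun t => ?_
    exact ContinuousAt.comp
      ((contDiffAt_apply_field (hm t i)).continuousAt_fderiv (by simp)) hy.continuousAt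
  exact (h1 0).prodMk (h1 1)

/-- If the differentials of the two symbols were dependent on `Z`, `Z'`, then the combinations
`d_j(Z') Z - d_j(Z) Z'` would be killed by both and hence vanish. Pairing them with `Z` and `Z'`
makes all four numbers zero, which forces `Z = 0`. -/
theorem det_symSq_symbolD_ne_zero {G : Mod → ℝ} {y Z Z' : Mod}
    (hinj : ∀ Z, IsContactVector G y Z →
      (∀ i, fderiv ℝ (fun y : Mod => y.2 (m i y.1)) y Z = 0) → Z = 0)
    (hZ : IsContactVector G y Z) (hZ' : IsContactVector G y Z') (h : symp Z Z' ≠ 0) :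
    (Matrix.of (symSq (symbolD m y Z) (symbolD m y Z'))).det ≠ 0 := by
  rw [det_symSq]
  intro hdet
  have h0 := pow_eq_zero_iff (three_ne_zero) |>.1 hdet
  simp only [symbolD] at h0
  set d := fun i => fderiv ℝ (fun y : Mod => y.2 (m i y.1)) y with hd
  have hcomb : ∀ r s : ℝ, IsContactVector G y (r • Z - s • Z') := fun r s =>
    ⟨by rw [map_sub, map_smul, map_smul, hZ.tangent, hZ'.tangent, smul_zero, smul_zero, sub_zero],
      by rw [map_sub, map_smul, map_smul, hZ.kernel, hZ'.kernel, smul_zero, smul_zero, sub_zero]⟩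
  have hz : ∀ j, d j Z' • Z - d j Z • Z' = 0 := fun j => by
    refine hinj _ (hcomb _ _) fun i => ?_
    change d i _ = 0
    rw [map_sub, map_smul, map_smul, smul_eq_mul, smul_eq_mul]
    have h0' : d 0 Z * d 1 Z' - d 1 Z * d 0 Z' = 0 := h0
    fin_cases i <;> fin_cases j <;> simp <;> linarith
  have hall : ∀ j, d j Z' = 0 ∧ d j Z = 0 := fun j => by
    have h1 := congrArg (fun V => symp V Z') (hz j)
    have h2 := congrArg (fun V => symp Z V) (hz j)
    simp only [symp_sub_left, symp_smul_left, symp_self, mul_zero, sub_zero,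
      symp_zero_left] at h1
    simp only [symp_sub_right, symp_smul_right, symp_self, mul_zero, zero_sub] at h2
    rw [symp_swap _ 0, symp_zero_left, neg_zero, neg_eq_zero] at h2
    exact ⟨(mul_eq_zero.1 h1).resolve_right h, (mul_eq_zero.1 h2).resolve_right h⟩
  have h3 : Z = 0 := hinj Z hZ fun i => (hall i).2
  rw [h3, symp_zero_left] at h
  exact h rfl

end Hessian

/-! ### Surjectivity onto the tangent space of the symplectic group. -/

section Surjectivity

attribute [local instance] cotTopology cotChartedSpace cot_isManifold cot_isManifold_one
  continuousSMul_mod modDualNACG modDualNS modDualACG modDualACM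
  modDualModule modDualTop modEndNACG modEndNS modDualDualNACG modDualDualNS

variable {S : Type*} [TopologicalSpace S] [ChartedSpace Plane S] [IsManifold (𝓡 2) ∞ S]
  {F : TangentBundle (𝓡 2) S → ℝ} {σ : ℝ → S} {l : ℝ} {W : Set S}

theorem nonempty_basis_contactPlane (hF : IsFinslerMetric F) {e : CotBundle S}
    (he : e ∈ cosphere F) : Nonempty (Module.Basis (Fin 2) ℝ (contactPlane F e)) := by
  have h := finrank_contactPlane hF he
  have : Module.Finite ℝ (contactPlane F e) := Module.finite_of_finrank_pos (by rw [h]; norm_num)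
  exact ⟨Module.finBasisOfFinrankEq ℝ _ h⟩

/-- Tangency to the symplectic group is symmetry of the form `ω(D X, P Y)`; on a plane such a form
has three free entries, as many as the coefficients available. -/
theorem symp_symm_of_mem_symplecticTangent {e : CotBundle S}
    {P D : contactPlane F e →ₗ[ℝ] contactPlane F e} (hD : D ∈ symplecticTangent F e P)
    (X Y : contactPlane F e) : symp (contactVec (D X)) (contactVec (P Y)) =
      symp (contactVec (D Y)) (contactVec (P X)) := by
  have h1 : symp (contactVec (D X)) (contactVec (P Y)) +
      symp (contactVec (P X)) (contactVec (D Y)) = 0 :=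
    (congrArg₂ (· + ·) (extDerivOne_contactVec _ _) (extDerivOne_contactVec _ _)).symm.trans
      (hD X Y)
  rw [symp_swap (contactVec (D Y))]
  linarith

/-- An endomorphism is determined by its symplectic pairing with a symplectic map. -/
theorem endomorphism_ext_of_symp (hF : IsFinslerMetric F) {e : CotBundle S} (he : e ∈ cosphere F)
    {P D D' : contactPlane F e →ₗ[ℝ] contactPlane F e} (hP : IsSymplectic F e P)
    (b : Module.Basis (Fin 2) ℝ (contactPlane F e))
    (h : ∀ i j, symp (contactVec (D (b i))) (contactVec (P (b j))) =
      symp (contactVec (D' (b i))) (contactVec (P (b j)))) : D = D' := by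
  refine b.ext fun i => ?_
  have hU : symp (contactVec (P (b 0))) (contactVec (P (b 1))) ≠ 0 := by
    have h1 : symp (contactVec (P (b 0))) (contactVec (P (b 1))) =
        symp (contactVec (b 0)) (contactVec (b 1)) :=
      (extDerivOne_contactVec _ _).symm.trans ((hP _ _).trans (extDerivOne_contactVec _ _))
    rw [h1]
    exact symp_basis_ne_zero hF he b
  refine sub_eq_zero.1 (eq_zero_of_symp_pair hF he (U := fun j => P (b j)) hU fun j => ?_)
  have h2 : contactVec (D (b i) - D' (b i)) = contactVec (D (b i)) - contactVec (D' (b i)) := rfl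
  rw [h2, symp_sub_left, h i j, sub_self]

variable [T2Space S] [CompactSpace S]

set_option maxHeartbeats 1000000 in
/-- Every tangent vector of the symplectic group is the derivative of the return map. -/
theorem IsClosedGeodesic.exists_isAdmissible_hasEndDerivAtZero (hF : IsFinslerMetric F)
    (hσ : IsClosedGeodesic F σ l) {t₁ : ℝ} (h0 : 0 < t₁) (hl : t₁ < l)
    (hreg : ∀ t ∈ Ico 0 l, σ t = σ t₁ → t = t₁) (hW : W ∈ 𝓝 (σ t₁))
    {D : contactPlane F (lift F σ 0) →ₗ[ℝ] contactPlane F (lift F σ 0)}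
    (hD : D ∈ symplecticTangent F (lift F σ 0)
      (linearizedReturnMap F (fun _ => 0) l (lift F σ 0))) :
    ∃ A : (q : S) → LinearMap.BilinForm ℝ (Cot q), IsAdmissible F (lift F σ) W A ∧
      HasEndDerivAtZero (fun s => linearizedReturnMap F (pert A s) l (lift F σ 0)) D := by
  obtain ⟨m, N, hN, hmemN, hm, hev, hinj⟩ := hσ.exists_transversal_fields hF t₁
  set q₀ := σ t₁ with hq₀
  obtain ⟨r₁, hr₁, hball⟩ := Metric.eventually_nhds_iff_ball.1
    (hev.and (isOpen_Ioo.mem_nhds (show t₁ ∈ Ioo 0 l from ⟨h0, hl⟩)))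
  let a := t₁ - r₁ / 2
  have ha : a = t₁ - r₁ / 2 := rfl
  let b := t₁ + r₁ / 2
  have hb : b = t₁ + r₁ / 2 := rfl
  have hab' : a < b := by linarith
  have hab := hab'.le
  have hIcc : ∀ t ∈ Icc a b, t ∈ Metric.ball t₁ r₁ := fun t ht =>
    show |t - t₁| < r₁ from abs_lt.2 ⟨by linarith [ht.1], by linarith [ht.2]⟩
  have hsrc : ∀ t ∈ Icc a b, σ t ∈ (extChartAt (𝓡 2) q₀).source := fun t ht =>
    (hball t (hIcc t ht)).1.1
  have ht₁ : t₁ ∈ Icc a b := ⟨by linarith, by linarith⟩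
  have h0a : 0 ≤ a := (hball a (hIcc a (left_mem_Icc.2 hab))).2.1.le
  have hbl : b ≤ l := (hball b (hIcc b (right_mem_Icc.2 hab))).2.2.le
  have he₀ := hσ.lift_mem hF 0
  obtain ⟨Z, hZc, hZcon, hZs, hpair⟩ := hσ.exists_pairing (W := W) hF h0a hab hbl hsrc
  obtain ⟨B⟩ := nonempty_basis_contactPlane hF he₀
  have hG := hσ.isCoordOrbit hF hab hsrc
  let y := coordLift F σ q₀ hab
  have hyval : ∀ t ∈ Icc a b, y t = cotChart q₀ (lift F σ t) := fun t ht =>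
    coordLift_of_mem hab ht
  have hyt : ∀ t, y t ∈ (cotChart q₀).target := fun t =>
    (cotChart q₀).map_source (mem_cotChart_lift.2 (hsrc _ (projIcc a b hab t).2))
  have hy1' : ∀ t, σ t ∈ (extChartAt (𝓡 2) q₀).source →
      (cotChart q₀ (lift F σ t)).1 = coordCurve q₀ σ t := fun t ht =>
    congrArg Prod.fst (cotChart_apply (e := lift F σ t) ht)
  have hyc : ∀ t ∈ Icc a b, (y t).1 = coordCurve q₀ σ t := fun t ht =>
    (congrArg Prod.fst (hyval t ht)).trans (hy1' t (hsrc t ht))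
  have hyp : ∀ t, (y t).1 ∈ N ∧ ∀ i, (y t).2 (m i (y t).1) = 0 := fun t => by
    have h1 := (projIcc a b hab t).2
    have h2 := (hball _ (hIcc _ h1)).1
    have h3 : (y t).1 = coordCurve q₀ σ (projIcc a b hab t) := hy1' _ h2.1
    exact ⟨h3.symm ▸ h2.2.1, fun i => (congrArg (fun x => (y t).2 (m i x)) h3).trans (h2.2.2 i)⟩
  let X : Fin 2 → Mod := fun i => contactVec (B i)
  have hXc : ∀ i, IsContact F (lift F σ 0) (X i) := fun i => isContact_contactVec _
  let η : Fin 2 → ℝ → ℝ × ℝ := fun i t => symbolD m (y t) (Z (X i) t)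
  have hηc : ∀ i, Continuous (η i) := fun i =>
    continuous_symbolD hG.continuous (hZc _) fun t j => hm j _ (hyp t).1
  let K : ℝ → Fin 3 → Fin 3 → ℝ := fun t => symSq (η 0 t) (η 1 t)
  have hKc : Continuous K := by
    have h1 := (hηc 0).fst
    have h2 := (hηc 0).snd
    have h3 := (hηc 1).fst
    have h4 := (hηc 1).snd
    refine continuous_pi fun i => continuous_pi fun j => ?_
    fin_cases i <;> fin_cases j <;> simp [K, symSq] <;> fun_prop
  have hdet : (Matrix.of (K t₁)).det ≠ 0 := by
    refine det_symSq_symbolD_ne_zero (G := coordG F q₀) ?_ (hZcon _ (hXc 0) t₁ ht₁)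
      (hZcon _ (hXc 1) t₁ ht₁) ?_
    · exact (hyval t₁ ht₁).symm ▸ hinj
    · exact fun h => symp_basis_ne_zero hF he₀ B ((hZs _ _ (hXc 0) (hXc 1) t₁ ht₁).symm.trans h)
  obtain ⟨r₂, hr₂, hint⟩ := exists_det_integral_ne_zero hKc hdet
  -- The radius `r₁ / 2` keeps the perturbed times inside `[a, b]`, where the vector fields are
  -- annihilated by the lift; `r₂` keeps the integrated matrix invertible.
  obtain ⟨O, hO, hOt⟩ := hσ.exists_nhds_disjoint h0 hreg (r := min (r₁ / 2) r₂)
    (lt_min (by linarith) hr₂) hl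
  have hNO : (extChartAt (𝓡 2) q₀) ⁻¹' N ∈ 𝓝 q₀ :=
    (continuousAt_extChartAt q₀).preimage_mem_nhds (hN.mem_nhds hmemN)
  obtain ⟨ψ, C, hψ, hψ0, hψpos, hCcl, hCs, hCO, hψC⟩ :=
    exists_chart_cutoff q₀ (Filter.inter_mem (Filter.inter_mem hO hNO) hW)
  have hCt : ∀ t ∈ Icc 0 l, σ t ∈ C → |t - t₁| < min (r₁ / 2) r₂ := fun t ht h =>
    hOt t ht (hCO h).1.1
  have hadm : ∀ k, IsAdmissible F (lift F σ) W (chartField q₀ ψ m k) := fun k => by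
    refine isAdmissible_chartField hCcl hCs (fun q hq => (hCO hq).2) hψ hψC
      (fun i q hq => hm i _ (hCO hq).1.2) fun t ht i => ?_
    -- Admissibility concerns all real times, so each is first moved into one period.
    obtain ⟨u, hu, htu⟩ := hσ.periodic_lift.exists_mem_Ico₀ hσ.length_pos t
    have hσu : σ t = σ u := congrArg TotalSpace.proj htu
    have hcu : coordCurve q₀ σ t = coordCurve q₀ σ u :=
      congrArg (extChartAt (𝓡 2) q₀) hσu
    have h1 := (hCt u ⟨hu.1, hu.2.le⟩ (hσu ▸ ht)).trans_le (min_le_left _ _)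
    have h2 := (hball u (h1.trans (by linarith))).1.2.2 i
    have key : ∀ (e e' : CotBundle S) (x x' : Plane), e = e' → x = x' →
        (cotChart q₀ e').2 (m i x') = 0 → (cotChart q₀ e).2 (m i x) = 0 := by
      rintro _ _ _ _ rfl rfl h
      exact h
    exact key _ _ _ _ htu hcu h2
  have hout : ∀ k, ∀ t ∈ Icc 0 a ∪ Icc b l, ∀ᶠ q in 𝓝 (σ t), chartField q₀ ψ m k q = 0 := by
    intro k t ht
    have h1 : σ t ∉ C := by
      intro h
      have h2 : t ∈ Icc 0 l := by
        rcases ht with ht | ht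
        · exact ⟨ht.1, ht.2.trans (hab.trans hbl)⟩
        · exact ⟨(h0a.trans hab).trans ht.1, ht.2⟩
      have h3 := abs_lt.1 ((hCt t h2 h).trans_le (min_le_left _ _))
      rcases ht with ht | ht
      · linarith [ht.2, h3.1]
      · linarith [ht.1, h3.2]
    filter_upwards [hCcl.isOpen_compl.mem_nhds h1] with q hq
    exact chartField_eq_zero_of_notMem hψC hq
  have hψc : Continuous fun t => ψ (y t).1 := hψ.continuous.comp hG.continuous.fst
  have hdetI := hint (fun t => ψ (y t).1) a b hab hψc (fun t => hψ0 _) (fun t ht h =>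
    (hCt t ⟨h0a.trans ht.1, ht.2.trans hbl⟩ (hψC _ (hsrc t ht) fun h' =>
      h ((congrArg ψ (hyc t ht)).trans h'))).trans_le (min_le_right _ _)) (intervalIntegral.integral_pos hab' hψc.continuousOn (fun t _ => hψ0 _)
        ⟨t₁, ht₁, hψpos.trans_eq (congrArg ψ (hyc t₁ ht₁)).symm⟩)
  let P := linearizedReturnMap F (fun _ => 0) l (lift F σ 0)
  let w₀ : Fin 2 → Fin 2 → ℝ := fun i j => symp (contactVec (D (B i))) (contactVec (P (B j)))
  -- The signs compensate the minus sign in `h = -½ (A p, p)`; the fourth entry follows from the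
  -- symmetry of both forms.
  obtain ⟨k, hk⟩ := exists_coefficients hKc hψc hdetI ![-w₀ 0 0, -w₀ 0 1, -w₀ 1 1]
  obtain ⟨D', hD', hDpair⟩ := hpair _ (hadm k) (hout k)
  have hPs : IsSymplectic F (lift F σ 0) P := by
    have := ((hadm k).returnMap_wellDefined hF hσ pertDefined_zero).2
    rwa [pert_zero] at this
  have hval : ∀ i j, symp (contactVec (D' (B i))) (contactVec (P (B j))) =
      -∫ t in a..b, ψ (y t).1 * (k 0 * ((η i t).1 * (η j t).1) +
        k 1 * ((η i t).1 * (η j t).2 + (η i t).2 * (η j t).1) +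
        k 2 * ((η i t).2 * (η j t).2)) := fun i j => by
    refine (hDpair (B i) (B j)).trans ?_
    refine Eq.trans ?_ intervalIntegral.integral_neg
    refine intervalIntegral.integral_congr fun t _ => ?_
    exact fderiv_fderiv_chartField (hyt t) (hadm k).smooth hψ (fun i => hm i _ (hyp t).1)
      (hyp t).2 _ _
  have hrow : ∀ i, ∫ t in a..b, ψ (y t).1 *
      (K t i 0 * k 0 + K t i 1 * k 1 + K t i 2 * k 2) = ![-w₀ 0 0, -w₀ 0 1, -w₀ 1 1] i := fun i => by
    refine Eq.trans ?_ (hk i)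
    exact intervalIntegral.integral_congr fun t _ =>
      congrArg (fun x => ψ (y t).1 * x) (Fin.sum_univ_three fun j => K t i j * k j).symm
  have hsymm : w₀ 1 0 = w₀ 0 1 := symp_symm_of_mem_symplecticTangent hD _ _
  have heq : D' = D := by
    refine endomorphism_ext_of_symp hF he₀ hPs B fun i j => ?_
    refine (hval i j).trans ?_
    change _ = w₀ i j
    have key : ∀ (n : Fin 3) (w : ℝ), ![-w₀ 0 0, -w₀ 0 1, -w₀ 1 1] n = -w →
        (∀ t, k 0 * ((η i t).1 * (η j t).1) + k 1 * ((η i t).1 * (η j t).2 +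
          (η i t).2 * (η j t).1) + k 2 * ((η i t).2 * (η j t).2) =
            K t n 0 * k 0 + K t n 1 * k 1 + K t n 2 * k 2) →
        -∫ t in a..b, ψ (y t).1 * (k 0 * ((η i t).1 * (η j t).1) +
          k 1 * ((η i t).1 * (η j t).2 + (η i t).2 * (η j t).1) +
          k 2 * ((η i t).2 * (η j t).2)) = w := fun n w hw h =>
      (congrArg Neg.neg (((intervalIntegral.integral_congr fun t _ =>
        congrArg (fun x => ψ (y t).1 * x) (h t)).trans (hrow n)).trans hw)).trans (neg_neg w)
    fin_cases i <;> fin_cases j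
    · exact key 0 _ rfl fun t => by simp [K, symSq]; ring
    · exact key 1 _ rfl fun t => by simp [K, symSq]; ring
    · exact key 1 _ (by simp [hsymm]) fun t => by simp [K, symSq]; ring
    · exact key 2 _ rfl fun t => by simp [K, symSq]; ring
  subst heq
  exact ⟨_, hadm k, hD'⟩

end Surjectivity

variable {S : Type*} [TopologicalSpace S] [T2Space S] [CompactSpace S] [ChartedSpace Plane S]
  [IsManifold (𝓡 2) ∞ S] {F : TangentBundle (𝓡 2) S → ℝ} {σ : ℝ → S} {l : ℝ}
  {U₁ : Set (CotBundle S)}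

theorem image_proj_mem_nhds_lift (hF : IsFinslerMetric F) {t₀ ε : ℝ} (hσ : IsClosedGeodesic F σ l)
    (hε : 0 < ε) (hU₁ : ∃ O : Set (CotBundle S), IsOpen O ∧ U₁ = O ∩ cosphere F)
    (hU₁γ : U₁ ∩ range (lift F σ) = lift F σ '' Ioo (l * (t₀ - ε)) (l * (t₀ + ε))) :
    TotalSpace.proj '' U₁ ∈ 𝓝 (σ (l * t₀)) := by
  obtain ⟨O, hO, rfl⟩ := hU₁
  have h1 : lift F σ (l * t₀) ∈ lift F σ '' Ioo (l * (t₀ - ε)) (l * (t₀ + ε)) :=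
    ⟨_, ⟨mul_lt_mul_of_pos_left (by linarith) hσ.length_pos,
      mul_lt_mul_of_pos_left (by linarith) hσ.length_pos⟩, rfl⟩
  rw [← hU₁γ] at h1
  exact image_proj_mem_nhds hF hO h1.1

end

end Finsler

theorem mainTheorem7 {S : Type*} [TopologicalSpace S] [T2Space S] [CompactSpace S]
    [ChartedSpace Plane S] [IsManifold (𝓡 2) ∞ S]
    (F : TangentBundle (𝓡 2) S → ℝ) (hF : IsFinslerMetric F)
    (σ : ℝ → S) (l : ℝ) (hσ : IsClosedGeodesic F σ l)
    (t₀ ε : ℝ) (hε : 0 < ε) (hleft : 0 ≤ t₀ - ε) (hright : t₀ + ε ≤ 1)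
    -- `l t₀` is a regular moment of `σ`
    (hreg : ∀ t ∈ Ico 0 l, σ t = σ (l * t₀) → t = l * t₀)
    -- `U₁` is an open subset of `S*_F S`
    (U₁ : Set (CotBundle S)) (hU₁ : ∃ O : Set (CotBundle S), IsOpen O ∧ U₁ = O ∩ cosphere F)
    -- `U₁` meets the orbit, and `π(U₁)` meets the geodesic, exactly in the arc around `l t₀`
    (hU₁γ : U₁ ∩ range (lift F σ) = lift F σ '' Ioo (l * (t₀ - ε)) (l * (t₀ + ε)))
    (hU₁σ : ∀ t ∈ Ico 0 l, σ t ∈ TotalSpace.proj '' U₁ → t ∈ Ioo (l * (t₀ - ε)) (l * (t₀ + ε))) :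
    -- the linearized Poincaré map `P_σ(f_s) ∈ Sp(ξ_F)` is well defined
    (∀ A : (q : S) → LinearMap.BilinForm ℝ (Cot q),
      IsAdmissible F (lift F σ) (TotalSpace.proj '' U₁) A → ∀ s : ℝ, PertDefined F A s →
        IsReebOrbit F (pert A s) (lift F σ) l ∧
        (∃! P, IsLinearizedReturnMap F (pert A s) l (lift F σ 0) P) ∧
        IsSymplectic F (lift F σ 0) (linearizedReturnMap F (pert A s) l (lift F σ 0))) ∧
    -- the formula for its derivative in the local model
    (∀ (δ : ℝ) (Φ : ℝ × Plane → CotBundle S) (H : ℝ × Plane → ℝ),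
      IsLocalModel F (lift F σ) l U₁ δ Φ H →
      -- `b` is the basis `∂/∂x₁, ∂/∂x₂` of `ξ_F` at `γ_σ(0)`, and `R₀` the fundamental solution
      ∃ b : Module.Basis (Fin 2) ℝ (contactPlane F (lift F σ 0)),
        (∀ i : Fin 2,
          (⟨lift F σ 0, (b i : TangentSpace cotModel (lift F σ 0))⟩ :
              TangentBundle cotModel (CotBundle S)) =
            ⟨Φ (0, 0), mfderiv 𝓘(ℝ, ℝ × Plane) cotModel Φ (0, 0)
              ((0, EuclideanSpace.single i 1) : ℝ × Plane)⟩) ∧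
        ∃ R₀ : ℝ → Matrix (Fin 2) (Fin 2) ℝ, IsFundamentalSolution l H R₀ ∧
          ∀ A : (q : S) → LinearMap.BilinForm ℝ (Cot q),
            IsAdmissible F (lift F σ) (TotalSpace.proj '' U₁) A →
            HasEndDerivAtZero (fun s => linearizedReturnMap F (pert A s) l (lift F σ 0))
              (Matrix.toLin b b
                (LinearMap.toMatrix b b (linearizedReturnMap F (pert A 0) l (lift F σ 0)) *
                  (R₀ t₀)⁻¹ * hessIntegral (pertVelocity A ∘ Φ) (t₀ - ε) (t₀ + ε) * R₀ t₀))) ∧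
    -- the derivative maps onto the tangent space of the symplectic group at `P_σ(0)`
    (∀ A : (q : S) → LinearMap.BilinForm ℝ (Cot q),
      IsAdmissible F (lift F σ) (TotalSpace.proj '' U₁) A →
      ∃ D ∈ symplecticTangent F (lift F σ 0)
          (linearizedReturnMap F (fun _ => 0) l (lift F σ 0)),
        HasEndDerivAtZero (fun s => linearizedReturnMap F (pert A s) l (lift F σ 0)) D) ∧
    (∀ D ∈ symplecticTangent F (lift F σ 0)
        (linearizedReturnMap F (fun _ => 0) l (lift F σ 0)),
      ∃ A : (q : S) → LinearMap.BilinForm ℝ (Cot q),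
        IsAdmissible F (lift F σ) (TotalSpace.proj '' U₁) A ∧
        HasEndDerivAtZero (fun s => linearizedReturnMap F (pert A s) l (lift F σ 0)) D) := by
  have hl := hσ.length_pos
  exact ⟨fun A hA s hs => ⟨hA.isReebOrbit hF hσ hs, hA.returnMap_wellDefined hF hσ hs⟩,
    fun δ Φ H hΦ => hΦ.exists_derivative_formula hF hσ hε hleft hright hU₁ hU₁γ hU₁σ,
    fun A hA => hA.exists_hasEndDerivAtZero hF hσ,
    fun D hD => hσ.exists_isAdmissible_hasEndDerivAtZero hF (mul_pos hl (by linarith))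
      (mul_lt_of_lt_one_right hl (by linarith)) hreg
      (image_proj_mem_nhds_lift hF hσ hε hU₁ hU₁γ) hD⟩
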